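/- \textbf{Conventions.} A ray in $\mathbb{R}^2$ is given by its endpoint $a$ and an interior point $b\neq a$; it is the set $\{a+s(b-a): s\ge 0\}$. A \emph{linear ray sweep} is given by points $a_0,a_1,b\in\mathbb{R}^2$ with $b\notin[a_0,a_1]$; it sweeps out the union, over $t\in[0,1]$, of the rays with endpoint $(1-t)a_0+ta_1$ and interior point $b$. A simple polygon is a closed polygonal chain with at least three vertices, all distinct, in which two different edges meet at most in a common endpoint of consecutive edges, together with the region it encloses; it is a closed set. \textbf{Theorem.} There are a real RAM program (unit cost per operation; addition, subtraction, multiplication, division and comparison of reals; addition, subtraction and comparison of natural numbers, which also serve as addresses; integer constants only; quotients with denominator $0$ evaluate to $0$) and a constant $C$ with the following property. Let $B\subset\mathbb{R}^2$ be the union of finitely many pairwise disjoint simple polygons with $k$ vertices in total, given by the lists of vertices of the polygons in cyclic order. Then the program halts on this input, with a finite list of linear ray sweeps whose union is exactly $$\bigcup\{R : R \text{ is a ray in } \mathbb{R}^2 \text{ with } R\cap \operatorname{Int} B=\varnothing\}.$$ Moreover, if there is at least one polygon, then the program halts after at most $C\,k^2\log k$ steps, and the list consists of at most $C\,k^2$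 linear ray sweeps. -/

import Mathlib

open Set

namespace RayCarving

/-! ## Planar geometry -/

/-- The plane `ℝ²`. (No metric notion is used below, only the topology and the affine structure.) -/
abbrev Pt : Type := ℝ × ℝ

/-- The ray with endpoint `a` that passes through `b`; it is a genuine ray when `a ≠ b`. -/
def ray (a b : Pt) : Set Pt := {x | ∃ s : ℝ, 0 ≤ s ∧ x = a + s • (b - a)}

/-- A sweep of a ray whose interior point `pivot` is constant while its endpoint is linearly
interpolated from `source` to `target`. -/
structure LinearRaySweep where
  source : Pt
  target : Pt
  pivot : Pt

namespace LinearRaySweep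

/-- The position of the endpoint of the ray at time `t ∈ [0, 1]`. -/
noncomputable def endpoint (R : LinearRaySweep) (t : ℝ) : Pt := AffineMap.lineMap R.source R.target t

/-- At every moment the endpoint and the interior point differ, so that they determine a ray. -/
def IsProper (R : LinearRaySweep) : Prop := ∀ t ∈ Icc (0 : ℝ) 1, R.endpoint t ≠ R.pivot

/-- The set of points swept out. -/
def region (R : LinearRaySweep) : Set Pt := ⋃ t ∈ Icc (0 : ℝ) 1, ray (R.endpoint t) R.pivot

end LinearRaySweep

/-- A closed polygonal chain in the plane is a simple polygon: it has at least three vertices, which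
are distinct, and two different edges meet at most in a common endpoint of consecutive edges. -/
def IsSimple {n : ℕ} (p : Polygon Pt n) : Prop :=
  3 ≤ n ∧ Function.Injective p.vertices ∧
    ∀ i j : Fin n, i ≠ j → ∀ x ∈ p.edgeSet ℝ i ∩ p.edgeSet ℝ j,
      (j = finRotate n i ∧ x = p j) ∨ (i = finRotate n j ∧ x = p i)

/-- Twice the signed area of the triangle `p q x`: positive if `x` lies to the left of the line
directed from `p` to `q`. -/
def orient (p q x : Pt) : ℝ := (q.1 - p.1) * (x.2 - p.2) - (q.2 - p.2) * (x.1 - p.1)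

/-- The horizontal rightward ray from `x` crosses the edge from `p` to `q`. The lower endpoint of the
edge is counted and the upper one is not, so that a passage through a vertex is counted correctly. -/
def Crosses (x p q : Pt) : Prop :=
  (p.2 ≤ x.2 ∧ x.2 < q.2 ∧ 0 < orient p q x) ∨ (q.2 ≤ x.2 ∧ x.2 < p.2 ∧ 0 < orient q p x)

/-- The points enclosed by a polygon (even-odd rule): the points off the boundary from which the
rightward ray crosses the boundary an odd number of times. -/
def enclosed {n : ℕ} (p : Polygon Pt n) : Set Pt :=
  {x | x ∉ p.boundary ℝ ∧ Odd {i : Fin n | Crosses x (p i) (p (finRotate n i))}.ncard}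

/-- The closed region bounded by a polygon. -/
def polygonRegion {n : ℕ} (p : Polygon Pt n) : Set Pt := p.boundary ℝ ∪ enclosed p

/-- A finite list of polygons, each with its number of vertices. -/
abbrev PolygonList : Type := List (Σ n : ℕ, Polygon Pt n)

namespace PolygonList

/-- Every polygon of the list is simple, and the closed regions they bound are pairwise disjoint. -/
def IsDisjointSimple (B : PolygonList) : Prop :=
  (∀ p ∈ B, IsSimple p.2) ∧
    B.Pairwise fun p q => Disjoint (polygonRegion p.2) (polygonRegion q.2)

/-- The union of the closed polygonal regions. -/
def union (B : PolygonList) : Set Pt := ⋃ p ∈ B, polygonRegion p.2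

/-- All vertices, polygon by polygon, in their cyclic order along each polygon. -/
def vertexList (B : PolygonList) : List Pt := B.flatMap fun p => List.ofFn p.2.vertices

/-- The total number of vertices. -/
def size (B : PolygonList) : ℕ := (vertexList B).length

end PolygonList

/-- The union of all rays in the plane that do not meet the interior of `S`. -/
def unionOfFreeRays (S : Set Pt) : Set Pt :=
  {x | ∃ a b : Pt, a ≠ b ∧ ray a b ∩ interior S = ∅ ∧ x ∈ ray a b}

/-! ## The real RAM

A machine with registers and arrays for natural numbers (counters, addresses) and for real numbers.
Arrays are indexed by computed natural numbers. Natural numbers can be added, subtracted and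
compared; reals can be added, subtracted, multiplied, divided and compared. No operation turns a real
into a natural number, and the only constants are integers. A program is a fixed finite text; it is
run with a step count in which each operation, memory access, assignment and branch counts one. -/

/-- The memory. -/
structure Memory where
  natReg : ℕ → ℕ
  realReg : ℕ → ℝ
  natArr : ℕ → ℕ → ℕ
  realArr : ℕ → ℕ → ℝ

/-- Expressions with natural-number value. -/
inductive NatExp : Type where
  | const (n : ℕ)
  | reg (r : ℕ)
  | arr (a : ℕ) (i : NatExp)
  | add (e f : NatExp)
  | sub (e f : NatExp)

/-- Expressions with real value. -/
inductive RealExp : Type where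
  | const (z : ℤ)
  | reg (r : ℕ)
  | arr (a : ℕ) (i : NatExp)
  | add (e f : RealExp)
  | sub (e f : RealExp)
  | mul (e f : RealExp)
  | div (e f : RealExp)

/-- Tests. -/
inductive Test : Type where
  | natLt (e f : NatExp)
  | natEq (e f : NatExp)
  | realLt (e f : RealExp)
  | realEq (e f : RealExp)
  | neg (b : Test)
  | conj (b c : Test)
  | disj (b c : Test)

/-- Programs. -/
inductive Program : Type where
  | skip
  | setNatReg (r : ℕ) (e : NatExp)
  | setRealReg (r : ℕ) (e : RealExp)
  | setNatArr (a : ℕ) (i : NatExp) (e : NatExp)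
  | setRealArr (a : ℕ) (i : NatExp) (e : RealExp)
  | seq (P Q : Program)
  | cond (b : Test) (P Q : Program)
  | loop (b : Test) (P : Program)

namespace NatExp

/-- The value of an expression; subtraction is truncated at zero. -/
def eval (m : Memory) : NatExp → ℕ
  | const n => n
  | reg r => m.natReg r
  | arr a i => m.natArr a (i.eval m)
  | add e f => e.eval m + f.eval m
  | sub e f => e.eval m - f.eval m

/-- The number of steps needed to evaluate an expression. -/
def cost : NatExp → ℕ
  | const _ => 1
  | reg _ => 1
  | arr _ i => i.cost + 1
  | add e f => e.cost + f.cost + 1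
  | sub e f => e.cost + f.cost + 1

end NatExp

namespace RealExp

/-- The value of an expression; a quotient with denominator zero is zero. -/
noncomputable def eval (m : Memory) : RealExp → ℝ
  | const z => z
  | reg r => m.realReg r
  | arr a i => m.realArr a (i.eval m)
  | add e f => e.eval m + f.eval m
  | sub e f => e.eval m - f.eval m
  | mul e f => e.eval m * f.eval m
  | div e f => e.eval m / f.eval m

/-- The number of steps needed to evaluate an expression. -/
def cost : RealExp → ℕ
  | const _ => 1
  | reg _ => 1
  | arr _ i => i.cost + 1
  | add e f => e.cost + f.cost + 1
  | sub e f => e.cost + f.cost + 1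
  | mul e f => e.cost + f.cost + 1
  | div e f => e.cost + f.cost + 1

end RealExp

namespace Test

/-- The truth value of a test. -/
def Holds (m : Memory) : Test → Prop
  | natLt e f => e.eval m < f.eval m
  | natEq e f => e.eval m = f.eval m
  | realLt e f => e.eval m < f.eval m
  | realEq e f => e.eval m = f.eval m
  | neg b => ¬ b.Holds m
  | conj b c => b.Holds m ∧ c.Holds m
  | disj b c => b.Holds m ∨ c.Holds m

/-- The number of steps needed to evaluate a test. -/
def cost : Test → ℕ
  | natLt e f => e.cost + f.cost + 1
  | natEq e f => e.cost + f.cost + 1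
  | realLt e f => e.cost + f.cost + 1
  | realEq e f => e.cost + f.cost + 1
  | neg b => b.cost + 1
  | conj b c => b.cost + c.cost + 1
  | disj b c => b.cost + c.cost + 1

end Test

namespace Memory

/-- Store `v` in the natural-number register `r`. -/
def setNatReg (m : Memory) (r v : ℕ) : Memory :=
  { m with natReg := Function.update m.natReg r v }

/-- Store `v` in the real register `r`. -/
noncomputable def setRealReg (m : Memory) (r : ℕ) (v : ℝ) : Memory :=
  { m with realReg := Function.update m.realReg r v }

/-- Store `v` in the natural-number array `a` at position `i`. -/
def setNatArr (m : Memory) (a i v : ℕ) : Memory :=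
  { m with natArr := Function.update m.natArr a (Function.update (m.natArr a) i v) }

/-- Store `v` in the real array `a` at position `i`. -/
noncomputable def setRealArr (m : Memory) (a i : ℕ) (v : ℝ) : Memory :=
  { m with realArr := Function.update m.realArr a (Function.update (m.realArr a) i v) }

end Memory

/-- `Runs P m m' t`: the program `P`, started with memory `m`, halts after exactly `t` steps with
memory `m'`. -/
inductive Runs : Program → Memory → Memory → ℕ → Prop where
  | skip (m : Memory) : Runs .skip m m 1
  | setNatReg (m : Memory) (r : ℕ) (e : NatExp) :
      Runs (.setNatReg r e) m (m.setNatReg r (e.eval m)) (e.cost + 1)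
  | setRealReg (m : Memory) (r : ℕ) (e : RealExp) :
      Runs (.setRealReg r e) m (m.setRealReg r (e.eval m)) (e.cost + 1)
  | setNatArr (m : Memory) (a : ℕ) (i e : NatExp) :
      Runs (.setNatArr a i e) m (m.setNatArr a (i.eval m) (e.eval m)) (i.cost + e.cost + 1)
  | setRealArr (m : Memory) (a : ℕ) (i : NatExp) (e : RealExp) :
      Runs (.setRealArr a i e) m (m.setRealArr a (i.eval m) (e.eval m)) (i.cost + e.cost + 1)
  | seq {P Q : Program} {m m' m'' : Memory} {t t' : ℕ} :
      Runs P m m' t → Runs Q m' m'' t' → Runs (.seq P Q) m m'' (t + t')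
  | cond_true {b : Test} {P Q : Program} {m m' : Memory} {t : ℕ} :
      b.Holds m → Runs P m m' t → Runs (.cond b P Q) m m' (b.cost + 1 + t)
  | cond_false {b : Test} {P Q : Program} {m m' : Memory} {t : ℕ} :
      ¬ b.Holds m → Runs Q m m' t → Runs (.cond b P Q) m m' (b.cost + 1 + t)
  | loop_true {b : Test} {P : Program} {m m' m'' : Memory} {t t' : ℕ} :
      b.Holds m → Runs P m m' t → Runs (.loop b P) m' m'' t' →
        Runs (.loop b P) m m'' (b.cost + 1 + t + t')
  | loop_false {b : Test} {P : Program} {m : Memory} :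
      ¬ b.Holds m → Runs (.loop b P) m m (b.cost + 1)

/-! ## Input and output conventions -/

/-- The initial memory for the input `B`: natural register `0` holds the number of polygons, natural
array `0` their numbers of vertices, and the real arrays `0` and `1` hold the `x`- and
`y`-coordinates of all vertices, polygon by polygon. Everything else is zero. -/
noncomputable def inputMemory (B : PolygonList) : Memory where
  natReg := fun r => if r = 0 then B.length else 0
  realReg := fun _ => 0
  natArr := fun a i => if a = 0 then (B.map Sigma.fst).getD i 0 else 0
  realArr := fun a i =>
    if a = 0 then ((PolygonList.vertexList B).getD i 0).1
    else if a = 1 then ((PolygonList.vertexList B).getD i 0).2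
    else 0

/-- The list of linear ray sweeps that a memory represents: natural register `1` holds their number,
and the real arrays `2, …, 7` hold the coordinates of their source, target and pivot points. -/
def outputSweeps (m : Memory) : List LinearRaySweep :=
  (List.range (m.natReg 1)).map fun i =>
    { source := (m.realArr 2 i, m.realArr 3 i)
      target := (m.realArr 4 i, m.realArr 5 i)
      pivot := (m.realArr 6 i, m.realArr 7 i) }

end RayCarving

/-! Modulo 2, the number of edges crossed by the rightward ray from a point is locally constant off
the edges and changes across an edge. So `inside`, the set of points of odd parity off the edges, is
open, and it is the interior of the union of the polygons (`edgeSystem_union`,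
`interior_inside_union_bd`). A point that can run to infinity along a ray off the edges has even
parity (`par_eq_zero_of_escape`); the existence arguments for free rays rest on this.

The geometric core is that free rays may be taken through vertices. Let `x` be on a free ray. The
part of the ray from `x` on is turned about `x` until it first meets a vertex. The turned ray is
still free, because an inside point on it, pushed a little in the old direction, could escape to
infinity between the two rays (`exists_free_vertex`). Hence it suffices to know, for every vertex
`v` and every direction `d`, the first obstructions ahead of and behind `v`: if nothing obstructs
ahead, the free rays through `v` may start anywhere up to the first obstruction behind.

The inverse distance from `v` to the line of an edge is linear in `d` (`edgeFun_eq_dt`). Between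
consecutive event directions the first obstruction on either side is therefore given by one linear
functional, and the free rays there form a single linear sweep whose endpoint runs along the
obstructing edge. An event direction may be free although its neighbours are not, so it has sweeps
of its own, with a constant ray. If nothing obstructs behind `v`, the endpoint is placed at an
artificial scale `T`. A point that is missed for this reason is strictly separated from all
vertices; then a line of support through some vertex is free as a whole
(`exists_supporting_vertex`), and the point lies ahead of the pivot of a sweep, where `T` plays no
role.

The envelope of a single edge has at most three entries. Different edges meet at most in endpoints,
so they never obstruct a generic direction at the same distance; two non-negative linear functionals
on a sector then do not change places, merging creates no new event directions
(`le_of_larger_at_end`, `Env.merge`), and lengths at most add up. Merging `k + 1` lists in queue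
order costs `O(k log k)` per vertex by a potential argument (`sum_heapList_le`) and leaves `O(k)`
entries with at most four sweeps each. The sum over all vertices gives the bounds. The list with
index `k` stands for no edge; it makes the horizontal direction an event.

Programs without loops are evaluated by `Program.exec`, loops are treated by `Does.loop` and
`Does.count`, and `Same` is the frame rule. After the input has been read, natural register 2 holds
`k`, 3 and 4 the current vertex and edge, 5 the next free entry position, 7 the number of queued
lists, 8 the number of merges done, 10 to 13 cursors and ends of lists, 14 a comparison flag. Real
register 0 holds `T`, 1 to 4 the previous and the current direction, those from 20 on are scratch.
Natural arrays 1 to 4 hold successors, predecessors, vertex parities and list offsets; real arrays 2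
to 7 hold the output and 8 to 15 the entries. -/

namespace RayCarving
open Filter Topology

/-! ## Crossing parity -/

/-- The cross product of two plane vectors. -/
def cr (a b : Pt) : ℝ := a.1 * b.2 - a.2 * b.1

open Classical in
/-- The crossing indicator of an edge, modulo two. -/
noncomputable def crossBit (x p q : Pt) : ZMod 2 := if Crosses x p q then 1 else 0

open Classical in
/-- The indicator of `w` lying right of `x` and not above `y`. -/
noncomputable def rightBit (x w y : Pt) : ZMod 2 := if w.2 ≤ y.2 ∧ x.1 < w.1 then 1 else 0

theorem crossBit_comm (x p q : Pt) : crossBit x p q = crossBit x q p := by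
  unfold crossBit
  classical exact if_congr or_comm rfl rfl

theorem zmod2_cases (a : ZMod 2) : a = 0 ∨ a = 1 := by revert a; decide

theorem zmod2_add_self (a : ZMod 2) : a + a = 0 := by revert a; decide

theorem mem_segment_iff_exists (x p q : Pt) : x ∈ segment ℝ p q ↔
    ∃ t : ℝ, 0 ≤ t ∧ t ≤ 1 ∧ x.1 = p.1 + t * (q.1 - p.1) ∧ x.2 = p.2 + t * (q.2 - p.2) := by
  rw [segment_eq_image_lineMap]
  constructor
  · rintro ⟨t, ⟨h0, h1⟩, rfl⟩
    refine ⟨t, h0, h1, ?_, ?_⟩ <;> simp [AffineMap.lineMap_apply] <;> ring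
  · rintro ⟨t, h0, h1, h2, h3⟩
    refine ⟨t, ⟨h0, h1⟩, ?_⟩
    ext <;> simp [AffineMap.lineMap_apply, h2, h3] <;> ring

theorem orient_ne_zero_of_not_mem {p q x : Pt} (hx : x ∉ segment ℝ p q) (h1 : p.2 < x.2)
    (h2 : x.2 < q.2) : orient p q x ≠ 0 := by
  intro h
  apply hx
  rw [mem_segment_iff_exists]
  have h0 : 0 < q.2 - p.2 := by linarith
  refine ⟨(x.2 - p.2) / (q.2 - p.2), by apply div_nonneg <;> linarith, by
    rw [div_le_one h0]; linarith, ?_, by field_simp; ring⟩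
  unfold orient at h
  field_simp
  linarith

theorem continuous_orient (p q : Pt) : Continuous fun x => orient p q x := by
  unfold orient; fun_prop

theorem orient_swap (p q x : Pt) : orient q p x = - orient p q x := by unfold orient; ring

/-- The crossing indicator of one edge is not locally constant off the edge: it jumps when `y`
passes the height of an endpoint lying to the right. The two `rightBit` terms jump at the same
moments and cancel this. The nine cases are the positions of the endpoints relative to the height of
`x`. -/
theorem edge_local_aux {p q x : Pt} (hx : x ∉ segment ℝ p q) (hpq : p.2 ≤ q.2) :
    ∀ᶠ y in 𝓝 x, crossBit y p q + rightBit x p y + rightBit x q y =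
      crossBit x p q + rightBit x p x + rightBit x q x := by
  have lo : ∀ c : ℝ, c < x.2 → ∀ᶠ y : Pt in 𝓝 x, c < y.2 := fun c hc =>
    (continuous_snd.tendsto x).eventually (eventually_gt_nhds hc)
  have hi : ∀ c : ℝ, x.2 < c → ∀ᶠ y : Pt in 𝓝 x, y.2 < c := fun c hc =>
    (continuous_snd.tendsto x).eventually (eventually_lt_nhds hc)
  have opos : 0 < orient p q x → ∀ᶠ y : Pt in 𝓝 x, 0 < orient p q y := fun hc =>
    ((continuous_orient p q).tendsto x).eventually (eventually_gt_nhds hc)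
  have oneg : orient p q x < 0 → ∀ᶠ y : Pt in 𝓝 x, orient p q y < 0 := fun hc =>
    ((continuous_orient p q).tendsto x).eventually (eventually_lt_nhds hc)
  have hp : x ≠ p := fun h => hx (h ▸ left_mem_segment ℝ x q)
  have hq : x ≠ q := fun h => hx (h ▸ right_mem_segment ℝ p x)
  have hp1 : x.2 = p.2 → x.1 ≠ p.1 := fun h h' => hp (Prod.ext h' h)
  have hq1 : x.2 = q.2 → x.1 ≠ q.1 := fun h h' => hq (Prod.ext h' h)
  simp only [crossBit, rightBit, Crosses, orient_swap p q]
  rcases lt_trichotomy p.2 x.2 with h1 | h1 | h1 <;> rcases lt_trichotomy q.2 x.2 with h2 | h2 | h2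
  · filter_upwards [lo _ h1, lo _ h2] with y hy1 hy2
    simp [h1.le, h2.le, hy1.le, hy2.le, hy1.not_gt, hy2.not_gt, h1.not_gt, h2.not_gt]
  · have : orient p q x = (x.2 - p.2) * (q.1 - x.1) := by unfold orient; rw [h2]; ring
    rcases lt_or_gt_of_ne (hq1 h2.symm) with h | h
    · filter_upwards [lo _ h1, opos (by rw [this]; apply mul_pos <;> linarith)] with y hy1 hy2
      rcases lt_or_ge y.2 q.2 with h3 | h3
      · have h3' : y.2 < x.2 := by linarith
        simp [h1.le, hy1.le, h1.not_gt, h2, hy2, h3', h, h3'.not_ge, hy1.not_gt]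
        ring
      · simp [h1.le, hy1.le, h1.not_gt, h2, h, h2 ▸ h3, hy1.not_gt]
    · filter_upwards [lo _ h1, oneg (by rw [this]; apply mul_neg_of_pos_of_neg <;> linarith)] with y hy1 hy2
      simp [h1.le, hy1.le, h1.not_gt, h2, h.not_gt, hy2.not_gt, hy1.not_gt]
  · rcases lt_or_gt_of_ne (orient_ne_zero_of_not_mem hx h1 h2) with h | h
    · filter_upwards [lo _ h1, hi _ h2, oneg h] with y hy1 hy2 hy3
      simp [h1.le, hy1.le, h1.not_gt, h2.not_ge, hy2.not_ge, hy3.not_gt, h.not_gt, hy1.not_gt]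
    · filter_upwards [lo _ h1, hi _ h2, opos h] with y hy1 hy2 hy3
      simp [h1.le, hy1.le, h1.not_gt, h2.not_ge, hy2.not_ge, hy3, h, h2, hy2]
  · linarith
  -- For a horizontal edge at the height of `x`, both endpoints are on the same side of `x`, since
  -- otherwise `x` would lie on the edge; so the two corrections agree.
  · have : (x.1 < p.1 ∧ x.1 < q.1) ∨ (¬ x.1 < p.1 ∧ ¬ x.1 < q.1) := by
      by_contra hcon
      apply hx
      rw [mem_segment_iff_exists]
      have hne : q.1 - p.1 ≠ 0 := by
        intro h
        have : q.1 = p.1 := by linarith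
        rw [this] at hcon
        tauto
      refine ⟨(x.1 - p.1) / (q.1 - p.1), ?_, ?_, by field_simp; ring, by rw [h1, h2]; ring⟩
      · rcases lt_or_ge x.1 p.1 with h3 | h3 <;> rcases lt_or_ge x.1 q.1 with h4 | h4
        · tauto
        · apply div_nonneg_of_nonpos <;> linarith
        · apply div_nonneg <;> linarith
        · exact absurd (Or.inr ⟨h3.not_gt, h4.not_gt⟩) hcon
      · rcases lt_or_ge x.1 p.1 with h3 | h3 <;> rcases lt_or_ge x.1 q.1 with h4 | h4
        · tauto
        · rw [div_le_one_of_neg (by linarith)]; linarith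
        · rw [div_le_one (by linarith)]; linarith
        · exact absurd (Or.inr ⟨h3.not_gt, h4.not_gt⟩) hcon
    refine Eventually.of_forall fun y => ?_
    rcases this with ⟨h3, h4⟩ | ⟨h3, h4⟩
    · by_cases h5 : x.2 ≤ y.2
      · simp [h1, h2, h3, h4, h5, h5.not_gt]
      · push Not at h5
        simp [h1, h2, h3, h4, h5.not_ge]
        decide
    · simp only [h1, h2, h3, h4, and_false, if_false]
      rw [if_neg, if_neg] <;> rintro (⟨h5, h6, -⟩ | ⟨h5, h6, -⟩) <;> linarith
  · have : orient p q x = (q.2 - x.2) * (p.1 - x.1) := by unfold orient; rw [h1]; ring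
    rcases lt_or_gt_of_ne (hp1 h1.symm) with h | h
    · have ho : 0 < orient p q x := by rw [this]; apply mul_pos <;> linarith
      filter_upwards [hi _ h2, opos ho] with y hy1 hy2
      rcases lt_or_ge y.2 p.2 with h3 | h3
      · have h3' := h1 ▸ h3
        simp [h2.not_ge, hy1.not_ge, h1, ho, h2, h, h3'.not_ge]
        decide
      · have h3' := h1 ▸ h3
        simp [h2.not_ge, hy1.not_ge, h1, ho, h2, h, h3', hy1, hy2]
    · have ho : orient p q x < 0 := by rw [this]; apply mul_neg_of_pos_of_neg <;> linarith
      filter_upwards [hi _ h2, oneg ho] with y hy1 hy2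
      simp [h2.not_ge, hy1.not_ge, h1, ho.not_gt, h.not_gt, hy2.not_gt]
  · linarith
  · linarith
  · filter_upwards [hi _ h1, hi _ h2] with y hy1 hy2
    simp [h1.not_ge, h2.not_ge, hy1.not_ge, hy2.not_ge]

theorem edge_local {p q x : Pt} (hx : x ∉ segment ℝ p q) :
    ∀ᶠ y in 𝓝 x, crossBit y p q + rightBit x p y + rightBit x q y =
      crossBit x p q + rightBit x p x + rightBit x q x := by
  rcases le_total p.2 q.2 with h | h
  · exact edge_local_aux hx h
  · rw [segment_symm] at hx
    filter_upwards [edge_local_aux hx h] with y hy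
    rw [crossBit_comm y, crossBit_comm x, add_right_comm, hy, add_right_comm]

end RayCarving

namespace RayCarving
open Filter Topology

/-! ## Edge systems -/

/-- Finitely many disjoint closed simple polygonal chains, with vertices numbered consecutively. -/
structure EdgeSystem where
  k : ℕ
  P : ℕ → Pt
  nx : ℕ → ℕ
  pv : ℕ → ℕ
  nx_lt : ∀ i < k, nx i < k
  pv_lt : ∀ i < k, pv i < k
  pv_nx : ∀ i < k, pv (nx i) = i
  nx_pv : ∀ i < k, nx (pv i) = i
  ne : ∀ i < k, P i ≠ P (nx i)
  simple : ∀ i < k, ∀ j < k, i ≠ j → ∀ x ∈ segment ℝ (P i) (P (nx i)),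
    x ∈ segment ℝ (P j) (P (nx j)) → (j = nx i ∧ x = P j) ∨ (i = nx j ∧ x = P i)

namespace EdgeSystem

variable (S : EdgeSystem)

/-- The edge starting at the vertex `i`. -/
def edge (i : ℕ) : Set Pt := segment ℝ (S.P i) (S.P (S.nx i))

/-- The union of all edges. -/
def bd : Set Pt := ⋃ i ∈ Finset.range S.k, S.edge i

/-- The parity of the number of edges crossed by the rightward ray. -/
noncomputable def par (x : Pt) : ZMod 2 := ∑ i ∈ Finset.range S.k, crossBit x (S.P i) (S.P (S.nx i))

/-- The points of odd parity off the edges. -/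
def inside : Set Pt := {x | x ∉ S.bd ∧ S.par x = 1}

theorem mem_bd {x : Pt} : x ∈ S.bd ↔ ∃ i < S.k, x ∈ S.edge i := by simp [bd]

theorem isClosed_edge (i : ℕ) : IsClosed (S.edge i) := by
  unfold edge
  rw [segment_eq_image_lineMap]
  exact (isCompact_Icc.image (AffineMap.lineMap_continuous)).isClosed

theorem isClosed_bd : IsClosed S.bd :=
  isClosed_biUnion_finset fun i _ => S.isClosed_edge i

theorem vertex_mem_bd {i : ℕ} (hi : i < S.k) : S.P i ∈ S.bd :=
  S.mem_bd.2 ⟨i, hi, left_mem_segment ℝ _ _⟩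

/-- A common position of two vertices is a common point of the edges starting there. By `simple`
these edges are then consecutive and one of them has length zero, against `ne`. -/
theorem vertex_inj {i j : ℕ} (hi : i < S.k) (hj : j < S.k) (h : S.P i = S.P j) : i = j := by
  by_contra hij
  have h1 := S.simple i hi j hj hij (S.P i) (left_mem_segment ℝ _ _) (h ▸ left_mem_segment ℝ _ _)
  rcases h1 with ⟨h1, -⟩ | ⟨h1, -⟩
  · exact S.ne i hi (by rw [← h1]; exact h)
  · exact S.ne j hj (by rw [← h1]; exact h.symm)

theorem nx_ne {i : ℕ} (hi : i < S.k) : S.nx i ≠ i := fun h => S.ne i hi (by rw [h])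

theorem pv_ne {i : ℕ} (hi : i < S.k) : S.pv i ≠ i := fun h => by
  have := S.nx_pv i hi
  rw [h] at this
  exact S.nx_ne hi this

theorem sum_nx {M : Type*} [AddCommMonoid M] (f : ℕ → M) :
    ∑ i ∈ Finset.range S.k, f (S.nx i) = ∑ i ∈ Finset.range S.k, f i := by
  apply Finset.sum_bij (fun i _ => S.nx i)
  · intro i hi; simpa using S.nx_lt i (by simpa using hi)
  · intro i hi j hj h
    rw [← S.pv_nx i (by simpa using hi), ← S.pv_nx j (by simpa using hj), h]
  · intro i hi
    exact ⟨S.pv i, by simpa using S.pv_lt i (by simpa using hi), S.nx_pv i (by simpa using hi)⟩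
  · intros; rfl

/-- The change of the corrected crossing indicator of an edge between `x` and `y`. -/
noncomputable def jump (x y : Pt) (i : ℕ) : ZMod 2 :=
  crossBit y (S.P i) (S.P (S.nx i)) + rightBit x (S.P i) y + rightBit x (S.P (S.nx i)) y +
    (crossBit x (S.P i) (S.P (S.nx i)) + rightBit x (S.P i) x + rightBit x (S.P (S.nx i)) x)

/-- In the sum over closed chains every vertex occurs once as a first and once as a second endpoint,
so its correction occurs twice and vanishes modulo 2. This is what makes the total parity locally
constant, although single indicators are not. -/
theorem par_eq_add_jump (x y : Pt) : S.par y = S.par x + ∑ i ∈ Finset.range S.k, S.jump x y i := by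
  have h : ∀ z, ∑ i ∈ Finset.range S.k, rightBit x (S.P (S.nx i)) z =
    ∑ i ∈ Finset.range S.k, rightBit x (S.P i) z := fun z => S.sum_nx fun i => rightBit x (S.P i) z
  unfold jump par
  simp only [Finset.sum_add_distrib, h]
  generalize (∑ i ∈ Finset.range S.k, crossBit x (S.P i) (S.P (S.nx i))) = a
  generalize (∑ i ∈ Finset.range S.k, crossBit y (S.P i) (S.P (S.nx i))) = b
  generalize (∑ i ∈ Finset.range S.k, rightBit x (S.P i) x) = c
  generalize (∑ i ∈ Finset.range S.k, rightBit x (S.P i) y) = e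
  revert a b c e; decide

theorem jump_eventually_zero {x : Pt} {i : ℕ} (h : x ∉ S.edge i) : ∀ᶠ y in 𝓝 x, S.jump x y i = 0 := by
  filter_upwards [edge_local h] with y hy
  unfold jump
  rw [hy]
  exact zmod2_add_self _

theorem not_mem_edge_eventually {x : Pt} {i : ℕ} (h : x ∉ S.edge i) : ∀ᶠ y in 𝓝 x, y ∉ S.edge i :=
  (S.isClosed_edge i).isOpen_compl.mem_nhds h

theorem par_eventually_eq {x : Pt} (h : x ∉ S.bd) : ∀ᶠ y in 𝓝 x, S.par y = S.par x := by
  have : ∀ᶠ y in 𝓝 x, ∀ i ∈ Finset.range S.k, S.jump x y i = 0 := by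
    rw [Filter.eventually_all_finset]
    intro i hi
    exact S.jump_eventually_zero fun hx => h (S.mem_bd.2 ⟨i, by simpa using hi, hx⟩)
  filter_upwards [this] with y hy
  rw [S.par_eq_add_jump x y, Finset.sum_eq_zero hy, add_zero]

theorem isOpen_inside : IsOpen S.inside := by
  rw [isOpen_iff_mem_nhds]
  rintro x ⟨h1, h2⟩
  filter_upwards [S.par_eventually_eq h1, S.isClosed_bd.isOpen_compl.mem_nhds h1] with y hy1 hy2
  exact ⟨hy2, by rw [hy1, h2]⟩

theorem vertex_not_mem_inside {i : ℕ} (hi : i < S.k) : S.P i ∉ S.inside := fun h =>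
  h.1 (S.vertex_mem_bd hi)

/-- The parity is constant along a ray off the edges. -/
theorem par_const_ray {z n : Pt} (h : ∀ r : ℝ, 0 ≤ r → z + r • n ∉ S.bd) {r : ℝ} (hr : 0 ≤ r) :
    S.par (z + r • n) = S.par z := by
  -- With the discrete topology the locally constant parity is a continuous function on a connected
  -- half-line.
  let _ : TopologicalSpace (ZMod 2) := ⊥
  have _ : DiscreteTopology (ZMod 2) := ⟨rfl⟩
  have hc : ContinuousOn (fun r : ℝ => S.par (z + r • n)) (Ici 0) := by
    intro r hr
    have h1 := S.par_eventually_eq (h r hr)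
    have h2 : Tendsto (fun r : ℝ => z + r • n) (𝓝 r) (𝓝 (z + r • n)) :=
      Continuous.tendsto (by fun_prop) r
    have h3 := h2.eventually h1
    exact (continuousAt_const.congr (h3.mono fun _ h => h.symm)).continuousWithinAt
  have := isPreconnected_Ici.constant hc (x := r) (y := 0) hr (by simp)
  simpa using this

theorem exists_vertex_bound : ∃ M : ℝ, ∀ i < S.k, |(S.P i).1| ≤ M ∧ |(S.P i).2| ≤ M := by
  refine ⟨∑ i ∈ Finset.range S.k, (|(S.P i).1| + |(S.P i).2|), fun i hi => ?_⟩
  have := Finset.single_le_sum (f := fun i => |(S.P i).1| + |(S.P i).2|)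
    (fun i _ => by positivity) (Finset.mem_range.2 hi)
  constructor <;> linarith [abs_nonneg (S.P i).1, abs_nonneg (S.P i).2]

theorem par_zero_of_high {z : Pt} (h : ∀ i < S.k, (S.P i).2 ≤ z.2) : S.par z = 0 := by
  apply Finset.sum_eq_zero
  intro i hi
  have hi : i < S.k := by simpa using hi
  unfold crossBit Crosses
  rw [if_neg]
  rintro (⟨-, h1, -⟩ | ⟨-, h1, -⟩)
  · linarith [h _ (S.nx_lt i hi)]
  · linarith [h _ hi]

theorem par_zero_of_low {z : Pt} (h : ∀ i < S.k, z.2 < (S.P i).2) : S.par z = 0 := by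
  apply Finset.sum_eq_zero
  intro i hi
  have hi : i < S.k := by simpa using hi
  unfold crossBit Crosses
  rw [if_neg]
  rintro (⟨h1, -, -⟩ | ⟨h1, -, -⟩)
  · linarith [h _ hi]
  · linarith [h _ (S.nx_lt i hi)]

/-- A ray that is not horizontal finally gets above or below all vertices, where no edge is crossed;
the parity has not changed on the way. -/
theorem par_eq_zero_of_vert {z n : Pt} (hn : n.2 ≠ 0) (h : ∀ r : ℝ, 0 ≤ r → z + r • n ∉ S.bd) :
    S.par z = 0 := by
  obtain ⟨M, hM⟩ := S.exists_vertex_bound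
  have hr : 0 ≤ (|M| + 1 + |z.2|) / |n.2| := by positivity
  rw [← S.par_const_ray h hr]
  have hn' := abs_pos.2 hn
  rcases lt_or_gt_of_ne hn with h1 | h1
  · apply S.par_zero_of_low
    intro i hi
    have : (|M| + 1 + |z.2|) / |n.2| * n.2 = -(|M| + 1 + |z.2|) := by
      rw [abs_of_neg h1]; field_simp
    simp only [Prod.snd_add, Prod.smul_snd, smul_eq_mul, this]
    linarith [neg_abs_le (S.P i).2, (hM i hi).2, le_abs_self M, le_abs_self z.2]
  · apply S.par_zero_of_high
    intro i hi
    have : (|M| + 1 + |z.2|) / |n.2| * n.2 = (|M| + 1 + |z.2|) := by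
      rw [abs_of_pos h1]; field_simp
    simp only [Prod.snd_add, Prod.smul_snd, smul_eq_mul, this]
    linarith [le_abs_self (S.P i).2, (hM i hi).2, le_abs_self M, neg_abs_le z.2]

/-- A point that can escape to infinity off the edges has even parity. -/
theorem par_eq_zero_of_escape {z n : Pt} (hn : n ≠ 0) (h : ∀ r : ℝ, 0 ≤ r → z + r • n ∉ S.bd) :
    S.par z = 0 := by
  by_cases h2 : n.2 = 0
  · have h1 : n.1 ≠ 0 := fun h1 => hn (Prod.ext h1 h2)
    obtain ⟨M, hM⟩ := S.exists_vertex_bound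
    have hr : 0 ≤ (|M| + 1 + |z.1|) / |n.1| := by positivity
    rw [← S.par_const_ray h hr]
    -- A horizontal ray does not change its height. Once it has left the range of abscissas of the
    -- edges, the escape is continued vertically.
    apply S.par_eq_zero_of_vert (n := (0, 1)) (by simp)
    intro r' _ hb
    obtain ⟨i, hi, hb⟩ := S.mem_bd.1 hb
    obtain ⟨t, h0, h1', h3, -⟩ := (mem_segment_iff_exists _ _ _).1 hb
    have hn' := abs_pos.2 h1
    have e1 := abs_le.1 (hM i hi).1
    have e2 := abs_le.1 (hM _ (S.nx_lt i hi)).1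
    have e3 : (S.P i).1 + t * ((S.P (S.nx i)).1 - (S.P i).1) ≤ M := by nlinarith
    have e4 : -M ≤ (S.P i).1 + t * ((S.P (S.nx i)).1 - (S.P i).1) := by nlinarith
    simp only [Prod.fst_add, Prod.smul_fst, smul_eq_mul, mul_zero, add_zero] at h3
    rcases lt_or_gt_of_ne h1 with h1 | h1
    · have : (|M| + 1 + |z.1|) / |n.1| * n.1 = -(|M| + 1 + |z.1|) := by
        rw [abs_of_neg h1]; field_simp
      rw [this] at h3
      linarith [le_abs_self M, le_abs_self z.1]
    · have : (|M| + 1 + |z.1|) / |n.1| * n.1 = (|M| + 1 + |z.1|) := by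
        rw [abs_of_pos h1]; field_simp
      rw [this] at h3
      linarith [le_abs_self M, neg_abs_le z.1]
  · exact S.par_eq_zero_of_vert h2 h

end EdgeSystem
end RayCarving

/-! ### The parity close to a vertex and close to a point of an edge -/

namespace RayCarving
open Filter Topology

/-- The direction `d` is a positive multiple of `g`. -/
def PosParallel (g d : Pt) : Prop := cr g d = 0 ∧ 0 < g.1 * d.1 + g.2 * d.2

/-- The condition under which an edge leaving a point `x` in direction `g` changes the parity between
`x` and a point slightly displaced from `x` in direction `d`. -/
def Turns (g d : Pt) : Prop :=
  (0 < g.2 ∧ 0 ≤ d.2 ∧ 0 < cr g d) ∨ (g.2 < 0 ∧ d.2 < 0 ∧ cr g d < 0) ∨ (g.2 = 0 ∧ 0 < g.1 ∧ d.2 < 0)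

open Classical in
/-- The indicator of `Turns`. -/
noncomputable def turnBit (g d : Pt) : ZMod 2 := if Turns g d then 1 else 0

theorem tendsto_displace (x d : Pt) : Tendsto (fun ε : ℝ => x + ε • d) (𝓝[>] 0) (𝓝 x) := by
  have : Tendsto (fun ε : ℝ => x + ε • d) (𝓝 0) (𝓝 (x + (0:ℝ) • d)) :=
    Continuous.tendsto (by fun_prop) 0
  rw [zero_smul, add_zero] at this
  exact this.mono_left nhdsWithin_le_nhds

theorem orient_displace (x q d : Pt) (ε : ℝ) : orient x q (x + ε • d) = ε * cr (q - x) d := by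
  simp [orient, cr]; ring

theorem crossBit_self_left (x q : Pt) : crossBit x x q = 0 := by
  unfold crossBit Crosses
  rw [if_neg]
  simp [orient]

/-- The indicator at `x` itself is zero, and a small displacement crosses the height of `q` only if
`q` is at the height of `x`. If it is not, the change is the new crossing indicator, a sign
condition on `d`. If it is, both crossing indicators vanish and the correction of `q` alone gives
the third alternative of `Turns`. -/
theorem end_jump (x q d : Pt) : ∀ᶠ ε : ℝ in 𝓝[>] 0,
    crossBit (x + ε • d) x q + rightBit x x (x + ε • d) + rightBit x q (x + ε • d) +
      (crossBit x x q + rightBit x x x + rightBit x q x) = turnBit (q - x) d := by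
  have hpos : ∀ᶠ ε : ℝ in 𝓝[>] 0, 0 < ε := self_mem_nhdsWithin
  have ht := (continuous_snd.tendsto x).comp (tendsto_displace x d)
  rcases lt_trichotomy q.2 x.2 with h | h | h
  · filter_upwards [hpos, ht.eventually (eventually_gt_nhds h)] with ε hε hy
    simp only [Function.comp, Prod.snd_add, Prod.smul_snd, smul_eq_mul] at hy
    rw [crossBit_self_left]
    have e1 : crossBit (x + ε • d) x q = turnBit (q - x) d := by
      unfold crossBit turnBit
      classical
      apply if_congr _ rfl rfl
      unfold Crosses Turns
      rw [orient_swap x q, orient_displace]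
      simp only [Prod.snd_add, Prod.smul_snd, smul_eq_mul, Prod.snd_sub]
      constructor
      · rintro (⟨h1, h2, h3⟩ | ⟨h1, h2, h3⟩)
        · linarith
        · exact Or.inr (Or.inl ⟨by linarith, by nlinarith, by nlinarith⟩)
      · rintro (⟨h1, h2, h3⟩ | ⟨h1, h2, h3⟩ | ⟨h1, h2, h3⟩)
        · linarith
        · exact Or.inr ⟨by linarith, by nlinarith, by nlinarith⟩
        · linarith
    rw [e1]
    simp only [rightBit, lt_irrefl, and_false, if_false, Prod.snd_add, Prod.smul_snd, smul_eq_mul,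
      h.le, hy.le, true_and, add_zero, zero_add]
    rw [add_assoc, zmod2_add_self, add_zero]
  · filter_upwards [hpos] with ε hε
    rw [crossBit_self_left]
    have e1 : crossBit (x + ε • d) x q = 0 := by
      unfold crossBit Crosses
      rw [if_neg]
      rintro (⟨h1, h2, h3⟩ | ⟨h1, h2, h3⟩) <;> linarith
    have e2 : (x.2 ≤ x.2 + ε * d.2) ↔ 0 ≤ d.2 := by
      constructor
      · intro h; by_contra hc; push Not at hc; nlinarith
      · intro h; nlinarith
    have e3 : Turns (q - x) d ↔ x.1 < q.1 ∧ d.2 < 0 := by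
      unfold Turns
      simp [h]
    rw [e1]
    simp only [rightBit, lt_irrefl, and_false, if_false, Prod.snd_add, Prod.smul_snd, smul_eq_mul,
      add_zero, zero_add, h, e2, turnBit, e3, le_refl, true_and]
    by_cases h4 : x.1 < q.1 <;> by_cases h5 : d.2 < 0
    · simp [h4, h5, h5.not_ge]
    · push Not at h5
      simp [h4, h5, h5.not_gt]; decide
    · simp [h4]
    · simp [h4]
  · filter_upwards [hpos, ht.eventually (eventually_lt_nhds h)] with ε hε hy
    simp only [Function.comp, Prod.snd_add, Prod.smul_snd, smul_eq_mul] at hy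
    rw [crossBit_self_left]
    have e1 : crossBit (x + ε • d) x q = turnBit (q - x) d := by
      unfold crossBit turnBit
      classical
      apply if_congr _ rfl rfl
      unfold Crosses Turns
      rw [orient_displace]
      simp only [Prod.snd_add, Prod.smul_snd, smul_eq_mul, Prod.snd_sub]
      constructor
      · rintro (⟨h1, h2, h3⟩ | ⟨h1, h2, h3⟩)
        · exact Or.inl ⟨by linarith, by nlinarith, by nlinarith⟩
        · linarith
      · rintro (⟨h1, h2, h3⟩ | ⟨h1, h2, h3⟩ | ⟨h1, h2, h3⟩)
        · exact Or.inl ⟨by nlinarith, by linarith, by nlinarith⟩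
        · linarith
        · linarith
    rw [e1]
    simp only [rightBit, lt_irrefl, and_false, if_false, Prod.snd_add, Prod.smul_snd, smul_eq_mul,
      h.not_ge, hy.not_ge, false_and, add_zero]

theorem displace_not_mem_segment {x q d : Pt} (hd : d ≠ 0) (hpar : ¬ PosParallel (q - x) d)
    {ε : ℝ} (hε : 0 < ε) : x + ε • d ∉ segment ℝ x q := by
  intro h
  obtain ⟨t, h0, h1, h2, h3⟩ := (mem_segment_iff_exists _ _ _).1 h
  simp only [Prod.fst_add, Prod.smul_fst, smul_eq_mul, Prod.snd_add, Prod.smul_snd] at h2 h3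
  have e1 : ε * d.1 = t * (q.1 - x.1) := by linarith
  have e2 : ε * d.2 = t * (q.2 - x.2) := by linarith
  have dd : 0 < d.1 * d.1 + d.2 * d.2 := by
    by_contra hc
    have a1 := mul_self_nonneg d.1
    have a2 := mul_self_nonneg d.2
    exact hd (Prod.ext (mul_self_eq_zero.1 (by linarith)) (mul_self_eq_zero.1 (by linarith)))
  have e3 : t * ((q.1 - x.1) * d.1 + (q.2 - x.2) * d.2) = ε * (d.1 * d.1 + d.2 * d.2) := by
    linear_combination (-d.1) * e1 - d.2 * e2
  have e4 : 0 < t * ((q.1 - x.1) * d.1 + (q.2 - x.2) * d.2) := by rw [e3]; positivity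
  have ht : 0 < t := by
    rcases h0.lt_or_eq with h | h
    · exact h
    · rw [← h] at e4; simp at e4
  apply hpar
  constructor
  · simp only [cr, Prod.fst_sub, Prod.snd_sub]
    have : t * ((q.1 - x.1) * d.2 - (q.2 - x.2) * d.1) = 0 := by
      linear_combination (-d.2) * e1 + d.1 * e2
    exact (mul_eq_zero.1 this).resolve_left ht.ne'
  · exact pos_of_mul_pos_right e4 ht.le

theorem displace_mem_segment {x q d : Pt} (hpar : PosParallel (q - x) d) :
    ∀ᶠ ε : ℝ in 𝓝[>] 0, x + ε • d ∈ segment ℝ x q := by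
  obtain ⟨h1, h2⟩ := hpar
  simp only [cr, Prod.fst_sub, Prod.snd_sub] at h1 h2
  obtain ⟨g1, hg1⟩ : ∃ g, g = q.1 - x.1 := ⟨_, rfl⟩
  obtain ⟨g2, hg2⟩ : ∃ g, g = q.2 - x.2 := ⟨_, rfl⟩
  rw [← hg1, ← hg2] at h1 h2
  have gg : 0 < g1 * g1 + g2 * g2 := by
    have a1 := mul_self_nonneg g1
    have a2 := mul_self_nonneg g2
    rcases (add_nonneg a1 a2).lt_or_eq with h | h
    · exact h
    · have b1 : g1 = 0 := mul_self_eq_zero.1 (by linarith)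
      have b2 : g2 = 0 := mul_self_eq_zero.1 (by linarith)
      rw [b1, b2] at h2; simp at h2
  have hpos : ∀ᶠ ε : ℝ in 𝓝[>] 0, 0 < ε := self_mem_nhdsWithin
  have hlt : ∀ᶠ ε : ℝ in 𝓝[>] 0, ε < (g1 * g1 + g2 * g2) / (g1 * d.1 + g2 * d.2) :=
    nhdsWithin_le_nhds (eventually_lt_nhds (by positivity))
  filter_upwards [hpos, hlt] with ε h3 h4
  rw [lt_div_iff₀ h2] at h4
  rw [mem_segment_iff_exists]
  -- The parameter of the orthogonal projection onto the edge; it is at most 1 by the choice of `ε`.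
  refine ⟨ε * (g1 * d.1 + g2 * d.2) / (g1 * g1 + g2 * g2), by positivity, ?_, ?_, ?_⟩
  · rw [div_le_one gg]; exact h4.le
  · rw [← hg1, div_mul_eq_mul_div, ← sub_eq_iff_eq_add', eq_div_iff gg.ne']
    simp only [Prod.fst_add, Prod.smul_fst, smul_eq_mul]
    linear_combination (-ε * g2) * h1
  · rw [← hg2, div_mul_eq_mul_div, ← sub_eq_iff_eq_add', eq_div_iff gg.ne']
    simp only [Prod.snd_add, Prod.smul_snd, smul_eq_mul]
    linear_combination (ε * g1) * h1

namespace EdgeSystem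
variable (S : EdgeSystem)

/-- The direction `d` points from the vertex `i` into the inside. -/
def InCone (i : ℕ) (d : Pt) : Prop :=
  ¬ PosParallel (S.P (S.nx i) - S.P i) d ∧ ¬ PosParallel (S.P (S.pv i) - S.P i) d ∧
    S.par (S.P i) + turnBit (S.P (S.nx i) - S.P i) d + turnBit (S.P (S.pv i) - S.P i) d = 1

theorem edge_pv {i : ℕ} (hi : i < S.k) : S.edge (S.pv i) = segment ℝ (S.P i) (S.P (S.pv i)) := by
  unfold edge
  rw [S.nx_pv i hi, segment_symm]

theorem vertex_mem_edge_iff {i j : ℕ} (hi : i < S.k) (hj : j < S.k) :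
    S.P i ∈ S.edge j ↔ j = i ∨ j = S.pv i := by
  constructor
  · intro h
    by_contra hc
    push Not at hc
    rcases S.simple i hi j hj hc.1.symm _ (left_mem_segment ℝ _ _) h with ⟨-, h1⟩ | ⟨h1, -⟩
    · exact hc.1 (S.vertex_inj hj hi h1.symm)
    · apply hc.2; rw [h1, S.pv_nx j hj]
  · rintro (rfl | rfl)
    · exact left_mem_segment ℝ _ _
    · rw [S.edge_pv hi]; exact left_mem_segment ℝ _ _

/-- Only the two edges at the vertex can contribute, and each contributes the indicator of
`end_jump`; all others keep a distance from the vertex. -/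
theorem vertex_jump {i : ℕ} (hi : i < S.k) (d : Pt) : ∀ᶠ ε : ℝ in 𝓝[>] 0,
    S.par (S.P i + ε • d) =
      S.par (S.P i) + turnBit (S.P (S.nx i) - S.P i) d + turnBit (S.P (S.pv i) - S.P i) d := by
  have h1 : ∀ᶠ ε : ℝ in 𝓝[>] 0, ∀ j ∈ Finset.range S.k, j ≠ i → j ≠ S.pv i →
      S.jump (S.P i) (S.P i + ε • d) j = 0 := by
    rw [Filter.eventually_all_finset]
    intro j hj
    by_cases h : j = i ∨ j = S.pv i
    · exact Eventually.of_forall fun _ => by tauto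
    · have := S.jump_eventually_zero fun hx =>
        h ((S.vertex_mem_edge_iff hi (by simpa using hj)).1 hx)
      filter_upwards [(tendsto_displace (S.P i) d).eventually this] with ε hε _ _
      exact hε
  filter_upwards [h1, end_jump (S.P i) (S.P (S.nx i)) d, end_jump (S.P i) (S.P (S.pv i)) d]
    with ε e1 e2 e3
  rw [S.par_eq_add_jump (S.P i), add_assoc]
  congr 1
  have hi' : i ∈ Finset.range S.k := by simpa using hi
  have hp' : S.pv i ∈ (Finset.range S.k).erase i := by
    simp [S.pv_lt i hi, S.pv_ne hi]
  rw [← Finset.add_sum_erase _ _ hi', ← Finset.add_sum_erase _ _ hp', Finset.sum_eq_zero, add_zero]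
  · congr 1
    unfold jump
    rw [S.nx_pv i hi, crossBit_comm, crossBit_comm _ (S.P (S.pv i))]
    linear_combination e3
  · intro j hj
    simp only [Finset.mem_erase, ne_eq] at hj
    exact e1 j hj.2.2 hj.2.1 hj.1

/-- Directions along one of the two edges at the vertex stay on the boundary for a while, hence
outside `inside`. Every other direction leaves the boundary at once, and `vertex_jump` gives the
parity. -/
theorem vertex_displace {i : ℕ} (hi : i < S.k) {d : Pt} (hd : d ≠ 0) : ∀ᶠ ε : ℝ in 𝓝[>] 0,
    (S.P i + ε • d ∈ S.inside ↔ S.InCone i d) := by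
  have hpos : ∀ᶠ ε : ℝ in 𝓝[>] 0, 0 < ε := self_mem_nhdsWithin
  by_cases h1 : PosParallel (S.P (S.nx i) - S.P i) d
  · filter_upwards [displace_mem_segment h1] with ε hε
    refine ⟨fun h => absurd (S.mem_bd.2 ⟨i, hi, hε⟩) h.1, fun h => absurd h1 h.1⟩
  by_cases h2 : PosParallel (S.P (S.pv i) - S.P i) d
  · filter_upwards [displace_mem_segment h2] with ε hε
    rw [← S.edge_pv hi] at hε
    refine ⟨fun h => absurd (S.mem_bd.2 ⟨_, S.pv_lt i hi, hε⟩) h.1, fun h => absurd h2 h.2.1⟩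
  have h3 : ∀ᶠ ε : ℝ in 𝓝[>] 0, ∀ j ∈ Finset.range S.k, j ≠ i → j ≠ S.pv i →
      S.P i + ε • d ∉ S.edge j := by
    rw [Filter.eventually_all_finset]
    intro j hj
    by_cases h : j = i ∨ j = S.pv i
    · exact Eventually.of_forall fun _ => by tauto
    · have := S.not_mem_edge_eventually fun hx =>
        h ((S.vertex_mem_edge_iff hi (by simpa using hj)).1 hx)
      filter_upwards [(tendsto_displace (S.P i) d).eventually this] with ε hε _ _
      exact hε
  filter_upwards [hpos, h3, S.vertex_jump hi d] with ε hε h4 h5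
  have hb : S.P i + ε • d ∉ S.bd := by
    intro hb
    obtain ⟨j, hj, hb⟩ := S.mem_bd.1 hb
    by_cases e1 : j = i
    · subst e1; exact displace_not_mem_segment hd h1 hε hb
    by_cases e2 : j = S.pv i
    · subst e2; rw [S.edge_pv hi] at hb; exact displace_not_mem_segment hd h2 hε hb
    exact h4 j (by simpa using hj) e1 e2 hb
  unfold InCone inside
  simp [hb, h1, h2, h5]

/-- Passing transversally through an interior point of an edge changes the parity. -/
theorem edge_displace {i : ℕ} (hi : i < S.k) {x d : Pt} (hx : x ∈ S.edge i) (h1 : x ≠ S.P i)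
    (h2 : x ≠ S.P (S.nx i)) (hd : cr (S.P (S.nx i) - S.P i) d ≠ 0) : ∀ᶠ ε : ℝ in 𝓝[>] 0,
      x + ε • d ∉ S.bd ∧ x + ε • (-d) ∉ S.bd ∧ S.par (x + ε • d) ≠ S.par (x + ε • (-d)) := by
  have hpos : ∀ᶠ ε : ℝ in 𝓝[>] 0, 0 < ε := self_mem_nhdsWithin
  have other : ∀ j < S.k, j ≠ i → x ∉ S.edge j := by
    intro j hj hji hxj
    rcases S.simple i hi j hj hji.symm x hx hxj with ⟨h3, h4⟩ | ⟨h3, h4⟩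
    · exact h2 (by rw [← h3]; exact h4)
    · exact h1 h4
  have h3 : ∀ d : Pt, ∀ᶠ ε : ℝ in 𝓝[>] 0, ∀ j ∈ Finset.range S.k, j ≠ i →
      x + ε • d ∉ S.edge j ∧ S.jump x (x + ε • d) j = 0 := by
    intro d
    rw [Filter.eventually_all_finset]
    intro j hj
    by_cases h : j = i
    · exact Eventually.of_forall fun _ => by tauto
    · have hjx := other j (by simpa using hj) h
      filter_upwards [(tendsto_displace x d).eventually (S.not_mem_edge_eventually hjx),
        (tendsto_displace x d).eventually (S.jump_eventually_zero hjx)] with ε h4 h5 _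
      exact ⟨h4, h5⟩
  obtain ⟨t, t0, t1, x1, x2⟩ := (mem_segment_iff_exists _ _ _).1 hx
  have ho : ∀ d : Pt, ∀ ε : ℝ, orient (S.P i) (S.P (S.nx i)) (x + ε • d) =
      ε * cr (S.P (S.nx i) - S.P i) d := by
    intro d ε
    simp [orient, cr, x1, x2]; ring
  have off : ∀ d : Pt, cr (S.P (S.nx i) - S.P i) d ≠ 0 → ∀ ε : ℝ, 0 < ε → x + ε • d ∉ S.edge i := by
    intro d hd ε hε h
    obtain ⟨s, -, -, s1, s2⟩ := (mem_segment_iff_exists _ _ _).1 h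
    have := ho d ε
    rw [show orient (S.P i) (S.P (S.nx i)) (x + ε • d) = 0 by unfold orient; rw [s1, s2]; ring] at this
    exact hd ((mul_eq_zero.1 this.symm).resolve_left hε.ne')
  have hneg : cr (S.P (S.nx i) - S.P i) (-d) = - cr (S.P (S.nx i) - S.P i) d := by simp [cr]; ring
  have hd' : cr (S.P (S.nx i) - S.P i) (-d) ≠ 0 := by rw [hneg]; exact neg_ne_zero.2 hd
  have par_eq : ∀ y, (∀ j ∈ Finset.range S.k, j ≠ i → S.jump x y j = 0) →
      S.par y = S.par x + S.jump x y i := by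
    intro y hy
    rw [S.par_eq_add_jump x y, Finset.sum_eq_single i hy]
    simp [hi]
  -- Only the edge `i` can distinguish the two sides of `x`. If it is not horizontal, its crossing
  -- indicator depends on the sign of `orient`, which is opposite on the two sides.
  have hj : ∀ᶠ ε : ℝ in 𝓝[>] 0, S.jump x (x + ε • d) i ≠ S.jump x (x + ε • (-d)) i := by
    have tp : 0 < t := t0.lt_of_ne' fun h => h1 (Prod.ext (by rw [x1, h]; ring) (by rw [x2, h]; ring))
    have tl : t < 1 := t1.lt_of_ne fun h => h2 (Prod.ext (by rw [x1, h]; ring) (by rw [x2, h]; ring))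
    have lo : ∀ d c : _, c < x.2 → ∀ᶠ ε : ℝ in 𝓝[>] 0, c < (x + ε • d).2 := fun d c hc =>
      ((continuous_snd.tendsto x).comp (tendsto_displace x d)).eventually (eventually_gt_nhds hc)
    have hh : ∀ d c : _, x.2 < c → ∀ᶠ ε : ℝ in 𝓝[>] 0, (x + ε • d).2 < c := fun d c hc =>
      ((continuous_snd.tendsto x).comp (tendsto_displace x d)).eventually (eventually_lt_nhds hc)
    unfold jump
    rcases lt_trichotomy (S.P i).2 (S.P (S.nx i)).2 with h | h | h
    · have a1 : (S.P i).2 < x.2 := by rw [x2]; nlinarith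
      have a2 : x.2 < (S.P (S.nx i)).2 := by rw [x2]; nlinarith
      filter_upwards [hpos, lo d _ a1, lo (-d) _ a1, hh d _ a2, hh (-d) _ a2] with ε e0 e1 e2 e3 e4
      simp only [rightBit, a1.le, a2.not_ge, e1.le, e2.le, e3.not_ge, e4.not_ge, crossBit, Crosses,
        ho, orient_swap (S.P i) (S.P (S.nx i)), hneg, e3, e4, e1.not_gt, e2.not_gt, true_and, false_and, or_false,
        and_false, ne_eq, add_left_inj, if_false]
      rcases lt_or_gt_of_ne hd with h5 | h5
      · rw [if_neg (by nlinarith), if_pos (by nlinarith)]; decide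
      · rw [if_pos (by nlinarith), if_neg (by nlinarith)]; decide
    · filter_upwards [hpos] with ε e0
      have c0 : ∀ y, crossBit y (S.P i) (S.P (S.nx i)) = 0 := by
        intro y
        unfold crossBit Crosses
        rw [if_neg]
        rintro (⟨h1, h2, h3⟩ | ⟨h1, h2, h3⟩) <;> linarith
      have xx : x.2 = (S.P i).2 := by rw [x2, h]; ring
      simp only [c0, rightBit, ← h, xx, Prod.snd_add, Prod.smul_snd, smul_eq_mul, le_add_iff_nonneg_right, Prod.snd_neg]
      have hne : (S.P i).1 ≠ (S.P (S.nx i)).1 := fun h' => S.ne i hi (Prod.ext h' h)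
      have hd2 : d.2 ≠ 0 := by
        intro h'
        apply hd
        simp [cr, h', h]
      -- For a horizontal edge exactly one endpoint lies to the right of `x`, and its correction
      -- carries the change of parity.
      have key : (x.1 < (S.P i).1 ∧ ¬ x.1 < (S.P (S.nx i)).1) ∨
          (¬ x.1 < (S.P i).1 ∧ x.1 < (S.P (S.nx i)).1) := by
        rcases lt_or_gt_of_ne hne with h6 | h6
        · right; constructor <;> rw [x1] <;> nlinarith
        · left; constructor <;> rw [x1] <;> nlinarith
      rcases lt_or_gt_of_ne hd2 with h7 | h7
      · have b1 : ¬ 0 ≤ ε * d.2 := by nlinarith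
        have b2 : 0 ≤ ε * -d.2 := by nlinarith
        rcases key with ⟨k1, k2⟩ | ⟨k1, k2⟩ <;> simp only [k1, k2, b1, b2, le_refl] <;> simp
      · have b1 : 0 ≤ ε * d.2 := by nlinarith
        have b2 : ¬ 0 ≤ ε * -d.2 := by nlinarith
        rcases key with ⟨k1, k2⟩ | ⟨k1, k2⟩ <;> simp only [k1, k2, b1, b2, le_refl] <;> simp
    · have a1 : (S.P (S.nx i)).2 < x.2 := by rw [x2]; nlinarith
      have a2 : x.2 < (S.P i).2 := by rw [x2]; nlinarith
      filter_upwards [hpos, lo d _ a1, lo (-d) _ a1, hh d _ a2, hh (-d) _ a2] with ε e0 e1 e2 e3 e4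
      simp only [rightBit, a1.le, a2.not_ge, e1.le, e2.le, e3.not_ge, e4.not_ge, crossBit, Crosses,
        ho, orient_swap (S.P i) (S.P (S.nx i)), hneg, e3, e4, e1.not_gt, e2.not_gt, true_and, false_and, false_or,
        and_false, ne_eq, add_left_inj, if_false]
      rcases lt_or_gt_of_ne hd with h5 | h5
      · rw [if_pos (by nlinarith), if_neg (by nlinarith)]; decide
      · rw [if_neg (by nlinarith), if_pos (by nlinarith)]; decide
  filter_upwards [hpos, h3 d, h3 (-d), hj] with ε e0 e1 e2 e3
  refine ⟨?_, ?_, ?_⟩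
  · intro hb
    obtain ⟨j, hj, hb⟩ := S.mem_bd.1 hb
    by_cases hji : j = i
    · subst hji; exact off d hd ε e0 hb
    · exact (e1 j (by simpa using hj) hji).1 hb
  · intro hb
    obtain ⟨j, hj, hb⟩ := S.mem_bd.1 hb
    by_cases hji : j = i
    · subst hji; exact off (-d) hd' ε e0 hb
    · exact (e2 j (by simpa using hj) hji).1 hb
  · rw [par_eq _ fun j hj hji => (e1 j hj hji).2, par_eq _ fun j hj hji => (e2 j hj hji).2]
    intro h
    exact e3 (add_left_cancel h)

end EdgeSystem
end RayCarving

/-! ### Free rays may be taken through vertices -/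

namespace RayCarving
open Filter Topology

/-- The scalar product of two plane vectors. -/
def dt (a b : Pt) : ℝ := a.1 * b.1 + a.2 * b.2

theorem dt_self_pos {d : Pt} (hd : d ≠ 0) : 0 < dt d d := by
  unfold dt
  have a1 := mul_self_nonneg d.1
  have a2 := mul_self_nonneg d.2
  rcases (add_nonneg a1 a2).lt_or_eq with h | h
  · exact h
  · exact absurd (Prod.ext (mul_self_eq_zero.1 (by linarith)) (mul_self_eq_zero.1 (by linarith))) hd

theorem add_mul_sub_nonpos {a b t : ℝ} (t0 : 0 ≤ t) (t1 : t ≤ 1) (ha : a ≤ 0) (hb : b ≤ 0) :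
    a + t * (b - a) ≤ 0 := by nlinarith

theorem mul_sub_mem_unit {t θ : ℝ} (t0 : 0 ≤ t) (t1 : t ≤ 1) (θ0 : 0 ≤ θ) (θ1 : θ ≤ 1) :
    0 ≤ t - θ * t ∧ t - θ * t ≤ 1 := by constructor <;> nlinarith

namespace EdgeSystem
variable (S : EdgeSystem)

/-- The ray from `x` in direction `d` avoids the inside. -/
def Free (x d : Pt) : Prop := ∀ s : ℝ, 0 ≤ s → x + s • d ∉ S.inside

/-- The two sides of the edge have different parities, so one of them is odd. -/
theorem edge_near_inside {i : ℕ} (hi : i < S.k) {x d : Pt} (hx : x ∈ S.edge i) (h1 : x ≠ S.P i)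
    (h2 : x ≠ S.P (S.nx i)) (hd : cr (S.P (S.nx i) - S.P i) d ≠ 0) {δ : ℝ} (hδ : 0 < δ) :
    ∃ ε : ℝ, |ε| < δ ∧ x + ε • d ∈ S.inside := by
  have hpos : ∀ᶠ ε : ℝ in 𝓝[>] 0, 0 < ε := self_mem_nhdsWithin
  have hlt : ∀ᶠ ε : ℝ in 𝓝[>] 0, ε < δ := nhdsWithin_le_nhds (eventually_lt_nhds hδ)
  obtain ⟨ε, h3, h4, h5, h6, h7⟩ := (hpos.and (hlt.and (S.edge_displace hi hx h1 h2 hd))).exists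
  rcases zmod2_cases (S.par (x + ε • d)) with h | h
  · rcases zmod2_cases (S.par (x + ε • (-d))) with h' | h'
    · exact absurd (h.trans h'.symm) h7
    · refine ⟨-ε, by rw [abs_neg, abs_of_pos h3]; exact h4, ?_⟩
      rw [neg_smul, ← smul_neg]
      exact ⟨h6, h'⟩
  · exact ⟨ε, by rw [abs_of_pos h3]; exact h4, h5, h⟩

/-- A transversal meeting with the interior of an edge would bring the ray into the inside nearby.
If the ray is parallel to the edge, it runs along it, and one of the endpoints lies ahead on the
ray, against `hv`. -/
theorem Free.not_mem_bd {x d : Pt} (hd : d ≠ 0) (hf : S.Free x d)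
    (hv : ∀ a < S.k, ∀ s : ℝ, 0 < s → x + s • d ≠ S.P a) {s : ℝ} (hs : 0 < s) : x + s • d ∉ S.bd := by
  intro hb
  obtain ⟨i, hi, hb⟩ := S.mem_bd.1 hb
  by_cases hc : cr (S.P (S.nx i) - S.P i) d = 0
  · obtain ⟨t, t0, t1, x1, x2⟩ := (mem_segment_iff_exists _ _ _).1 hb
    have hne := S.ne i hi
    have hp := hv i hi
    have hq := hv _ (S.nx_lt i hi)
    generalize S.P i = p at *
    generalize S.P (S.nx i) = q at *
    have gg : 0 < dt (q - p) (q - p) := dt_self_pos (sub_ne_zero.2 hne.symm)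
    have dd : 0 < dt d d := dt_self_pos hd
    simp only [dt, cr, Prod.fst_sub, Prod.snd_sub, Prod.fst_add, Prod.snd_add, Prod.smul_fst, Prod.smul_snd,
      smul_eq_mul] at hc x1 x2 gg dd
    obtain ⟨g1, hg1⟩ : ∃ g, g = q.1 - p.1 := ⟨_, rfl⟩
    obtain ⟨g2, hg2⟩ : ∃ g, g = q.2 - p.2 := ⟨_, rfl⟩
    rw [← hg1, ← hg2] at hc gg
    rw [← hg1] at x1
    rw [← hg2] at x2
    have key1 : ∀ τ : ℝ, x.1 + (s + τ * (g1 * d.1 + g2 * d.2) / (d.1 * d.1 + d.2 * d.2)) * d.1 =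
        x.1 + s * d.1 + τ * g1 := by
      intro τ
      have : τ * (g1 * d.1 + g2 * d.2) / (d.1 * d.1 + d.2 * d.2) * d.1 = τ * g1 := by
        rw [div_mul_eq_mul_div, div_eq_iff dd.ne']
        linear_combination (-τ * d.2) * hc
      rw [add_mul, this]; ring
    have key2 : ∀ τ : ℝ, x.2 + (s + τ * (g1 * d.1 + g2 * d.2) / (d.1 * d.1 + d.2 * d.2)) * d.2 =
        x.2 + s * d.2 + τ * g2 := by
      intro τ
      have : τ * (g1 * d.1 + g2 * d.2) / (d.1 * d.1 + d.2 * d.2) * d.2 = τ * g2 := by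
        rw [div_mul_eq_mul_div, div_eq_iff dd.ne']
        linear_combination (τ * d.1) * hc
      rw [add_mul, this]; ring
    -- The sign tells which endpoint of the edge lies ahead; the parameters `1 - t` and `-t` lead
    -- from the common point to the second and to the first endpoint.
    rcases le_total 0 (g1 * d.1 + g2 * d.2) with h | h
    · have := hq (s + (1 - t) * (g1 * d.1 + g2 * d.2) / (d.1 * d.1 + d.2 * d.2))
        (by have : 0 ≤ (1 - t) * (g1 * d.1 + g2 * d.2) / (d.1 * d.1 + d.2 * d.2) :=
              div_nonneg (mul_nonneg (by linarith) h) dd.le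
            linarith)
      apply this
      ext
      · simp only [Prod.fst_add, Prod.smul_fst, smul_eq_mul, key1, x1]; rw [hg1]; ring
      · simp only [Prod.snd_add, Prod.smul_snd, smul_eq_mul, key2, x2]; rw [hg2]; ring
    · have := hp (s + (-t) * (g1 * d.1 + g2 * d.2) / (d.1 * d.1 + d.2 * d.2))
        (by have : 0 ≤ (-t) * (g1 * d.1 + g2 * d.2) / (d.1 * d.1 + d.2 * d.2) :=
              div_nonneg (mul_nonneg_of_nonpos_of_nonpos (by linarith) h) dd.le
            linarith)
      apply this
      ext
      · simp only [Prod.fst_add, Prod.smul_fst, smul_eq_mul, key1, x1]; ring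
      · simp only [Prod.snd_add, Prod.smul_snd, smul_eq_mul, key2, x2]; ring
  · obtain ⟨ε, h1, h2⟩ := S.edge_near_inside hi hb (hv i hi s hs) (hv _ (S.nx_lt i hi) s hs) hc hs
    rw [add_assoc, ← add_smul] at h2
    exact hf _ (by linarith [neg_abs_le ε]) h2

/-- Not all vertices are on one line. -/
theorem exists_vertex_off_line (hk : 0 < S.k) (x : Pt) {d : Pt} (hd : d ≠ 0) :
    ∃ u < S.k, cr d (S.P u - x) ≠ 0 := by
  by_contra hcon
  push Not at hcon
  have hn : ∀ y ∈ S.bd, cr d (y - x) = 0 := by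
    intro y hy
    obtain ⟨i, hi, hy⟩ := S.mem_bd.1 hy
    obtain ⟨t, t0, t1, y1, y2⟩ := (mem_segment_iff_exists _ _ _).1 hy
    have e1 := hcon i hi
    have e2 := hcon _ (S.nx_lt i hi)
    simp only [cr, Prod.fst_sub, Prod.snd_sub] at e1 e2 ⊢
    rw [y1, y2]
    linear_combination (1 - t) * e1 + t * e2
  -- If all vertices were on one line, the points on both sides of the midpoint of an edge could
  -- escape along the normals of the line. Both would have even parity, against `edge_displace`.
  set n : Pt := (-d.2, d.1) with hnd
  have dd := dt_self_pos hd
  have hn0 : n ≠ 0 := by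
    intro h
    apply hd
    have h1 := congrArg Prod.fst h
    have h2 := congrArg Prod.snd h
    simp [hnd] at h1 h2
    exact Prod.ext h2 h1
  have e1 := hcon 0 hk
  have e2 := hcon _ (S.nx_lt 0 hk)
  have hne := S.ne 0 hk
  set p := S.P 0 with hp
  set q := S.P (S.nx 0) with hq
  set m : Pt := (p.1 + 1/2 * (q.1 - p.1), p.2 + 1/2 * (q.2 - p.2)) with hm
  have hme : m ∈ S.edge 0 := (mem_segment_iff_exists _ _ _).2 ⟨1/2, by norm_num, by norm_num, rfl, rfl⟩
  have m1 : m ≠ p := by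
    intro h
    apply hne
    have h1 := congrArg Prod.fst h
    have h2 := congrArg Prod.snd h
    simp only [hm] at h1 h2
    exact Prod.ext (by linarith) (by linarith)
  have m2 : m ≠ q := by
    intro h
    apply hne
    have h1 := congrArg Prod.fst h
    have h2 := congrArg Prod.snd h
    simp only [hm] at h1 h2
    exact Prod.ext (by linarith) (by linarith)
  have hcr : cr (q - p) n ≠ 0 := by
    intro h
    apply hne
    simp only [cr, dt, Prod.fst_sub, Prod.snd_sub, hnd] at e1 e2 h dd
    have a1 : (d.1 * d.1 + d.2 * d.2) * (q.1 - p.1) = 0 := by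
      linear_combination d.1 * h + d.2 * e1 - d.2 * e2
    have a2 : (d.1 * d.1 + d.2 * d.2) * (q.2 - p.2) = 0 := by
      linear_combination d.2 * h + d.1 * e2 - d.1 * e1
    have b1 := (mul_eq_zero.1 a1).resolve_left dd.ne'
    have b2 := (mul_eq_zero.1 a2).resolve_left dd.ne'
    exact Prod.ext (by linarith) (by linarith)
  have hpos : ∀ᶠ ε : ℝ in 𝓝[>] 0, 0 < ε := self_mem_nhdsWithin
  obtain ⟨ε, h3, h5, h6, h7⟩ := (hpos.and (S.edge_displace hk hme m1 m2 hcr)).exists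
  have off : ∀ c : ℝ, c ≠ 0 → m + c • n ∉ S.bd := by
    intro c hc hb
    have h := hn _ hb
    have h0 := hn m (S.mem_bd.2 ⟨0, hk, hme⟩)
    simp only [cr, Prod.fst_sub, Prod.snd_sub, Prod.fst_add, Prod.snd_add, Prod.smul_fst, Prod.smul_snd,
      smul_eq_mul, hnd, dt] at h h0 dd
    have : c * (d.1 * d.1 + d.2 * d.2) = 0 := by linear_combination h - h0
    exact hc ((mul_eq_zero.1 this).resolve_right dd.ne')
  apply h7
  rw [S.par_eq_zero_of_escape hn0, S.par_eq_zero_of_escape (neg_ne_zero.2 hn0)]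
  · intro r hr
    rw [add_assoc, ← add_smul, smul_neg, ← neg_smul]
    exact off _ (by linarith)
  · intro r hr
    rw [add_assoc, ← add_smul]
    exact off _ (by linarith)

set_option maxHeartbeats 1000000 in
/-- A point with a free ray has a free ray through another vertex. -/
theorem exists_free_vertex (hk : 0 < S.k) {x d : Pt} (hd : d ≠ 0) (hf : S.Free x d) :
    ∃ a < S.k, S.P a ≠ x ∧ S.Free x (S.P a - x) := by
  by_cases hv : ∀ a < S.k, ∀ s : ℝ, 0 < s → x + s • d ≠ S.P a
  swap
  · push Not at hv
    obtain ⟨a, ha, s, hs, h⟩ := hv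
    refine ⟨a, ha, ?_, ?_⟩
    · intro h'
      rw [h'] at h
      have : s • d = 0 := by simpa using h
      exact hd ((smul_eq_zero.1 this).resolve_left hs.ne')
    · intro r hr
      rw [← h, add_sub_cancel_left, smul_smul]
      exact hf _ (by positivity)
  have hoff := fun s hs => Free.not_mem_bd S hd hf hv (s := s) hs
  obtain ⟨u, hu, hu0⟩ := S.exists_vertex_off_line hk x hd
  have dd := dt_self_pos hd
  -- Up to positive factors, `A` is the distance from the line of the ray, counted positive on the
  -- side of `u`, and `B` is the coordinate along the ray.
  let A : Pt → ℝ := fun w => cr d (w - x) * cr d (S.P u - x)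
  let B : Pt → ℝ := fun w => dt d (w - x)
  classical
  let F := (Finset.range S.k).filter fun w => 0 < A (S.P w)
  have huF : u ∈ F := by
    simp only [F, Finset.mem_filter, Finset.mem_range]
    exact ⟨hu, mul_self_pos.2 hu0⟩
  -- The quotient is a positive multiple of the cotangent of the angle with `d`. So `a` is a vertex
  -- that the ray meets first when it turns towards `u`.
  obtain ⟨a, haF, hmax⟩ := F.exists_max_image (fun w => B (S.P w) / A (S.P w)) ⟨u, huF⟩
  simp only [F, Finset.mem_filter, Finset.mem_range] at haF hmax
  obtain ⟨ha, hA⟩ := haF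
  have hD : ∀ w < S.k, 0 < A (S.P w) → B (S.P w) * A (S.P a) - B (S.P a) * A (S.P w) ≤ 0 := by
    intro w hw hAw
    have := hmax w ⟨hw, hAw⟩
    rw [div_le_div_iff₀ hAw hA] at this
    linarith
  refine ⟨a, ha, ?_, ?_⟩
  · intro h
    have : A (S.P a) = 0 := by simp [A, h, cr]
    linarith
  intro s hs hin
  rcases hs.lt_or_eq with hs | hs
  swap
  · rw [← hs, zero_smul, add_zero] at hin
    exact hf 0 le_rfl (by simpa using hin)
  have hpos : ∀ᶠ ε : ℝ in 𝓝[>] 0, 0 < ε := self_mem_nhdsWithin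
  obtain ⟨ε, hε, hin'⟩ := (hpos.and ((tendsto_displace _ d).eventually
    (S.isOpen_inside.mem_nhds hin))).exists
  -- An inside point on the new ray stays inside when pushed slightly in direction `d`. From there
  -- the way in direction `d` remains in the wedge between the new and the old ray, which no edge
  -- enters.
  have hesc : S.par (x + s • (S.P a - x) + ε • d) = 0 := by
    apply S.par_eq_zero_of_escape hd
    intro r hr hb
    rw [add_assoc, ← add_smul] at hb
    obtain ⟨i, hi, hb⟩ := S.mem_bd.1 hb
    set y := x + s • (S.P a - x) + (ε + r) • d with hy
    obtain ⟨t, t0, t1, y1, y2⟩ := (mem_segment_iff_exists _ _ _).1 hb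
    -- On the side of `u`, positive values mean a smaller angle with `d` than that of `a`. By
    -- maximality no vertex has `A` and `D` both positive. An edge through `y`, where both are
    -- positive, thus has an endpoint with `D` positive and `A` non-positive, and on the way to it
    -- meets the old ray.
    let D : Pt → ℝ := fun w => B w * A (S.P a) - B (S.P a) * A w
    have hAy : A y = s * A (S.P a) := by
      simp only [A, cr, hy, Prod.fst_sub, Prod.snd_sub, Prod.fst_add, Prod.snd_add, Prod.smul_fst,
        Prod.smul_snd, smul_eq_mul]
      ring
    have hBy : B y = s * B (S.P a) + (ε + r) * dt d d := by
      simp only [B, dt, hy, Prod.fst_sub, Prod.snd_sub, Prod.fst_add, Prod.snd_add, Prod.smul_fst,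
        Prod.smul_snd, smul_eq_mul]
      ring
    have hDy : 0 < D y := by
      have : D y = (ε + r) * dt d d * A (S.P a) := by
        simp only [D, hAy, hBy]; ring
      rw [this]; positivity
    have hAy' : 0 < A y := by rw [hAy]; positivity
    have aff : ∀ (p q z : Pt) (t : ℝ), z.1 = p.1 + t * (q.1 - p.1) → z.2 = p.2 + t * (q.2 - p.2) →
        A z = A p + t * (A q - A p) ∧ D z = D p + t * (D q - D p) := by
      intro p q z t h1 h2
      have hA : A z = A p + t * (A q - A p) := by
        simp only [A, cr, Prod.fst_sub, Prod.snd_sub, h1, h2]; ring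
      have hB : B z = B p + t * (B q - B p) := by
        simp only [B, dt, Prod.fst_sub, Prod.snd_sub, h1, h2]; ring
      refine ⟨hA, ?_⟩
      simp only [D, hA, hB]; ring
    -- a point of an edge at which `A` vanishes and `D` is positive is on the free ray
    have final : ∀ q : Pt, (∀ θ : ℝ, 0 ≤ θ → θ ≤ 1 → (y.1 + θ * (q.1 - y.1), y.2 + θ * (q.2 - y.2)) ∈ S.bd) →
        A q ≤ 0 → 0 < D q → False := by
      intro q hbd hAq hDq
      have hden : 0 < A y - A q := by linarith
      set θ := A y / (A y - A q) with hθ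
      have θ0 : 0 ≤ θ := by positivity
      have θ1 : θ ≤ 1 := by rw [hθ, div_le_one hden]; linarith
      set z : Pt := (y.1 + θ * (q.1 - y.1), y.2 + θ * (q.2 - y.2)) with hz
      obtain ⟨zA, zD⟩ := aff y q z θ rfl rfl
      have zA0 : A z = 0 := by rw [zA, hθ]; field_simp; ring
      have zD0 : 0 < D z := by
        rw [zD]
        by_contra hc; push Not at hc
        rcases θ1.lt_or_eq with h | h
        · linarith [mul_pos (by linarith : 0 < 1 - θ) hDy, mul_nonneg θ0 hDq.le]
        · rw [h] at hc; linarith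
      have zB : 0 < B z := by
        simp only [D, zA0, mul_zero, sub_zero] at zD0
        exact pos_of_mul_pos_left zD0 hA.le
      have zc : cr d (z - x) = 0 := (mul_eq_zero.1 zA0).resolve_right hu0
      have hzz : z = x + (B z / dt d d) • d := by
        simp only [B, dt, cr, Prod.fst_sub, Prod.snd_sub] at zc zB dd ⊢
        ext
        · simp only [Prod.fst_add, Prod.smul_fst, smul_eq_mul]
          rw [← sub_eq_iff_eq_add', div_mul_eq_mul_div, eq_div_iff dd.ne']
          linear_combination (-d.2) * zc
        · simp only [Prod.snd_add, Prod.smul_snd, smul_eq_mul]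
          rw [← sub_eq_iff_eq_add', div_mul_eq_mul_div, eq_div_iff dd.ne']
          linear_combination (d.1) * zc
      exact hoff (B z / dt d d) (by positivity) (hzz ▸ hbd θ θ0 θ1)
    obtain ⟨yA, yD⟩ := aff _ _ y t y1 y2
    have e1 := hD i hi
    have e2 := hD _ (S.nx_lt i hi)
    change 0 < A _ → D _ ≤ 0 at e1
    change 0 < A _ → D _ ≤ 0 at e2
    rcases le_or_gt (A (S.P i)) 0 with h1 | h1
    · rcases le_or_gt (A (S.P (S.nx i))) 0 with h2 | h2
      · linarith [add_mul_sub_nonpos t0 t1 h1 h2]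
      · apply final (S.P i) _ h1
        · by_contra hc; push Not at hc
          linarith [add_mul_sub_nonpos t0 t1 hc (e2 h2)]
        · intro θ θ0 θ1
          refine S.mem_bd.2 ⟨i, hi, (mem_segment_iff_exists _ _ _).2 ⟨t - θ * t,
            (mul_sub_mem_unit t0 t1 θ0 θ1).1, (mul_sub_mem_unit t0 t1 θ0 θ1).2, ?_, ?_⟩⟩
          · simp only [y1]; ring
          · simp only [y2]; ring
    · have h3 := e1 h1
      have h4 : 0 < D (S.P (S.nx i)) := by
        by_contra hc; push Not at hc
        linarith [add_mul_sub_nonpos t0 t1 h3 hc]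
      have h5 : A (S.P (S.nx i)) ≤ 0 := by
        by_contra hc; push Not at hc; linarith [e2 hc]
      apply final (S.P (S.nx i)) _ h5 h4
      intro θ θ0 θ1
      refine S.mem_bd.2 ⟨i, hi, (mem_segment_iff_exists _ _ _).2 ⟨1 - ((1 - t) - θ * (1 - t)), ?_, ?_, ?_, ?_⟩⟩
      · linarith [(mul_sub_mem_unit (t := 1 - t) (by linarith) (by linarith) θ0 θ1).2]
      · linarith [(mul_sub_mem_unit (t := 1 - t) (by linarith) (by linarith) θ0 θ1).1]
      · simp only [y1]; ring
      · simp only [y2]; ring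
  rw [hin'.2] at hesc
  exact one_ne_zero hesc

/-- From a point strictly separated from all vertices there is a line of support through a vertex. -/
theorem exists_supporting_vertex (hk : 0 < S.k) {x c : Pt} (hc : ∀ i < S.k, dt c (S.P i - x) < 0) :
    ∃ a < S.k, S.P a ≠ x ∧ ∀ s : ℝ, x + s • (S.P a - x) ∉ S.inside := by
  -- All vertices are on one open side of a line through `x`, so their directions from `x` are
  -- ordered by this quotient; the extreme one gives the line of support.
  obtain ⟨a, ha, hmax⟩ := (Finset.range S.k).exists_max_image
    (fun w => cr c (S.P w - x) / (-dt c (S.P w - x))) ⟨0, by simpa using hk⟩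
  simp only [Finset.mem_range] at ha hmax
  have hca := hc a ha
  let D : Pt → ℝ := fun n => cr c n * (-dt c (S.P a - x)) - cr c (S.P a - x) * (-dt c n)
  have hD : ∀ y ∈ S.bd, D (y - x) ≤ 0 := by
    intro y hy
    obtain ⟨i, hi, hy⟩ := S.mem_bd.1 hy
    obtain ⟨t, t0, t1, y1, y2⟩ := (mem_segment_iff_exists _ _ _).1 hy
    have vert : ∀ w < S.k, D (S.P w - x) ≤ 0 := by
      intro w hw
      have := hmax w hw
      rw [div_le_div_iff₀ (by linarith [hc w hw]) (by linarith)] at this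
      simp only [D]; linarith
    have e1 := vert i hi
    have e2 := vert _ (S.nx_lt i hi)
    have : D (y - x) = D (S.P i - x) + t * (D (S.P (S.nx i) - x) - D (S.P i - x)) := by
      simp only [D, cr, dt, Prod.fst_sub, Prod.snd_sub, y1, y2]; ring
    rw [this]; nlinarith
  refine ⟨a, ha, ?_, ?_⟩
  · intro h; rw [h] at hca; simp [dt] at hca
  intro s hin
  have hc0 : c ≠ 0 := by intro h; rw [h] at hca; simp [dt] at hca
  have cc := dt_self_pos hc0
  -- `D` is non-positive on all edges, zero on the line, and increases along `n`; so an inside point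
  -- of the line, pushed along `n`, could escape.
  set n : Pt := (-c.2, c.1) with hn
  have hDn : 0 < D n := by
    have : D n = dt c c * (-dt c (S.P a - x)) := by
      simp only [D, cr, dt, hn]; ring
    rw [this]; exact mul_pos cc (by linarith)
  have hn0 : n ≠ 0 := by
    intro h; rw [h] at hDn; simp [D, cr, dt] at hDn
  have hpos : ∀ᶠ ε : ℝ in 𝓝[>] 0, 0 < ε := self_mem_nhdsWithin
  obtain ⟨ε, hε, hin'⟩ := (hpos.and ((tendsto_displace _ n).eventually
    (S.isOpen_inside.mem_nhds hin))).exists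
  have hesc : S.par (x + s • (S.P a - x) + ε • n) = 0 := by
    apply S.par_eq_zero_of_escape hn0
    intro r hr hb
    have h1 := hD _ hb
    have h2 : D (x + s • (S.P a - x) + ε • n + r • n - x) = (ε + r) * D n := by
      simp only [D, cr, dt, Prod.fst_sub, Prod.snd_sub, Prod.fst_add, Prod.snd_add, Prod.smul_fst,
        Prod.smul_snd, smul_eq_mul]; ring
    rw [h2] at h1
    have : 0 < (ε + r) * D n := by positivity
    linarith
  rw [hin'.2] at hesc
  exact one_ne_zero hesc

/-! ## Obstructions seen from a vertex -/

/-- The inverse of the distance at which the line from `v` in direction `d` meets the line of an edge. -/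
noncomputable def edgeFun (v : Pt) (i : ℕ) (d : Pt) : ℝ :=
  cr d (S.P (S.nx i) - S.P i) / cr (S.P i - v) (S.P (S.nx i) - v)

/-- The line from `v` in direction `d` separates the endpoints of an edge. -/
def Separates (v : Pt) (i : ℕ) (d : Pt) : Prop :=
  cr d (S.P i - v) * cr d (S.P (S.nx i) - v) < 0

/-- The ray from `v` in direction `d` is obstructed at distance `1 / u` by the edge `i` or its first
vertex. -/
def Hit (v : Pt) (i : ℕ) (d : Pt) (u : ℝ) : Prop :=
  0 < u ∧ ((S.Separates v i d ∧ u = S.edgeFun v i d) ∨ (u • (S.P i - v) = d ∧ S.InCone i d))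

/-- Cramer's rule puts the intersection at the parameter `-a / (b - a)` of the edge, where `a` and
`b` are the cross products of `d` with the endpoints. Since these have opposite signs, the parameter
is strictly between 0 and 1. -/
theorem Separates.mem_edge {v d : Pt} {i : ℕ} (h : S.Separates v i d) (hu : 0 < S.edgeFun v i d) :
    v + (1 / S.edgeFun v i d) • d ∈ S.edge i ∧ v + (1 / S.edgeFun v i d) • d ≠ S.P i ∧
      v + (1 / S.edgeFun v i d) • d ≠ S.P (S.nx i) ∧ cr (S.P (S.nx i) - S.P i) d ≠ 0 := by
  unfold Separates at h
  unfold edgeFun at hu ⊢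
  unfold edge
  generalize S.P i = p at *
  generalize S.P (S.nx i) = q at *
  set N := cr d (q - p) with hN
  set D := cr (p - v) (q - v) with hD
  set a := cr d (p - v) with ha
  set b := cr d (q - v) with hb
  have hN0 : N ≠ 0 := by intro h; rw [h] at hu; simp at hu
  have hD0 : D ≠ 0 := by intro h; rw [h] at hu; simp at hu
  have hNab : N = b - a := by simp only [hN, ha, hb, cr, Prod.fst_sub, Prod.snd_sub]; ring
  have e1 : v.1 + D / N * d.1 = p.1 + (-a / N) * (q.1 - p.1) := by
    field_simp
    simp only [hN, hD, ha, cr, Prod.fst_sub, Prod.snd_sub]; ring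
  have e2 : v.2 + D / N * d.2 = p.2 + (-a / N) * (q.2 - p.2) := by
    field_simp
    simp only [hN, hD, ha, cr, Prod.fst_sub, Prod.snd_sub]; ring
  have hba : 0 < -a / N ∧ -a / N < 1 := by
    rw [hNab] at hN0 ⊢
    rcases lt_or_gt_of_ne hN0 with h1 | h1
    · have : b < 0 ∧ 0 < a := by
        rcases mul_neg_iff.1 h with h2 | h2
        · exact ⟨h2.2, h2.1⟩
        · linarith
      exact ⟨div_pos_of_neg_of_neg (by linarith) h1, by rw [div_lt_one_of_neg h1]; linarith⟩
    · have : 0 < b ∧ a < 0 := by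
        rcases mul_neg_iff.1 h with h2 | h2
        · linarith
        · exact ⟨h2.2, h2.1⟩
      exact ⟨div_pos (by linarith) h1, by rw [div_lt_one h1]; linarith⟩
  have hcr : cr (q - p) d ≠ 0 := by
    have : cr (q - p) d = -N := by simp only [hN, cr, Prod.fst_sub, Prod.snd_sub]; ring
    rw [this]; exact neg_ne_zero.2 hN0
  rw [one_div_div]
  have onl : ∀ t : ℝ, v + (D / N) • d = (p.1 + t * (q.1 - p.1), p.2 + t * (q.2 - p.2)) → -a / N = t := by
    intro t ht
    have h1 := congrArg Prod.fst ht
    have h2 := congrArg Prod.snd ht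
    simp only [Prod.fst_add, Prod.snd_add, Prod.smul_fst, Prod.smul_snd, smul_eq_mul] at h1 h2
    rw [e1] at h1
    rw [e2] at h2
    have : (-a / N - t) * cr d (q - p) = 0 := by
      generalize -a / N = w at h1 h2 ⊢
      simp only [cr, Prod.fst_sub, Prod.snd_sub]
      linear_combination d.1 * h2 - d.2 * h1
    rw [← hN] at this
    have := (mul_eq_zero.1 this).resolve_right hN0
    linarith
  refine ⟨(mem_segment_iff_exists _ _ _).2 ⟨-a / N, hba.1.le, hba.2.le, e1, e2⟩, ?_, ?_, hcr⟩
  · intro h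
    have := onl 0 (by rw [h]; ext <;> simp)
    linarith [hba.1]
  · intro h
    have := onl 1 (by rw [h]; ext <;> simp)
    linarith [hba.2]

/-- An obstruction is effective: an edge crossed transversally has inside points of the ray
immediately before or after it, a vertex with `InCone` has them immediately after it. The converse
is `exists_hit`. -/
theorem Hit.exists_inside {v d : Pt} {i : ℕ} {u : ℝ} (hi : i < S.k) (hd : d ≠ 0) (h : S.Hit v i d u)
    {c : ℝ} (hc : 1 / u < c) : ∃ s : ℝ, 0 < s ∧ s < c ∧ v + s • d ∈ S.inside := by
  obtain ⟨hu, ⟨h1, rfl⟩ | ⟨h1, h2⟩⟩ := h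
  · obtain ⟨e1, e2, e3, e4⟩ := Separates.mem_edge S h1 hu
    have hu' := one_div_pos.2 hu
    obtain ⟨ε, hε, hin⟩ := S.edge_near_inside hi e1 e2 e3 e4
      -- The first bound keeps the inside point ahead of `v`, the second one keeps it before
      -- distance `c`.
      (δ := min (1 / S.edgeFun v i d) (c - 1 / S.edgeFun v i d)) (lt_min hu' (by linarith))
    rw [lt_min_iff] at hε
    rw [add_assoc, ← add_smul] at hin
    exact ⟨_, by linarith [neg_abs_le ε, hε.1], by linarith [le_abs_self ε, hε.2], hin⟩
  · have hpos : ∀ᶠ ε : ℝ in 𝓝[>] 0, 0 < ε := self_mem_nhdsWithin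
    have hlt : ∀ᶠ ε : ℝ in 𝓝[>] 0, ε < c - 1 / u :=
      nhdsWithin_le_nhds (eventually_lt_nhds (by linarith))
    obtain ⟨ε, e1, e2, e3⟩ := (hpos.and (hlt.and (S.vertex_displace hi hd))).exists
    refine ⟨1 / u + ε, by positivity, by linarith, ?_⟩
    have : S.P i = v + (1 / u) • d := by
      rw [← h1, smul_smul, one_div_mul_cancel hu.ne', one_smul]; simp
    rw [add_smul, ← add_assoc, ← this]
    exact e3.2 h2

/-- An inside point on a ray from a vertex comes with an obstruction that is not farther away. -/
theorem exists_hit {a : ℕ} (ha : a < S.k) {d : Pt} (hd : d ≠ 0) {s : ℝ} (hs : 0 < s)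
    (hin : S.P a + s • d ∈ S.inside) :
    S.InCone a d ∨ ∃ i < S.k, ∃ u, S.Hit (S.P a) i d u ∧ 1 / u ≤ s := by
  set v := S.P a with hv
  have hcont : Continuous fun r : ℝ => v + r • d := by fun_prop
  -- Let `r` be the last parameter up to `s` outside the inside. The point there is on the boundary,
  -- as the parity is locally constant elsewhere. It is the base vertex, another vertex, or an
  -- interior point of an edge; the latter is crossed transversally, since the ray is inside
  -- directly afterwards.
  have hcl : IsCompact (Icc 0 s ∩ {r : ℝ | v + r • d ∉ S.inside}) :=
    isCompact_Icc.inter_right ((S.isOpen_inside.preimage hcont).isClosed_compl)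
  obtain ⟨r, ⟨⟨r0, rs⟩, hr⟩, hmax⟩ := hcl.exists_isGreatest
    ⟨0, ⟨le_rfl, hs.le⟩, by simpa using S.vertex_not_mem_inside ha⟩
  have hlt : r < s := rs.lt_of_ne fun h => hr (h ▸ hin)
  have after : ∀ ε : ℝ, 0 < ε → ε < s - r → v + r • d + ε • d ∈ S.inside := by
    intro ε e0 e1
    rw [add_assoc, ← add_smul]
    by_contra hc
    have := hmax ⟨⟨by linarith, by linarith⟩, hc⟩
    linarith
  have hpos : ∀ᶠ ε : ℝ in 𝓝[>] 0, 0 < ε := self_mem_nhdsWithin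
  have hsm : ∀ᶠ ε : ℝ in 𝓝[>] 0, ε < s - r :=
    nhdsWithin_le_nhds (eventually_lt_nhds (by linarith))
  have hyb : v + r • d ∈ S.bd := by
    by_contra hb
    obtain ⟨ε, e0, e1, e2⟩ := (hpos.and (hsm.and ((tendsto_displace _ d).eventually
      (S.par_eventually_eq hb)))).exists
    have := (after ε e0 e1).2
    rw [e2] at this
    exact hr ⟨hb, this⟩
  have vert : ∀ i < S.k, v + r • d = S.P i →
      S.InCone a d ∨ ∃ i < S.k, ∃ u, S.Hit v i d u ∧ 1 / u ≤ s := by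
    intro i hi hy
    obtain ⟨ε, e0, e1, e2⟩ := (hpos.and (hsm.and (S.vertex_displace hi hd))).exists
    have hcone := e2.1 (hy ▸ after ε e0 e1)
    rcases r0.lt_or_eq with h | h
    · right
      refine ⟨i, hi, 1 / r, ⟨by positivity, Or.inr ⟨?_, hcone⟩⟩, by rw [one_div_one_div]; exact rs⟩
      rw [← hy, add_sub_cancel_left, smul_smul, one_div_mul_cancel h.ne', one_smul]
    · left
      rw [← h, zero_smul, add_zero] at hy
      rwa [S.vertex_inj ha hi hy]
  obtain ⟨i, hi, hy⟩ := S.mem_bd.1 hyb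
  by_cases h1 : v + r • d = S.P i
  · exact vert i hi h1
  by_cases h2 : v + r • d = S.P (S.nx i)
  · exact vert _ (S.nx_lt i hi) h2
  right
  obtain ⟨t, t0, t1, y1, y2⟩ := (mem_segment_iff_exists _ _ _).1 hy
  have tp : 0 < t := t0.lt_of_ne' fun h => h1 (Prod.ext (by rw [y1, h]; ring) (by rw [y2, h]; ring))
  have tl : t < 1 := t1.lt_of_ne fun h => h2 (Prod.ext (by rw [y1, h]; ring) (by rw [y2, h]; ring))
  have rp : 0 < r := by
    rcases r0.lt_or_eq with h | h
    · exact h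
    · rw [← h, zero_smul, add_zero] at hy h1 h2
      rcases (S.vertex_mem_edge_iff ha hi).1 hy with h3 | h3
      · exact absurd (by rw [hv, h3]) h1
      · exact absurd (by rw [hv, h3, S.nx_pv a ha]) h2
  have hcr : cr (S.P (S.nx i) - S.P i) d ≠ 0 := by
    intro h0
    -- then the ray runs along the edge
    have hx : ∀ᶠ ε : ℝ in 𝓝[>] 0, v + r • d + ε • d ∈ S.edge i := by
      have gg : 0 < dt (S.P (S.nx i) - S.P i) (S.P (S.nx i) - S.P i) :=
        dt_self_pos (sub_ne_zero.2 (S.ne i hi).symm)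
      set c := dt (S.P (S.nx i) - S.P i) d / dt (S.P (S.nx i) - S.P i) (S.P (S.nx i) - S.P i) with hcdef
      have hlim : Tendsto (fun ε : ℝ => t + ε * c) (𝓝[>] 0) (𝓝 t) := by
        have : Tendsto (fun ε : ℝ => t + ε * c) (𝓝 0) (𝓝 (t + 0 * c)) :=
          Continuous.tendsto (by fun_prop) 0
        rw [zero_mul, add_zero] at this
        exact this.mono_left nhdsWithin_le_nhds
      filter_upwards [hlim.eventually (eventually_gt_nhds tp), hlim.eventually (eventually_lt_nhds tl)]
        with ε e0 e1
      refine (mem_segment_iff_exists _ _ _).2 ⟨t + ε * c, e0.le, e1.le, ?_, ?_⟩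
      · have : c * ((S.P (S.nx i)).1 - (S.P i).1) = d.1 := by
          rw [hcdef, div_mul_eq_mul_div, div_eq_iff gg.ne']
          simp only [cr, dt, Prod.fst_sub, Prod.snd_sub] at h0 ⊢
          linear_combination ((S.P (S.nx i)).2 - (S.P i).2) * h0
        rw [Prod.fst_add, y1, Prod.smul_fst, smul_eq_mul]
        linear_combination (-ε) * this
      · have : c * ((S.P (S.nx i)).2 - (S.P i).2) = d.2 := by
          rw [hcdef, div_mul_eq_mul_div, div_eq_iff gg.ne']
          simp only [cr, dt, Prod.fst_sub, Prod.snd_sub] at h0 ⊢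
          linear_combination (-((S.P (S.nx i)).1 - (S.P i).1)) * h0
        rw [Prod.snd_add, y2, Prod.smul_snd, smul_eq_mul]
        linear_combination (-ε) * this
    obtain ⟨ε, e0, e1, e2⟩ := (hpos.and (hsm.and hx)).exists
    exact (after ε e0 e1).1 (S.mem_bd.2 ⟨i, hi, e2⟩)
  simp only [Prod.fst_add, Prod.snd_add, Prod.smul_fst, Prod.smul_snd, smul_eq_mul] at y1 y2
  have hN : cr d (S.P (S.nx i) - S.P i) ≠ 0 := by
    intro h; apply hcr
    simp only [cr, Prod.fst_sub, Prod.snd_sub] at h ⊢; linarith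
  have ea : cr d (S.P i - v) = -t * cr d (S.P (S.nx i) - S.P i) := by
    simp only [cr, Prod.fst_sub, Prod.snd_sub]
    linear_combination d.2 * y1 - d.1 * y2
  have eb : cr d (S.P (S.nx i) - v) = (1 - t) * cr d (S.P (S.nx i) - S.P i) := by
    simp only [cr, Prod.fst_sub, Prod.snd_sub]
    linear_combination d.2 * y1 - d.1 * y2
  have eD : cr (S.P i - v) (S.P (S.nx i) - v) = r * cr d (S.P (S.nx i) - S.P i) := by
    simp only [cr, Prod.fst_sub, Prod.snd_sub]
    linear_combination ((S.P (S.nx i)).1 - (S.P i).1) * y2 - ((S.P (S.nx i)).2 - (S.P i).2) * y1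
  have hfun : S.edgeFun v i d = 1 / r := by
    unfold edgeFun
    rw [eD, eq_div_iff rp.ne']
    field_simp
  refine ⟨i, hi, 1 / r, ⟨by positivity, Or.inl ⟨?_, hfun.symm⟩⟩, by rw [one_div_one_div]; exact rs⟩
  unfold Separates
  rw [ea, eb]
  have := mul_self_pos.2 hN
  have : 0 < t * (1 - t) * (cr d (S.P (S.nx i) - S.P i) * cr d (S.P (S.nx i) - S.P i)) :=
    mul_pos (mul_pos tp (by linarith)) this
  linarith

/-- An open set that contains a boundary point contains a point in the relative interior of an edge,
and then points on both sides of it. One of these has even parity, so it is not in the union. -/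
theorem interior_inside_union_bd : interior (S.inside ∪ S.bd) = S.inside := by
  apply subset_antisymm
  · intro x hx
    rcases interior_subset hx with h | h
    · exact h
    exfalso
    obtain ⟨i, hi, h⟩ := S.mem_bd.1 h
    -- a point of the edge other than its endpoints in the same open set
    obtain ⟨m, hm, hme, m1, m2⟩ : ∃ m ∈ interior (S.inside ∪ S.bd), m ∈ S.edge i ∧ m ≠ S.P i ∧
        m ≠ S.P (S.nx i) := by
      have hinf : ∃ m ∈ interior (S.inside ∪ S.bd), m ∈ openSegment ℝ (S.P i) (S.P (S.nx i)) := by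
        have : x ∈ closure (openSegment ℝ (S.P i) (S.P (S.nx i))) := by
          rw [closure_openSegment]; exact h
        rw [mem_closure_iff] at this
        exact this _ isOpen_interior hx
      obtain ⟨m, h1, h2⟩ := hinf
      refine ⟨m, h1, openSegment_subset_segment ℝ _ _ h2, ?_, ?_⟩
      · rintro rfl
        exact S.ne i hi (left_mem_openSegment_iff.1 h2)
      · rintro rfl
        exact S.ne i hi (right_mem_openSegment_iff.1 h2)
    have hg : S.P (S.nx i) - S.P i ≠ 0 := sub_ne_zero.2 (S.ne i hi).symm
    have gg := dt_self_pos hg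
    set g := S.P (S.nx i) - S.P i with hgdef
    set n : Pt := (-g.2, g.1) with hn
    have hcr : cr g n ≠ 0 := by
      have : cr g n = dt g g := by simp only [cr, dt, hn]; ring
      rw [this]; exact gg.ne'
    have ev := fun d => (tendsto_displace m d).eventually (isOpen_interior.mem_nhds hm)
    obtain ⟨ε, e1, e2, e3, e4, e5⟩ := ((ev n).and ((ev (-n)).and (S.edge_displace hi hme m1 m2 hcr))).exists
    have f1 := (interior_subset e1).resolve_right e3
    have f2 := (interior_subset e2).resolve_right e4
    exact e5 (f1.2.trans f2.2.symm)
  · exact interior_maximal subset_union_left S.isOpen_inside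

end EdgeSystem
end RayCarving

namespace RayCarving

/-! ## Visibility envelopes -/

/-- A direction `d` of an envelope, with the inverse distances `xf` and `xb` of the first obstruction
in the directions `d` and `-d`, and linear functionals that give the inverse distances for the
directions between the preceding direction and `d`. The value `0` means that there is none. -/
structure Entry where
  d : Pt
  xf : ℝ
  xb : ℝ
  lf : Pt
  lb : Pt

/-- The downward direction, at which the enumeration of directions starts. -/
def startDir : Pt := (0, -1)

/-- The upward direction, at which the enumeration of directions ends. -/
def endDir : Pt := (0, 1)

/-- The normal form of a direction. -/
def Normal (d : Pt) : Prop := d.1 = 1 ∨ d = endDir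

/-- The order of directions. -/
def Before (a b : Pt) : Prop := a = startDir ∨ (Normal a ∧ 0 < cr a b)

/-- The directions between `a` and `b`. -/
def Leaf (a b : Pt) : Set Pt := {d | 0 < cr a d ∧ 0 < cr d b}

/-- The clockwise normal. -/
def cw (d : Pt) : Pt := (d.2, -d.1)

theorem cr_swap (a b : Pt) : cr a b = - cr b a := by simp [cr]; ring

theorem cr_neg_left (a b : Pt) : cr (-a) b = - cr a b := by simp [cr]; ring

theorem cr_neg_right (a b : Pt) : cr a (-b) = - cr a b := by simp [cr]; ring

theorem dt_neg_left (a b : Pt) : dt (-a) b = - dt a b := by simp [dt]; ring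

theorem dt_neg_right (a b : Pt) : dt a (-b) = - dt a b := by simp [dt]; ring

theorem dt_comb (l a b : Pt) (s t : ℝ) : dt l (s • a + t • b) = s * dt l a + t * dt l b := by
  simp [dt]; ring

theorem cr_comb (l a b : Pt) (s t : ℝ) : cr l (s • a + t • b) = s * cr l a + t * cr l b := by
  simp [cr]; ring

theorem cr_comb_left (l a b : Pt) (s t : ℝ) : cr (s • a + t • b) l = s * cr a l + t * cr b l := by
  simp [cr]; ring

theorem Leaf.ne_zero {a b d : Pt} (h : d ∈ Leaf a b) : d ≠ 0 := by
  rintro rfl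
  have := h.1
  simp [cr] at this

theorem Leaf.comb {a b x y : Pt} (hx : x ∈ Leaf a b) (hy : y ∈ Leaf a b) {s t : ℝ} (hs : 0 ≤ s) (ht : 0 ≤ t)
    (hst : 0 < s + t) : s • x + t • y ∈ Leaf a b := by
  obtain ⟨x1, x2⟩ := hx
  obtain ⟨y1, y2⟩ := hy
  have key : ∀ u w : ℝ, 0 < u → 0 < w → 0 < s * u + t * w := by
    intro u w hu hw
    rcases hs.lt_or_eq with h | h
    · have := mul_pos h hu; have := mul_nonneg ht hw.le; linarith
    · have : 0 < t := by linarith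
      have := mul_pos this hw; have := mul_nonneg hs hu.le; linarith
  constructor
  · rw [cr_comb]; exact key _ _ x1 y1
  · rw [cr_comb_left]; exact key _ _ x2 y2

/-- A linear functional without zeros between two directions has constant sign there. -/
theorem same_sign {a b x y l : Pt} (h : ∀ z ∈ Leaf a b, dt l z ≠ 0) (hx : x ∈ Leaf a b) (hy : y ∈ Leaf a b) :
    0 < dt l x * dt l y := by
  by_contra hc
  have hx0 := h x hx
  have hy0 := h y hy
  have hneg : dt l x * dt l y < 0 := lt_of_le_of_ne (not_lt.1 hc) (mul_ne_zero hx0 hy0)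
  rcases mul_neg_iff.1 hneg with ⟨h1, h2⟩ | ⟨h1, h2⟩
  · apply h (( - dt l y) • x + dt l x • y)
      (Leaf.comb hx hy (by linarith) h1.le (by linarith))
    rw [dt_comb]; ring
  · apply h ((dt l y) • x + (- dt l x) • y)
      (Leaf.comb hx hy h2.le (by linarith) (by linarith))
    rw [dt_comb]; ring

theorem Normal.eq_of_cr_eq_zero {a b : Pt} (ha : Normal a) (hb : Normal b) (h1 : ¬ 0 < cr a b) (h2 : ¬ 0 < cr b a) :
    a = b := by
  have h : cr a b = 0 := by rw [cr_swap b a] at h2; linarith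
  unfold cr at h
  rcases ha with ha | rfl <;> rcases hb with hb | rfl
  · rw [ha, hb] at h
    exact Prod.ext (by rw [ha, hb]) (by linarith)
  · simp [endDir, ha] at h
  · simp [endDir, hb] at h
  · rfl

/-- A leaf is an open interval of slopes in the right half-plane; `startDir` and `endDir` play the
roles of the slopes minus and plus infinity. -/
theorem mem_leaf_iff {a b d : Pt} (hb : Normal b) (hab : Before a b) : d ∈ Leaf a b ↔
    0 < d.1 ∧ (a = startDir ∨ a.2 * d.1 < d.2) ∧ (b = endDir ∨ d.2 < b.2 * d.1) := by
  unfold Leaf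
  simp only [mem_ofPred_eq]
  rcases hab with rfl | ⟨ha, hab⟩
  · rcases hb with hb | rfl
    · have : b ≠ endDir := by rintro rfl; simp [endDir] at hb
      simp only [cr, startDir, hb, this, true_or, true_and, false_or]
      constructor <;> rintro ⟨h1, h2⟩ <;> constructor <;> linarith
    · simp [cr, startDir, endDir]
  · rcases ha with ha | rfl
    · have ha' : a ≠ startDir := by rintro rfl; simp [startDir] at ha
      rcases hb with hb | rfl
      · have : b ≠ endDir := by rintro rfl; simp [endDir] at hb
        simp only [cr, ha, hb, this, ha', false_or] at hab ⊢
        constructor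
        · rintro ⟨h1, h2⟩
          have : 0 < d.1 := by nlinarith
          refine ⟨this, ?_, ?_⟩ <;> linarith
        · rintro ⟨h1, h2, h3⟩; constructor <;> linarith
      · simp only [cr, ha, endDir, ha', false_or, true_or, and_true]
        constructor
        · rintro ⟨h1, h2⟩; constructor <;> linarith
        · rintro ⟨h1, h2⟩; constructor <;> linarith
    · rcases hb with hb | rfl
      · simp [cr, endDir, hb] at hab; linarith
      · simp [cr, endDir] at hab

theorem startDir_not_normal : ¬ Normal startDir := by
  rintro (h | h)
  · simp [startDir] at h
  · have := congrArg Prod.snd h; simp [startDir, endDir] at this; linarith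

theorem Before.trans {a b c : Pt} (hb : Normal b) (hc : Normal c) (h1 : Before a b) (h2 : Before b c) : Before a c := by
  rcases h1 with rfl | ⟨ha, h1⟩
  · exact Or.inl rfl
  rcases h2 with rfl | ⟨-, h2⟩
  · exact absurd hb startDir_not_normal
  refine Or.inr ⟨ha, ?_⟩
  unfold cr at *
  rcases ha with ha | rfl
  · rcases hb with hb | rfl
    · rcases hc with hc | rfl
      · rw [ha, hb] at h1; rw [hb, hc] at h2; rw [ha, hc]; linarith
      · simp [ha, endDir]
    · rcases hc with hc | rfl
      · simp [endDir, hc] at h2; linarith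
      · simp [endDir] at h2
  · rcases hb with hb | rfl
    · simp [endDir, hb] at h1; linarith
    · simp [endDir] at h1

theorem Leaf.mono_left {a a' b : Pt} (ha : Normal a') (hb : Normal b) (h1 : Before a a') (h2 : Before a' b) :
    Leaf a' b ⊆ Leaf a b := by
  intro d hd
  rw [mem_leaf_iff hb h2] at hd
  rw [mem_leaf_iff hb (h1.trans ha hb h2)]
  obtain ⟨d1, d2, d3⟩ := hd
  refine ⟨d1, ?_, d3⟩
  rcases d2 with rfl | d2
  · exact absurd ha startDir_not_normal
  rcases h1 with h1 | ⟨h0, h1⟩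
  · exact Or.inl h1
  right
  rcases h2 with rfl | ⟨-, h2⟩
  · exact absurd ha startDir_not_normal
  unfold cr at h1 h2
  rcases ha with ha | rfl
  · rcases h0 with h0 | rfl
    · rw [h0, ha] at h1; nlinarith
    · simp [endDir, ha] at h1; linarith
  · rcases hb with hb | rfl
    · simp [endDir, hb] at h2; linarith
    · simp [endDir] at h2

theorem Leaf.mono_right {a b b' : Pt} (hb : Normal b) (hb' : Normal b') (h1 : Before a b') (h2 : Before b' b) :
    Leaf a b' ⊆ Leaf a b := by
  intro d hd
  rw [mem_leaf_iff hb' h1] at hd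
  rw [mem_leaf_iff hb (h1.trans hb' hb h2)]
  obtain ⟨d1, d2, d3⟩ := hd
  refine ⟨d1, d2, ?_⟩
  rcases h2 with rfl | ⟨-, h2⟩
  · exact absurd hb' startDir_not_normal
  unfold cr at h2
  rcases hb with hb | rfl
  · rcases hb' with hb' | rfl
    · rcases d3 with rfl | d3
      · simp [endDir] at hb'
      · rw [hb, hb'] at h2; right; nlinarith
    · simp [endDir, hb] at h2; linarith
  · exact Or.inl rfl

namespace EdgeSystem
variable (S : EdgeSystem) (v : Pt)

/-- The inverse distances of the obstructions from edges in `E` in direction `d`. -/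
def hitSet (E : Set ℕ) (d : Pt) : Set ℝ := {u | ∃ i ∈ E, i < S.k ∧ S.Hit v i d u}

/-- `u` is the inverse distance of the first obstruction from `E`, or zero if there is none. -/
def First (E : Set ℕ) (d : Pt) (u : ℝ) : Prop := IsGreatest (insert 0 (S.hitSet v E d)) u

/-- The line in direction `d` passes through no endpoint of an edge in `E`; indices beyond the number
of edges stand for the horizontal direction. -/
def Generic (E : Set ℕ) (d : Pt) : Prop :=
  ∀ i ∈ E, (i < S.k → (S.P i = v ∨ cr d (S.P i - v) ≠ 0) ∧
    (S.P (S.nx i) = v ∨ cr d (S.P (S.nx i) - v) ≠ 0)) ∧ (S.k ≤ i → d.2 ≠ 0)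

/-- The exact values of an entry are right. -/
def ExactOK (E : Set ℕ) (e : Entry) : Prop := S.First v E e.d e.xf ∧ S.First v E (-e.d) e.xb

/-- The functionals of an entry are right between `a` and its direction. -/
def OpenOK (E : Set ℕ) (a : Pt) (e : Entry) : Prop :=
  ∀ x ∈ Leaf a e.d, S.Generic v E x ∧ S.First v E x (dt e.lf x) ∧ S.First v E (-x) (dt e.lb (-x))

/-- A list of entries describes what is seen from `v` of the edges in `E`, beyond direction `a`. -/
def Env (E : Set ℕ) : Pt → List Entry → Prop
  | a, [] => a = endDir
  | a, e :: l => Normal e.d ∧ Before a e.d ∧ S.ExactOK v E e ∧ S.OpenOK v E a e ∧ Env E e.d l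

variable {S v}

theorem First.nonneg {E : Set ℕ} {d : Pt} {u : ℝ} (h : S.First v E d u) : 0 ≤ u := h.2 (mem_insert _ _)

theorem First.union {E₁ E₂ : Set ℕ} {d : Pt} {u₁ u₂ : ℝ} (h₁ : S.First v E₁ d u₁) (h₂ : S.First v E₂ d u₂) :
    S.First v (E₁ ∪ E₂) d (max u₁ u₂) := by
  have : S.hitSet v (E₁ ∪ E₂) d = S.hitSet v E₁ d ∪ S.hitSet v E₂ d := by
    ext u
    simp only [hitSet, mem_ofPred_eq, mem_union]
    constructor
    · rintro ⟨i, h | h, h'⟩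
      · exact Or.inl ⟨i, h, h'⟩
      · exact Or.inr ⟨i, h, h'⟩
    · rintro (⟨i, h, h'⟩ | ⟨i, h, h'⟩)
      · exact ⟨i, Or.inl h, h'⟩
      · exact ⟨i, Or.inr h, h'⟩
  unfold First at *
  rw [this, insert_union_distrib]
  exact h₁.union h₂

theorem Generic.union {E₁ E₂ : Set ℕ} {d : Pt} (h₁ : S.Generic v E₁ d) (h₂ : S.Generic v E₂ d) :
    S.Generic v (E₁ ∪ E₂) d := by
  rintro i (h | h)
  · exact h₁ i h
  · exact h₂ i h

theorem Generic.neg {E : Set ℕ} {d : Pt} (h : S.Generic v E d) : S.Generic v E (-d) := by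
  intro i hi
  obtain ⟨h1, h2⟩ := h i hi
  simp only [cr_neg_left, neg_ne_zero, Prod.snd_neg]
  exact ⟨h1, h2⟩

/-- In a generic direction only interior points of edges obstruct. -/
theorem Hit.separates {E : Set ℕ} {d : Pt} (hd : d ≠ 0) (hg : S.Generic v E d) {i : ℕ} (hi : i ∈ E) (hik : i < S.k)
    {u : ℝ} (h : S.Hit v i d u) : S.Separates v i d ∧ u = S.edgeFun v i d := by
  obtain ⟨hu, h | ⟨h, -⟩⟩ := h
  · exact h
  exfalso
  rcases ((hg i hi).1 hik).1 with h1 | h1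
  · rw [h1] at h; simp at h; exact hd h.symm
  · apply h1
    rw [← h]
    simp [cr]; ring

/-- Different edges do not obstruct a generic direction at the same distance. -/
theorem eq_zero_of_first_eq {E₁ E₂ : Set ℕ} (hE : Disjoint E₁ E₂) {d : Pt} (hd : d ≠ 0)
    (hg₁ : S.Generic v E₁ d) (hg₂ : S.Generic v E₂ d) {u : ℝ} (h₁ : S.First v E₁ d u) (h₂ : S.First v E₂ d u) :
    u = 0 := by
  rcases h₁.1 with h | ⟨i, hi, hik, hit⟩
  · exact h
  rcases h₂.1 with h | ⟨j, hj, hjk, hjt⟩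
  · exact h
  exfalso
  have hij : i ≠ j := fun h => disjoint_left.1 hE hi (h ▸ hj)
  obtain ⟨s1, e1⟩ := Hit.separates hd hg₁ hi hik hit
  obtain ⟨s2, e2⟩ := Hit.separates hd hg₂ hj hjk hjt
  obtain ⟨a1, a2, a3, -⟩ := Separates.mem_edge S s1 (e1 ▸ hit.1)
  obtain ⟨b1, b2, b3, -⟩ := Separates.mem_edge S s2 (e2 ▸ hjt.1)
  rw [← e1] at a1 a2 a3
  rw [← e2] at b1 b2 b3
  rcases S.simple i hik j hjk hij _ a1 b1 with ⟨-, h⟩ | ⟨-, h⟩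
  · exact b2 h
  · exact a2 h

end EdgeSystem

/-! ## Merging envelopes -/

/-- The functional with the larger values just before `d` (where `n` is the normal towards the
preceding directions). -/
noncomputable def pick (d n l₁ l₂ : Pt) : Pt :=
  open Classical in if dt l₁ d < dt l₂ d ∨ (dt l₁ d = dt l₂ d ∧ dt l₁ n < dt l₂ n) then l₂ else l₁

open Classical in
/-- The common refinement of two entries up to the earlier of their directions. -/
noncomputable def mergeEntry (e₁ e₂ : Entry) : Entry :=
  let d := if 0 < cr e₂.d e₁.d then e₂.d else e₁.d
  { d := d
    xf := max (if 0 < cr e₂.d e₁.d then dt e₁.lf d else e₁.xf) (if 0 < cr e₁.d e₂.d then dt e₂.lf d else e₂.xf)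
    xb := max (if 0 < cr e₂.d e₁.d then dt e₁.lb (-d) else e₁.xb)
      (if 0 < cr e₁.d e₂.d then dt e₂.lb (-d) else e₂.xb)
    lf := pick d (cw d) e₁.lf e₂.lf
    lb := pick (-d) (-cw d) e₁.lb e₂.lb }

open Classical in
/-- The merge of two envelopes. -/
noncomputable def mergeEnv : List Entry → List Entry → List Entry
  | [], _ => []
  | _ :: _, [] => []
  | e₁ :: t₁, e₂ :: t₂ =>
    mergeEntry e₁ e₂ ::
      (if 0 < cr e₂.d e₁.d then mergeEnv (e₁ :: t₁) t₂
      else if 0 < cr e₁.d e₂.d then mergeEnv t₁ (e₂ :: t₂)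
      else mergeEnv t₁ t₂)
termination_by l₁ l₂ => l₁.length + l₂.length

/-- It reduces the backward functionals to the forward case. -/
theorem pick_neg (d n l₁ l₂ : Pt) : -pick (-d) (-n) l₁ l₂ = pick d n (-l₁) (-l₂) := by
  unfold pick
  simp only [dt_neg_left, dt_neg_right]
  split_ifs <;> rfl

/-- By `heq` the functionals agree at most where both vanish. If their order at `x` differed from
that at `d`, they would agree in between and vanish there; being non-negative and linear, both would
then vanish at `d` too. So the comparison at the end `d`, refined by the normal in case of a tie,
decides for the whole leaf. -/
theorem le_of_larger_at_end {a d m₁ m₂ : Pt} (had : 0 ≤ cr a d) (hd : d ≠ 0)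
    (h₁ : ∀ x ∈ Leaf a d, 0 ≤ dt m₁ x) (h₂ : ∀ x ∈ Leaf a d, 0 ≤ dt m₂ x)
    (heq : ∀ x ∈ Leaf a d, dt m₁ x = dt m₂ x → dt m₁ x = 0)
    (hc : dt m₂ d < dt m₁ d ∨ (dt m₂ d = dt m₁ d ∧ dt m₂ (cw d) ≤ dt m₁ (cw d))) :
    ∀ x ∈ Leaf a d, dt m₂ x ≤ dt m₁ x := by
  intro x hx
  by_contra hlt
  push Not at hlt
  rcases hc with hc | ⟨hc1, hc2⟩
  · have hden : 0 < dt m₁ d - dt m₂ d + (dt m₂ x - dt m₁ x) := by linarith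
    -- The point between `d` and `x` at which the difference of the functionals vanishes.
    obtain ⟨t, ht⟩ : ∃ t, t = (dt m₁ d - dt m₂ d) / (dt m₁ d - dt m₂ d + (dt m₂ x - dt m₁ x)) := ⟨_, rfl⟩
    have t0 : 0 < t := by rw [ht]; apply div_pos <;> linarith
    have t1 : t < 1 := by rw [ht, div_lt_one hden]; linarith
    have mem : ∀ s : ℝ, 0 < s → s ≤ 1 → (1 - s) • d + s • x ∈ Leaf a d := by
      intro s hs hs1
      constructor
      · rw [cr_comb]
        have := mul_pos hs hx.1
        have := mul_nonneg (by linarith : 0 ≤ 1 - s) had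
        linarith
      · rw [cr_comb_left]
        have : cr d d = 0 := by simp [cr]; ring
        rw [this]
        have := mul_pos hs hx.2
        linarith
    have e0 : dt m₁ ((1 - t) • d + t • x) = dt m₂ ((1 - t) • d + t • x) := by
      rw [dt_comb, dt_comb]
      have : t * (dt m₁ d - dt m₂ d + (dt m₂ x - dt m₁ x)) = dt m₁ d - dt m₂ d := by
        rw [ht]; field_simp
      linarith
    have z1 := heq _ (mem t t0 t1.le) e0
    have z2 := e0.symm.trans z1
    have aux : ∀ m : Pt, (∀ x ∈ Leaf a d, 0 ≤ dt m x) → dt m ((1 - t) • d + t • x) = 0 → dt m d = 0 := by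
      intro m hm hz
      have h3 := hm _ (mem (t / 2) (by linarith) (by linarith))
      have h4 := hm _ hx
      rw [dt_comb] at h3 hz
      have hB : dt m d - dt m x ≥ 0 := by
        by_contra hcon
        push Not at hcon
        have := mul_pos_of_neg_of_neg hcon (by linarith : - t < 0)
        nlinarith
      have hA : dt m d ≤ 0 := by
        by_contra hcon
        push Not at hcon
        have := mul_pos (by linarith : 0 < 1 - t) hcon
        have := mul_nonneg t0.le h4
        linarith
      have hx0 : dt m x = 0 := by linarith
      rw [hx0] at hz
      have := (mul_eq_zero.1 (show (1 - t) * dt m d = 0 by linarith)).resolve_left (by linarith)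
      exact this
    rw [aux m₁ h₁ z1, aux m₂ h₂ z2] at hc
    exact lt_irrefl _ hc
  · have dd := dt_self_pos hd
    have hcr := hx.2
    -- The decomposition of `x` along `d` and its clockwise normal; the coefficient `cr x d` of the
    -- normal part is positive on the leaf.
    have e : ∀ m : Pt, dt d d * dt m x = dt d x * dt m d + cr x d * dt m (cw d) := by
      intro m; simp [dt, cr, cw]; ring
    have e1 := e m₁
    have e2 := e m₂
    rw [hc1] at e2
    have : dt d d * dt m₂ x ≤ dt d d * dt m₁ x := by
      rw [e1, e2]
      have := mul_le_mul_of_nonneg_left hc2 hcr.le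
      linarith
    have := le_of_mul_le_mul_left this dd
    linarith

namespace EdgeSystem
variable {S : EdgeSystem} {v : Pt}

theorem pick_max {a d m₁ m₂ : Pt} (had : 0 ≤ cr a d) (hd : d ≠ 0)
    (h₁ : ∀ x ∈ Leaf a d, 0 ≤ dt m₁ x) (h₂ : ∀ x ∈ Leaf a d, 0 ≤ dt m₂ x)
    (heq : ∀ x ∈ Leaf a d, dt m₁ x = dt m₂ x → dt m₁ x = 0) {x : Pt} (hx : x ∈ Leaf a d) :
    dt (pick d (cw d) m₁ m₂) x = max (dt m₁ x) (dt m₂ x) := by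
  unfold pick
  split_ifs with hc
  · refine (max_eq_right (le_of_larger_at_end had hd h₂ h₁ ?_ ?_ x hx)).symm
    · intro x hx h
      rw [h]; exact heq x hx h.symm
    · rcases hc with h | ⟨h, h'⟩
      · exact Or.inl h
      · exact Or.inr ⟨h, h'.le⟩
  · refine (max_eq_left (le_of_larger_at_end had hd h₁ h₂ heq ?_ x hx)).symm
    push Not at hc
    rcases hc.1.lt_or_eq with h | h
    · exact Or.inl h
    · exact Or.inr ⟨h, hc.2 h.symm⟩

theorem Before.cr_nonneg {a d : Pt} (hd : Normal d) (h : Before a d) : 0 ≤ cr a d := by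
  rcases h with rfl | ⟨-, h⟩
  · rcases hd with h | rfl
    · simp [cr, startDir, h]
    · simp [cr, startDir, endDir]
  · exact h.le

theorem Normal.ne_zero {d : Pt} (hd : Normal d) : d ≠ 0 := by
  rintro rfl
  rcases hd with h | h
  · simp at h
  · have := congrArg Prod.snd h; simp [endDir] at this

theorem Before.mem_leaf {a d b : Pt} (hd : Normal d) (hb : Normal b) (h1 : Before a d) (h2 : 0 < cr d b) : d ∈ Leaf a b := by
  rw [mem_leaf_iff hb (h1.trans hd hb (Or.inr ⟨hd, h2⟩))]
  unfold cr at h2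
  rcases hd with hd | rfl
  · refine ⟨by rw [hd]; norm_num, ?_, ?_⟩
    · rcases h1 with h1 | ⟨ha, h1⟩
      · exact Or.inl h1
      · right
        unfold cr at h1
        rcases ha with ha | rfl
        · rw [ha, hd] at h1; rw [hd]; linarith
        · simp [endDir, hd] at h1; linarith
    · rcases hb with hb | hb
      · right; rw [hd, hb] at h2; rw [hd]; linarith
      · exact Or.inl hb
  · rcases hb with hb | rfl
    · simp [endDir, hb] at h2; linarith
    · simp [endDir] at h2

theorem OpenOK.mono {E : Set ℕ} {a a' : Pt} {e : Entry} (h : Leaf a' e.d ⊆ Leaf a e.d) (ho : S.OpenOK v E a e) :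
    S.OpenOK v E a' e := fun x hx => ho x (h hx)

theorem Env.mono {E : Set ℕ} {a a' : Pt} {e : Entry} {l : List Entry} (ha : Normal a') (h1 : Before a a')
    (h2 : 0 < cr a' e.d) (h : S.Env v E a (e :: l)) : S.Env v E a' (e :: l) := by
  obtain ⟨n, b, x, o, t⟩ := h
  have hb : Before a' e.d := Or.inr ⟨ha, h2⟩
  exact ⟨n, hb, x, o.mono (Leaf.mono_left ha n h1 hb), t⟩

/-- The sign `σ` treats forward and backward rays at once. The hypothesis of `pick_max` on common
values is supplied by `eq_zero_of_first_eq`, that is, by the disjointness of the index sets. -/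
theorem pick_open {E₁ E₂ : Set ℕ} (hE : Disjoint E₁ E₂) {a d l₁ l₂ : Pt} (hd : Normal d) (had : Before a d)
    {σ : ℝ} (hσ : σ = 1 ∨ σ = -1)
    (h₁ : ∀ x ∈ Leaf a d, S.Generic v E₁ x ∧ S.First v E₁ (σ • x) (dt l₁ (σ • x)))
    (h₂ : ∀ x ∈ Leaf a d, S.Generic v E₂ x ∧ S.First v E₂ (σ • x) (dt l₂ (σ • x))) :
    ∀ x ∈ Leaf a d, S.First v (E₁ ∪ E₂) (σ • x) (dt (pick (σ • d) (σ • cw d) l₁ l₂) (σ • x)) := by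
  intro x hx
  have e : dt (pick (σ • d) (σ • cw d) l₁ l₂) (σ • x) = max (dt l₁ (σ • x)) (dt l₂ (σ • x)) := by
    have hgen : ∀ x ∈ Leaf a d, dt l₁ (σ • x) = dt l₂ (σ • x) → dt l₁ (σ • x) = 0 := by
      intro x hx h
      have hne : σ • x ≠ 0 := by
        rcases hσ with rfl | rfl
        · simpa using Leaf.ne_zero hx
        · simpa using Leaf.ne_zero hx
      have g : ∀ E, S.Generic v E x → S.Generic v E (σ • x) := by
        intro E hE
        rcases hσ with rfl | rfl
        · simpa using hE
        · simpa using hE.neg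
      exact eq_zero_of_first_eq hE hne (g _ (h₁ x hx).1) (g _ (h₂ x hx).1) (h₁ x hx).2 (h ▸ (h₂ x hx).2)
    rcases hσ with rfl | rfl
    · simp only [one_smul] at *
      exact pick_max (Before.cr_nonneg hd had) (Normal.ne_zero hd) (fun x hx => (h₁ x hx).2.nonneg)
        (fun x hx => (h₂ x hx).2.nonneg) hgen hx
    · simp only [neg_smul, one_smul] at *
      have n : ∀ l y : Pt, dt l (-y) = dt (-l) y := fun l y => by rw [dt_neg_left, dt_neg_right]
      simp only [n, pick_neg] at *
      exact pick_max (Before.cr_nonneg hd had) (Normal.ne_zero hd) (fun x hx => (h₁ x hx).2.nonneg)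
        (fun x hx => (h₂ x hx).2.nonneg) hgen hx
  rw [e]
  exact (h₁ x hx).2.union (h₂ x hx).2

theorem merge_open {E₁ E₂ : Set ℕ} (hE : Disjoint E₁ E₂) {a d : Pt} {e₁ e₂ e : Entry} (hd : Normal d) (had : Before a d)
    (he : e.d = d) (hf : e.lf = pick d (cw d) e₁.lf e₂.lf) (hb : e.lb = pick (-d) (-cw d) e₁.lb e₂.lb)
    (h₁ : S.OpenOK v E₁ a e₁) (h₂ : S.OpenOK v E₂ a e₂) (s₁ : Leaf a d ⊆ Leaf a e₁.d) (s₂ : Leaf a d ⊆ Leaf a e₂.d) :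
    S.OpenOK v (E₁ ∪ E₂) a e := by
  intro x hx
  rw [he] at hx
  refine ⟨(h₁ x (s₁ hx)).1.union (h₂ x (s₂ hx)).1, ?_, ?_⟩
  · have := pick_open (S := S) (v := v) hE (l₁ := e₁.lf) (l₂ := e₂.lf) hd had (Or.inl rfl)
      (fun x hx => ⟨(h₁ x (s₁ hx)).1, by simpa using (h₁ x (s₁ hx)).2.1⟩)
      (fun x hx => ⟨(h₂ x (s₂ hx)).1, by simpa using (h₂ x (s₂ hx)).2.1⟩) x hx
    simpa [hf] using this
  · have := pick_open (S := S) (v := v) hE (l₁ := e₁.lb) (l₂ := e₂.lb) hd had (Or.inr rfl)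
      (fun x hx => ⟨(h₁ x (s₁ hx)).1, by simpa using (h₁ x (s₁ hx)).2.2⟩)
      (fun x hx => ⟨(h₂ x (s₂ hx)).1, by simpa using (h₂ x (s₂ hx)).2.2⟩) x hx
    simpa [hb] using this

/-- The earlier of the two head directions lies inside the leaf of the other head, whose functional
therefore supplies the exact value there. Since the functionals do not change places on a leaf, the
union of the event directions suffices. -/
theorem Env.merge {E₁ E₂ : Set ℕ} (hE : Disjoint E₁ E₂) (l₁ l₂ : List Entry) : ∀ a : Pt,
    S.Env v E₁ a l₁ → S.Env v E₂ a l₂ → S.Env v (E₁ ∪ E₂) a (mergeEnv l₁ l₂) := by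
  induction l₁, l₂ using mergeEnv.induct with
  | case1 l => intro a h _; rw [mergeEnv]; exact h
  | case2 => intro a _ h; rw [mergeEnv]; exact h
  | case3 e₁ t₁ e₂ t₂ ih1 ih2 ih3 =>
    intro a h₁ h₂
    have h₁' := h₁
    have h₂' := h₂
    obtain ⟨n₁, b₁, x₁, o₁, r₁⟩ := h₁
    obtain ⟨n₂, b₂, x₂, o₂, r₂⟩ := h₂
    rw [mergeEnv]
    by_cases c1 : 0 < cr e₂.d e₁.d
    · have c2 : ¬ 0 < cr e₁.d e₂.d := by rw [cr_swap]; linarith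
      have hd : (mergeEntry e₁ e₂).d = e₂.d := by simp [mergeEntry, c1]
      have hm : e₂.d ∈ Leaf a e₁.d := Before.mem_leaf n₂ n₁ b₂ c1
      simp only [c1, if_true]
      refine ⟨hd ▸ n₂, hd ▸ b₂, ⟨?_, ?_⟩, ?_, ?_⟩
      · rw [hd]; simp only [mergeEntry, c1, c2, if_true, if_false]
        exact (o₁ _ hm).2.1.union x₂.1
      · rw [hd]; simp only [mergeEntry, c1, c2, if_true, if_false]
        exact (o₁ _ hm).2.2.union x₂.2
      · exact merge_open hE n₂ b₂ hd (by simp [mergeEntry, c1]) (by simp [mergeEntry, c1]) o₁ o₂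
          (Leaf.mono_right n₁ n₂ b₂ (Or.inr ⟨n₂, c1⟩)) subset_rfl
      · rw [hd]
        exact ih1 _ (Env.mono n₂ b₂ c1 h₁') r₂
    · by_cases c2 : 0 < cr e₁.d e₂.d
      · have hd : (mergeEntry e₁ e₂).d = e₁.d := by simp [mergeEntry, c1]
        have hm : e₁.d ∈ Leaf a e₂.d := Before.mem_leaf n₁ n₂ b₁ c2
        simp only [c1, c2, if_true, if_false]
        refine ⟨hd ▸ n₁, hd ▸ b₁, ⟨?_, ?_⟩, ?_, ?_⟩
        · rw [hd]; simp only [mergeEntry, c1, c2, if_true, if_false]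
          exact x₁.1.union (o₂ _ hm).2.1
        · rw [hd]; simp only [mergeEntry, c1, c2, if_true, if_false]
          exact x₁.2.union (o₂ _ hm).2.2
        · exact merge_open hE n₁ b₁ hd (by simp [mergeEntry, c1]) (by simp [mergeEntry, c1]) o₁ o₂
            subset_rfl (Leaf.mono_right n₂ n₁ b₁ (Or.inr ⟨n₁, c2⟩))
        · rw [hd]
          exact ih2 _ r₁ (Env.mono n₁ b₁ c2 h₂')
      · have hd : (mergeEntry e₁ e₂).d = e₁.d := by simp [mergeEntry, c1]
        have he : e₁.d = e₂.d := Normal.eq_of_cr_eq_zero n₁ n₂ c2 c1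
        simp only [c1, c2, if_false]
        refine ⟨hd ▸ n₁, hd ▸ b₁, ⟨?_, ?_⟩, ?_, ?_⟩
        · rw [hd]; simp only [mergeEntry, c1, c2, if_false]
          exact x₁.1.union (he ▸ x₂.1)
        · rw [hd]; simp only [mergeEntry, c1, c2, if_false]
          exact x₁.2.union (he ▸ x₂.2)
        · exact merge_open hE n₁ b₁ hd (by simp [mergeEntry, c1]) (by simp [mergeEntry, c1]) o₁ o₂
            subset_rfl (he ▸ subset_rfl)
        · rw [hd]
          exact ih3 _ r₁ (he ▸ r₂)

end EdgeSystem

theorem length_mergeEnv_le (l₁ l₂ : List Entry) : (mergeEnv l₁ l₂).length ≤ l₁.length + l₂.length := by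
  induction l₁, l₂ using mergeEnv.induct with
  | case1 l => simp [mergeEnv]
  | case2 => simp [mergeEnv]
  | case3 e₁ t₁ e₂ t₂ ih1 ih2 ih3 =>
    rw [mergeEnv]
    split_ifs <;> simp at * <;> omega

end RayCarving

/-! ### The envelope of a single edge -/

namespace RayCarving

/-- The normalized direction of the line through `v` and `w`. -/
noncomputable def dirTo (v w : Pt) : Pt :=
  open Classical in if w.1 = v.1 then endDir else (1, (w.2 - v.2) / (w.1 - v.1))

theorem normal_dirTo (v w : Pt) : Normal (dirTo v w) := by
  unfold dirTo; split_ifs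
  · exact Or.inr rfl
  · exact Or.inl rfl

/-- Leaves are cones, so the normalized direction of a line is in a leaf with any other direction of
this line in it. Contrapositively, a leaf without the directions to the endpoints of an edge is
generic for this edge. -/
theorem dirTo_mem_leaf {v w a b x : Pt} (hb : Normal b) (hab : Before a b) (hx : x ∈ Leaf a b)
    (hw : w ≠ v) (hc : cr x (w - v) = 0) : dirTo v w ∈ Leaf a b := by
  have hx' := (mem_leaf_iff hb hab).1 hx
  have h1 : w.1 ≠ v.1 := by
    intro h
    apply hw
    simp only [cr, Prod.fst_sub, Prod.snd_sub, h, sub_self, mul_zero, sub_zero] at hc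
    have := (mul_eq_zero.1 hc).resolve_left hx'.1.ne'
    exact Prod.ext h (by linarith)
  have h2 : dirTo v w = (1 / x.1) • x := by
    have h3 : w.1 - v.1 ≠ 0 := sub_ne_zero.2 h1
    have h4 := hx'.1.ne'
    unfold dirTo
    rw [if_neg h1]
    ext
    · simp [h4]
    · simp only [Prod.smul_snd, smul_eq_mul]
      rw [div_eq_iff h3]
      field_simp
      simp only [cr, Prod.fst_sub, Prod.snd_sub] at hc
      linarith
  rw [h2]
  have := Leaf.comb hx hx (s := 1 / x.1) (t := 0) (by have := hx'.1; positivity) le_rfl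
    (by have := hx'.1; positivity)
  simpa using this

namespace EdgeSystem
variable (S : EdgeSystem) (v : Pt)

/-- The functional that gives the inverse distances of the points of an edge. -/
noncomputable def edgeVec (i : ℕ) : Pt :=
  (((S.P (S.nx i)).2 - (S.P i).2) / cr (S.P i - v) (S.P (S.nx i) - v),
    -((S.P (S.nx i)).1 - (S.P i).1) / cr (S.P i - v) (S.P (S.nx i) - v))

open Classical in
/-- The inverse distance of the obstruction from an edge or its first vertex, or zero. -/
noncomputable def exactVal (i : ℕ) (d : Pt) : ℝ :=
  if S.Separates v i d ∧ 0 < S.edgeFun v i d then S.edgeFun v i d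
  else if (cr d (S.P i - v) = 0 ∧ 0 < dt d (S.P i - v)) ∧ S.InCone i d then dt d d / dt d (S.P i - v)
  else 0

open Classical in
/-- The functional of an edge if the edge obstructs the direction `m`, and zero otherwise. -/
noncomputable def openVec (i : ℕ) (m : Pt) : Pt :=
  if S.Separates v i m ∧ 0 < S.edgeFun v i m then S.edgeVec v i else 0

/-- The entry of a single edge for the direction `d` following `a`. -/
noncomputable def edgeEntry (i : ℕ) (a d : Pt) : Entry where
  d := d
  xf := S.exactVal v i d
  xb := S.exactVal v i (-d)
  lf := S.openVec v i (a + d)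
  lb := S.openVec v i (-(a + d))

open Classical in
/-- The envelope of an edge with prescribed candidate directions. -/
noncomputable def edgeListAux (i : ℕ) (a b : Pt) : List Entry :=
  if 0 < cr a b then
    if 0 < b.1 then [S.edgeEntry v i startDir a, S.edgeEntry v i a b, S.edgeEntry v i b endDir]
    else [S.edgeEntry v i startDir a, S.edgeEntry v i a endDir]
  else if 0 < b.1 then [S.edgeEntry v i startDir b, S.edgeEntry v i b endDir]
  else [S.edgeEntry v i startDir endDir]

open Classical in
/-- The envelope of a single edge. -/
noncomputable def edgeList (i : ℕ) : List Entry :=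
  if 0 < cr (dirTo v (S.P (S.nx i))) (dirTo v (S.P i)) then
    S.edgeListAux v i (dirTo v (S.P (S.nx i))) (dirTo v (S.P i))
  else S.edgeListAux v i (dirTo v (S.P i)) (dirTo v (S.P (S.nx i)))

/-- The envelope without edges. -/
def emptyList : List Entry := [⟨(1, 0), 0, 0, 0, 0⟩, ⟨endDir, 0, 0, 0, 0⟩]

variable {S v}

theorem edgeFun_eq_dt (i : ℕ) (d : Pt) : S.edgeFun v i d = dt (S.edgeVec v i) d := by
  simp [edgeFun, edgeVec, cr, dt]; ring

theorem edgeFun_neg (i : ℕ) (d : Pt) : S.edgeFun v i (-d) = - S.edgeFun v i d := by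
  rw [edgeFun_eq_dt, edgeFun_eq_dt, dt_neg_right]

theorem Separates.neg {i : ℕ} {d : Pt} : S.Separates v i (-d) ↔ S.Separates v i d := by
  unfold Separates; rw [cr_neg_left, cr_neg_left, neg_mul_neg]

/-- The two kinds of obstruction exclude each other, because a vertex on the line makes one of the
factors in `Separates` zero. For a vertex, `u • (S.P i - v) = d` determines `u` by a scalar product
with `d`. -/
theorem exactVal_first {i : ℕ} (hi : i < S.k) {d : Pt} (hd : d ≠ 0) : S.First v {i} d (S.exactVal v i d) := by
  have dd := dt_self_pos hd
  have vert : ∀ u : ℝ, 0 < u → u • (S.P i - v) = d → cr d (S.P i - v) = 0 ∧ 0 < dt d (S.P i - v) ∧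
      u = dt d d / dt d (S.P i - v) := by
    intro u hu h
    have h1 : cr d (S.P i - v) = 0 := by rw [← h]; simp [cr]; ring
    have h2 : dt d d = u * dt d (S.P i - v) := by
      nth_rw 2 [← h]; simp [dt]; ring
    have h3 : 0 < dt d (S.P i - v) := by
      rw [h2] at dd; exact pos_of_mul_pos_right dd hu.le
    exact ⟨h1, h3, by rw [h2]; field_simp⟩
  unfold exactVal
  split_ifs with h1 h2
  · refine ⟨Or.inr ⟨i, rfl, hi, h1.2, Or.inl ⟨h1.1, rfl⟩⟩, ?_⟩
    rintro u (rfl | ⟨j, rfl, -, hu, ⟨-, h⟩ | ⟨h, -⟩⟩)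
    · exact h1.2.le
    · exact h.le
    · have := (vert u hu h).1
      have h3 := h1.1
      unfold Separates at h3
      rw [this] at h3; simp at h3
  · obtain ⟨⟨a1, a2⟩, a3⟩ := h2
    refine ⟨Or.inr ⟨i, rfl, hi, by positivity, Or.inr ⟨?_, a3⟩⟩, ?_⟩
    · simp only [cr, dt, Prod.fst_sub, Prod.snd_sub] at a1 a2 dd ⊢
      ext
      · simp only [Prod.smul_fst, Prod.fst_sub, smul_eq_mul]
        rw [div_mul_eq_mul_div, div_eq_iff a2.ne']
        linear_combination (-d.2) * a1
      · simp only [Prod.smul_snd, Prod.snd_sub, smul_eq_mul]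
        rw [div_mul_eq_mul_div, div_eq_iff a2.ne']
        linear_combination (d.1) * a1
    · rintro u (rfl | ⟨j, rfl, -, hu, ⟨h3, -⟩ | ⟨h, -⟩⟩)
      · positivity
      · unfold Separates at h3
        rw [a1] at h3; simp at h3
      · exact (vert u hu h).2.2.le
  · refine ⟨Or.inl rfl, ?_⟩
    rintro u (rfl | ⟨j, rfl, -, hu, ⟨h3, h4⟩ | ⟨h, h3⟩⟩)
    · exact le_rfl
    · exact absurd ⟨h3, h4 ▸ hu⟩ h1
    · obtain ⟨b1, b2, -⟩ := vert u hu h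
      exact absurd ⟨⟨b1, b2⟩, h3⟩ h2

theorem edgeEntry_exact {i : ℕ} (hi : i < S.k) {a d : Pt} (hd : d ≠ 0) : S.ExactOK v {i} (S.edgeEntry v i a d) :=
  ⟨exactVal_first hi hd, exactVal_first hi (neg_ne_zero.2 hd)⟩

/-- The functional is chosen by a test at one direction `m`; it is right at `x` if the test has the
same outcome there. -/
theorem openVec_first {i : ℕ} (hi : i < S.k) {x m : Pt} (hx : x ≠ 0) (hg : S.Generic v {i} x)
    (hsep : (S.Separates v i x ∧ 0 < S.edgeFun v i x) ↔ (S.Separates v i m ∧ 0 < S.edgeFun v i m)) :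
    S.First v {i} x (dt (S.openVec v i m) x) := by
  unfold openVec
  split_ifs with h
  · have h1 := hsep.2 h
    rw [← edgeFun_eq_dt]
    refine ⟨Or.inr ⟨i, rfl, hi, h1.2, Or.inl ⟨h1.1, rfl⟩⟩, ?_⟩
    rintro u (rfl | ⟨j, rfl, hj, hit⟩)
    · exact h1.2.le
    · exact (Hit.separates hx hg rfl hj hit).2.le
  · have : dt 0 x = 0 := by simp [dt]
    rw [this]
    refine ⟨Or.inl rfl, ?_⟩
    rintro u (rfl | ⟨j, rfl, hj, hit⟩)
    · exact le_rfl
    · obtain ⟨h1, h2⟩ := Hit.separates hx hg rfl hj hit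
      exact absurd (hsep.1 ⟨h1, h2 ▸ hit.1⟩) h

/-- On a leaf without the directions to the endpoints, the cross products with the endpoints keep
their signs, hence so do separation and the sign of `edgeFun` where the edge separates. It is enough
to test at `a + d`. -/
theorem edgeEntry_open {i : ℕ} (hi : i < S.k) {a d : Pt} (hd : Normal d) (hab : Before a d)
    (hp : dirTo v (S.P i) ∉ Leaf a d) (hq : dirTo v (S.P (S.nx i)) ∉ Leaf a d) :
    S.OpenOK v {i} a (S.edgeEntry v i a d) := by
  have hgen : ∀ x ∈ Leaf a d, S.Generic v {i} x := by
    rintro x hx j rfl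
    refine ⟨fun _ => ⟨?_, ?_⟩, fun h => absurd hi (not_lt.2 h)⟩
    · by_contra hc
      push Not at hc
      exact hp (dirTo_mem_leaf hd hab hx hc.1 hc.2)
    · by_contra hc
      push Not at hc
      exact hq (dirTo_mem_leaf hd hab hx hc.1 hc.2)
  intro x hx
  have hx' : x ∈ Leaf a d := hx
  have hg := hgen x hx'
  have hx0 := Leaf.ne_zero hx'
  refine ⟨hg, ?_⟩
  -- If `v` is on the line of the edge, the quotient with denominator zero makes `edgeFun` vanish,
  -- and the interior of the edge does not obstruct.
  by_cases hD : cr (S.P i - v) (S.P (S.nx i) - v) = 0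
  · have hz : ∀ y, S.edgeFun v i y = 0 := fun y => by simp [edgeFun, hD]
    constructor
    · apply openVec_first hi hx0 hg; simp [hz]
    · apply openVec_first hi (neg_ne_zero.2 hx0) hg.neg; simp [hz]
  have hpv : S.P i ≠ v := by
    intro h; apply hD; rw [h]; simp [cr]
  have hqv : S.P (S.nx i) ≠ v := by
    intro h; apply hD; rw [h]; simp [cr]
  -- The case to be excluded is the leaf from `startDir` to `endDir`, where `a + d` is zero. There
  -- both endpoints would have the abscissa of `v`, against `hD`.
  have had : 0 < cr a d := by
    rcases hab with rfl | ⟨-, h⟩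
    · rcases hd with h | rfl
      · simp [cr, startDir, h]
      · exfalso
        have hv : ∀ w, dirTo v w ∉ Leaf startDir endDir → w.1 = v.1 := by
          intro w hw
          by_contra h
          apply hw
          unfold dirTo
          rw [if_neg h]
          simp [Leaf, cr, startDir, endDir]
        apply hD
        simp [cr, hv _ hp, hv _ hq]
    · exact h
  have hm : a + d ∈ Leaf a d := by
    constructor
    · have : cr a (a + d) = cr a d := by simp [cr]; ring
      rw [this]; exact had
    · have : cr (a + d) d = cr a d := by simp [cr]; ring
      rw [this]; exact had
  have sgn : ∀ w : Pt, (∀ z ∈ Leaf a d, cr z w ≠ 0) → 0 < cr x w * cr (a + d) w := by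
    intro w hw
    have e : ∀ z, cr z w = dt (cw w) z := fun z => by simp [cr, dt, cw]; ring
    simp only [e] at hw ⊢
    exact same_sign hw hx' hm
  have s1 := sgn (S.P i - v) fun z hz => (((hgen z hz) i rfl).1 hi).1.resolve_left hpv
  have s2 := sgn (S.P (S.nx i) - v) fun z hz => (((hgen z hz) i rfl).1 hi).2.resolve_left hqv
  have hfun : ∀ z, S.edgeFun v i z = (cr z (S.P (S.nx i) - v) - cr z (S.P i - v)) /
      cr (S.P i - v) (S.P (S.nx i) - v) := by
    intro z; unfold edgeFun; congr 1; simp [cr]; ring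
  have hD2 : 0 < cr (S.P i - v) (S.P (S.nx i) - v) * cr (S.P i - v) (S.P (S.nx i) - v) := mul_self_pos.2 hD
  have hsep : S.Separates v i x ↔ S.Separates v i (a + d) := by
    unfold Separates
    rcases mul_pos_iff.1 s1 with ⟨a1, a2⟩ | ⟨a1, a2⟩ <;> rcases mul_pos_iff.1 s2 with ⟨b1, b2⟩ | ⟨b1, b2⟩
    · exact iff_of_false (not_lt.2 (mul_pos a1 b1).le) (not_lt.2 (mul_pos a2 b2).le)
    · exact iff_of_true (mul_neg_of_pos_of_neg a1 b1) (mul_neg_of_pos_of_neg a2 b2)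
    · exact iff_of_true (mul_neg_of_neg_of_pos a1 b1) (mul_neg_of_neg_of_pos a2 b2)
    · exact iff_of_false (not_lt.2 (mul_pos_of_neg_of_neg a1 b1).le)
        (not_lt.2 (mul_pos_of_neg_of_neg a2 b2).le)
  have hprod : S.Separates v i x → 0 < S.edgeFun v i x * S.edgeFun v i (a + d) := by
    intro h
    have h' := hsep.1 h
    rw [hfun, hfun, div_mul_div_comm]
    apply div_pos _ hD2
    unfold Separates at h h'
    rcases mul_neg_iff.1 h with ⟨a1, a2⟩ | ⟨a1, a2⟩ <;> rcases mul_neg_iff.1 h' with ⟨b1, b2⟩ | ⟨b1, b2⟩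
    · exact mul_pos_of_neg_of_neg (by linarith) (by linarith)
    · exact absurd (mul_neg_of_pos_of_neg a1 b1) (not_lt.2 s1.le)
    · exact absurd (mul_neg_of_neg_of_pos a1 b1) (not_lt.2 s1.le)
    · exact mul_pos (by linarith) (by linarith)
  constructor
  · apply openVec_first hi hx0 hg
    constructor
    · rintro ⟨h1, h2⟩; exact ⟨hsep.1 h1, pos_of_mul_pos_right (hprod h1) h2.le⟩
    · rintro ⟨h1, h2⟩; exact ⟨hsep.2 h1, pos_of_mul_pos_left (hprod (hsep.2 h1)) h2.le⟩
  · apply openVec_first hi (neg_ne_zero.2 hx0) hg.neg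
    rw [Separates.neg, Separates.neg, edgeFun_neg, edgeFun_neg]
    constructor
    · rintro ⟨h1, h2⟩
      refine ⟨hsep.1 h1, ?_⟩
      have := hprod h1
      rw [← neg_mul_neg] at this
      exact pos_of_mul_pos_right this h2.le
    · rintro ⟨h1, h2⟩
      refine ⟨hsep.2 h1, ?_⟩
      have := hprod (hsep.2 h1)
      rw [← neg_mul_neg] at this
      exact pos_of_mul_pos_left this h2.le

theorem not_mem_leaf_left (a b : Pt) : a ∉ Leaf a b := fun h => by
  have := h.1
  simp [cr] at this
  linarith

theorem not_mem_leaf_right (a b : Pt) : b ∉ Leaf a b := fun h => by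
  have := h.2
  simp [cr] at this
  linarith

theorem normal_cases {b : Pt} (hb : Normal b) : (0 < b.1 ∧ 0 < cr b endDir) ∨ (¬ 0 < b.1 ∧ b = endDir) := by
  rcases hb with h | rfl
  · left; simp [cr, endDir, h]
  · right; simp [endDir]

theorem edgeListAux_env {i : ℕ} (hi : i < S.k) {a b : Pt} (ha : Normal a) (hb : Normal b) (hba : ¬ 0 < cr b a)
    (hp : dirTo v (S.P i) = a ∨ dirTo v (S.P i) = b)
    (hq : dirTo v (S.P (S.nx i)) = a ∨ dirTo v (S.P (S.nx i)) = b) :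
    S.Env v {i} startDir (S.edgeListAux v i a b) := by
  have hend : Normal endDir := Or.inr rfl
  have op : ∀ c d : Pt, Normal d → Before c d → a ∉ Leaf c d → b ∉ Leaf c d →
      S.OpenOK v {i} c (S.edgeEntry v i c d) := by
    intro c d hd hcd h1 h2
    apply edgeEntry_open hi hd hcd
    · rcases hp with h | h <;> rw [h] <;> assumption
    · rcases hq with h | h <;> rw [h] <;> assumption
  have ex : ∀ c d : Pt, Normal d → S.ExactOK v {i} (S.edgeEntry v i c d) := fun c d hd =>
    edgeEntry_exact hi (Normal.ne_zero hd)
  have hst : ∀ d, Before startDir d := fun d => Or.inl rfl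
  unfold edgeListAux
  split_ifs with h1 h2 h2
  · have hbe := ((normal_cases hb).resolve_right fun h => h.1 h2).2
    have hab : Before a b := Or.inr ⟨ha, h1⟩
    refine ⟨ha, hst _, ex _ _ ha, op _ _ ha (hst _) (not_mem_leaf_right _ _) ?_, hb, hab, ex _ _ hb,
      op _ _ hb hab (not_mem_leaf_left _ _) (not_mem_leaf_right _ _), hend, Or.inr ⟨hb, hbe⟩, ex _ _ hend,
      op _ _ hend (Or.inr ⟨hb, hbe⟩) ?_ (not_mem_leaf_left _ _), rfl⟩
    · exact fun h => hba h.2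
    · exact fun h => hba h.1
  · have hbe := ((normal_cases hb).resolve_left fun h => h2 h.1).2
    subst hbe
    have hab : Before a endDir := Or.inr ⟨ha, h1⟩
    exact ⟨ha, hst _, ex _ _ ha, op _ _ ha (hst _) (not_mem_leaf_right _ _) (fun h => hba h.2), hend, hab,
      ex _ _ hend, op _ _ hend hab (not_mem_leaf_left _ _) (not_mem_leaf_right _ _), rfl⟩
  · have hbe := ((normal_cases hb).resolve_right fun h => h.1 h2).2
    have hab := Normal.eq_of_cr_eq_zero ha hb h1 hba
    subst hab
    exact ⟨hb, hst _, ex _ _ hb, op _ _ hb (hst _) (not_mem_leaf_right _ _) (not_mem_leaf_right _ _), hend,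
      Or.inr ⟨hb, hbe⟩, ex _ _ hend, op _ _ hend (Or.inr ⟨hb, hbe⟩) (not_mem_leaf_left _ _)
      (not_mem_leaf_left _ _), rfl⟩
  · have hbe := ((normal_cases hb).resolve_left fun h => h2 h.1).2
    have hab := Normal.eq_of_cr_eq_zero ha hb h1 hba
    subst hab
    subst hbe
    exact ⟨hend, hst _, ex _ _ hend, op _ _ hend (hst _) (not_mem_leaf_right _ _) (not_mem_leaf_right _ _), rfl⟩

theorem edgeList_env {i : ℕ} (hi : i < S.k) : S.Env v {i} startDir (S.edgeList v i) := by
  unfold edgeList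
  split_ifs with h
  · exact edgeListAux_env hi (normal_dirTo _ _) (normal_dirTo _ _) (by rw [cr_swap]; linarith)
      (Or.inr rfl) (Or.inl rfl)
  · exact edgeListAux_env hi (normal_dirTo _ _) (normal_dirTo _ _) h (Or.inl rfl) (Or.inr rfl)

theorem length_edgeList_le (i : ℕ) : (S.edgeList v i).length ≤ 3 := by
  unfold edgeList edgeListAux
  split_ifs <;> simp

/-- An index beyond the edges has no obstructions, but its `Generic` condition excludes the
horizontal direction. Its list therefore splits the leaves at `(1, 0)`. This is needed because
`Turns` depends on the sign of the second coordinate, and it also keeps every leaf within a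
quadrant. -/
theorem emptyList_env {i : ℕ} (hi : S.k ≤ i) : S.Env v {i} startDir emptyList := by
  have hf : ∀ d, S.First v {i} d 0 := by
    intro d
    refine ⟨Or.inl rfl, ?_⟩
    rintro u (rfl | ⟨j, rfl, hj, -⟩)
    · exact le_rfl
    · omega
  have hend : Normal endDir := Or.inr rfl
  have h1 : Normal (1, 0) := Or.inl rfl
  have h2 : Before (1, 0) endDir := Or.inr ⟨h1, by simp [cr, endDir]⟩
  have hz : ∀ x, dt 0 x = 0 := fun x => by simp [dt]
  refine ⟨h1, Or.inl rfl, ⟨hf _, hf _⟩, ?_, hend, h2, ⟨hf _, hf _⟩, ?_, rfl⟩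
  · intro x hx
    rw [mem_leaf_iff h1 (Or.inl rfl)] at hx
    refine ⟨?_, by rw [hz]; exact hf _, by rw [hz]; exact hf _⟩
    rintro j rfl
    refine ⟨fun h => by omega, fun _ => ?_⟩
    rcases hx.2.2 with h | h
    · have := congrArg Prod.fst h; simp [endDir] at this
    · simp at h; exact h.ne
  · intro x hx
    rw [mem_leaf_iff hend h2] at hx
    refine ⟨?_, by rw [hz]; exact hf _, by rw [hz]; exact hf _⟩
    rintro j rfl
    refine ⟨fun h => by omega, fun _ => ?_⟩
    rcases hx.2.1 with h | h
    · have := congrArg Prod.fst h; simp [startDir] at this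
    · simp at h; exact h.ne'

end EdgeSystem
end RayCarving

namespace RayCarving
open Filter Topology

/-! ## The sweeps of an envelope -/

/-- The segment joining the first obstructions behind `v` opposite to `p` and `g`, or points at
scale `T` if there are none. -/
noncomputable def sideSweep (v : Pt) (T : ℝ) (p g l : Pt) : LinearRaySweep :=
  open Classical in
  if dt l (p + g) = 0 then ⟨v - T • p, v - T • g, v⟩
  else ⟨v - (1 / dt l (-p)) • p, v - (1 / dt l (-g)) • g, v⟩

/-- A single ray, starting at distance `1 / u` behind `v`, or `T` if `u` vanishes. -/
noncomputable def raySweep (v : Pt) (T : ℝ) (d : Pt) (u : ℝ) : LinearRaySweep :=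
  open Classical in
  if u = 0 then ⟨v - T • d, v - T • d, v⟩ else ⟨v - (1 / u) • d, v - (1 / u) • d, v⟩

theorem mem_region_iff {R : LinearRaySweep} {x : Pt} : x ∈ R.region ↔
    ∃ t ∈ Icc (0 : ℝ) 1, x ∈ ray (R.endpoint t) R.pivot := by
  simp [LinearRaySweep.region]

theorem endpoint_eq (a b v : Pt) (α β t : ℝ) :
    LinearRaySweep.endpoint ⟨v - α • a, v - β • b, v⟩ t = v - (((1 - t) * α) • a + (t * β) • b) := by
  unfold LinearRaySweep.endpoint
  simp only [AffineMap.lineMap_apply]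
  ext
  · simp; ring
  · simp; ring

/-- The ray starts behind `v` at scale `c` and never ends ahead of `v`, so negative `r` are allowed.
-/
theorem mem_ray_of_le {v y w : Pt} {c r : ℝ} (hc : 0 < c) (hw : w = v - c • y) (hr : r ≤ c) : v - r • y ∈ ray w v := by
  refine ⟨1 - r / c, by have : r / c ≤ 1 := (div_le_one hc).2 hr
                        linarith, ?_⟩
  have hc' := hc.ne'
  rw [hw]
  ext
  · simp; field_simp; ring
  · simp; field_simp; ring

namespace EdgeSystem
variable {S : EdgeSystem} {v : Pt}

theorem Hit.mem_bd {d : Pt} {i : ℕ} {u : ℝ} (hi : i < S.k) (h : S.Hit v i d u) : v + (1 / u) • d ∈ S.bd := by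
  obtain ⟨hu, ⟨h1, rfl⟩ | ⟨h1, -⟩⟩ := h
  · exact S.mem_bd.2 ⟨i, hi, (Separates.mem_edge S h1 hu).1⟩
  · have : S.P i = v + (1 / u) • d := by
      rw [← h1, smul_smul, one_div_mul_cancel hu.ne', one_smul]; simp
    rw [← this]; exact S.vertex_mem_bd hi

/-- Before the first obstruction the ray from a vertex is free. -/
theorem First.not_inside {E : Set ℕ} (hE : ∀ i < S.k, i ∈ E) {a : ℕ} (ha : a < S.k) {d : Pt} (hd : d ≠ 0) {u : ℝ}
    (h : S.First (S.P a) E d u) (hc : ¬ S.InCone a d) {s : ℝ} (hs : 0 < s) (hu : u * s ≤ 1) :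
    S.P a + s • d ∉ S.inside := by
  intro hin
  rcases S.exists_hit ha hd hs hin with h1 | ⟨i, hi, w, hit, hw⟩
  · exact hc h1
  have hwu : w ≤ u := h.2 (Or.inr ⟨i, hE i hi, hi, hit⟩)
  have hw0 := hit.1
  rw [div_le_iff₀ hw0] at hw
  have h2 : w * s ≤ u * s := mul_le_mul_of_nonneg_right hwu hs.le
  have h3 : s = 1 / w := by field_simp; linarith
  rw [h3] at hin
  exact hin.1 (hit.mem_bd hi)

/-- An unobstructed initial segment of a ray ends before the first obstruction. -/
theorem First.le_of_free {E : Set ℕ} {d : Pt} (hd : d ≠ 0) {u : ℝ} (h : S.First v E d u) {c : ℝ}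
    (hf : ∀ s : ℝ, 0 < s → s < c → v + s • d ∉ S.inside) : u * c ≤ 1 := by
  rcases h.1 with rfl | ⟨i, -, hi, hit⟩
  · simp
  · by_contra hlt
    push Not at hlt
    have hu := hit.1
    obtain ⟨s, s0, s1, hin⟩ := Hit.exists_inside S hi hd hit (c := c) (by rw [div_lt_iff₀ hu]; linarith)
    exact hf s s0 s1 hin

theorem First.eq_zero_of_free {E : Set ℕ} {d : Pt} (hd : d ≠ 0) {u : ℝ} (h : S.First v E d u)
    (hf : ∀ s : ℝ, 0 < s → v + s • d ∉ S.inside) : u = 0 := by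
  by_contra hu
  have hu : 0 < u := h.nonneg.lt_of_ne' hu
  -- Any multiple of `1 / u` with a factor larger than 1 contradicts the bound.
  have := h.le_of_free hd (c := 2 / u) (fun s hs _ => hf s hs)
  have e : u * (2 / u) = 2 := by field_simp
  linarith

theorem not_inCone_of_free {a : ℕ} (ha : a < S.k) {d : Pt} (hd : d ≠ 0) {c : ℝ} (hc : 0 < c)
    (hf : ∀ s : ℝ, 0 < s → s < c → S.P a + s • d ∉ S.inside) : ¬ S.InCone a d := by
  intro h
  have hpos : ∀ᶠ ε : ℝ in 𝓝[>] 0, 0 < ε := self_mem_nhdsWithin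
  have hlt : ∀ᶠ ε : ℝ in 𝓝[>] 0, ε < c := nhdsWithin_le_nhds (eventually_lt_nhds hc)
  obtain ⟨ε, h1, h2, h3⟩ := (hpos.and (hlt.and (S.vertex_displace ha hd))).exists
  exact hf ε h1 h2 (h3.2 h)

/-- The values of the functionals on a sector between two directions, one side of the pivot. -/
structure Sector (S : EdgeSystem) (v : Pt) (E : Set ℕ) (p g lF lB : Pt) : Prop where
  pos : 0 < cr p g
  ok : ∀ x ∈ Leaf p g, S.Generic v E x ∧ S.First v E x (dt lF x) ∧ S.First v E (-x) (dt lB (-x))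

theorem neg_mem_leaf {p g x : Pt} : -x ∈ Leaf (-p) (-g) ↔ x ∈ Leaf p g := by
  simp [Leaf, cr_neg_left, cr_neg_right]

theorem Sector.neg {E : Set ℕ} {p g lF lB : Pt} (h : Sector S v E p g lF lB) : Sector S v E (-p) (-g) lB lF := by
  refine ⟨by rw [cr_neg_left, cr_neg_right, neg_neg]; exact h.pos, fun x hx => ?_⟩
  have hx' : -x ∈ Leaf p g := by rw [← neg_mem_leaf, neg_neg]; exact hx
  obtain ⟨h1, h2, h3⟩ := h.ok _ hx'
  rw [neg_neg] at h3
  refine ⟨by simpa using h1.neg, h3, h2⟩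

theorem mid_mem_leaf {p g : Pt} (h : 0 < cr p g) {α β : ℝ} (hα : 0 < α) (hβ : 0 < β) : α • p + β • g ∈ Leaf p g := by
  have e : ∀ z : Pt, cr z z = 0 := fun z => by simp [cr]; ring
  constructor
  · rw [cr_comb, e]; have := mul_pos hβ h; linarith
  · rw [cr_comb_left, e]; have := mul_pos hα h; linarith

theorem exists_comb_of_mem_leaf {p g x : Pt} (h : 0 < cr p g) (hx : x ∈ Leaf p g) :
    ∃ α β : ℝ, 0 < α ∧ 0 < β ∧ x = α • p + β • g := by
  refine ⟨cr x g / cr p g, cr p x / cr p g, div_pos hx.2 h, div_pos hx.1 h, ?_⟩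
  have h' := h.ne'
  ext
  · simp only [Prod.fst_add, Prod.smul_fst, smul_eq_mul]
    field_simp
    simp only [cr]; ring
  · simp only [Prod.snd_add, Prod.smul_snd, smul_eq_mul]
    field_simp
    simp only [cr]; ring

/-- A linear functional that is non-negative on a sector and vanishes at one point vanishes there. -/
theorem dt_eq_zero_of_nonneg {p g l : Pt} (hpg : 0 < cr p g) (h : ∀ x ∈ Leaf p g, 0 ≤ dt l x) {x y : Pt} (hx : x ∈ Leaf p g)
    (hy : y ∈ Leaf p g) (h0 : dt l x = 0) : dt l y = 0 := by
  refine le_antisymm ?_ (h y hy)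
  -- `x - ε y` is still in the sector for small `ε`
  obtain ⟨α, β, hα, hβ, rfl⟩ := exists_comb_of_mem_leaf hpg hx
  obtain ⟨γ, δ, hγ, hδ, rfl⟩ := exists_comb_of_mem_leaf hpg hy
  have h1 := mid_mem_leaf hpg (α := 1) (β := 1) one_pos one_pos
  -- Non-negativity passes to the bounding directions: against a negative value at one of them, a
  -- multiple of the other is taken so small that it compensates at most half of it.
  have key : 0 ≤ dt l p ∧ 0 ≤ dt l g := by
    constructor
    · by_contra hc
      push Not at hc
      have hg := h _ (mid_mem_leaf hpg (α := 1) (β := -dt l p / (2 * (|dt l g| + 1))) one_pos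
        (div_pos (by linarith) (by positivity)))
      rw [dt_comb] at hg
      have : -dt l p / (2 * (|dt l g| + 1)) * dt l g ≤ -dt l p / 2 := by
        rw [div_mul_eq_mul_div, div_le_iff₀ (by positivity)]
        nlinarith [le_abs_self (dt l g), abs_nonneg (dt l g)]
      linarith
    · by_contra hc
      push Not at hc
      have hg := h _ (mid_mem_leaf hpg (β := 1) (α := -dt l g / (2 * (|dt l p| + 1)))
        (div_pos (by linarith) (by positivity)) one_pos)
      rw [dt_comb] at hg
      have : -dt l g / (2 * (|dt l p| + 1)) * dt l p ≤ -dt l g / 2 := by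
        rw [div_mul_eq_mul_div, div_le_iff₀ (by positivity)]
        nlinarith [le_abs_self (dt l p), abs_nonneg (dt l p)]
      linarith
  rw [dt_comb] at h0 ⊢
  have e1 := mul_nonneg hα.le key.1
  have e2 := mul_nonneg hβ.le key.2
  have e3 := (mul_eq_zero.1 (by linarith : α * dt l p = 0)).resolve_left hα.ne'
  have e4 := (mul_eq_zero.1 (by linarith : β * dt l g = 0)).resolve_left hβ.ne'
  rw [e3, e4]; simp

/-- A non-vanishing functional of a sector is positive at the bounding directions, because the edges
are bounded. -/
theorem pos_at_end {E : Set ℕ} {p g l : Pt} (hp : p ≠ 0)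
    (h : ∀ ε : ℝ, 0 < ε → 0 < dt l (p + ε • g) ∧ S.First v E (p + ε • g) (dt l (p + ε • g))) : 0 < dt l p := by
  by_contra hc
  push Not at hc
  obtain ⟨M, hM⟩ : ∃ M : ℝ, ∀ y ∈ S.bd, |y.1 - v.1| ≤ M ∧ |y.2 - v.2| ≤ M := by
    obtain ⟨M, hM⟩ := S.exists_vertex_bound
    refine ⟨M + |v.1| + |v.2|, fun y hy => ?_⟩
    obtain ⟨i, hi, hy⟩ := S.mem_bd.1 hy
    obtain ⟨t, t0, t1, y1, y2⟩ := (mem_segment_iff_exists _ _ _).1 hy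
    have a1 := abs_le.1 (hM i hi).1
    have a2 := abs_le.1 (hM i hi).2
    have b1 := abs_le.1 (hM _ (S.nx_lt i hi)).1
    have b2 := abs_le.1 (hM _ (S.nx_lt i hi)).2
    have c1 := abs_nonneg v.1
    have c2 := abs_nonneg v.2
    have c3 := neg_abs_le v.1
    have c4 := neg_abs_le v.2
    have c5 := le_abs_self v.1
    have c6 := le_abs_self v.2
    constructor <;> rw [abs_le] <;> constructor
    · rw [y1]; nlinarith
    · rw [y1]; nlinarith
    · rw [y2]; nlinarith
    · rw [y2]; nlinarith
  -- The obstruction in direction `p + ε • g` is at scale `1 / u` and within distance `M` in each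
  -- coordinate, so the coordinates of the direction are at most `u * M`. If `dt l p` were
  -- non-positive, `u` would be at most `ε * dt l g`, which tends to zero, and `p` would be zero.
  have key : ∀ ε : ℝ, 0 < ε → |p.1 + ε * g.1| ≤ ε * dt l g * M ∧ |p.2 + ε * g.2| ≤ ε * dt l g * M := by
    intro ε hε
    obtain ⟨h1, h2⟩ := h ε hε
    have e : dt l (p + ε • g) = dt l p + ε * dt l g := by simp [dt]; ring
    rcases h2.1 with h3 | ⟨i, -, hi, hit⟩
    · exact absurd h3 h1.ne'
    have hb := hM _ (hit.mem_bd hi)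
    set u := dt l (p + ε • g) with hu
    have hM0 : 0 ≤ M := (abs_nonneg _).trans hb.1
    have hle : u * M ≤ ε * dt l g * M := mul_le_mul_of_nonneg_right (by linarith) hM0
    simp only [Prod.fst_add, Prod.snd_add, Prod.smul_fst, Prod.smul_snd, smul_eq_mul, add_sub_cancel_left,
      abs_div, abs_of_pos h1, one_div_mul_eq_div] at hb
    rw [div_le_iff₀ h1, div_le_iff₀ h1] at hb
    constructor <;> linarith [hb.1, hb.2]
  have lim : ∀ f : Pt → ℝ, Continuous f → (∀ ε : ℝ, 0 < ε → |f (p + ε • g)| ≤ ε * dt l g * M) → f p = 0 := by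
    intro f hf hb
    have t1 : Tendsto (fun ε : ℝ => |f (p + ε • g)|) (𝓝[>] 0) (𝓝 |f p|) :=
      ((hf.tendsto p).comp (tendsto_displace p g)).abs
    have t2 : Tendsto (fun ε : ℝ => ε * dt l g * M) (𝓝[>] 0) (𝓝 (0 * dt l g * M)) :=
      Tendsto.mono_left (Continuous.tendsto (by fun_prop) 0) nhdsWithin_le_nhds
    have := le_of_tendsto_of_tendsto t1 t2 (by
      filter_upwards [self_mem_nhdsWithin] with ε hε using hb ε hε)
    simp at this
    exact this
  apply hp
  exact Prod.ext (lim Prod.fst continuous_fst fun ε hε => by simpa using (key ε hε).1)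
    (lim Prod.snd continuous_snd fun ε hε => by simpa using (key ε hε).2)

theorem Sector.ne_zero_left {E : Set ℕ} {p g lF lB : Pt} (h : Sector S v E p g lF lB) : p ≠ 0 := by
  rintro rfl; have := h.pos; simp [cr] at this

theorem Sector.ne_zero_right {E : Set ℕ} {p g lF lB : Pt} (h : Sector S v E p g lF lB) : g ≠ 0 := by
  rintro rfl; have := h.pos; simp [cr] at this

theorem Sector.mid {E : Set ℕ} {p g lF lB : Pt} (h : Sector S v E p g lF lB) : p + g ∈ Leaf p g := by
  simpa using mid_mem_leaf h.pos one_pos one_pos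

/-- A zero of the functional in the leaf would make it vanish at `p + g` too
(`dt_eq_zero_of_nonneg`), and at the bounding directions `pos_at_end` applies. So the quotients in
`sideSweep` are positive distances. -/
theorem Sector.back_pos {E : Set ℕ} {p g lF lB : Pt} (h : Sector S v E p g lF lB) (hm : dt lB (p + g) ≠ 0) :
    0 < dt lB (-p) ∧ 0 < dt lB (-g) ∧ ∀ x ∈ Leaf p g, 0 < dt lB (-x) := by
  have hpos : ∀ x ∈ Leaf p g, 0 < dt lB (-x) := by
    intro x hx
    refine (h.ok x hx).2.2.nonneg.lt_of_ne' fun h0 => hm ?_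
    have := dt_eq_zero_of_nonneg (l := -lB) h.pos (fun y hy => by
      rw [dt_neg_left, ← dt_neg_right]; exact (h.ok y hy).2.2.nonneg) hx h.mid
      (by rw [dt_neg_left, ← dt_neg_right]; exact h0)
    rw [dt_neg_left] at this; linarith
  refine ⟨?_, ?_, hpos⟩
  · apply pos_at_end (S := S) (v := v) (E := E) (g := -g) (neg_ne_zero.2 h.ne_zero_left)
    intro ε hε
    have hx : p + ε • g ∈ Leaf p g := by simpa using mid_mem_leaf h.pos one_pos hε
    have e : -p + ε • -g = -(p + ε • g) := by simp; abel
    rw [e]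
    exact ⟨hpos _ hx, (h.ok _ hx).2.2⟩
  · apply pos_at_end (S := S) (v := v) (E := E) (g := -p) (neg_ne_zero.2 h.ne_zero_right)
    intro ε hε
    have hx : ε • p + g ∈ Leaf p g := by simpa using mid_mem_leaf h.pos hε one_pos
    have e : -g + ε • -p = -(ε • p + g) := by simp
    rw [e]
    exact ⟨hpos _ hx, (h.ok _ hx).2.2⟩

theorem posParallel_cr {g d : Pt} (h : PosParallel g d) : cr d g = 0 := by rw [cr_swap, h.1, neg_zero]

/-- Away from the horizontal direction and the line of `g`, only the signs of `d.2` and of the cross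
product enter `Turns`. -/
theorem turns_congr {g x y : Pt} (h2 : 0 < x.2 * y.2) (hc : 0 < cr x g * cr y g) : Turns g x ↔ Turns g y := by
  unfold Turns
  rw [cr_swap g x, cr_swap g y]
  rcases mul_pos_iff.1 h2 with ⟨a1, a2⟩ | ⟨a1, a2⟩ <;> rcases mul_pos_iff.1 hc with ⟨b1, b2⟩ | ⟨b1, b2⟩ <;>
    simp [a1, a2, b1, b2, a1.le, a2.le, a1.not_gt, a2.not_gt, b1.not_gt, b2.not_gt, a1.not_ge, a2.not_ge]

theorem turnBit_congr {g x y : Pt} (h2 : 0 < x.2 * y.2) (hc : 0 < cr x g * cr y g) : turnBit g x = turnBit g y := by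
  classical exact if_congr (turns_congr h2 hc) rfl rfl

/-- The cone condition is constant on a sector. -/
theorem Sector.inCone_iff {a : ℕ} (ha : a < S.k) {E : Set ℕ} (hE : ∀ i ≤ S.k, i ∈ E) {p g lF lB : Pt}
    (h : Sector S (S.P a) E p g lF lB) {x y : Pt} (hx : x ∈ Leaf p g) (hy : y ∈ Leaf p g) :
    S.InCone a x ↔ S.InCone a y := by
  have e : ∀ z w : Pt, cr z w = dt (cw w) z := fun z w => by simp [cr, dt, cw]; ring
  have e2 : ∀ z : Pt, z.2 = dt (0, 1) z := fun z => by simp [dt]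
  -- The dummy index `S.k` ensures that no direction of the leaf is horizontal.
  have n2 : ∀ z ∈ Leaf p g, z.2 ≠ 0 := fun z hz => ((h.ok z hz).1 S.k (hE _ le_rfl)).2 le_rfl
  have nn : ∀ z ∈ Leaf p g, cr z (S.P (S.nx a) - S.P a) ≠ 0 := fun z hz =>
    ((((h.ok z hz).1 a (hE _ ha.le)).1 ha).2).resolve_left (S.ne a ha).symm
  have np : ∀ z ∈ Leaf p g, cr z (S.P (S.pv a) - S.P a) ≠ 0 := fun z hz =>
    ((((h.ok z hz).1 (S.pv a) (hE _ (S.pv_lt a ha).le)).1 (S.pv_lt a ha)).1).resolve_left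
      fun h' => S.pv_ne ha (S.vertex_inj (S.pv_lt a ha) ha h')
  have s2 : 0 < x.2 * y.2 := by
    rw [e2 x, e2 y]; exact same_sign (fun z hz => by rw [← e2]; exact n2 z hz) hx hy
  have sn : 0 < cr x (S.P (S.nx a) - S.P a) * cr y (S.P (S.nx a) - S.P a) := by
    rw [e, e]; exact same_sign (fun z hz => by rw [← e]; exact nn z hz) hx hy
  have sp : 0 < cr x (S.P (S.pv a) - S.P a) * cr y (S.P (S.pv a) - S.P a) := by
    rw [e, e]; exact same_sign (fun z hz => by rw [← e]; exact np z hz) hx hy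
  have q : ∀ z ∈ Leaf p g, ¬ PosParallel (S.P (S.nx a) - S.P a) z ∧ ¬ PosParallel (S.P (S.pv a) - S.P a) z :=
    fun z hz => ⟨fun h => nn z hz (posParallel_cr h), fun h => np z hz (posParallel_cr h)⟩
  unfold InCone
  simp only [q x hx, q y hy, not_false_eq_true, true_and, turnBit_congr s2 sn, turnBit_congr s2 sp]

/-! ### Soundness -/

theorem ray_free {w v : Pt} (hf : ∀ s : ℝ, 0 < s → v + s • (v - w) ∉ S.inside) (hv : v ∉ S.inside)
    (hb : ∀ s : ℝ, 0 < s → s ≤ 1 → v + s • (w - v) ∉ S.inside) : ray w v ∩ S.inside = ∅ := by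
  rw [eq_empty_iff_forall_notMem]
  rintro x ⟨⟨s, hs, rfl⟩, hin⟩
  rcases lt_trichotomy s 1 with h | h | h
  · apply hb (1 - s) (by linarith) (by linarith)
    convert hin using 1
    ext <;> simp <;> ring
  · subst h; simp at hin; exact hv hin
  · apply hf (s - 1) (by linarith)
    convert hin using 1
    ext <;> simp <;> ring

/-- If the rays inside a sweep are free, then so are the first and the last one. -/
theorem sweep_free {R : LinearRaySweep}
    (h : ∀ t : ℝ, 0 < t → t < 1 → ray (R.endpoint t) R.pivot ∩ S.inside = ∅) {t : ℝ} (ht : t ∈ Icc (0 : ℝ) 1) :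
    ray (R.endpoint t) R.pivot ∩ S.inside = ∅ := by
  rw [eq_empty_iff_forall_notMem]
  rintro x ⟨⟨s, hs, rfl⟩, hin⟩
  have hcont : Continuous fun t : ℝ => R.endpoint t + s • (R.pivot - R.endpoint t) := by
    unfold LinearRaySweep.endpoint
    simp only [AffineMap.lineMap_apply, vsub_eq_sub, vadd_eq_add]
    fun_prop
  -- The inside is open, so a meeting at an extreme time would persist at nearby times in the open
  -- interval.
  have hopen := S.isOpen_inside.preimage hcont
  have hcl : t ∈ closure (Ioo (0 : ℝ) 1) := by rw [closure_Ioo (by norm_num)]; exact ht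
  obtain ⟨r, hr, hr'⟩ := mem_closure_iff.1 hcl _ hopen hin
  have := h r hr'.1 hr'.2
  rw [eq_empty_iff_forall_notMem] at this
  exact this _ ⟨⟨s, hs, rfl⟩, hr⟩

/-- Source and target are the points where the backward functional has the value 1, so by linearity
it is 1 on the segment between them: the endpoint reaches the first obstruction behind the vertex
but does not pass it. With scale `T` the functional is zero. Ahead nothing obstructs, since `lF`
vanishes on the leaf. The two extreme rays, whose directions need not be generic, follow by
`sweep_free`. -/
theorem sideSweep_sound {a : ℕ} (ha : a < S.k) {E : Set ℕ} (hE : ∀ i ≤ S.k, i ∈ E) {T : ℝ} (hT : 0 < T) {p g lF lB : Pt}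
    (h : Sector S (S.P a) E p g lF lB) (h1 : ¬ S.InCone a (p + g)) (h2 : ¬ S.InCone a (-(p + g)))
    (hF : dt lF (p + g) = 0) : (sideSweep (S.P a) T p g lB).IsProper ∧
      ∀ t ∈ Icc (0 : ℝ) 1, ray ((sideSweep (S.P a) T p g lB).endpoint t) (S.P a) ∩ S.inside = ∅ := by
  obtain ⟨α, β, hα, hβ, hS, hB⟩ : ∃ α β : ℝ, 0 < α ∧ 0 < β ∧
      sideSweep (S.P a) T p g lB = ⟨S.P a - α • p, S.P a - β • g, S.P a⟩ ∧
      ∀ t : ℝ, 0 < t → t < 1 → dt lB (-(((1 - t) * α) • p + (t * β) • g)) ≤ 1 := by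
    unfold sideSweep
    split_ifs with h0
    · refine ⟨T, T, hT, hT, rfl, fun t t0 t1 => ?_⟩
      have := dt_eq_zero_of_nonneg (l := -lB) h.pos (fun y hy => by
        rw [dt_neg_left, ← dt_neg_right]; exact (h.ok y hy).2.2.nonneg) h.mid
        (mid_mem_leaf h.pos (α := (1 - t) * T) (β := t * T) (mul_pos (by linarith) hT) (mul_pos t0 hT))
        (by rw [dt_neg_left, h0, neg_zero])
      rw [dt_neg_left, ← dt_neg_right] at this
      rw [this]; norm_num
    · obtain ⟨b1, b2, -⟩ := h.back_pos h0
      refine ⟨_, _, one_div_pos.2 b1, one_div_pos.2 b2, rfl, fun t t0 t1 => ?_⟩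
      rw [dt_neg_right] at b1 b2 ⊢
      rw [dt_comb, dt_neg_right, dt_neg_right]
      have : dt lB p ≠ 0 := by intro h; rw [h] at b1; simp at b1
      have : dt lB g ≠ 0 := by intro h; rw [h] at b2; simp at b2
      field_simp
      linarith
  rw [hS]
  have hpiv : ∀ R : LinearRaySweep, R = ⟨S.P a - α • p, S.P a - β • g, S.P a⟩ → R.pivot = S.P a := by
    rintro R rfl; rfl
  constructor
  · intro t ht heq
    rw [endpoint_eq] at heq
    have h0 : ((1 - t) * α) • p + (t * β) • g = 0 := by simpa using heq
    rcases ht.1.lt_or_eq with ht0 | ht0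
    · have e := congrArg (cr p) h0
      rw [cr_comb] at e
      simp only [cr, Prod.fst_zero, Prod.snd_zero] at e
      have := h.pos
      simp only [cr] at this
      have := mul_pos (mul_pos ht0 hβ) this
      linarith
    · rw [← ht0] at h0
      simp at h0
      rcases h0 with h0 | h0
      · exact hα.ne' h0
      · exact h.ne_zero_left h0
  · intro t ht
    refine sweep_free (R := ⟨S.P a - α • p, S.P a - β • g, S.P a⟩) (fun t t0 t1 => ?_) ht
    rw [endpoint_eq]
    have hx := mid_mem_leaf h.pos (mul_pos (by linarith : 0 < 1 - t) hα) (mul_pos t0 hβ)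
    have hB' := hB t t0 t1
    set y := ((1 - t) * α) • p + (t * β) • g with hy
    have hy0 := Leaf.ne_zero hx
    obtain ⟨-, f1, f2⟩ := h.ok y hx
    have hc1 : ¬ S.InCone a y := by rwa [h.inCone_iff ha hE hx h.mid]
    have hc2 : ¬ S.InCone a (-y) := by
      rwa [h.neg.inCone_iff ha hE (neg_mem_leaf.2 hx) (neg_mem_leaf.2 h.mid)]
    have hF0 : dt lF y = 0 := dt_eq_zero_of_nonneg h.pos (fun z hz => (h.ok z hz).2.1.nonneg) h.mid hx hF
    have hE' : ∀ i < S.k, i ∈ E := fun i hi => hE i hi.le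
    apply ray_free
    · intro s hs
      rw [sub_sub_cancel]
      exact f1.not_inside hE' ha hy0 hc1 hs (by rw [hF0]; simp)
    · exact S.vertex_not_mem_inside ha
    · intro s hs hs1
      rw [show S.P a - y - S.P a = -y by abel]
      refine f2.not_inside hE' ha (neg_ne_zero.2 hy0) hc2 hs ?_
      have := mul_le_mul hB' hs1 hs.le zero_le_one
      linarith

theorem raySweep_sound {a : ℕ} (ha : a < S.k) {E : Set ℕ} (hE : ∀ i ≤ S.k, i ∈ E) {T : ℝ} (hT : 0 < T) {d : Pt} (hd : d ≠ 0)
    {u : ℝ} (h1 : ¬ S.InCone a d) (h2 : ¬ S.InCone a (-d)) (hF : S.First (S.P a) E d 0)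
    (hB : S.First (S.P a) E (-d) u) : (raySweep (S.P a) T d u).IsProper ∧
      ∀ t ∈ Icc (0 : ℝ) 1, ray ((raySweep (S.P a) T d u).endpoint t) (S.P a) ∩ S.inside = ∅ := by
  obtain ⟨c, hc, hS, hcu⟩ : ∃ c : ℝ, 0 < c ∧ raySweep (S.P a) T d u = ⟨S.P a - c • d, S.P a - c • d, S.P a⟩ ∧
      u * c ≤ 1 := by
    unfold raySweep
    split_ifs with h0
    · exact ⟨T, hT, rfl, by rw [h0]; simp⟩
    · have := hB.nonneg.lt_of_ne' h0
      exact ⟨1 / u, by positivity, rfl, by field_simp; exact le_rfl⟩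
  have hE' : ∀ i < S.k, i ∈ E := fun i hi => hE i hi.le
  have hend : ∀ t : ℝ, LinearRaySweep.endpoint ⟨S.P a - c • d, S.P a - c • d, S.P a⟩ t = S.P a - c • d := by
    intro t; rw [endpoint_eq]; congr 1; rw [← add_smul]; congr 1; ring
  rw [hS]
  constructor
  · intro t _
    rw [hend]
    simp [hc.ne', hd]
  · intro t _
    rw [hend]
    apply ray_free
    · intro s hs
      rw [sub_sub_cancel, smul_smul]
      exact hF.not_inside hE' ha hd h1 (by positivity) (by simp)
    · exact S.vertex_not_mem_inside ha
    · intro s hs hs1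
      rw [show S.P a - c • d - S.P a = c • (-d) by rw [smul_neg]; abel, smul_smul]
      refine hB.not_inside hE' ha (neg_ne_zero.2 hd) h2 (by positivity) ?_
      have := mul_le_mul hcu hs1 hs.le zero_le_one
      linarith

end EdgeSystem
end RayCarving

/-! ### The sweeps at one vertex: collection, soundness and completeness -/

namespace RayCarving
namespace EdgeSystem
variable {S : EdgeSystem} {v : Pt}

open Classical in
/-- The sweeps through the vertex `a` for the direction of an entry and the sector before it. -/
noncomputable def entrySweeps (S : EdgeSystem) (a : ℕ) (T : ℝ) (p : Pt) (e : Entry) : List LinearRaySweep :=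
  (if ¬ S.InCone a e.d ∧ ¬ S.InCone a (-e.d) then
    (if e.xf = 0 then [raySweep (S.P a) T e.d e.xb] else []) ++
      (if e.xb = 0 then [raySweep (S.P a) T (-e.d) e.xf] else [])
  else []) ++
  (if ¬ S.InCone a (p + e.d) ∧ ¬ S.InCone a (-(p + e.d)) then
    (if dt e.lf (p + e.d) = 0 then [sideSweep (S.P a) T p e.d e.lb] else []) ++
      (if dt e.lb (p + e.d) = 0 then [sideSweep (S.P a) T (-p) (-e.d) e.lf] else [])
  else [])

/-- The sweeps of an envelope. -/
noncomputable def envSweeps (S : EdgeSystem) (a : ℕ) (T : ℝ) : Pt → List Entry → List LinearRaySweep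
  | _, [] => []
  | p, e :: l => S.entrySweeps a T p e ++ envSweeps S a T e.d l

theorem length_entrySweeps_le (a : ℕ) (T : ℝ) (p : Pt) (e : Entry) : (S.entrySweeps a T p e).length ≤ 4 := by
  unfold entrySweeps
  simp only [List.length_append]
  split_ifs <;> simp

theorem length_envSweeps_le (a : ℕ) (T : ℝ) (l : List Entry) : ∀ p : Pt, (S.envSweeps a T p l).length ≤ 4 * l.length := by
  induction l with
  | nil => intro p; simp [envSweeps]
  | cons e l ih =>
    intro p
    simp only [envSweeps, List.length_append, List.length_cons]
    have := length_entrySweeps_le (S := S) a T p e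
    have := ih e.d
    omega

theorem sideSweep_pivot (v : Pt) (T : ℝ) (p g l : Pt) : (sideSweep v T p g l).pivot = v := by
  unfold sideSweep; split_ifs <;> rfl

theorem raySweep_pivot (v : Pt) (T : ℝ) (d : Pt) (u : ℝ) : (raySweep v T d u).pivot = v := by
  unfold raySweep; split_ifs <;> rfl

theorem one_zero_not_mem_leaf {E : Set ℕ} (hE : S.k ∈ E) {p : Pt} {e : Entry} (h : S.OpenOK v E p e) :
    ((1, 0) : Pt) ∉ Leaf p e.d := fun hm => ((h _ hm).1 _ hE).2 le_rfl rfl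

/-- The cross product could fail to be positive only for the leaf from `startDir` to `endDir`, which
contains the horizontal direction and is excluded by the dummy index. -/
theorem sector_of_openOK {E : Set ℕ} (hE : S.k ∈ E) {p : Pt} {e : Entry} (hd : Normal e.d) (hp : Before p e.d)
    (h : S.OpenOK v E p e) : Sector S v E p e.d e.lf e.lb := by
  refine ⟨?_, h⟩
  rcases hp with rfl | ⟨-, hp⟩
  · rcases hd with hd | hd
    · simp [cr, startDir, hd]
    · exfalso
      apply one_zero_not_mem_leaf hE h
      rw [hd]
      simp [Leaf, cr, startDir, endDir]
  · exact hp

theorem mem_ite_nil {α : Type*} {c : Prop} [Decidable c] {l : List α} {x : α} :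
    x ∈ (if c then l else []) ↔ c ∧ x ∈ l := by
  split_ifs with h <;> simp [h]

theorem envSweeps_sound {a : ℕ} (ha : a < S.k) {E : Set ℕ} (hE : ∀ i ≤ S.k, i ∈ E) {T : ℝ} (hT : 0 < T) (l : List Entry) :
    ∀ p : Pt, S.Env (S.P a) E p l → ∀ R ∈ S.envSweeps a T p l, R.IsProper ∧
      ∀ t ∈ Icc (0 : ℝ) 1, ray (R.endpoint t) R.pivot ∩ S.inside = ∅ := by
  induction l with
  | nil => intro p _ R hR; simp [envSweeps] at hR
  | cons e l ih =>
    rintro p ⟨hn, hb, hx, ho, hl⟩ R hR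
    rw [envSweeps, List.mem_append] at hR
    rcases hR with hR | hR
    · have hs := sector_of_openOK (hE _ le_rfl) hn hb ho
      have hd := Normal.ne_zero hn
      unfold entrySweeps at hR
      simp only [List.mem_append, mem_ite_nil, List.mem_singleton] at hR
      rcases hR with ⟨h1, ⟨h2, rfl⟩ | ⟨h2, rfl⟩⟩ | ⟨h1, ⟨h2, rfl⟩ | ⟨h2, rfl⟩⟩
      · rw [raySweep_pivot]
        exact raySweep_sound ha hE hT hd h1.1 h1.2 (h2 ▸ hx.1) hx.2
      · rw [raySweep_pivot]
        exact raySweep_sound ha hE hT (neg_ne_zero.2 hd) h1.2 (by rw [neg_neg]; exact h1.1) (h2 ▸ hx.2)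
          (by rw [neg_neg]; exact hx.1)
      · rw [sideSweep_pivot]
        exact sideSweep_sound ha hE hT hs h1.1 h1.2 h2
      · have e1 : -p + -e.d = -(p + e.d) := by abel
        rw [sideSweep_pivot]
        exact sideSweep_sound ha hE hT hs.neg (by rw [e1]; exact h1.2) (by rw [e1, neg_neg]; exact h1.1)
          (by rw [e1, dt_neg_right, h2, neg_zero])
    · exact ih _ hl R hR

/-! ### Completeness -/

/-- The segment from `v - A • p` to `v - B • g` meets the ray opposite to `α • p + β • g` at scale
`A * B / (α * B + β * A)`. For the distances from the backward functional this scale is exactly the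
first obstruction, by linearity; for `A = B = T` it is `T / (α + β)`. -/
theorem sideSweep_mem {E : Set ℕ} {T : ℝ} (hT : 0 < T) {p g lF lB : Pt} (h : Sector S v E p g lF lB) {y : Pt}
    (hy : y ∈ Leaf p g) : ∃ c : ℝ, 0 < c ∧ (∀ r ≤ c, v - r • y ∈ (sideSweep v T p g lB).region) ∧
      ((0 < dt lB (-y) ∧ c = 1 / dt lB (-y)) ∨
        ∃ α β : ℝ, 0 < α ∧ 0 < β ∧ y = α • p + β • g ∧ c = T / (α + β)) := by
  obtain ⟨α, β, hα, hβ, rfl⟩ := exists_comb_of_mem_leaf h.pos hy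
  -- a sweep between points on the rays opposite to `p` and `g`
  have gen : ∀ A B : ℝ, 0 < A → 0 < B → ∀ c : ℝ, c = A * B / (α * B + β * A) → ∀ r ≤ c,
      v - r • (α • p + β • g) ∈ LinearRaySweep.region ⟨v - A • p, v - B • g, v⟩ := by
    rintro A B hA hB c rfl r hr
    have hden : 0 < α * B + β * A := by positivity
    rw [mem_region_iff]
    -- The time at which the moving endpoint lies opposite to `α • p + β • g`.
    refine ⟨β * A / (α * B + β * A), ⟨by positivity, ?_⟩, ?_⟩
    · rw [div_le_one hden]; nlinarith
    · apply mem_ray_of_le (c := A * B / (α * B + β * A)) (by positivity) _ hr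
      rw [endpoint_eq]
      congr 1
      rw [smul_add, smul_smul, smul_smul]
      congr 2 <;> field_simp
      ring
  unfold sideSweep
  split_ifs with h0
  · refine ⟨T / (α + β), by positivity, gen T T hT hT _ ?_, Or.inr ⟨α, β, hα, hβ, rfl, rfl⟩⟩
    field_simp
  · obtain ⟨b1, b2, b3⟩ := h.back_pos h0
    have b4 := b3 _ hy
    refine ⟨1 / dt lB (-(α • p + β • g)), by positivity, gen _ _ (one_div_pos.2 b1) (one_div_pos.2 b2) _ ?_,
      Or.inl ⟨b4, rfl⟩⟩
    have e : dt lB (-(α • p + β • g)) = α * dt lB (-p) + β * dt lB (-g) := by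
      rw [dt_neg_right, dt_comb, dt_neg_right, dt_neg_right]; ring
    rw [e]
    field_simp

theorem raySweep_mem {T : ℝ} (hT : 0 < T) {d : Pt} {u : ℝ} (hu : 0 ≤ u) : ∃ c : ℝ, 0 < c ∧
    (∀ r ≤ c, v - r • d ∈ (raySweep v T d u).region) ∧ ((0 < u ∧ c = 1 / u) ∨ c = T) := by
  have gen : ∀ A : ℝ, 0 < A → ∀ r ≤ A, v - r • d ∈ LinearRaySweep.region ⟨v - A • d, v - A • d, v⟩ := by
    intro A hA r hr
    rw [mem_region_iff]
    refine ⟨0, by simp, mem_ray_of_le hA ?_ hr⟩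
    rw [endpoint_eq]; simp
  unfold raySweep
  split_ifs with h0
  · exact ⟨T, hT, gen T hT, Or.inr rfl⟩
  · have hu' : 0 < u := hu.lt_of_ne' h0
    exact ⟨1 / u, by positivity, gen _ (by positivity), Or.inl ⟨hu', rfl⟩⟩

/-- A functional that bounds the extent of a sector from below. -/
def Bounded (c p g : Pt) : Prop := |c.1| ≤ 1 ∧ |c.2| ≤ 1 ∧ 1 ≤ dt c p ∧ 1 ≤ dt c g

/-- The direction `y` lies in a sector or on a single ray for which the sweeps in `L` are present. -/
def Located (S : EdgeSystem) (a : ℕ) (T : ℝ) (E : Set ℕ) (L : List LinearRaySweep) (y : Pt) : Prop :=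
  (∃ p g lF lB c : Pt, Sector S (S.P a) E p g lF lB ∧ y ∈ Leaf p g ∧ Bounded c p g ∧
    (¬ S.InCone a (p + g) → ¬ S.InCone a (-(p + g)) →
      (dt lF (p + g) = 0 → sideSweep (S.P a) T p g lB ∈ L) ∧
      (dt lB (p + g) = 0 → sideSweep (S.P a) T (-p) (-g) lF ∈ L))) ∨
  (∃ d : Pt, ∃ uF uB lam : ℝ, ∃ c : Pt, d ≠ 0 ∧ S.First (S.P a) E d uF ∧ S.First (S.P a) E (-d) uB ∧ 0 < lam ∧
    y = lam • d ∧ Bounded c d d ∧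
    (¬ S.InCone a d → ¬ S.InCone a (-d) →
      (uF = 0 → raySweep (S.P a) T d uB ∈ L) ∧ (uB = 0 → raySweep (S.P a) T (-d) uF ∈ L)))

theorem Bounded.neg {c p g : Pt} (h : Bounded c p g) : Bounded (-c) (-p) (-g) := by
  obtain ⟨h1, h2, h3, h4⟩ := h
  refine ⟨by simpa using h1, by simpa using h2, ?_, ?_⟩ <;> rw [dt_neg_left, dt_neg_right, neg_neg] <;> assumption

theorem Located.neg {a : ℕ} {T : ℝ} {E : Set ℕ} {L : List LinearRaySweep} {y : Pt} (h : Located S a T E L y) :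
    Located S a T E L (-y) := by
  rcases h with ⟨p, g, lF, lB, c, hs, hy, hc, hm⟩ | ⟨d, uF, uB, lam, c, hd, hF, hB, hl, hy, hc, hm⟩
  · left
    have e1 : -p + -g = -(p + g) := by abel
    refine ⟨-p, -g, lB, lF, -c, hs.neg, neg_mem_leaf.2 hy, hc.neg, fun h1 h2 => ?_⟩
    rw [e1] at h1 h2 ⊢
    rw [neg_neg] at h2
    obtain ⟨m1, m2⟩ := hm h2 h1
    rw [dt_neg_right, dt_neg_right, neg_eq_zero, neg_eq_zero, neg_neg, neg_neg]
    exact ⟨m2, m1⟩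
  · right
    refine ⟨-d, uB, uF, lam, -c, neg_ne_zero.2 hd, hB, by rwa [neg_neg], hl, by rw [hy, smul_neg], hc.neg, fun h1 h2 => ?_⟩
    rw [neg_neg] at h2 ⊢
    obtain ⟨m1, m2⟩ := hm h2 h1
    exact ⟨m2, m1⟩

/-- As the leaf does not contain `(1, 0)`, both bounding directions are in one closed quadrant,
where `(1, -1)`, `(1, 0)` or `(1, 1)` is at least 1 on both. This measures how far a point beyond
the scale `T` must be. -/
theorem bounded_of_openOK {E : Set ℕ} (hE : S.k ∈ E) {p : Pt} {e : Entry} (hd : Normal e.d) (hp : Before p e.d)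
    (h : S.OpenOK v E p e) : ∃ c, Bounded c p e.d := by
  have hs := sector_of_openOK hE hd hp h
  have h0 := one_zero_not_mem_leaf hE h
  have hpos := hs.pos
  generalize e.d = d at *
  rcases hp with rfl | ⟨hp, -⟩
  · rcases hd with hd | rfl
    · refine ⟨(1, -1), by simp, by simp, by simp [dt, startDir], ?_⟩
      have : d.2 ≤ 0 := by
        by_contra hc
        push Not at hc
        exact h0 ⟨by simp [cr, startDir], by simpa [cr] using hc⟩
      simp only [dt, hd]; linarith
    · simp [cr, startDir, endDir] at hpos
  · rcases hp with hp | rfl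
    · rcases hd with hd | rfl
      · exact ⟨(1, 0), by simp, by simp, by simp [dt, hp], by simp [dt, hd]⟩
      · refine ⟨(1, 1), by simp, by simp, ?_, by simp [dt, endDir]⟩
        have : 0 ≤ p.2 := by
          by_contra hc
          push Not at hc
          exact h0 ⟨by simpa [cr] using hc, by simp [cr, endDir]⟩
        simp only [dt, hp]; linarith
    · rcases hd with hd | rfl
      · simp [cr, endDir, hd] at hpos; linarith
      · simp [cr, endDir] at hpos

theorem Normal.bounded {d : Pt} (hd : Normal d) : ∃ c, Bounded c d d := by
  rcases hd with hd | rfl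
  · exact ⟨(1, 0), by simp, by simp, by simp [dt, hd], by simp [dt, hd]⟩
  · exact ⟨(0, 1), by simp, by simp, by simp [dt, endDir], by simp [dt, endDir]⟩

/-- The list is followed until its direction reaches or passes `y`. Directions in the other
half-plane are treated by `Located.neg`. -/
theorem located_of_env {a : ℕ} {T : ℝ} {E : Set ℕ} (hE : S.k ∈ E) {L : List LinearRaySweep} {y : Pt}
    (hy : 0 < y.1 ∨ (y.1 = 0 ∧ 0 < y.2)) (l : List Entry) : ∀ p : Pt, (p = startDir ∨ 0 < cr p y) →
      S.Env (S.P a) E p l → S.envSweeps a T p l ⊆ L → Located S a T E L y := by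
  induction l with
  | nil =>
    rintro p hp h -
    simp only [Env] at h
    subst h
    exfalso
    rcases hp with h | h
    · have := congrArg Prod.snd h; simp [endDir, startDir] at this; linarith
    · simp [cr, endDir] at h
      rcases hy with h' | h'
      · linarith
      · linarith [h'.1]
  | cons e l ih =>
    rintro p hp ⟨hn, hb, hx, ho, hl⟩ hL
    rw [envSweeps, List.append_subset] at hL
    obtain ⟨hL1, hL2⟩ := hL
    unfold entrySweeps at hL1
    rw [List.append_subset] at hL1
    obtain ⟨hL1, hL3⟩ := hL1
    rcases lt_trichotomy (cr y e.d) 0 with h | h | h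
    · exact ih e.d (Or.inr (by rw [cr_swap]; linarith)) hl hL2
    · right
      obtain ⟨lam, hl0, hlam⟩ : ∃ lam : ℝ, 0 < lam ∧ y = lam • e.d := by
        rcases hn with hn | hn
        · refine ⟨y.1, ?_, ?_⟩
          · rcases hy with hy | hy
            · exact hy
            · simp [cr, hn, hy.1] at h; linarith [hy.2]
          · ext
            · simp [hn]
            · simp only [cr, hn] at h; simp; linarith
        · rw [hn] at h ⊢
          have : y.1 = 0 := by simpa [cr, endDir] using h
          refine ⟨y.2, ?_, ?_⟩
          · rcases hy with hy | hy
            · linarith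
            · exact hy.2
          · ext <;> simp [endDir, this]
      obtain ⟨c, hc⟩ := Normal.bounded hn
      refine ⟨e.d, e.xf, e.xb, lam, c, Normal.ne_zero hn, hx.1, hx.2, hl0, hlam, hc, fun h1 h2 => ?_⟩
      rw [if_pos ⟨h1, h2⟩, List.append_subset] at hL1
      constructor
      · intro h3
        have := hL1.1
        rw [if_pos h3] at this
        exact this (by simp)
      · intro h3
        have := hL1.2
        rw [if_pos h3] at this
        exact this (by simp)
    · left
      obtain ⟨c, hc⟩ := bounded_of_openOK hE hn hb ho
      refine ⟨p, e.d, e.lf, e.lb, c, sector_of_openOK hE hn hb ho, ⟨?_, h⟩, hc, fun h1 h2 => ?_⟩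
      · rcases hp with rfl | hp
        · rcases hy with hy | hy
          · simpa [cr, startDir] using hy
          · exfalso
            simp only [cr, hy.1, zero_mul, zero_sub] at h
            rcases hn with hn | hn
            · rw [hn] at h; linarith [hy.2]
            · rw [hn] at h; simp [endDir] at h
        · exact hp
      rw [if_pos ⟨h1, h2⟩, List.append_subset] at hL3
      constructor
      · intro h3
        have := hL3.1
        rw [if_pos h3] at this
        exact this (by simp)
      · intro h3
        have := hL3.2
        rw [if_pos h3] at this
        exact this (by simp)

theorem located {a : ℕ} {T : ℝ} {E : Set ℕ} (hE : S.k ∈ E) {l : List Entry} (h : S.Env (S.P a) E startDir l) {y : Pt}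
    (hy : y ≠ 0) : Located S a T E (S.envSweeps a T startDir l) y := by
  have : (0 < y.1 ∨ (y.1 = 0 ∧ 0 < y.2)) ∨ (0 < (-y).1 ∨ ((-y).1 = 0 ∧ 0 < (-y).2)) := by
    simp only [Prod.fst_neg, Prod.snd_neg]
    rcases lt_trichotomy y.1 0 with h1 | h1 | h1
    · right; left; linarith
    · rcases lt_trichotomy y.2 0 with h2 | h2 | h2
      · right; right; constructor <;> linarith
      · exact absurd (Prod.ext h1 h2) hy
      · left; right; exact ⟨h1, h2⟩
    · left; left; exact h1
  rcases this with h1 | h1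
  · exact located_of_env hE h1 l _ (Or.inl rfl) h (List.Subset.refl _)
  · have := (located_of_env (T := T) hE h1 l _ (Or.inl rfl) h (List.Subset.refl _)).neg
    rwa [neg_neg] at this

/-- A point on a line that is free and passes through a vertex is covered. -/
theorem covered_of_line {a : ℕ} (ha : a < S.k) {T : ℝ} (hT : 0 < T) {E : Set ℕ} (hE : ∀ i ≤ S.k, i ∈ E) {L : List LinearRaySweep}
    {y : Pt} (hy : y ≠ 0) (hl : Located S a T E L y) (hf : ∀ s : ℝ, S.P a + s • y ∉ S.inside) :
    ∃ R ∈ L, S.P a - y ∈ R.region := by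
  have hf' : ∀ s : ℝ, S.P a + s • (-y) ∉ S.inside := fun s => by
    rw [smul_neg, ← neg_smul]; exact hf _
  rcases hl with ⟨p, g, lF, lB, c, hs, hyl, -, hm⟩ | ⟨d, uF, uB, lam, c, hd, hF, hB, hl, rfl, -, hm⟩
  · have c1 := not_inCone_of_free ha hy one_pos fun s _ _ => hf s
    have c2 := not_inCone_of_free ha (neg_ne_zero.2 hy) one_pos fun s _ _ => hf' s
    rw [hs.inCone_iff ha hE hyl hs.mid] at c1
    rw [hs.neg.inCone_iff ha hE (neg_mem_leaf.2 hyl) (neg_mem_leaf.2 hs.mid)] at c2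
    have z := (hs.ok _ hyl).2.2.eq_zero_of_free (neg_ne_zero.2 hy) fun s _ => hf' s
    have z' := dt_eq_zero_of_nonneg hs.neg.pos (fun x hx => (hs.neg.ok x hx).2.1.nonneg) (neg_mem_leaf.2 hyl)
      (neg_mem_leaf.2 hs.mid) z
    rw [dt_neg_right, neg_eq_zero] at z'
    refine ⟨_, (hm c1 c2).2 z', ?_⟩
    obtain ⟨c, hc, hr, -⟩ := sideSweep_mem hT hs.neg (neg_mem_leaf.2 hyl)
    -- The whole line is free, so the sweep with reversed direction is available; the parameter is
    -- negative, that is, the point lies ahead of the pivot, and the scale `T` does not limit it.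
    have := hr (-1) (by linarith)
    simpa [sub_eq_add_neg] using this
  · have nn : ∀ s : ℝ, S.P a + s • d ∉ S.inside := fun s => by
      have := hf (s / lam)
      rwa [smul_smul, div_mul_cancel₀ _ hl.ne'] at this
    have nn' : ∀ s : ℝ, S.P a + s • (-d) ∉ S.inside := fun s => by
      rw [smul_neg, ← neg_smul]; exact nn _
    have c1 := not_inCone_of_free ha hd one_pos fun s _ _ => nn s
    have c2 := not_inCone_of_free ha (neg_ne_zero.2 hd) one_pos fun s _ _ => nn' s
    have z := hB.eq_zero_of_free (neg_ne_zero.2 hd) fun s _ => nn' s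
    refine ⟨_, (hm c1 c2).2 z, ?_⟩
    obtain ⟨c, hc, hr, -⟩ := raySweep_mem (v := S.P a) hT (d := -d) hF.nonneg
    have := hr (-lam) (by linarith)
    simpa [sub_eq_add_neg] using this

/-- A point with a free ray through a vertex is covered or far away from all edges. -/
theorem covered_of_free {a : ℕ} (ha : a < S.k) {T : ℝ} (hT : 0 < T) {E : Set ℕ} (hE : ∀ i ≤ S.k, i ∈ E) {L : List LinearRaySweep}
    {y : Pt} (hy : y ≠ 0) (hl : Located S a T E L y) (hf : S.Free (S.P a - y) y) :
    (∃ R ∈ L, S.P a - y ∈ R.region) ∨ ∃ c : Pt, |c.1| ≤ 1 ∧ |c.2| ≤ 1 ∧ T < dt c y := by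
  have front : ∀ s : ℝ, 0 < s → S.P a + s • y ∉ S.inside := fun s hs => by
    have := hf (1 + s) (by linarith)
    rwa [add_smul, one_smul, ← add_assoc, sub_add_cancel] at this
  have back : ∀ s : ℝ, 0 < s → s < 1 → S.P a + s • (-y) ∉ S.inside := fun s hs hs1 => by
    have := hf (1 - s) (by linarith)
    rwa [sub_smul, one_smul, show S.P a - y + (y - s • y) = S.P a + s • (-y) by rw [smul_neg]; abel] at this
  rcases hl with ⟨p, g, lF, lB, c, hs, hyl, hc, hm⟩ | ⟨d, uF, uB, lam, c, hd, hF, hB, hl, rfl, hc, hm⟩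
  · have c1 := not_inCone_of_free ha hy one_pos fun s hs _ => front s hs
    have c2 := not_inCone_of_free ha (neg_ne_zero.2 hy) one_pos back
    rw [hs.inCone_iff ha hE hyl hs.mid] at c1
    rw [hs.neg.inCone_iff ha hE (neg_mem_leaf.2 hyl) (neg_mem_leaf.2 hs.mid)] at c2
    have z := (hs.ok _ hyl).2.1.eq_zero_of_free hy front
    have z' := dt_eq_zero_of_nonneg hs.pos (fun x hx => (hs.ok x hx).2.1.nonneg) hyl hs.mid z
    have hR := (hm c1 c2).1 z'
    obtain ⟨r, hr, hmem, hcase⟩ := sideSweep_mem hT hs hyl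
    -- The point is at parameter 1 behind the vertex. If the sweep does not reach so far, it does
    -- not stop at an obstruction, as the ray from the point is free; so it stops at scale `T`, and
    -- `c` exceeds `T` at `y`.
    by_cases h1 : 1 ≤ r
    · left
      refine ⟨_, hR, ?_⟩
      simpa using hmem 1 h1
    · right
      push Not at h1
      rcases hcase with ⟨u0, rfl⟩ | ⟨α, β, hα, hβ, hyc, rfl⟩
      · have := (hs.ok _ hyl).2.2.le_of_free (neg_ne_zero.2 hy) back
        rw [div_lt_one u0] at h1
        linarith
      · refine ⟨c, hc.1, hc.2.1, ?_⟩
        rw [div_lt_one (by positivity)] at h1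
        rw [hyc, dt_comb]
        have := mul_le_mul_of_nonneg_left hc.2.2.1 hα.le
        have := mul_le_mul_of_nonneg_left hc.2.2.2 hβ.le
        linarith
  · have nf : ∀ s : ℝ, 0 < s → S.P a + s • d ∉ S.inside := fun s hs => by
      have := front (s / lam) (by positivity)
      rwa [smul_smul, div_mul_cancel₀ _ hl.ne'] at this
    have nb : ∀ s : ℝ, 0 < s → s < lam → S.P a + s • (-d) ∉ S.inside := fun s hs hsl => by
      have := back (s / lam) (by positivity) ((div_lt_one hl).2 hsl)
      rwa [← smul_neg, smul_smul, div_mul_cancel₀ _ hl.ne'] at this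
    have c1 := not_inCone_of_free ha hd one_pos fun s hs _ => nf s hs
    have c2 := not_inCone_of_free ha (neg_ne_zero.2 hd) hl nb
    have z := hF.eq_zero_of_free hd nf
    have hR := (hm c1 c2).1 z
    obtain ⟨r, hr, hmem, hcase⟩ := raySweep_mem (v := S.P a) hT (d := d) hB.nonneg
    by_cases h1 : lam ≤ r
    · left
      exact ⟨_, hR, hmem lam h1⟩
    · right
      push Not at h1
      rcases hcase with ⟨u0, rfl⟩ | rfl
      · have := hB.le_of_free (neg_ne_zero.2 hd) nb
        rw [div_lt_iff₀ u0] at h1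
        linarith
      · refine ⟨c, hc.1, hc.2.1, ?_⟩
        have : dt c (lam • d) = lam * dt c d := by simp [dt]; ring
        rw [this]
        have := mul_le_mul_of_nonneg_left hc.2.2.1 hl.le
        linarith

theorem mem_unionOfFreeRays_iff {x : Pt} {U : Set Pt} (hU : interior U = S.inside) :
    x ∈ unionOfFreeRays U ↔ ∃ a b : Pt, a ≠ b ∧ ray a b ∩ S.inside = ∅ ∧ x ∈ ray a b := by
  unfold unionOfFreeRays
  rw [hU, mem_ofPred_eq]

/-- The sweeps of the envelopes of all vertices cover exactly the free rays. -/
theorem union_envSweeps (hk : 0 < S.k) {U : Set Pt} (hU : interior U = S.inside) {T : ℝ} (hT : 0 < T)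
    (hTk : ∀ i < S.k, ∀ j < S.k, |(S.P i).1 - (S.P j).1| + |(S.P i).2 - (S.P j).2| ≤ T)
    {E : Set ℕ} (hE : ∀ i ≤ S.k, i ∈ E) {l : ℕ → List Entry} (hl : ∀ a < S.k, S.Env (S.P a) E startDir (l a)) :
    (∀ a < S.k, ∀ R ∈ S.envSweeps a T startDir (l a), R.IsProper) ∧
    {x | ∃ a < S.k, ∃ R ∈ S.envSweeps a T startDir (l a), x ∈ R.region} = unionOfFreeRays U := by
  refine ⟨fun a ha R hR => (envSweeps_sound ha hE hT _ _ (hl a ha) R hR).1, ?_⟩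
  ext x
  rw [mem_unionOfFreeRays_iff hU]
  constructor
  · rintro ⟨a, ha, R, hR, hx⟩
    obtain ⟨h1, h2⟩ := envSweeps_sound ha hE hT _ _ (hl a ha) R hR
    obtain ⟨t, ht, hx⟩ := mem_region_iff.1 hx
    exact ⟨_, _, h1 t ht, h2 t ht, hx⟩
  · rintro ⟨p, q, hpq, hray, s, hs, rfl⟩
    have hd : q - p ≠ 0 := sub_ne_zero.2 hpq.symm
    set x := p + s • (q - p) with hx
    have hfree : S.Free x (q - p) := by
      intro r hr hin
      rw [eq_empty_iff_forall_notMem] at hray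
      refine hray _ ⟨⟨s + r, by linarith, ?_⟩, hin⟩
      rw [hx, add_smul, add_assoc]
    obtain ⟨a, ha, hax, hf⟩ := S.exists_free_vertex hk hd hfree
    have hy : S.P a - x ≠ 0 := sub_ne_zero.2 hax
    rcases covered_of_free ha hT hE hy (located (T := T) (hE _ le_rfl) (hl a ha) hy)
      (by rw [sub_sub_cancel]; exact hf) with ⟨R, hR, hxR⟩ | ⟨c, c1, c2, hc⟩
    · rw [sub_sub_cancel] at hxR
      exact ⟨a, ha, R, hR, hxR⟩
    -- Along `c` the point is farther than `T` from the vertex `a`, while by `hTk` every vertex is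
    -- within `T` of `a`. Thus `-c` separates the point strictly from all vertices, and a line of
    -- support exists.
    · have hsep : ∀ i < S.k, dt (-c) (S.P i - x) < 0 := by
        intro i hi
        have h1 := hTk i hi a ha
        have e : dt (-c) (S.P i - x) = -(c.1 * ((S.P i).1 - (S.P a).1)) - c.2 * ((S.P i).2 - (S.P a).2) - dt c (S.P a - x) := by
          simp [dt]; ring
        have a1 : -(c.1 * ((S.P i).1 - (S.P a).1)) ≤ |(S.P i).1 - (S.P a).1| := by
          have := neg_abs_le (c.1 * ((S.P i).1 - (S.P a).1))
          rw [abs_mul] at this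
          have := mul_le_mul_of_nonneg_right c1 (abs_nonneg ((S.P i).1 - (S.P a).1))
          linarith
        have a2 : -(c.2 * ((S.P i).2 - (S.P a).2)) ≤ |(S.P i).2 - (S.P a).2| := by
          have := neg_abs_le (c.2 * ((S.P i).2 - (S.P a).2))
          rw [abs_mul] at this
          have := mul_le_mul_of_nonneg_right c2 (abs_nonneg ((S.P i).2 - (S.P a).2))
          linarith
        rw [e]; linarith
      obtain ⟨b, hb, hbx, hline⟩ := S.exists_supporting_vertex hk hsep
      have hyb : S.P b - x ≠ 0 := sub_ne_zero.2 hbx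
      obtain ⟨R, hR, hxR⟩ := covered_of_line hb hT hE hyb (located (T := T) (hE _ le_rfl) (hl b hb) hyb) (by
        intro r
        have := hline (1 + r)
        rwa [add_smul, one_smul, ← add_assoc, add_sub_cancel] at this)
      rw [sub_sub_cancel] at hxR
      exact ⟨b, hb, R, hR, hxR⟩

end EdgeSystem
end RayCarving

namespace RayCarving

/-! ## Verification of programs -/

namespace Memory
variable (m : Memory) (r s v i j a b : ℕ) (x : ℝ)

@[simp] theorem setNatReg_natReg : (m.setNatReg r v).natReg s = if s = r then v else m.natReg s := by
  simp [setNatReg, Function.update_apply]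
@[simp] theorem setNatReg_realReg : (m.setNatReg r v).realReg = m.realReg := rfl
@[simp] theorem setNatReg_natArr : (m.setNatReg r v).natArr = m.natArr := rfl
@[simp] theorem setNatReg_realArr : (m.setNatReg r v).realArr = m.realArr := rfl
@[simp] theorem setRealReg_natReg : (m.setRealReg r x).natReg = m.natReg := rfl
@[simp] theorem setRealReg_realReg : (m.setRealReg r x).realReg s = if s = r then x else m.realReg s := by
  simp [setRealReg, Function.update_apply]
@[simp] theorem setRealReg_natArr : (m.setRealReg r x).natArr = m.natArr := rfl
@[simp] theorem setRealReg_realArr : (m.setRealReg r x).realArr = m.realArr := rfl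
@[simp] theorem setNatArr_natReg : (m.setNatArr a i v).natReg = m.natReg := rfl
@[simp] theorem setNatArr_realReg : (m.setNatArr a i v).realReg = m.realReg := rfl
@[simp] theorem setNatArr_natArr : (m.setNatArr a i v).natArr b j = if b = a ∧ j = i then v else m.natArr b j := by
  by_cases h : b = a
  · subst h; simp [setNatArr, Function.update_apply]
  · simp [setNatArr, h]
@[simp] theorem setNatArr_realArr : (m.setNatArr a i v).realArr = m.realArr := rfl
@[simp] theorem setRealArr_natReg : (m.setRealArr a i x).natReg = m.natReg := rfl
@[simp] theorem setRealArr_realReg : (m.setRealArr a i x).realReg = m.realReg := rfl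
@[simp] theorem setRealArr_natArr : (m.setRealArr a i x).natArr = m.natArr := rfl
@[simp] theorem setRealArr_realArr :
    (m.setRealArr a i x).realArr b j = if b = a ∧ j = i then x else m.realArr b j := by
  by_cases h : b = a
  · subst h; simp [setRealArr, Function.update_apply]
  · simp [setRealArr, h]

end Memory

attribute [simp] NatExp.eval RealExp.eval Test.Holds

namespace Program

/-- The program has no loops. -/
def loopFree : Program → Bool
  | seq P Q => P.loopFree && Q.loopFree
  | cond _ P Q => P.loopFree && Q.loopFree
  | loop _ _ => false
  | _ => true

open Classical in
/-- The memory after running a program without loops. -/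
noncomputable def exec : Program → Memory → Memory
  | skip, m => m
  | setNatReg r e, m => m.setNatReg r (e.eval m)
  | setRealReg r e, m => m.setRealReg r (e.eval m)
  | setNatArr a i e, m => m.setNatArr a (i.eval m) (e.eval m)
  | setRealArr a i e, m => m.setRealArr a (i.eval m) (e.eval m)
  | seq P Q, m => Q.exec (P.exec m)
  | cond b P Q, m => if b.Holds m then P.exec m else Q.exec m
  | loop _ _, m => m

/-- A bound on the number of steps of a program without loops. -/
def bound : Program → ℕ
  | skip => 1
  | setNatReg _ e => e.cost + 1
  | setRealReg _ e => e.cost + 1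
  | setNatArr _ i e => i.cost + e.cost + 1
  | setRealArr _ i e => i.cost + e.cost + 1
  | seq P Q => P.bound + Q.bound
  | cond b P Q => b.cost + 1 + (P.bound + Q.bound)
  | loop _ _ => 0

theorem runs_exec (P : Program) : ∀ m, P.loopFree = true → ∃ t ≤ P.bound, Runs P m (P.exec m) t := by
  induction P with
  | skip => exact fun m _ => ⟨1, le_rfl, .skip m⟩
  | setNatReg r e => exact fun m _ => ⟨_, le_rfl, .setNatReg m r e⟩
  | setRealReg r e => exact fun m _ => ⟨_, le_rfl, .setRealReg m r e⟩
  | setNatArr a i e => exact fun m _ => ⟨_, le_rfl, .setNatArr m a i e⟩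
  | setRealArr a i e => exact fun m _ => ⟨_, le_rfl, .setRealArr m a i e⟩
  | seq P Q hP hQ =>
    intro m h
    simp only [loopFree, Bool.and_eq_true] at h
    obtain ⟨t, ht, hr⟩ := hP m h.1
    obtain ⟨t', ht', hr'⟩ := hQ (P.exec m) h.2
    exact ⟨t + t', add_le_add ht ht', .seq hr hr'⟩
  | cond b P Q hP hQ =>
    intro m h
    simp only [loopFree, Bool.and_eq_true] at h
    by_cases hb : b.Holds m
    · obtain ⟨t, ht, hr⟩ := hP m h.1
      refine ⟨b.cost + 1 + t, by simp only [bound]; omega, ?_⟩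
      simp only [exec, if_pos hb]
      exact .cond_true hb hr
    · obtain ⟨t, ht, hr⟩ := hQ m h.2
      refine ⟨b.cost + 1 + t, by simp only [bound]; omega, ?_⟩
      simp only [exec, if_neg hb]
      exact .cond_false hb hr
  | loop b P _ => intro m h; simp [loopFree] at h

/-- The program may write to the natural-number register. -/
def writesNatReg (s : ℕ) : Program → Bool
  | setNatReg r _ => r == s
  | seq P Q => P.writesNatReg s || Q.writesNatReg s
  | cond _ P Q => P.writesNatReg s || Q.writesNatReg s
  | loop _ P => P.writesNatReg s
  | _ => false

/-- The program may write to the real register. -/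
def writesRealReg (s : ℕ) : Program → Bool
  | setRealReg r _ => r == s
  | seq P Q => P.writesRealReg s || Q.writesRealReg s
  | cond _ P Q => P.writesRealReg s || Q.writesRealReg s
  | loop _ P => P.writesRealReg s
  | _ => false

/-- The program may write to the array of natural numbers. -/
def writesNatArr (s : ℕ) : Program → Bool
  | setNatArr a _ _ => a == s
  | seq P Q => P.writesNatArr s || Q.writesNatArr s
  | cond _ P Q => P.writesNatArr s || Q.writesNatArr s
  | loop _ P => P.writesNatArr s
  | _ => false

/-- The program may write to the array of real numbers. -/
def writesRealArr (s : ℕ) : Program → Bool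
  | setRealArr a _ _ => a == s
  | seq P Q => P.writesRealArr s || Q.writesRealArr s
  | cond _ P Q => P.writesRealArr s || Q.writesRealArr s
  | loop _ P => P.writesRealArr s
  | _ => false

end Program

/-- The two memories agree in all places that the program does not write to. -/
structure Same (P : Program) (m m' : Memory) : Prop where
  natReg : ∀ r, P.writesNatReg r = false → m'.natReg r = m.natReg r
  realReg : ∀ r, P.writesRealReg r = false → m'.realReg r = m.realReg r
  natArr : ∀ a, P.writesNatArr a = false → m'.natArr a = m.natArr a
  realArr : ∀ a, P.writesRealArr a = false → m'.realArr a = m.realArr a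

/-- The frame rule. What a program may write is a Boolean function of its text, so for concrete
programs the side conditions usually hold by `rfl`. -/
theorem Runs.same {P : Program} {m m' : Memory} {t : ℕ} (h : Runs P m m' t) : Same P m m' := by
  induction h with
  | skip | loop_false => exact ⟨fun _ _ => rfl, fun _ _ => rfl, fun _ _ => rfl, fun _ _ => rfl⟩
  | setNatReg m r e =>
    refine ⟨fun s hs => ?_, fun _ _ => rfl, fun _ _ => rfl, fun _ _ => rfl⟩
    simp only [Program.writesNatReg, beq_eq_false_iff_ne, ne_eq] at hs
    simp [Ne.symm hs]
  | setRealReg m r e =>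
    refine ⟨fun _ _ => rfl, fun s hs => ?_, fun _ _ => rfl, fun _ _ => rfl⟩
    simp only [Program.writesRealReg, beq_eq_false_iff_ne, ne_eq] at hs
    simp [Ne.symm hs]
  | setNatArr m a i e =>
    refine ⟨fun _ _ => rfl, fun _ _ => rfl, fun s hs => ?_, fun _ _ => rfl⟩
    simp only [Program.writesNatArr, beq_eq_false_iff_ne, ne_eq] at hs
    ext; simp [Ne.symm hs]
  | setRealArr m a i e =>
    refine ⟨fun _ _ => rfl, fun _ _ => rfl, fun _ _ => rfl, fun s hs => ?_⟩
    simp only [Program.writesRealArr, beq_eq_false_iff_ne, ne_eq] at hs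
    ext; simp [Ne.symm hs]
  | seq _ _ h1 h2 =>
    constructor <;> intro r hr <;>
      simp only [Program.writesNatReg, Program.writesRealReg, Program.writesNatArr, Program.writesRealArr,
        Bool.or_eq_false_iff] at hr
    · rw [h2.natReg r hr.2, h1.natReg r hr.1]
    · rw [h2.realReg r hr.2, h1.realReg r hr.1]
    · rw [h2.natArr r hr.2, h1.natArr r hr.1]
    · rw [h2.realArr r hr.2, h1.realArr r hr.1]
  | cond_true _ _ h1 =>
    constructor <;> intro r hr <;>
      simp only [Program.writesNatReg, Program.writesRealReg, Program.writesNatArr, Program.writesRealArr,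
        Bool.or_eq_false_iff] at hr
    · exact h1.natReg r hr.1
    · exact h1.realReg r hr.1
    · exact h1.natArr r hr.1
    · exact h1.realArr r hr.1
  | cond_false _ _ h1 =>
    constructor <;> intro r hr <;>
      simp only [Program.writesNatReg, Program.writesRealReg, Program.writesNatArr, Program.writesRealArr,
        Bool.or_eq_false_iff] at hr
    · exact h1.natReg r hr.2
    · exact h1.realReg r hr.2
    · exact h1.natArr r hr.2
    · exact h1.realArr r hr.2
  | loop_true _ _ _ h1 h2 =>
    constructor <;> intro r hr
    · rw [h2.natReg r hr, h1.natReg r hr]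
    · rw [h2.realReg r hr, h1.realReg r hr]
    · rw [h2.natArr r hr, h1.natArr r hr]
    · rw [h2.realArr r hr, h1.realArr r hr]

theorem Program.same_exec {P : Program} (h : P.loopFree = true) (m : Memory) : Same P m (P.exec m) := by
  obtain ⟨t, -, hr⟩ := P.runs_exec m h
  exact hr.same

/-- The program halts within `n` steps, in a memory with the property `Q`. -/
def Does (P : Program) (n : ℕ) (m : Memory) (Q : Memory → Prop) : Prop :=
  ∃ m' t, Runs P m m' t ∧ t ≤ n ∧ Q m'

namespace Does
variable {P P' : Program} {n n' : ℕ} {m : Memory} {Q Q' : Memory → Prop} {b : Test}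

theorem mono (h : Does P n m Q) (hn : n ≤ n') (hQ : ∀ m', Same P m m' → Q m' → Q' m') : Does P n' m Q' := by
  obtain ⟨m', t, h1, h2, h3⟩ := h
  exact ⟨m', t, h1, h2.trans hn, hQ m' h1.same h3⟩

theorem exec (h : P.loopFree = true) (hQ : Q (P.exec m)) : Does P P.bound m Q := by
  obtain ⟨t, ht, hr⟩ := P.runs_exec m h
  exact ⟨_, t, hr, ht, hQ⟩

theorem seq (h : Does P n m fun m' => Does P' n' m' Q) : Does (.seq P P') (n + n') m Q := by
  obtain ⟨m', t, h1, h2, m'', t', h3, h4, h5⟩ := h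
  exact ⟨m'', t + t', .seq h1 h3, add_le_add h2 h4, h5⟩

theorem cond (h : b.Holds m → Does P n m Q) (h' : ¬ b.Holds m → Does P' n m Q) :
    Does (.cond b P P') (b.cost + 1 + n) m Q := by
  by_cases hb : b.Holds m
  · obtain ⟨m', t, h1, h2, h3⟩ := h hb
    exact ⟨m', _, .cond_true hb h1, by omega, h3⟩
  · obtain ⟨m', t, h1, h2, h3⟩ := h' hb
    exact ⟨m', _, .cond_false hb h1, by omega, h3⟩

/-- An invariant `I` with the remaining time as a parameter. -/
theorem loop (I : ℕ → Memory → Prop)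
    (h : ∀ n m, I n m → b.Holds m → ∃ c, Does P c m fun m' => ∃ n', b.cost + 1 + c + n' ≤ n ∧ I n' m') :
    ∀ n m, I n m → Does (.loop b P) (n + (b.cost + 1)) m fun m' => ¬ b.Holds m' ∧ ∃ n', I n' m' := by
  intro n
  induction n using Nat.strong_induction_on with
  | _ n ih =>
    intro m hI
    by_cases hb : b.Holds m
    · obtain ⟨c, m', t, h1, h2, n', h3, h4⟩ := h n m hI hb
      obtain ⟨m'', t', h5, h6, h7⟩ := ih n' (by omega) m' h4
      exact ⟨m'', _, .loop_true hb h1 h5, by omega, h7⟩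
    · exact ⟨m, _, .loop_false hb, by omega, hb, n, hI⟩

/-- A loop in which the natural-number register `r` counts up to the value of register `s`. -/
theorem count (r s : ℕ) (c : ℕ → ℕ) (I : ℕ → Memory → Prop) (N : ℕ)
    (hI : ∀ i m, I i m → m.natReg r = i ∧ m.natReg s = N)
    (h : ∀ i m, i < N → I i m → Does P (c i) m (I (i + 1))) (hm : I 0 m) :
    Does (.loop (.natLt (.reg r) (.reg s)) P) (∑ i ∈ Finset.range N, (c i + 4) + 4) m (I N) := by
  have h0 : ∑ i ∈ Finset.range N, (c i + 4) = ∑ i ∈ Finset.Ico 0 N, (c i + 4) := by rw [Finset.range_eq_Ico]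
  refine (loop (b := .natLt (.reg r) (.reg s)) (P := P)
    (fun n m => ∃ i ≤ N, I i m ∧ n = ∑ i ∈ Finset.Ico i N, (c i + 4)) ?_ _ m ⟨0, N.zero_le, hm, h0⟩).mono le_rfl ?_
  · rintro n m ⟨i, hi, hm, rfl⟩ hb
    obtain ⟨h1, h2⟩ := hI i m hm
    simp only [Test.Holds, NatExp.eval, h1, h2] at hb
    refine ⟨c i, (h i m hb hm).mono le_rfl fun m' _ hm' => ⟨_, ?_, i + 1, hb, hm', rfl⟩⟩
    rw [Finset.sum_eq_sum_Ico_succ_bot hb]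
    -- The 4 per round is the cost 3 of comparing two registers plus 1 for the branch.
    simp only [Test.cost, NatExp.cost]
    omega
  · rintro m' - ⟨hb, n', i, hi, hm, -⟩
    obtain ⟨h1, h2⟩ := hI i m' hm
    simp only [Test.Holds, NatExp.eval, h1, h2] at hb
    rwa [show N = i by omega]

end Does

/-! ### Derived expressions and programs -/

namespace Test

/-- Exclusive disjunction. -/
def xor (b c : Test) : Test := disj (conj b (neg c)) (conj (neg b) c)

@[simp] theorem holds_xor (m : Memory) (b c : Test) : (xor b c).Holds m ↔ Xor (b.Holds m) (c.Holds m) := by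
  simp only [xor, Holds, Xor]; tauto

end Test

/-- Expressions whose value is a point. -/
structure PtExp where
  x : RealExp
  y : RealExp

namespace PtExp

/-- The value of an expression. -/
noncomputable def eval (m : Memory) (p : PtExp) : Pt := (p.x.eval m, p.y.eval m)

/-- The point in two registers. -/
def reg (r s : ℕ) : PtExp := ⟨.reg r, .reg s⟩
/-- The point in two arrays. -/
def arr (a b : ℕ) (i : NatExp) : PtExp := ⟨.arr a i, .arr b i⟩
/-- The sum. -/
def add (p q : PtExp) : PtExp := ⟨.add p.x q.x, .add p.y q.y⟩
/-- The difference. -/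
def sub (p q : PtExp) : PtExp := ⟨.sub p.x q.x, .sub p.y q.y⟩
/-- The negative. -/
def neg (p : PtExp) : PtExp := ⟨.sub (.const 0) p.x, .sub (.const 0) p.y⟩
/-- A multiple. -/
def smul (e : RealExp) (p : PtExp) : PtExp := ⟨.mul e p.x, .mul e p.y⟩
/-- The rotation by a right angle. -/
def cw (p : PtExp) : PtExp := ⟨p.y, .sub (.const 0) p.x⟩
/-- The cross product. -/
def _root_.RayCarving.RealExp.cr (p q : PtExp) : RealExp := .sub (.mul p.x q.y) (.mul p.y q.x)
/-- The scalar product. -/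
def _root_.RayCarving.RealExp.dt (p q : PtExp) : RealExp := .add (.mul p.x q.x) (.mul p.y q.y)

variable (m : Memory) (p q : PtExp)

@[simp] theorem eval_mk (x y : RealExp) : (PtExp.mk x y).eval m = (x.eval m, y.eval m) := rfl
@[simp] theorem eval_x : p.x.eval m = (p.eval m).1 := rfl
@[simp] theorem eval_y : p.y.eval m = (p.eval m).2 := rfl
@[simp] theorem eval_reg (r s : ℕ) : (reg r s).eval m = (m.realReg r, m.realReg s) := rfl
@[simp] theorem eval_arr (a b : ℕ) (i : NatExp) :
    (arr a b i).eval m = (m.realArr a (i.eval m), m.realArr b (i.eval m)) := rfl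
@[simp] theorem eval_add : (p.add q).eval m = p.eval m + q.eval m := rfl
@[simp] theorem eval_sub : (p.sub q).eval m = p.eval m - q.eval m := rfl
@[simp] theorem eval_neg : p.neg.eval m = -p.eval m := by ext <;> simp [neg]
@[simp] theorem eval_smul (e : RealExp) : (smul e p).eval m = e.eval m • p.eval m := rfl
@[simp] theorem eval_cw : p.cw.eval m = RayCarving.cw (p.eval m) := by ext <;> simp [cw, RayCarving.cw]
@[simp] theorem eval_cr : (RealExp.cr p q).eval m = RayCarving.cr (p.eval m) (q.eval m) := by
  simp [RealExp.cr, RayCarving.cr]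
@[simp] theorem eval_dt : (RealExp.dt p q).eval m = RayCarving.dt (p.eval m) (q.eval m) := by
  simp [RealExp.dt, RayCarving.dt]

end PtExp

/-- Real expressions with case distinctions. -/
inductive CaseExp : Type where
  | leaf (e : RealExp)
  | ite (b : Test) (e f : CaseExp)

namespace CaseExp

open Classical in
/-- The value. -/
noncomputable def eval (m : Memory) : CaseExp → ℝ
  | leaf e => e.eval m
  | ite b e f => if b.Holds m then e.eval m else f.eval m

attribute [simp] eval

theorem eval_ite {m : Memory} {b : Test} {p : Prop} [Decidable p] (h : b.Holds m ↔ p) (e f : CaseExp) :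
    (ite b e f).eval m = if p then e.eval m else f.eval m := by
  rw [eval]
  by_cases hp : p
  · rw [if_pos (h.2 hp), if_pos hp]
  · rw [if_neg (mt h.1 hp), if_neg hp]

/-- The assignment of the value to a register. -/
def assign (r : ℕ) : CaseExp → Program
  | leaf e => .setRealReg r e
  | ite b e f => .cond b (e.assign r) (f.assign r)

@[simp] theorem exec_assign (r : ℕ) (e : CaseExp) (m : Memory) :
    (e.assign r).exec m = m.setRealReg r (e.eval m) := by
  induction e with
  | leaf e => rfl
  | ite b e f he hf =>
    simp only [assign, Program.exec, he, hf, eval]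
    split_ifs <;> rfl

@[simp] theorem loopFree_assign (r : ℕ) (e : CaseExp) : (e.assign r).loopFree = true := by
  induction e with
  | leaf e => rfl
  | ite b e f he hf => simp [assign, Program.loopFree, he, hf]

end CaseExp

/-- Consecutive execution. -/
def Program.block : List Program → Program
  | [] => .skip
  | [P] => P
  | P :: l => .seq P (block l)

end RayCarving

namespace RayCarving

/-! ## The program: tests and entries -/

/-- The memory contains the edge system, the parities at its vertices, and a length scale. -/
structure Ready (S : EdgeSystem) (T : ℝ) (m : Memory) : Prop where
  k : m.natReg 2 = S.k
  P : ∀ i, (m.realArr 0 i, m.realArr 1 i) = S.P i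
  nx : m.natArr 1 = S.nx
  pv : m.natArr 2 = S.pv
  bit : ∀ i < S.k, m.natArr 3 i = 1 ↔ S.par (S.P i) = 1
  T : m.realReg 0 = T

/-- Whether a program preserves `Ready`. -/
def Program.safe (P : Program) : Bool :=
  !P.writesNatReg 2 && !P.writesRealArr 0 && !P.writesRealArr 1 && !P.writesNatArr 1 && !P.writesNatArr 2 &&
    !P.writesNatArr 3 && !P.writesRealReg 0

theorem Ready.same {S : EdgeSystem} {T : ℝ} {m m' : Memory} (h : Ready S T m) {P : Program} (hs : Same P m m')
    (hP : P.safe = true) : Ready S T m' := by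
  simp only [Program.safe, Bool.and_eq_true, Bool.not_eq_true'] at hP
  obtain ⟨⟨⟨⟨⟨⟨h1, h2⟩, h3⟩, h4⟩, h5⟩, h6⟩, h7⟩ := hP
  constructor
  · rw [hs.natReg _ h1, h.k]
  · intro i; rw [hs.realArr _ h2, hs.realArr _ h3, h.P]
  · rw [hs.natArr _ h4, h.nx]
  · rw [hs.natArr _ h5, h.pv]
  · intro i hi; rw [hs.natArr _ h6, h.bit i hi]
  · rw [hs.realReg _ h7, h.T]

/-- The vertex with the given index. -/
def vtx (i : NatExp) : PtExp := .arr 0 1 i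

theorem Ready.vtx {S : EdgeSystem} {T : ℝ} {m : Memory} (h : Ready S T m) (i : NatExp) :
    (vtx i).eval m = S.P (i.eval m) := h.P _

/-- The zero constant. -/
def rzero : RealExp := .const 0

@[simp] theorem eval_rzero (m : Memory) : rzero.eval m = 0 := by simp [rzero]

namespace Test

/-- The test for positively parallel vectors. -/
def posParallel (g d : PtExp) : Test := conj (realEq (.cr g d) rzero) (realLt rzero (.dt g d))

/-- The test for a change of parity. -/
def turns (g d : PtExp) : Test :=
  disj (conj (realLt rzero g.y) (conj (neg (realLt d.y rzero)) (realLt rzero (.cr g d))))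
    (disj (conj (realLt g.y rzero) (conj (realLt d.y rzero) (realLt (.cr g d) rzero)))
      (conj (realEq g.y rzero) (conj (realLt rzero g.x) (realLt d.y rzero))))

/-- The test whether a direction points into the region. -/
def inCone (i : NatExp) (d : PtExp) : Test :=
  conj (neg (posParallel ((vtx (.arr 1 i)).sub (vtx i)) d))
    (conj (neg (posParallel ((vtx (.arr 2 i)).sub (vtx i)) d))
      (xor (natEq (.arr 3 i) (.const 1))
        (xor (turns ((vtx (.arr 1 i)).sub (vtx i)) d) (turns ((vtx (.arr 2 i)).sub (vtx i)) d))))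

/-- The test for the crossing of an edge with the rightward ray. -/
def crosses (x p q : PtExp) : Test :=
  disj (conj (neg (realLt x.y p.y)) (conj (realLt x.y q.y) (realLt rzero (.cr (q.sub p) (x.sub p)))))
    (conj (neg (realLt x.y q.y)) (conj (realLt x.y p.y) (realLt rzero (.cr (p.sub q) (x.sub q)))))

variable {m : Memory}

@[simp] theorem holds_posParallel (g d : PtExp) :
    (posParallel g d).Holds m ↔ PosParallel (g.eval m) (d.eval m) := by
  simp [posParallel, rzero, PosParallel, dt]

@[simp] theorem holds_turns (g d : PtExp) : (turns g d).Holds m ↔ Turns (g.eval m) (d.eval m) := by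
  simp [turns, rzero, Turns]

@[simp] theorem holds_crosses (x p q : PtExp) :
    (crosses x p q).Holds m ↔ Crosses (x.eval m) (p.eval m) (q.eval m) := by
  simp [crosses, rzero, Crosses, orient, cr]

theorem zmod2_add_eq_one_iff (a b : ZMod 2) : a + b = 1 ↔ Xor (a = 1) (b = 1) := by
  revert a b; decide

theorem holds_inCone {S : EdgeSystem} {T : ℝ} (h : Ready S T m) {i : NatExp} (hi : i.eval m < S.k) (d : PtExp) :
    (inCone i d).Holds m ↔ S.InCone (i.eval m) (d.eval m) := by
  have ht : ∀ g d : Pt, turnBit g d = 1 ↔ Turns g d := by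
    intro g d; unfold turnBit; split_ifs with h <;> simp [h]
  simp only [inCone, Holds, holds_posParallel, holds_xor, holds_turns, PtExp.eval_sub, h.vtx, NatExp.eval, h.nx,
    h.pv, h.bit _ hi, EdgeSystem.InCone, add_assoc, zmod2_add_eq_one_iff, ht]

end Test

/-- The entry in the arrays `8, …, 15` at the given position. -/
def entryAt (m : Memory) (i : ℕ) : Entry where
  d := (m.realArr 8 i, m.realArr 9 i)
  xf := m.realArr 10 i
  xb := m.realArr 11 i
  lf := (m.realArr 12 i, m.realArr 13 i)
  lb := (m.realArr 14 i, m.realArr 15 i)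

/-- The list of entries is stored from position `a` on. -/
def Stored (m : Memory) : ℕ → List Entry → Prop
  | _, [] => True
  | a, e :: l => entryAt m a = e ∧ Stored m (a + 1) l

theorem stored_append {m : Memory} (l l' : List Entry) : ∀ a,
    Stored m a (l ++ l') ↔ Stored m a l ∧ Stored m (a + l.length) l' := by
  induction l with
  | nil => simp [Stored]
  | cons e l ih =>
    intro a
    simp only [List.cons_append, Stored, ih, List.length_cons, and_assoc]
    rw [show a + 1 + l.length = a + (l.length + 1) by omega]

theorem Stored.congr {m m' : Memory} {l : List Entry} : ∀ {a : ℕ}, Stored m a l →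
    (∀ i, a ≤ i → i < a + l.length → entryAt m' i = entryAt m i) → Stored m' a l := by
  induction l with
  | nil => intro _ _ _; trivial
  | cons e l ih =>
    rintro a ⟨h1, h2⟩ h
    refine ⟨(h a le_rfl (by simp)).trans h1, ih h2 fun i hi hi' => h i (by omega) ?_⟩
    simp only [List.length_cons]; omega

/-- A list of entries has been stored at the position in the register `5`, which has been advanced. -/
structure Appends (m m' : Memory) (l : List Entry) : Prop where
  pos : m'.natReg 5 = m.natReg 5 + l.length
  new : Stored m' (m.natReg 5) l
  old : ∀ i < m.natReg 5, entryAt m' i = entryAt m i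

theorem Appends.trans {m m' m'' : Memory} {l l' : List Entry} (h : Appends m m' l) (h' : Appends m' m'' l') :
    Appends m m'' (l ++ l') := by
  refine ⟨?_, ?_, ?_⟩
  · rw [h'.pos, h.pos, List.length_append, add_assoc]
  · rw [stored_append, ← h.pos]
    exact ⟨h.new.congr fun i _ hi => h'.old i (by rw [h.pos]; exact hi), h'.new⟩
  · intro i hi
    rw [h'.old i (by rw [h.pos]; omega), h.old i hi]

theorem Appends.refl {m m' : Memory} (h1 : m'.natReg 5 = m.natReg 5) (h2 : ∀ i, entryAt m' i = entryAt m i) :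
    Appends m m' [] := ⟨by simpa using h1, trivial, fun i _ => h2 i⟩

theorem Appends.of_eq {m m' m'' : Memory} {l : List Entry} (h : Appends m' m'' l) (h1 : m'.natReg 5 = m.natReg 5)
    (h2 : ∀ i, entryAt m' i = entryAt m i) : Appends m m'' l :=
  (Appends.refl h1 h2).trans h

theorem Appends.then_eq {m m' m'' : Memory} {l : List Entry} (h : Appends m m' l) (h1 : m''.natReg 5 = m'.natReg 5)
    (h2 : ∀ i, entryAt m'' i = entryAt m' i) : Appends m m'' l := by
  simpa using h.trans (Appends.refl h1 h2)

/-- Whether a program leaves all entries and the register `5` unchanged. -/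
def Program.quiet (P : Program) : Bool :=
  !P.writesNatReg 5 && !P.writesRealArr 8 && !P.writesRealArr 9 && !P.writesRealArr 10 && !P.writesRealArr 11 &&
    !P.writesRealArr 12 && !P.writesRealArr 13 && !P.writesRealArr 14 && !P.writesRealArr 15

theorem Same.entryAt {m m' : Memory} {P : Program} (h : Same P m m') (hP : P.quiet = true) (i : ℕ) :
    entryAt m' i = entryAt m i := by
  simp only [Program.quiet, Bool.and_eq_true, Bool.not_eq_true'] at hP
  obtain ⟨⟨⟨⟨⟨⟨⟨⟨-, h1⟩, h2⟩, h3⟩, h4⟩, h5⟩, h6⟩, h7⟩, h8⟩ := hP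
  simp only [RayCarving.entryAt, h.realArr _ h1, h.realArr _ h2, h.realArr _ h3, h.realArr _ h4, h.realArr _ h5,
    h.realArr _ h6, h.realArr _ h7, h.realArr _ h8]

theorem Same.appends_nil {m m' : Memory} {P : Program} (h : Same P m m') (hP : P.quiet = true) :
    Appends m m' [] := by
  refine .refl (h.natReg _ ?_) (h.entryAt hP)
  simp only [Program.quiet, Bool.and_eq_true, Bool.not_eq_true'] at hP
  tauto

namespace Program

/-- Append the entry whose components are in the real registers `20, …, 27`. -/
def storeEntry : Program := block [
  setRealArr 8 (.reg 5) (.reg 20), setRealArr 9 (.reg 5) (.reg 21), setRealArr 10 (.reg 5) (.reg 22),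
  setRealArr 11 (.reg 5) (.reg 23), setRealArr 12 (.reg 5) (.reg 24), setRealArr 13 (.reg 5) (.reg 25),
  setRealArr 14 (.reg 5) (.reg 26), setRealArr 15 (.reg 5) (.reg 27),
  setNatReg 5 (.add (.reg 5) (.const 1))]

theorem exec_storeEntry (m : Memory) : Appends m (storeEntry.exec m)
    [⟨(m.realReg 20, m.realReg 21), m.realReg 22, m.realReg 23, (m.realReg 24, m.realReg 25),
      (m.realReg 26, m.realReg 27)⟩] := by
  constructor
  · simp [storeEntry, block, exec]
  · simp [storeEntry, block, exec, Stored, entryAt]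
  · intro i hi
    simp [storeEntry, block, exec, entryAt, hi.ne]

end Program

end RayCarving

namespace RayCarving

/-! ## The program: the envelope of an edge -/

/-- The index of the current edge. -/
def ei : NatExp := .reg 4
/-- The base point of the envelope. -/
def vP : PtExp := vtx (.reg 3)
/-- The first vertex of the current edge, relative to the base point. -/
def eP : PtExp := (vtx ei).sub vP
/-- The second vertex of the current edge, relative to the base point. -/
def eQ : PtExp := (vtx (.arr 1 ei)).sub vP
/-- The vector of the current edge. -/
def eV : PtExp := (vtx (.arr 1 ei)).sub (vtx ei)

/-- The value of `edgeFun`. -/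
def edgeFunE (d : PtExp) : RealExp := .div (.cr d eV) (.cr eP eQ)

/-- The test for an obstruction by the interior of the current edge. -/
def obstructs (d : PtExp) : Test :=
  .conj (.realLt (.mul (.cr d eP) (.cr d eQ)) rzero) (.realLt rzero (edgeFunE d))

/-- The value of `exactVal`. -/
def exactE (d : PtExp) : CaseExp :=
  .ite (obstructs d) (.leaf (edgeFunE d))
    (.ite (.conj (.conj (.realEq (.cr d eP) rzero) (.realLt rzero (.dt d eP))) (.inCone ei d))
      (.leaf (.div (.dt d d) (.dt d eP))) (.leaf rzero))

/-- The first coordinate of `openVec`. -/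
def openXE (d : PtExp) : CaseExp := .ite (obstructs d) (.leaf (.div eV.y (.cr eP eQ))) (.leaf rzero)
/-- The second coordinate of `openVec`. -/
def openYE (d : PtExp) : CaseExp :=
  .ite (obstructs d) (.leaf (.div (PtExp.neg eV).x (.cr eP eQ))) (.leaf rzero)

/-- The memory contains an edge system, with current vertex `v` and current edge `i`, and the previous
direction `p` and the current direction `d`. -/
structure AtEdge (S : EdgeSystem) (T : ℝ) (v i : ℕ) (p d : Pt) (m : Memory) : Prop where
  ready : Ready S T m
  v : m.natReg 3 = v
  i : m.natReg 4 = i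
  p : (m.realReg 1, m.realReg 2) = p
  d : (m.realReg 3, m.realReg 4) = d

namespace AtEdge
variable {S : EdgeSystem} {T : ℝ} {v i : ℕ} {p d : Pt} {m : Memory}

theorem setRealReg {r : ℕ} (hr : 20 ≤ r) (x : ℝ) (h : AtEdge S T v i p d m) : AtEdge S T v i p d (m.setRealReg r x) := by
  have := h.ready
  refine ⟨⟨this.k, this.P, this.nx, this.pv, this.bit, ?_⟩, h.v, h.i, ?_, ?_⟩
  · simp only [Memory.setRealReg_realReg, ← this.T]; rw [if_neg (by omega)]
  · simp only [Memory.setRealReg_realReg, ← h.p]; rw [if_neg (by omega), if_neg (by omega)]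
  · simp only [Memory.setRealReg_realReg, ← h.d]; rw [if_neg (by omega), if_neg (by omega)]

theorem eval_edgeFunE (h : AtEdge S T v i p d m) (c : PtExp) :
    (edgeFunE c).eval m = S.edgeFun (S.P v) i (c.eval m) := by
  simp only [edgeFunE, RealExp.eval, PtExp.eval_cr, eV, eP, eQ, vP, PtExp.eval_sub, h.ready.vtx, ei, NatExp.eval,
    h.v, h.i, h.ready.nx, EdgeSystem.edgeFun]

theorem holds_obstructs (h : AtEdge S T v i p d m) (c : PtExp) :
    (obstructs c).Holds m ↔ S.Separates (S.P v) i (c.eval m) ∧ 0 < S.edgeFun (S.P v) i (c.eval m) := by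
  simp only [obstructs, Test.Holds, h.eval_edgeFunE, RealExp.eval, PtExp.eval_cr, eP, eQ, vP, PtExp.eval_sub,
    h.ready.vtx, ei, NatExp.eval, h.v, h.i, h.ready.nx, rzero, Int.cast_zero, EdgeSystem.Separates]

theorem eval_exactE (h : AtEdge S T v i p d m) (hi : i < S.k) (c : PtExp) :
    (exactE c).eval m = S.exactVal (S.P v) i (c.eval m) := by
  have hc : (Test.inCone ei c).Holds m ↔ S.InCone i (c.eval m) := by
    have := Test.holds_inCone h.ready (i := ei) (by simpa [ei, h.i] using hi) c
    simpa only [ei, NatExp.eval, h.i] using this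
  have hc' : (Test.inCone (.reg 4) c).Holds m ↔ S.InCone i (c.eval m) := hc
  have h2 : (Test.conj (.conj (.realEq (.cr c eP) rzero) (.realLt rzero (.dt c eP))) (.inCone ei c)).Holds m ↔
      (cr (c.eval m) (S.P i - S.P v) = 0 ∧ 0 < dt (c.eval m) (S.P i - S.P v)) ∧ S.InCone i (c.eval m) := by
    simp only [Test.Holds, hc', PtExp.eval_cr, PtExp.eval_dt, eP, vP, PtExp.eval_sub, h.ready.vtx, ei, NatExp.eval,
      h.v, h.i, rzero, RealExp.eval, Int.cast_zero]
  unfold exactE EdgeSystem.exactVal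
  simp only [CaseExp.eval]
  classical
  refine if_congr (h.holds_obstructs c) (h.eval_edgeFunE c) (if_congr h2 ?_ ?_)
  · simp only [RealExp.eval, PtExp.eval_dt, eP, vP, PtExp.eval_sub, h.ready.vtx, ei, NatExp.eval, h.v, h.i]
  · simp [rzero]

theorem eval_openE (h : AtEdge S T v i p d m) (c : PtExp) :
    ((openXE c).eval m, (openYE c).eval m) = S.openVec (S.P v) i (c.eval m) := by
  unfold openXE openYE EdgeSystem.openVec
  by_cases hc : (obstructs c).Holds m
  · rw [if_pos ((h.holds_obstructs c).1 hc)]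
    simp only [CaseExp.eval, if_pos hc]
    simp only [EdgeSystem.edgeVec, RealExp.eval, PtExp.eval_cr, eV, eP, eQ, vP, PtExp.eval_sub, PtExp.eval_x,
      PtExp.eval_y, PtExp.eval_neg, h.ready.vtx, ei, NatExp.eval, h.v, h.i, h.ready.nx, Prod.fst_neg, Prod.snd_sub,
      Prod.fst_sub]
  · rw [if_neg (fun h' => hc ((h.holds_obstructs c).2 h'))]
    simp [CaseExp.eval, if_neg hc, rzero]

end AtEdge

/-- The previous direction. -/
def pE : PtExp := .reg 1 2
/-- The current direction. -/
def dE : PtExp := .reg 3 4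

namespace Program

/-- Append the entry of the current edge for the current direction. -/
def writeEdge : Program := .seq (block [
  setRealReg 20 dE.x, setRealReg 21 dE.y, (exactE dE).assign 22, (exactE dE.neg).assign 23,
  (openXE (pE.add dE)).assign 24, (openYE (pE.add dE)).assign 25,
  (openXE (pE.add dE).neg).assign 26, (openYE (pE.add dE).neg).assign 27]) storeEntry

end Program

/-- `AtEdge` does not mention registers from 20 on, so it survives each of the assignments, and
every expression can be evaluated as in the initial memory. -/
theorem AtEdge.exec_writeEdge {S : EdgeSystem} {T : ℝ} {v i : ℕ} {p d : Pt} {m : Memory}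
    (h : AtEdge S T v i p d m) (hi : i < S.k) :
    Appends m (Program.writeEdge.exec m) [S.edgeEntry (S.P v) i p d] := by
  have ed : ∀ {m}, AtEdge S T v i p d m → dE.eval m = d := fun h => h.d
  have ep : ∀ {m}, AtEdge S T v i p d m → pE.eval m = p := fun h => h.p
  have h1 : ∀ {m}, AtEdge S T v i p d m → (exactE dE).eval m = S.exactVal (S.P v) i d := fun h => by
    rw [h.eval_exactE hi, ed h]
  have h2 : ∀ {m}, AtEdge S T v i p d m → (exactE dE.neg).eval m = S.exactVal (S.P v) i (-d) := fun h => by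
    rw [h.eval_exactE hi, PtExp.eval_neg, ed h]
  have h3 : ∀ {m}, AtEdge S T v i p d m → (openXE (pE.add dE)).eval m = (S.openVec (S.P v) i (p + d)).1 := fun h => by
    rw [← ep h, ← ed h, ← PtExp.eval_add, ← h.eval_openE]
  have h4 : ∀ {m}, AtEdge S T v i p d m → (openYE (pE.add dE)).eval m = (S.openVec (S.P v) i (p + d)).2 := fun h => by
    rw [← ep h, ← ed h, ← PtExp.eval_add, ← h.eval_openE]
  have h5 : ∀ {m}, AtEdge S T v i p d m →
      (openXE (pE.add dE).neg).eval m = (S.openVec (S.P v) i (-(p + d))).1 := fun h => by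
    rw [← ep h, ← ed h, ← PtExp.eval_add, ← PtExp.eval_neg, ← h.eval_openE]
  have h6 : ∀ {m}, AtEdge S T v i p d m →
      (openYE (pE.add dE).neg).eval m = (S.openVec (S.P v) i (-(p + d))).2 := fun h => by
    rw [← ep h, ← ed h, ← PtExp.eval_add, ← PtExp.eval_neg, ← h.eval_openE]
  have c1 := h.setRealReg (r := 20) (by omega) d.1
  have c2 := c1.setRealReg (r := 21) (by omega) d.2
  have c3 := c2.setRealReg (r := 22) (by omega) (S.exactVal (S.P v) i d)
  have c4 := c3.setRealReg (r := 23) (by omega) (S.exactVal (S.P v) i (-d))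
  have c5 := c4.setRealReg (r := 24) (by omega) (S.openVec (S.P v) i (p + d)).1
  have c6 := c5.setRealReg (r := 25) (by omega) (S.openVec (S.P v) i (p + d)).2
  have c7 := c6.setRealReg (r := 26) (by omega) (S.openVec (S.P v) i (-(p + d))).1
  have e1 : dE.x.eval m = d.1 := by rw [PtExp.eval_x, ed h]
  have e2 : dE.y.eval (m.setRealReg 20 d.1) = d.2 := by rw [PtExp.eval_y, ed c1]
  unfold Program.writeEdge
  simp only [Program.exec, Program.block, CaseExp.exec_assign]
  rw [e1, e2, h1 c2, h2 c3, h3 c4, h4 c5, h5 c6, h6 c7]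
  have := Program.exec_storeEntry ((((((((m.setRealReg 20 d.1).setRealReg 21 d.2).setRealReg 22
    (S.exactVal (S.P v) i d)).setRealReg 23 (S.exactVal (S.P v) i (-d))).setRealReg 24
    (S.openVec (S.P v) i (p + d)).1).setRealReg 25 (S.openVec (S.P v) i (p + d)).2).setRealReg 26
    (S.openVec (S.P v) i (-(p + d))).1).setRealReg 27 (S.openVec (S.P v) i (-(p + d))).2)
  simp only [Memory.setRealReg_realReg, Nat.reduceEqDiff, if_true, if_false] at this
  exact this.of_eq rfl fun _ => rfl

namespace Program

/-- Append the entry of the current edge for a direction, if the test holds. -/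
def addDir (b : Test) (c : PtExp) : Program :=
  cond b (.seq (block [setRealReg 3 c.x, setRealReg 4 c.y])
    (.seq writeEdge (block [setRealReg 1 (.reg 3), setRealReg 2 (.reg 4)]))) skip

end Program

theorem writeEdge_loopFree : Program.writeEdge.loopFree = true := by
  simp [Program.writeEdge, Program.loopFree, Program.block, Program.storeEntry]

/-- The memory contains an edge system, with current vertex `v` and current edge `i`, and two candidate
directions `a` and `b`. -/
structure AtDirs (S : EdgeSystem) (T : ℝ) (v i : ℕ) (a b : Pt) (m : Memory) : Prop where
  ready : Ready S T m
  v : m.natReg 3 = v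
  i : m.natReg 4 = i
  a : (m.realReg 9, m.realReg 10) = a
  b : (m.realReg 11, m.realReg 12) = b

theorem AtDirs.same {S : EdgeSystem} {T : ℝ} {v i : ℕ} {a b : Pt} {m m' : Memory} {P : Program}
    (h : AtDirs S T v i a b m) (hs : Same P m m') (h1 : P.safe = true) (h2 : P.writesNatReg 3 = false)
    (h3 : P.writesNatReg 4 = false) (h4 : P.writesRealReg 9 = false) (h5 : P.writesRealReg 10 = false)
    (h6 : P.writesRealReg 11 = false) (h7 : P.writesRealReg 12 = false) : AtDirs S T v i a b m' := by
  refine ⟨h.ready.same hs h1, ?_, ?_, ?_, ?_⟩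
  · rw [hs.natReg _ h2, h.v]
  · rw [hs.natReg _ h3, h.i]
  · rw [hs.realReg _ h4, hs.realReg _ h5, h.a]
  · rw [hs.realReg _ h6, hs.realReg _ h7, h.b]

/-- The hypothesis `hc` concerns the memory after the first assignment, because the second
coordinate is evaluated when register 3 has already been overwritten. -/
theorem exec_addDir {S : EdgeSystem} {T : ℝ} {v i : ℕ} {a b p d : Pt} {m : Memory} (h : AtDirs S T v i a b m)
    (hi : i < S.k) {t : Test} {c : PtExp} (hp : (m.realReg 1, m.realReg 2) = p) (hd : c.eval m = d)
    (hc : c.y.eval (m.setRealReg 3 d.1) = d.2) :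
    open Classical in Appends m ((Program.addDir t c).exec m) (if t.Holds m then [S.edgeEntry (S.P v) i p d] else []) ∧
    AtDirs S T v i a b ((Program.addDir t c).exec m) ∧
    (((Program.addDir t c).exec m).realReg 1, ((Program.addDir t c).exec m).realReg 2) = if t.Holds m then d else p := by
  have hw := writeEdge_loopFree
  have hf : (Program.addDir t c).loopFree = true := by
    simp [Program.addDir, Program.loopFree, Program.block, hw]
  refine ⟨?_, h.same (Program.same_exec hf m) rfl rfl rfl rfl rfl rfl rfl, ?_⟩
  · by_cases ht : t.Holds m
    · rw [if_pos ht, Program.addDir, Program.exec, if_pos ht]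
      have hd1 : c.x.eval m = d.1 := by rw [PtExp.eval_x, hd]
      simp only [Program.exec, Program.block, hd1, hc]
      have hA : AtEdge S T v i p d ((m.setRealReg 3 d.1).setRealReg 4 d.2) := by
        refine ⟨⟨h.ready.k, h.ready.P, h.ready.nx, h.ready.pv, h.ready.bit, ?_⟩, h.v, h.i, ?_, ?_⟩
        · simpa using h.ready.T
        · simpa using hp
        · simp
      have := (hA.exec_writeEdge hi).of_eq (m := m) rfl fun _ => rfl
      exact this.then_eq (by simp) fun _ => by simp [entryAt]
    · rw [if_neg ht, Program.addDir, Program.exec, if_neg ht]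
      exact .refl rfl fun _ => rfl
  · by_cases ht : t.Holds m
    · rw [if_pos ht, Program.addDir, Program.exec, if_pos ht]
      have hd1 : c.x.eval m = d.1 := by rw [PtExp.eval_x, hd]
      have hs := Program.same_exec hw ((m.setRealReg 3 d.1).setRealReg 4 d.2)
      simp only [Program.exec, Program.block, hd1, hc]
      simp [hs.realReg 3 rfl, hs.realReg 4 rfl]
    · rw [if_neg ht, Program.addDir, Program.exec, if_neg ht]
      exact hp

/-- The direction from the base point to a point, as a pair of values. -/
def dirXE (w : PtExp) : CaseExp := .ite (.realEq w.x vP.x) (.leaf rzero) (.leaf (.const 1))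
/-- The second coordinate of `dirTo`. -/
def dirYE (w : PtExp) : CaseExp :=
  .ite (.realEq w.x vP.x) (.leaf (.const 1)) (.leaf (.div (w.sub vP).y (w.sub vP).x))

theorem eval_dirE (m : Memory) (w : PtExp) :
    ((dirXE w).eval m, (dirYE w).eval m) = dirTo (vP.eval m) (w.eval m) := by
  by_cases h : (w.eval m).1 = (vP.eval m).1
  · simp [dirXE, dirYE, dirTo, h, rzero, endDir]
  · simp [dirXE, dirYE, dirTo, h]

namespace Program

/-- Compute the candidate directions of the current edge in order. -/
def sortDirs : Program := .seq (block [
    (dirXE (vtx (.arr 1 ei))).assign 5, (dirYE (vtx (.arr 1 ei))).assign 6,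
    (dirXE (vtx ei)).assign 7, (dirYE (vtx ei)).assign 8])
  (.seq (.cond (.realLt rzero (.cr (.reg 5 6) (.reg 7 8)))
      (block [setRealReg 9 (.reg 5), setRealReg 10 (.reg 6), setRealReg 11 (.reg 7), setRealReg 12 (.reg 8)])
      (block [setRealReg 9 (.reg 7), setRealReg 10 (.reg 8), setRealReg 11 (.reg 5), setRealReg 12 (.reg 6)]))
    (block [setRealReg 1 (.const 0), setRealReg 2 (.const (-1))]))

/-- Append the envelope of the current edge. -/
def writeEdgeList : Program := .seq sortDirs
  (.seq (addDir (.realLt rzero (.cr (.reg 9 10) (.reg 11 12))) (.reg 9 10))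
    (.seq (addDir (.realLt rzero (.reg 11)) (.reg 11 12))
      (addDir (.natEq (.const 0) (.const 0)) ⟨.const 0, .const 1⟩)))

end Program

/-- The candidate directions of an edge in order. -/
noncomputable def EdgeSystem.sortedDirs (S : EdgeSystem) (v : Pt) (i : ℕ) : Pt × Pt :=
  open Classical in
  if 0 < cr (dirTo v (S.P (S.nx i))) (dirTo v (S.P i)) then (dirTo v (S.P (S.nx i)), dirTo v (S.P i))
  else (dirTo v (S.P i), dirTo v (S.P (S.nx i)))

theorem exec_sortDirs {S : EdgeSystem} {T : ℝ} {v i : ℕ} {m : Memory} (h : Ready S T m) (hv : m.natReg 3 = v)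
    (hi : m.natReg 4 = i) :
    AtDirs S T v i (S.sortedDirs (S.P v) i).1 (S.sortedDirs (S.P v) i).2 (Program.sortDirs.exec m) ∧
      ((Program.sortDirs.exec m).realReg 1, (Program.sortDirs.exec m).realReg 2) = startDir := by
  have hs := Program.same_exec (P := Program.sortDirs) (by
    simp [Program.sortDirs, Program.loopFree, Program.block]) m
  have h1 := eval_dirE m (vtx (.arr 1 ei))
  have h2 := eval_dirE m (vtx ei)
  simp only [vP, h.vtx, ei, NatExp.eval, hv, hi, h.nx] at h1 h2
  obtain ⟨h1x, h1y⟩ := Prod.ext_iff.1 h1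
  obtain ⟨h2x, h2y⟩ := Prod.ext_iff.1 h2
  simp only at h1x h1y h2x h2y
  have hreg : ∀ (r : ℕ) (x : ℝ) (m : Memory) (w : NatExp), (∀ m, w.eval (m.setRealReg r x) = w.eval m) →
      (dirXE (vtx w)).eval (m.setRealReg r x) = (dirXE (vtx w)).eval m ∧
      (dirYE (vtx w)).eval (m.setRealReg r x) = (dirYE (vtx w)).eval m := by
    intro r x m w hw
    simp [dirXE, dirYE, vtx, vP, hw, eval_rzero]
  have hx1 := fun r x m => hreg r x m (.arr 1 (.reg 4)) fun m => rfl
  have hx2 := fun r x m => hreg r x m (.reg 4) fun m => rfl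
  refine ⟨⟨h.same hs rfl, ?_, ?_, ?_, ?_⟩, ?_⟩
  · rw [hs.natReg _ rfl, hv]
  · rw [hs.natReg _ rfl, hi]
  all_goals
    simp only [Program.sortDirs, Program.exec, Program.block, CaseExp.exec_assign, ei, hx1, hx2, h1x, h1y, h2x, h2y,
      EdgeSystem.sortedDirs, Test.Holds, PtExp.eval_cr, PtExp.eval_reg, rzero, RealExp.eval]
    simp only [Memory.setRealReg_realReg, Nat.reduceEqDiff, if_true, if_false, Int.cast_zero, Prod.mk.eta]
    try split_ifs
  all_goals simp [startDir]

theorem EdgeSystem.edgeList_eq (S : EdgeSystem) (v : Pt) (i : ℕ) :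
    S.edgeList v i = S.edgeListAux v i (S.sortedDirs v i).1 (S.sortedDirs v i).2 := by
  unfold EdgeSystem.edgeList EdgeSystem.sortedDirs; split_ifs <;> rfl

theorem addDir_loopFree (b : Test) (c : PtExp) : (Program.addDir b c).loopFree = true := by
  simp [Program.addDir, Program.loopFree, Program.block, writeEdge_loopFree]

/-- Three guarded steps produce the four cases of `edgeListAux`: the first direction is skipped if
it coincides with the second, the second if it is vertical, and the vertical direction is always
written. -/
theorem exec_writeEdgeList {S : EdgeSystem} {T : ℝ} {v i : ℕ} {m : Memory} (h : Ready S T m) (hv : m.natReg 3 = v)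
    (hi : m.natReg 4 = i) (hik : i < S.k) :
    Appends m (Program.writeEdgeList.exec m) (S.edgeList (S.P v) i) := by
  classical
  obtain ⟨h1, p1⟩ := exec_sortDirs h hv hi
  have hq := (Program.same_exec (P := Program.sortDirs) (by
    simp [Program.sortDirs, Program.loopFree, Program.block]) m).appends_nil rfl
  rw [S.edgeList_eq]
  unfold Program.writeEdgeList
  simp only [Program.exec]
  generalize Program.sortDirs.exec m = m1 at h1 p1 hq
  generalize (S.sortedDirs (S.P v) i).1 = a at h1
  generalize (S.sortedDirs (S.P v) i).2 = b at h1
  obtain ⟨A2, h2, p2⟩ := exec_addDir h1 hik (t := .realLt rzero (.cr (.reg 9 10) (.reg 11 12))) (c := .reg 9 10)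
    p1 h1.a (by simpa [PtExp.reg] using congrArg Prod.snd h1.a)
  generalize (Program.addDir (.realLt rzero (.cr (.reg 9 10) (.reg 11 12))) (.reg 9 10)).exec m1 = m2 at A2 h2 p2
  obtain ⟨A3, h3, p3⟩ := exec_addDir h2 hik (t := .realLt rzero (.reg 11)) (c := .reg 11 12)
    p2 h2.b (by simpa [PtExp.reg] using congrArg Prod.snd h2.b)
  generalize (Program.addDir (.realLt rzero (.reg 11)) (.reg 11 12)).exec m2 = m3 at A3 h3 p3
  obtain ⟨A4, -, -⟩ := exec_addDir h3 hik (t := .natEq (.const 0) (.const 0)) (c := ⟨.const 0, .const 1⟩) (d := endDir)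
    p3 (by simp [endDir]) (by simp [endDir])
  have e1 : (Test.realLt rzero (.cr (.reg 9 10) (.reg 11 12))).Holds m1 ↔ 0 < cr a b := by
    simp [rzero, h1.a, h1.b]
  have e2 : (Test.realLt rzero (.reg 11)).Holds m2 ↔ 0 < b.1 := by
    simp [rzero, ← h2.b]
  have e3 : (Test.natEq (.const 0) (.const 0)).Holds m3 := rfl
  have := hq.trans (A2.trans (A3.trans A4))
  convert this using 1
  simp only [e1, e2, if_pos e3, EdgeSystem.edgeListAux]
  split_ifs <;> simp

end RayCarving

namespace RayCarving

/-! ## The program: merging envelopes -/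

/-- Components of the entry at the position in the register `r`. -/
def entD (r : ℕ) : PtExp := .arr 8 9 (.reg r)
/-- The forward functional. -/
def entLf (r : ℕ) : PtExp := .arr 12 13 (.reg r)
/-- The backward functional. -/
def entLb (r : ℕ) : PtExp := .arr 14 15 (.reg r)
/-- The forward exact value. -/
def entXf (r : ℕ) : RealExp := .arr 10 (.reg r)
/-- The backward exact value. -/
def entXb (r : ℕ) : RealExp := .arr 11 (.reg r)

section
variable (m : Memory) (r : ℕ)
@[simp] theorem eval_entD : (entD r).eval m = (entryAt m (m.natReg r)).d := rfl
@[simp] theorem eval_entLf : (entLf r).eval m = (entryAt m (m.natReg r)).lf := rfl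
@[simp] theorem eval_entLb : (entLb r).eval m = (entryAt m (m.natReg r)).lb := rfl
@[simp] theorem eval_entXf : (entXf r).eval m = (entryAt m (m.natReg r)).xf := rfl
@[simp] theorem eval_entXb : (entXb r).eval m = (entryAt m (m.natReg r)).xb := rfl
@[simp] theorem entryAt_setRealReg (x : ℝ) : entryAt (m.setRealReg r x) = entryAt m := rfl
@[simp] theorem entryAt_setNatReg (x : ℕ) : entryAt (m.setNatReg r x) = entryAt m := rfl
@[simp] theorem entryAt_setNatArr (i x : ℕ) : entryAt (m.setNatArr r i x) = entryAt m := rfl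
end

/-- The test that decides about `pick`. -/
def pickTest (d n l₁ l₂ : PtExp) : Test :=
  .disj (.realLt (.dt l₁ d) (.dt l₂ d))
    (.conj (.realEq (.dt l₁ d) (.dt l₂ d)) (.realLt (.dt l₁ n) (.dt l₂ n)))

/-- The merged direction. -/
def mD : PtExp := .reg 20 21

/-- The maximum of two registers. -/
def maxE (r s : ℕ) : CaseExp := .ite (.realLt (.reg s) (.reg r)) (.leaf (.reg r)) (.leaf (.reg s))

/-- A choice according to the register `14`. -/
def flagE (f : ℕ) (a b : RealExp) : CaseExp := .ite (.natEq (.reg 14) (.const f)) (.leaf a) (.leaf b)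

@[simp] theorem eval_maxE (m : Memory) (r s : ℕ) : (maxE r s).eval m = max (m.realReg r) (m.realReg s) := by
  classical
  rw [maxE, CaseExp.eval_ite (p := m.realReg s < m.realReg r) Iff.rfl]
  by_cases h : m.realReg s < m.realReg r
  · rw [if_pos h, max_eq_left h.le]; rfl
  · rw [if_neg h, max_eq_right (not_lt.1 h)]; rfl

@[simp] theorem eval_flagE (m : Memory) (f : ℕ) (a b : RealExp) :
    (flagE f a b).eval m = if m.natReg 14 = f then a.eval m else b.eval m :=
  CaseExp.eval_ite (p := m.natReg 14 = f) Iff.rfl _ _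

theorem eval_pickTest (m : Memory) (d n l₁ l₂ : PtExp) :
    ((CaseExp.ite (pickTest d n l₁ l₂) (.leaf l₂.x) (.leaf l₁.x)).eval m,
      (CaseExp.ite (pickTest d n l₁ l₂) (.leaf l₂.y) (.leaf l₁.y)).eval m) =
      pick (d.eval m) (n.eval m) (l₁.eval m) (l₂.eval m) := by
  simp only [CaseExp.eval, pickTest, Test.Holds, PtExp.eval_dt, PtExp.eval_x, PtExp.eval_y, pick]
  split_ifs <;> rfl

namespace Program

/-- Compare the directions of two entries. -/
def compareHeads : Program :=
  cond (.realLt rzero (.cr (entD 12) (entD 10))) (setNatReg 14 (.const 2))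
    (cond (.realLt rzero (.cr (entD 10) (entD 12))) (setNatReg 14 (.const 1)) (setNatReg 14 (.const 0)))

/-- Compute the direction of the merged entry. -/
def mergeD : Program :=
  block [(flagE 2 (entD 12).x (entD 10).x).assign 20, (flagE 2 (entD 12).y (entD 10).y).assign 21]

/-- Compute the forward exact value of the merged entry. -/
def mergeXf : Program := block [
  (flagE 2 (.dt (entLf 10) mD) (entXf 10)).assign 28, (flagE 1 (.dt (entLf 12) mD) (entXf 12)).assign 29,
  (maxE 28 29).assign 22]

/-- Compute the backward exact value of the merged entry. -/
def mergeXb : Program := block [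
  (flagE 2 (.dt (entLb 10) mD.neg) (entXb 10)).assign 28, (flagE 1 (.dt (entLb 12) mD.neg) (entXb 12)).assign 29,
  (maxE 28 29).assign 23]

/-- Compute the forward functional of the merged entry. -/
def mergeLf : Program := block [
  (CaseExp.ite (pickTest mD mD.cw (entLf 10) (entLf 12)) (.leaf (entLf 12).x) (.leaf (entLf 10).x)).assign 24,
  (CaseExp.ite (pickTest mD mD.cw (entLf 10) (entLf 12)) (.leaf (entLf 12).y) (.leaf (entLf 10).y)).assign 25]

/-- Compute the backward functional of the merged entry. -/
def mergeLb : Program := block [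
  (CaseExp.ite (pickTest mD.neg mD.cw.neg (entLb 10) (entLb 12)) (.leaf (entLb 12).x) (.leaf (entLb 10).x)).assign 26,
  (CaseExp.ite (pickTest mD.neg mD.cw.neg (entLb 10) (entLb 12)) (.leaf (entLb 12).y) (.leaf (entLb 10).y)).assign 27]

/-- Compute the components of the merged entry. -/
def mergeHeads : Program := .seq mergeD (.seq mergeXf (.seq mergeXb (.seq mergeLf mergeLb)))

/-- Advance in the lists of entries. -/
def advance : Program :=
  .seq (cond (.natEq (.reg 14) (.const 2)) skip (setNatReg 10 (.add (.reg 10) (.const 1))))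
    (cond (.natEq (.reg 14) (.const 1)) skip (setNatReg 12 (.add (.reg 12) (.const 1))))

/-- A step of the merging of two lists of entries. -/
def mergeStep : Program := .seq compareHeads (.seq mergeHeads (.seq storeEntry advance))

end Program

/-- The outcome of the comparison of two directions. -/
noncomputable def headFlag (d₁ d₂ : Pt) : ℕ :=
  open Classical in if 0 < cr d₂ d₁ then 2 else if 0 < cr d₁ d₂ then 1 else 0

theorem headFlag_eq_two (d₁ d₂ : Pt) : headFlag d₁ d₂ = 2 ↔ 0 < cr d₂ d₁ := by
  unfold headFlag; split_ifs <;> simp [*]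

theorem headFlag_eq_one (d₁ d₂ : Pt) : headFlag d₁ d₂ = 1 ↔ 0 < cr d₁ d₂ := by
  unfold headFlag
  split_ifs with h1 h2
  · rw [cr_swap] at h1
    simp only [OfNat.ofNat_ne_one, false_iff, not_lt]; linarith
  · simp [h2]
  · simp [h2]

theorem exec_compareHeads (m : Memory) : Program.compareHeads.exec m =
    m.setNatReg 14 (headFlag (entryAt m (m.natReg 10)).d (entryAt m (m.natReg 12)).d) := by
  simp only [Program.compareHeads, Program.exec, Test.Holds, PtExp.eval_cr, eval_entD, eval_rzero, headFlag, NatExp.eval]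
  split_ifs <;> rfl

/-- The registers `10` and `12` point to two entries, and their directions have been compared. -/
structure AtHeads (e₁ e₂ : Entry) (m : Memory) : Prop where
  fst : entryAt m (m.natReg 10) = e₁
  snd : entryAt m (m.natReg 12) = e₂
  flag : m.natReg 14 = headFlag e₁.d e₂.d

theorem AtHeads.same {e₁ e₂ : Entry} {m m' : Memory} {P : Program} (h : AtHeads e₁ e₂ m) (hs : Same P m m')
    (h1 : P.quiet = true) (h2 : P.writesNatReg 10 = false) (h3 : P.writesNatReg 12 = false)
    (h4 : P.writesNatReg 14 = false) : AtHeads e₁ e₂ m' := by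
  refine ⟨?_, ?_, ?_⟩
  · rw [hs.entryAt h1, hs.natReg _ h2, h.fst]
  · rw [hs.entryAt h1, hs.natReg _ h3, h.snd]
  · rw [hs.natReg _ h4, h.flag]

theorem loopFree_mergeParts : Program.mergeD.loopFree = true ∧ Program.mergeXf.loopFree = true ∧
    Program.mergeXb.loopFree = true ∧ Program.mergeLf.loopFree = true ∧ Program.mergeLb.loopFree = true := by
  simp [Program.mergeD, Program.mergeXf, Program.mergeXb, Program.mergeLf, Program.mergeLb, Program.block,
    Program.loopFree]

namespace AtHeads
variable {e₁ e₂ : Entry} {m : Memory}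

theorem mergeD (h : AtHeads e₁ e₂ m) : ((Program.mergeD.exec m).realReg 20, (Program.mergeD.exec m).realReg 21) =
    (mergeEntry e₁ e₂).d := by
  classical
  simp only [Program.mergeD, Program.exec, Program.block, CaseExp.exec_assign, eval_flagE, PtExp.eval_x, PtExp.eval_y,
    eval_entD, Memory.setRealReg_realReg, Memory.setRealReg_natReg, entryAt_setRealReg, h.fst, h.snd, h.flag,
    headFlag_eq_two, mergeEntry, Nat.reduceEqDiff, if_true, if_false]
  split_ifs <;> rfl

theorem mergeXf (h : AtHeads e₁ e₂ m) (hd : mD.eval m = (mergeEntry e₁ e₂).d) :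
    (Program.mergeXf.exec m).realReg 22 = (mergeEntry e₁ e₂).xf := by
  classical
  have hd' : ∀ x, mD.eval (m.setRealReg 28 x) = (mergeEntry e₁ e₂).d := by
    intro x; rw [← hd]; simp [mD]
  simp only [Program.mergeXf, Program.exec, Program.block, CaseExp.exec_assign, eval_flagE, eval_maxE,
    eval_entLf, eval_entXf, PtExp.eval_dt, hd, hd', Memory.setRealReg_realReg, Memory.setRealReg_natReg, entryAt_setRealReg,
    h.fst, h.snd, h.flag, headFlag_eq_two, headFlag_eq_one]
  simp [mergeEntry]

theorem mergeXb (h : AtHeads e₁ e₂ m) (hd : mD.eval m = (mergeEntry e₁ e₂).d) :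
    (Program.mergeXb.exec m).realReg 23 = (mergeEntry e₁ e₂).xb := by
  classical
  have hd' : ∀ x, mD.eval (m.setRealReg 28 x) = (mergeEntry e₁ e₂).d := by
    intro x; rw [← hd]; simp [mD]
  simp only [Program.mergeXb, Program.exec, Program.block, CaseExp.exec_assign, eval_flagE, eval_maxE, PtExp.eval_neg,
    eval_entLb, eval_entXb, PtExp.eval_dt, hd, hd', Memory.setRealReg_realReg, Memory.setRealReg_natReg, entryAt_setRealReg,
    h.fst, h.snd, h.flag, headFlag_eq_two, headFlag_eq_one]
  simp [mergeEntry]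

theorem mergeLf (h : AtHeads e₁ e₂ m) (hd : mD.eval m = (mergeEntry e₁ e₂).d) :
    ((Program.mergeLf.exec m).realReg 24, (Program.mergeLf.exec m).realReg 25) = (mergeEntry e₁ e₂).lf := by
  have h1 := eval_pickTest m mD mD.cw (entLf 10) (entLf 12)
  have h2 : ∀ x, (CaseExp.ite (pickTest mD mD.cw (entLf 10) (entLf 12)) (.leaf (entLf 12).y)
      (.leaf (entLf 10).y)).eval (m.setRealReg 24 x) = (CaseExp.ite (pickTest mD mD.cw (entLf 10) (entLf 12))
        (.leaf (entLf 12).y) (.leaf (entLf 10).y)).eval m := fun x => by simp [pickTest, mD]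
  rw [PtExp.eval_cw, hd, eval_entLf, eval_entLf, h.fst, h.snd] at h1
  have h3 : (mergeEntry e₁ e₂).lf = pick (mergeEntry e₁ e₂).d (cw (mergeEntry e₁ e₂).d) e₁.lf e₂.lf := rfl
  rw [h3, ← h1]
  simp only [Program.mergeLf, Program.exec, Program.block, CaseExp.exec_assign, h2, Memory.setRealReg_realReg]
  simp

theorem mergeLb (h : AtHeads e₁ e₂ m) (hd : mD.eval m = (mergeEntry e₁ e₂).d) :
    ((Program.mergeLb.exec m).realReg 26, (Program.mergeLb.exec m).realReg 27) = (mergeEntry e₁ e₂).lb := by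
  have h1 := eval_pickTest m mD.neg mD.cw.neg (entLb 10) (entLb 12)
  have h2 : ∀ x, (CaseExp.ite (pickTest mD.neg mD.cw.neg (entLb 10) (entLb 12)) (.leaf (entLb 12).y)
      (.leaf (entLb 10).y)).eval (m.setRealReg 26 x) = (CaseExp.ite (pickTest mD.neg mD.cw.neg (entLb 10) (entLb 12))
        (.leaf (entLb 12).y) (.leaf (entLb 10).y)).eval m := fun x => by simp [pickTest, mD]
  rw [PtExp.eval_neg, PtExp.eval_neg, PtExp.eval_cw, hd, eval_entLb, eval_entLb, h.fst, h.snd] at h1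
  have h3 : (mergeEntry e₁ e₂).lb = pick (-(mergeEntry e₁ e₂).d) (-cw (mergeEntry e₁ e₂).d) e₁.lb e₂.lb := rfl
  rw [h3, ← h1]
  simp only [Program.mergeLb, Program.exec, Program.block, CaseExp.exec_assign, h2, Memory.setRealReg_realReg]
  simp

theorem mergeHeads (h : AtHeads e₁ e₂ m) :
    (⟨((Program.mergeHeads.exec m).realReg 20, (Program.mergeHeads.exec m).realReg 21),
      (Program.mergeHeads.exec m).realReg 22, (Program.mergeHeads.exec m).realReg 23,
      ((Program.mergeHeads.exec m).realReg 24, (Program.mergeHeads.exec m).realReg 25),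
      ((Program.mergeHeads.exec m).realReg 26, (Program.mergeHeads.exec m).realReg 27)⟩ : Entry) =
    mergeEntry e₁ e₂ := by
  obtain ⟨l1, l2, l3, l4, l5⟩ := loopFree_mergeParts
  simp only [Program.mergeHeads, Program.exec]
  have s1 := Program.same_exec l1 m
  have k1 := h.same s1 rfl rfl rfl rfl
  have d1 := h.mergeD
  generalize Program.mergeD.exec m = m1 at s1 k1 d1
  have s2 := Program.same_exec l2 m1
  have k2 := k1.same s2 rfl rfl rfl rfl
  have x2 := k1.mergeXf d1
  generalize Program.mergeXf.exec m1 = m2 at s2 k2 x2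
  have d2 : mD.eval m2 = (mergeEntry e₁ e₂).d := by
    rw [← d1, mD, PtExp.eval_reg, s2.realReg _ rfl, s2.realReg _ rfl]
  have s3 := Program.same_exec l3 m2
  have k3 := k2.same s3 rfl rfl rfl rfl
  have x3 := k2.mergeXb d2
  generalize Program.mergeXb.exec m2 = m3 at s3 k3 x3
  have d3 : mD.eval m3 = (mergeEntry e₁ e₂).d := by
    rw [← d2, mD, PtExp.eval_reg, PtExp.eval_reg, s3.realReg _ rfl, s3.realReg _ rfl]
  have s4 := Program.same_exec l4 m3
  have k4 := k3.same s4 rfl rfl rfl rfl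
  have x4 := k3.mergeLf d3
  generalize Program.mergeLf.exec m3 = m4 at s4 k4 x4
  have d4 : mD.eval m4 = (mergeEntry e₁ e₂).d := by
    rw [← d3, mD, PtExp.eval_reg, PtExp.eval_reg, s4.realReg _ rfl, s4.realReg _ rfl]
  have s5 := Program.same_exec l5 m4
  have x5 := k4.mergeLb d4
  generalize Program.mergeLb.exec m4 = m5 at s5 x5
  rw [x5, s5.realReg 24 rfl, s5.realReg 25 rfl, x4, s5.realReg 23 rfl, s4.realReg 23 rfl, x3, s5.realReg 22 rfl,
    s4.realReg 22 rfl, s3.realReg 22 rfl, x2, s5.realReg 20 rfl, s5.realReg 21 rfl]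
  rw [mD, PtExp.eval_reg] at d4
  rw [d4]

end AtHeads

theorem loopFree_mergeStep : Program.mergeStep.loopFree = true ∧ Program.compareHeads.loopFree = true ∧
    Program.mergeHeads.loopFree = true ∧ Program.storeEntry.loopFree = true ∧ Program.advance.loopFree = true := by
  obtain ⟨l1, l2, l3, l4, l5⟩ := loopFree_mergeParts
  simp [Program.mergeStep, Program.compareHeads, Program.mergeHeads, Program.storeEntry, Program.advance,
    Program.block, Program.loopFree, l1, l2, l3, l4, l5]

theorem exec_advance (m : Memory) :
    (Program.advance.exec m).natReg 10 = (if m.natReg 14 = 2 then m.natReg 10 else m.natReg 10 + 1) ∧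
    (Program.advance.exec m).natReg 12 = (if m.natReg 14 = 1 then m.natReg 12 else m.natReg 12 + 1) := by
  simp only [Program.advance, Program.exec, Test.Holds, NatExp.eval]
  by_cases h2 : m.natReg 14 = 2
  · simp [h2]
  · by_cases h1 : m.natReg 14 = 1
    · simp [h1]
    · simp [h1, h2]

theorem exec_mergeStep (m : Memory) : 
    Appends m (Program.mergeStep.exec m) [mergeEntry (entryAt m (m.natReg 10)) (entryAt m (m.natReg 12))] ∧
    (Program.mergeStep.exec m).natReg 10 =
      (if headFlag (entryAt m (m.natReg 10)).d (entryAt m (m.natReg 12)).d = 2 then m.natReg 10 else m.natReg 10 + 1) ∧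
    (Program.mergeStep.exec m).natReg 12 =
      (if headFlag (entryAt m (m.natReg 10)).d (entryAt m (m.natReg 12)).d = 1 then m.natReg 12 else m.natReg 12 + 1) := by
  obtain ⟨-, l1, l2, l3, l4⟩ := loopFree_mergeStep
  simp only [Program.mergeStep, Program.exec]
  have s1 := Program.same_exec l1 m
  have q1 := exec_compareHeads m
  generalize Program.compareHeads.exec m = m1 at s1 q1
  have h1 : AtHeads (entryAt m (m.natReg 10)) (entryAt m (m.natReg 12)) m1 := by subst q1; exact ⟨rfl, rfl, by simp⟩
  have s2 := Program.same_exec l2 m1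
  have q2 := h1.mergeHeads
  generalize Program.mergeHeads.exec m1 = m2 at s2 q2
  have s3 := Program.same_exec l3 m2
  have q3 := Program.exec_storeEntry m2
  rw [q2] at q3
  generalize Program.storeEntry.exec m2 = m3 at s3 q3
  have s4 := Program.same_exec l4 m3
  obtain ⟨q4, q4'⟩ := exec_advance m3
  generalize Program.advance.exec m3 = m4 at s4 q4 q4'
  refine ⟨((s1.appends_nil rfl).trans ((s2.appends_nil rfl).trans (q3.trans (s4.appends_nil rfl)))), ?_, ?_⟩
  · rw [q4, s3.natReg _ rfl, s2.natReg _ rfl, h1.flag, s3.natReg _ rfl, s2.natReg _ rfl, s1.natReg _ rfl]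
  · rw [q4', s3.natReg _ rfl, s2.natReg _ rfl, h1.flag, s3.natReg _ rfl, s2.natReg _ rfl, s1.natReg _ rfl]

namespace Program

/-- Merge two lists of entries. -/
def mergeLoop : Program :=
  loop (.conj (.natLt (.reg 10) (.reg 11)) (.natLt (.reg 12) (.reg 13))) mergeStep

end Program

/-- The time needed per step of a merge. -/
def mergeCost : ℕ := Program.mergeStep.bound + 8

/-- The state of a merge that has started with the memory `m₀`. -/
structure Merging (m₀ : Memory) (l : List Entry) (n : ℕ) (m : Memory) : Prop where
  done : ∃ t l₁ l₂, Appends m₀ m t ∧ l = t ++ mergeEnv l₁ l₂ ∧ Stored m (m.natReg 10) l₁ ∧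
    Stored m (m.natReg 12) l₂ ∧ m.natReg 10 + l₁.length = m.natReg 11 ∧ m.natReg 12 + l₂.length = m.natReg 13 ∧
    (l₁.length + l₂.length) * mergeCost ≤ n
  le₁ : m.natReg 11 ≤ m₀.natReg 5
  le₂ : m.natReg 13 ≤ m₀.natReg 5

/-- The invariant is that the entries written so far, followed by the merge of the two remaining
lists, form the result. Each round consumes at least one head, so the remaining lengths measure the
remaining time. The 8 is the cost of the final test. -/
theorem does_mergeLoop {m : Memory} {l₁ l₂ : List Entry} (h1 : Stored m (m.natReg 10) l₁)
    (h2 : Stored m (m.natReg 12) l₂) (h3 : m.natReg 10 + l₁.length = m.natReg 11)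
    (h4 : m.natReg 12 + l₂.length = m.natReg 13) (h5 : m.natReg 11 ≤ m.natReg 5) (h6 : m.natReg 13 ≤ m.natReg 5) :
    Does Program.mergeLoop ((l₁.length + l₂.length) * mergeCost + 8) m fun m' => Appends m m' (mergeEnv l₁ l₂) := by
  refine (Does.loop (Merging m (mergeEnv l₁ l₂)) ?_ _ m
    ⟨⟨[], l₁, l₂, .refl rfl fun _ => rfl, rfl, h1, h2, h3, h4, le_rfl⟩, h5, h6⟩).mono le_rfl ?_
  · rintro n m' ⟨⟨t, k₁, k₂, hA, hl, s1, s2, e1, e2, hn⟩, le1, le2⟩ ⟨b1, b2⟩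
    simp only [Test.Holds, NatExp.eval] at b1 b2
    rcases k₁ with - | ⟨x₁, k₁⟩
    · simp at e1; omega
    rcases k₂ with - | ⟨x₂, k₂⟩
    · simp at e2; omega
    refine ⟨Program.mergeStep.bound, Does.mono (Q := fun m'' => m'' = Program.mergeStep.exec m')
      (Does.exec loopFree_mergeStep.1 rfl) le_rfl ?_⟩
    rintro m'' hs rfl
    obtain ⟨q1, q2, q3⟩ := exec_mergeStep m'
    generalize Program.mergeStep.exec m' = m'' at hs q1 q2 q3
    obtain ⟨s1, s1'⟩ := s1
    obtain ⟨s2, s2'⟩ := s2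
    rw [s1, s2] at q1 q2 q3
    have e11 := hs.natReg 11 rfl
    have e13 := hs.natReg 13 rfl
    have hpos := hA.pos
    -- New entries are written from the position in register 5 on, beyond both lists, which
    -- therefore survive.
    have keep : ∀ (a : ℕ) (k : List Entry), Stored m' a k → a + k.length ≤ m'.natReg 5 → Stored m'' a k := by
      intro a k hk hle
      exact hk.congr fun i _ hi => q1.old i (by omega)
    simp only [List.length_cons] at e1 e2 hn
    rw [mergeEnv] at hl
    simp only [headFlag_eq_one, headFlag_eq_two] at q2 q3
    have hc : (Test.conj (.natLt (.reg 10) (.reg 11)) (.natLt (.reg 12) (.reg 13))).cost + 1 = 8 := rfl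
    have hm : mergeCost = Program.mergeStep.bound + 8 := rfl
    rw [hc]
    by_cases c2 : 0 < cr x₂.d x₁.d
    · have c1 : ¬ 0 < cr x₁.d x₂.d := by rw [cr_swap]; linarith
      rw [if_pos c2] at hl q2
      rw [if_neg c1] at q3
      refine ⟨(k₁.length + 1 + k₂.length) * mergeCost, ?_, ⟨_, x₁ :: k₁, k₂, hA.trans q1, by simpa using hl, ?_, ?_, ?_, ?_, ?_⟩,
        by omega, by omega⟩
      · rw [hm] at hn ⊢; linarith
      · rw [q2]; exact keep _ _ ⟨s1, s1'⟩ (by simp only [List.length_cons]; omega)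
      · rw [q3]; exact keep _ _ s2' (by omega)
      · simp only [List.length_cons]; omega
      · omega
      · simp
    · rw [if_neg c2] at hl q2
      by_cases c1 : 0 < cr x₁.d x₂.d
      · rw [if_pos c1] at hl q3
        refine ⟨(k₁.length + (k₂.length + 1)) * mergeCost, ?_, ⟨_, k₁, x₂ :: k₂, hA.trans q1, by simpa using hl, ?_, ?_, ?_, ?_, ?_⟩,
          by omega, by omega⟩
        · rw [hm] at hn ⊢; linarith
        · rw [q2]; exact keep _ _ s1' (by omega)
        · rw [q3]; exact keep _ _ ⟨s2, s2'⟩ (by simp only [List.length_cons]; omega)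
        · omega
        · simp only [List.length_cons]; omega
        · simp
      · rw [if_neg c1] at hl q3
        refine ⟨(k₁.length + k₂.length) * mergeCost, ?_, ⟨_, k₁, k₂, hA.trans q1, by simpa using hl, ?_, ?_, ?_, ?_, ?_⟩,
          by omega, by omega⟩
        · rw [hm] at hn ⊢; nlinarith
        · rw [q2]; exact keep _ _ s1' (by omega)
        · rw [q3]; exact keep _ _ s2' (by omega)
        · omega
        · omega
        · simp
  · rintro m' - ⟨hb, n', ⟨t, k₁, k₂, hA, hl, s1, s2, e1, e2, hn⟩, le1, le2⟩
    simp only [Test.Holds, NatExp.eval] at hb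
    have : mergeEnv k₁ k₂ = [] := by
      rcases k₁ with - | ⟨x₁, k₁⟩
      · rw [mergeEnv]
      rcases k₂ with - | ⟨x₂, k₂⟩
      · rw [mergeEnv]
      simp only [List.length_cons] at e1 e2
      omega
    rw [hl, this, List.append_nil]
    exact hA

end RayCarving

namespace RayCarving

/-! ## The program: the envelope of all edges -/

namespace EdgeSystem
variable (S : EdgeSystem) (v : Pt)

/-- The envelope of an edge, or the envelope without edges for indices that are too large. -/
noncomputable def baseList (i : ℕ) : List Entry := if i < S.k then S.edgeList v i else emptyList

/-- The envelopes computed by merging repeatedly the first two lists of a queue. -/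
noncomputable def heapList (j : ℕ) : List Entry :=
  if j ≤ S.k ∨ 2 * S.k < j then S.baseList v j
  else mergeEnv (heapList (2 * (j - S.k - 1))) (heapList (2 * (j - S.k - 1) + 1))
termination_by j
decreasing_by all_goals omega

/-- The indices of the edges that contribute to `heapList`. -/
def heapSet (k : ℕ) (j : ℕ) : Set ℕ :=
  if j ≤ k ∨ 2 * k < j then {j} else heapSet k (2 * (j - k - 1)) ∪ heapSet k (2 * (j - k - 1) + 1)
termination_by j
decreasing_by all_goals omega

variable {S v}

theorem heapList_of_le {j : ℕ} (h : j ≤ S.k) : S.heapList v j = S.baseList v j := by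
  rw [heapList, if_pos (Or.inl h)]

theorem heapList_merge {c : ℕ} (h : c < S.k) :
    S.heapList v (S.k + 1 + c) = mergeEnv (S.heapList v (2 * c)) (S.heapList v (2 * c + 1)) := by
  rw [heapList, if_neg (by omega), show S.k + 1 + c - S.k - 1 = c by omega]

theorem heapSet_of_le {k j : ℕ} (h : j ≤ k) : heapSet k j = {j} := by
  rw [heapSet, if_pos (Or.inl h)]

theorem heapSet_merge {k c : ℕ} (h : c < k) :
    heapSet k (k + 1 + c) = heapSet k (2 * c) ∪ heapSet k (2 * c + 1) := by
  rw [heapSet, if_neg (by omega), show k + 1 + c - k - 1 = c by omega]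

theorem baseList_env (i : ℕ) : S.Env v {i} startDir (S.baseList v i) := by
  unfold baseList
  split_ifs with h
  · exact edgeList_env h
  · exact emptyList_env (not_lt.1 h)

theorem length_baseList_le (i : ℕ) : (S.baseList v i).length ≤ 3 := by
  unfold baseList
  split_ifs
  · exact length_edgeList_le i
  · simp [emptyList]

/-- After `c` merges the queue consists of the lists `2 * c` to `k + c`: two lists leave at the
front and their merge is appended as number `k + 1 + c`. The index sets in the queue stay disjoint,
as `Env.merge` requires, and still cover everything up to `k`. -/
theorem heapSet_queue (k : ℕ) : ∀ c ≤ k,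
    (∀ j j', 2 * c ≤ j → j < k + 1 + c → 2 * c ≤ j' → j' < k + 1 + c → j ≠ j' → Disjoint (heapSet k j) (heapSet k j')) ∧
    ∀ i ≤ k, ∃ j, 2 * c ≤ j ∧ j < k + 1 + c ∧ i ∈ heapSet k j := by
  intro c
  induction c with
  | zero =>
    intro _
    refine ⟨fun j j' _ hj _ hj' h => ?_, fun i hi => ⟨i, by omega, by omega, ?_⟩⟩
    · rw [heapSet_of_le (by omega), heapSet_of_le (by omega)]
      simpa using h
    · rw [heapSet_of_le hi]; rfl
  | succ c ih =>
    intro hc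
    obtain ⟨h1, h2⟩ := ih (by omega)
    have hm := heapSet_merge (k := k) (c := c) (by omega)
    have h3 : ∀ j, 2 * (c + 1) ≤ j → j < k + 1 + c → Disjoint (heapSet k (k + 1 + c)) (heapSet k j) := by
      intro j hj hj'
      rw [hm, Set.disjoint_union_left]
      exact ⟨h1 _ _ (by omega) (by omega) (by omega) hj' (by omega), h1 _ _ (by omega) (by omega) (by omega) hj' (by omega)⟩
    constructor
    · intro j j' hj hjk hj' hjk' hne
      by_cases e : j = k + 1 + c
      · subst e; exact h3 j' hj' (by omega)
      · by_cases e' : j' = k + 1 + c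
        · subst e'; exact (h3 j hj (by omega)).symm
        · exact h1 j j' (by omega) (by omega) (by omega) (by omega) hne
    · intro i hi
      obtain ⟨j, hj, hjk, hm'⟩ := h2 i hi
      by_cases e : j < 2 * (c + 1)
      · refine ⟨k + 1 + c, by omega, by omega, ?_⟩
        rw [hm]
        obtain rfl | rfl : j = 2 * c ∨ j = 2 * c + 1 := by omega
        · exact Or.inl hm'
        · exact Or.inr hm'
      · exact ⟨j, by omega, by omega, hm'⟩

theorem heapList_env (j : ℕ) (hj : j ≤ 2 * S.k) : S.Env v (heapSet S.k j) startDir (S.heapList v j) := by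
  induction j using Nat.strong_induction_on with
  | _ j ih =>
    by_cases h : j ≤ S.k
    · rw [heapList_of_le h, heapSet_of_le h]; exact baseList_env j
    · obtain ⟨c, rfl⟩ : ∃ c, j = S.k + 1 + c := ⟨j - (S.k + 1), by omega⟩
      rw [heapList_merge (by omega), heapSet_merge (by omega)]
      exact Env.merge ((heapSet_queue S.k c (by omega)).1 _ _ (by omega) (by omega) (by omega) (by omega) (by omega))
        _ _ _ (ih _ (by omega) (by omega)) (ih _ (by omega) (by omega))

theorem mem_heapSet_last {k i : ℕ} (hi : i ≤ k) : i ∈ heapSet k (2 * k) := by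
  obtain ⟨j, h1, h2, h3⟩ := (heapSet_queue k k le_rfl).2 i hi
  rwa [show 2 * k = j by omega]

/-- The total length of the lists merged is bounded by means of a potential. -/
theorem sum_heapList_le {c : ℕ} (hc : c ≤ S.k) :
    ∑ i ∈ Finset.range c, ((S.heapList v (2 * i)).length + (S.heapList v (2 * i + 1)).length) +
      ∑ j ∈ Finset.Ico (2 * c) (S.k + 1 + c), (S.heapList v j).length * Nat.log 2 (2 * S.k + 1 - j) ≤
    ∑ j ∈ Finset.range (S.k + 1), (S.heapList v j).length * Nat.log 2 (2 * S.k + 1 - j) := by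
  induction c with
  | zero => rw [Finset.sum_range_zero, zero_add, mul_zero, add_zero, Finset.range_eq_Ico]
  | succ c ih =>
    refine le_trans ?_ (ih (by omega))
    rw [Finset.sum_range_succ, Finset.sum_eq_sum_Ico_succ_bot (show 2 * c < S.k + 1 + c by omega),
      Finset.sum_eq_sum_Ico_succ_bot (show 2 * c + 1 < S.k + 1 + c by omega), ← add_assoc (S.k + 1) c 1,
      Finset.sum_Ico_succ_top (show 2 * (c + 1) ≤ S.k + 1 + c by omega), show 2 * c + 1 + 1 = 2 * (c + 1) by ring]
    -- The weight of list `j` is the logarithm of the number of lists from `j` to `2 * k`. For the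
    -- two lists at the front this number is `2 * g + 3` and `2 * g + 2`, for their merge it is `g +
    -- 1`. So the logarithm drops by exactly 1, which pays for the merge.
    obtain ⟨g, hg⟩ : ∃ g, S.k = c + g + 1 := ⟨S.k - c - 1, by omega⟩
    have l1 : Nat.log 2 (2 * S.k + 1 - 2 * c) = Nat.log 2 (g + 1) + 1 := by
      rw [show 2 * S.k + 1 - 2 * c = 2 * g + 3 by omega, Nat.log_of_one_lt_of_le (by norm_num) (by omega),
        show (2 * g + 3) / 2 = g + 1 by omega]
    have l2 : Nat.log 2 (2 * S.k + 1 - (2 * c + 1)) = Nat.log 2 (g + 1) + 1 := by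
      rw [show 2 * S.k + 1 - (2 * c + 1) = 2 * g + 2 by omega, Nat.log_of_one_lt_of_le (by norm_num) (by omega),
        show (2 * g + 2) / 2 = g + 1 by omega]
    have l3 : 2 * S.k + 1 - (S.k + 1 + c) = g + 1 := by omega
    have hlen : (S.heapList v (S.k + 1 + c)).length ≤ (S.heapList v (2 * c)).length + (S.heapList v (2 * c + 1)).length := by
      rw [heapList_merge (by omega)]; exact length_mergeEnv_le _ _
    rw [l1, l2, l3]
    have := Nat.mul_le_mul_right (Nat.log 2 (g + 1)) hlen
    linarith

/-- The initial potential bounds the total work: `k + 1` lists of at most three entries, each with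
weight at most the logarithm of `2 * k + 1`. -/
theorem sum_length_heapList_le : ∑ i ∈ Finset.range S.k, ((S.heapList v (2 * i)).length + (S.heapList v (2 * i + 1)).length) ≤
    3 * (S.k + 1) * Nat.log 2 (2 * S.k + 1) := by
  refine le_trans (Nat.le_add_right _ _) ((sum_heapList_le (v := v) le_rfl).trans ?_)
  calc _ ≤ ∑ j ∈ Finset.range (S.k + 1), 3 * Nat.log 2 (2 * S.k + 1) := by
        refine Finset.sum_le_sum fun j hj => ?_
        rw [Finset.mem_range] at hj
        rw [heapList_of_le (by omega)]
        exact Nat.mul_le_mul (length_baseList_le j) (Nat.log_mono_right (by omega))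
    _ = _ := by rw [Finset.sum_const, Finset.card_range, smul_eq_mul]; ring

/-- A merge does not increase the total length, so the initial bound persists up to the last list.
-/
theorem length_queue_le {c : ℕ} (hc : c ≤ S.k) :
    ∑ j ∈ Finset.Ico (2 * c) (S.k + 1 + c), (S.heapList v j).length ≤ 3 * (S.k + 1) := by
  induction c with
  | zero =>
    calc _ ≤ ∑ j ∈ Finset.Ico 0 (S.k + 1), 3 := by
          refine Finset.sum_le_sum fun j hj => ?_
          rw [Finset.mem_Ico] at hj
          rw [heapList_of_le (by omega)]
          exact length_baseList_le j
      _ = _ := by simp; ring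
  | succ c ih =>
    refine le_trans ?_ (ih (by omega))
    rw [Finset.sum_eq_sum_Ico_succ_bot (show 2 * c < S.k + 1 + c by omega),
      Finset.sum_eq_sum_Ico_succ_bot (show 2 * c + 1 < S.k + 1 + c by omega), ← add_assoc (S.k + 1) c 1,
      Finset.sum_Ico_succ_top (show 2 * (c + 1) ≤ S.k + 1 + c by omega), show 2 * c + 1 + 1 = 2 * (c + 1) by ring]
    have hlen : (S.heapList v (S.k + 1 + c)).length ≤ (S.heapList v (2 * c)).length + (S.heapList v (2 * c + 1)).length := by
      rw [heapList_merge (by omega)]; exact length_mergeEnv_le _ _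
    linarith

theorem length_heapList_last_le : (S.heapList v (2 * S.k)).length ≤ 3 * (S.k + 1) := by
  have := length_queue_le (v := v) (c := S.k) le_rfl
  rwa [show S.k + 1 + S.k = 2 * S.k + 1 by ring, Finset.sum_eq_sum_Ico_succ_bot (by omega), Finset.Ico_self,
    Finset.sum_empty, add_zero] at this

end EdgeSystem

/-- Consecutive lists of entries with their offsets in the array `4`; their number is in the register `7`. -/
structure Queue (f : ℕ → List Entry) (n : ℕ) (m : Memory) : Prop where
  num : m.natReg 7 = n
  pos : m.natReg 5 = m.natArr 4 n
  next : ∀ j < n, m.natArr 4 (j + 1) = m.natArr 4 j + (f j).length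
  stored : ∀ j < n, Stored m (m.natArr 4 j) (f j)

theorem Queue.le {f : ℕ → List Entry} {n : ℕ} {m : Memory} (h : Queue f n m) {j : ℕ} (hj : j ≤ n) :
    m.natArr 4 j ≤ m.natReg 5 := by
  induction hj using Nat.decreasingInduction with
  | self => exact h.pos.ge
  | of_succ j hj ih => exact (by rw [h.next j hj]; omega : _ ≤ m.natArr 4 (j + 1)).trans ih

theorem Queue.same {f : ℕ → List Entry} {n : ℕ} {m m' : Memory} {P : Program} (h : Queue f n m) (hs : Same P m m')
    (h1 : P.quiet = true) (h2 : P.writesNatReg 7 = false) (h3 : P.writesNatArr 4 = false) : Queue f n m' := by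
  have h5 : m'.natReg 5 = m.natReg 5 := (hs.appends_nil h1).pos
  refine ⟨?_, ?_, ?_, ?_⟩
  · rw [hs.natReg _ h2, h.num]
  · rw [h5, hs.natArr _ h3, h.pos]
  · rw [hs.natArr _ h3]; exact h.next
  · rw [hs.natArr _ h3]; exact fun j hj => (h.stored j hj).congr fun i _ _ => hs.entryAt h1 i

namespace Program

/-- Record the end of a list of entries. -/
def pushOffset : Program :=
  .seq (setNatReg 7 (.add (.reg 7) (.const 1))) (setNatArr 4 (.reg 7) (.reg 5))

end Program

theorem Queue.push {f : ℕ → List Entry} {n : ℕ} {m m' : Memory} (h : Queue f n m) (hA : Appends m m' (f n))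
    (h7 : m'.natReg 7 = m.natReg 7) (h4 : m'.natArr 4 = m.natArr 4) :
    Queue f (n + 1) (Program.pushOffset.exec m') := by
  have e7 : m'.natReg 7 = n := h7.trans h.num
  have hoff : ∀ j, (Program.pushOffset.exec m').natArr 4 j = if j = n + 1 then m'.natReg 5 else m.natArr 4 j := by
    intro j
    simp [Program.pushOffset, Program.exec, e7, h4]
  have hent : ∀ i, entryAt (Program.pushOffset.exec m') i = entryAt m' i := fun i => rfl
  have h5 : (Program.pushOffset.exec m').natReg 5 = m'.natReg 5 := by simp [Program.pushOffset, Program.exec]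
  constructor
  · simp [Program.pushOffset, Program.exec, e7]
  · rw [h5, hoff, if_pos rfl]
  · intro j hj
    rw [hoff, hoff, if_neg (show j ≠ n + 1 by omega)]
    rcases Nat.lt_succ_iff_lt_or_eq.1 hj with hj | rfl
    · rw [if_neg (by omega), h.next j hj]
    · rw [if_pos rfl, hA.pos, h.pos]
  · intro j hj
    rw [hoff, if_neg (show j ≠ n + 1 by omega)]
    rcases Nat.lt_succ_iff_lt_or_eq.1 hj with hj | rfl
    · refine (h.stored j hj).congr fun i _ hi => ?_
      rw [hent, hA.old]
      have := h.le (j := j + 1) hj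
      rw [h.next j hj] at this
      omega
    · rw [← h.pos]
      exact hA.new.congr fun i _ _ => hent i

end RayCarving

/-! ### Running the queue of envelopes on the machine -/

namespace RayCarving

namespace Program

/-- Append the envelope without edges. -/
def writeEmptyList : Program :=
  .seq (block [setRealReg 20 (.const 1), setRealReg 21 (.const 0), setRealReg 22 (.const 0), setRealReg 23 (.const 0),
    setRealReg 24 (.const 0), setRealReg 25 (.const 0), setRealReg 26 (.const 0), setRealReg 27 (.const 0)])
  (.seq storeEntry (.seq (block [setRealReg 20 (.const 0), setRealReg 21 (.const 1)]) storeEntry))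

/-- Append the list of the current edge. -/
def writeBaseList : Program := cond (.natLt (.reg 4) (.reg 2)) writeEdgeList writeEmptyList

/-- Append the list of the current edge, and proceed to the next one. -/
def baseStep : Program :=
  .seq writeBaseList (.seq pushOffset (setNatReg 4 (.add (.reg 4) (.const 1))))

/-- Set up the queue. -/
def baseInit : Program := block [setNatReg 5 (.const 0), setNatReg 7 (.const 0), setNatArr 4 (.const 0) (.const 0),
  setNatReg 4 (.const 0), setNatReg 6 (.add (.reg 2) (.const 1))]

/-- Fill the queue with the lists of single edges. -/
def baseAll : Program := .seq baseInit (loop (.natLt (.reg 4) (.reg 6)) baseStep)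

/-- Find the two lists at the front of the queue. -/
def mergeInit : Program := block [
  setNatReg 10 (.arr 4 (.add (.reg 8) (.reg 8))),
  setNatReg 11 (.arr 4 (.add (.add (.reg 8) (.reg 8)) (.const 1))),
  setNatReg 12 (.arr 4 (.add (.add (.reg 8) (.reg 8)) (.const 1))),
  setNatReg 13 (.arr 4 (.add (.add (.reg 8) (.reg 8)) (.const 2)))]

/-- Merge the two lists at the front of the queue. -/
def mergePair : Program :=
  .seq mergeInit (.seq mergeLoop (.seq pushOffset (setNatReg 8 (.add (.reg 8) (.const 1)))))

/-- Merge all lists in the queue. -/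
def mergeAll : Program := .seq (setNatReg 8 (.const 0)) (loop (.natLt (.reg 8) (.reg 2)) mergePair)

end Program

theorem exec_writeEmptyList (m : Memory) : Appends m (Program.writeEmptyList.exec m) EdgeSystem.emptyList := by
  obtain ⟨-, -, -, l3, -⟩ := loopFree_mergeStep
  simp only [Program.writeEmptyList, Program.exec, Program.block, RealExp.eval]
  generalize hm1 : (((((((m.setRealReg 20 _).setRealReg 21 _).setRealReg 22 _).setRealReg 23 _).setRealReg
    24 _).setRealReg 25 _).setRealReg 26 _).setRealReg 27 _ = m1
  have a1 : Appends m m1 [] := by rw [← hm1]; exact .refl rfl fun _ => rfl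
  have s2 := Program.same_exec l3 m1
  have a2 := Program.exec_storeEntry m1
  generalize Program.storeEntry.exec m1 = m2 at s2 a2
  have a3 := (Program.exec_storeEntry ((m2.setRealReg 20 0).setRealReg 21 1)).of_eq (m := m2) rfl fun _ => rfl
  simp only [Memory.setRealReg_realReg, Nat.reduceEqDiff, if_true, if_false, s2.realReg 22 rfl, s2.realReg 23 rfl,
    s2.realReg 24 rfl, s2.realReg 25 rfl, s2.realReg 26 rfl, s2.realReg 27 rfl] at a3
  have := a1.trans (a2.trans a3)
  rw [← hm1] at this
  simp only [Memory.setRealReg_realReg, Nat.reduceEqDiff, if_true, if_false, Int.cast_zero, Int.cast_one] at this ⊢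
  have e : EdgeSystem.emptyList = [] ++ ([⟨(1, 0), 0, 0, (0, 0), (0, 0)⟩] ++ [⟨(0, 1), 0, 0, (0, 0), (0, 0)⟩]) := rfl
  rw [e]
  exact this

theorem loopFree_baseStep : Program.baseStep.loopFree = true ∧ Program.writeBaseList.loopFree = true ∧
    Program.writeEdgeList.loopFree = true ∧ Program.writeEmptyList.loopFree = true := by
  obtain ⟨-, -, -, l3, -⟩ := loopFree_mergeStep
  simp [Program.baseStep, Program.writeBaseList, Program.writeEdgeList, Program.writeEmptyList, Program.sortDirs,
    Program.pushOffset, Program.block, Program.loopFree, l3, addDir_loopFree]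

/-- The memory contains an edge system and the index of the current vertex. -/
structure AtVertex (S : EdgeSystem) (T : ℝ) (v : ℕ) (m : Memory) : Prop where
  ready : Ready S T m
  v : m.natReg 3 = v

theorem AtVertex.same {S : EdgeSystem} {T : ℝ} {v : ℕ} {m m' : Memory} {P : Program}
    (h : AtVertex S T v m) (hs : Same P m m') (h1 : P.safe = true) (h2 : P.writesNatReg 3 = false) :
    AtVertex S T v m' := ⟨h.ready.same hs h1, (hs.natReg _ h2).trans h.v⟩

section
variable {S : EdgeSystem} {T : ℝ} {v : ℕ} {m : Memory}

theorem exec_writeBaseList (h : AtVertex S T v m) {i : ℕ} (hi : m.natReg 4 = i) :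
    Appends m (Program.writeBaseList.exec m) (S.baseList (S.P v) i) := by
  rw [Program.writeBaseList, Program.exec, EdgeSystem.baseList]
  simp only [Test.Holds, NatExp.eval, hi, h.ready.k]
  by_cases hik : i < S.k
  · rw [if_pos hik, if_pos hik]
    exact exec_writeEdgeList h.ready h.v hi hik
  · rw [if_neg hik, if_neg hik]
    exact exec_writeEmptyList m

theorem exec_baseStep (h : AtVertex S T v m) {i : ℕ} (hi : m.natReg 4 = i) (hik : i ≤ S.k)
    (hq : Queue (S.heapList (S.P v)) i m) :
    Queue (S.heapList (S.P v)) (i + 1) (Program.baseStep.exec m) ∧ (Program.baseStep.exec m).natReg 4 = i + 1 := by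
  have s1 := Program.same_exec loopFree_baseStep.2.1 m
  have a1 := exec_writeBaseList h hi
  rw [Program.baseStep, Program.exec, Program.exec]
  generalize Program.writeBaseList.exec m = m1 at s1 a1
  rw [← EdgeSystem.heapList_of_le hik] at a1
  have q := hq.push a1 (s1.natReg _ rfl) (s1.natArr _ rfl)
  have e4 : m1.natReg 4 = i := (s1.natReg _ rfl).trans hi
  exact ⟨q.same (Program.same_exec rfl _) rfl rfl rfl, by simp [Program.exec, Program.pushOffset, e4]⟩

/-- The time needed to fill the queue. -/
def baseTime (k : ℕ) : ℕ := Program.baseInit.bound + ((k + 1) * (Program.baseStep.bound + 4) + 4)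

theorem does_baseAll (h : AtVertex S T v m) :
    Does Program.baseAll (baseTime S.k) m fun m' => Queue (S.heapList (S.P v)) (S.k + 1) m' := by
  have lf : Program.baseInit.loopFree = true := rfl
  refine Does.seq (Does.exec lf ?_)
  have s0 := Program.same_exec lf m
  have h' := h.same s0 rfl rfl
  have key := Does.count (P := Program.baseStep) 4 6 (fun _ => Program.baseStep.bound)
    (fun i m => AtVertex S T v m ∧ m.natReg 4 = i ∧ m.natReg 6 = S.k + 1 ∧ Queue (S.heapList (S.P v)) i m) (S.k + 1)
    (fun i m hI => ⟨hI.2.1, hI.2.2.1⟩) ?_ (m := Program.baseInit.exec m) ?_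
  · refine key.mono ?_ fun m' _ hm' => hm'.2.2.2
    rw [Finset.sum_const, Finset.card_range, smul_eq_mul]
  · rintro i m hi ⟨h1, h2, h3, h4⟩
    refine Does.exec loopFree_baseStep.1 ?_
    obtain ⟨q1, q2⟩ := exec_baseStep h1 h2 (by omega) h4
    have s := Program.same_exec loopFree_baseStep.1 m
    exact ⟨h1.same s rfl rfl, q2, (s.natReg _ rfl).trans h3, q1⟩
  · refine ⟨h', ?_, ?_, ?_, ?_, fun j hj => absurd hj (by omega), fun j hj => absurd hj (by omega)⟩
    all_goals simp [Program.baseInit, Program.exec, Program.block, h.ready.k]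

/-- The time needed to merge two lists, apart from the time that depends on their lengths. -/
def pairCost : ℕ := Program.mergeInit.bound + (8 + (Program.pushOffset.bound + 4))

theorem does_mergePair {f : ℕ → List Entry} {k c : ℕ} (hc : c < k) (h8 : m.natReg 8 = c)
    (hq : Queue f (k + 1 + c) m) (hf : f (k + 1 + c) = mergeEnv (f (2 * c)) (f (2 * c + 1))) :
    Does Program.mergePair (((f (2 * c)).length + (f (2 * c + 1)).length) * mergeCost + pairCost) m fun m' =>
      Queue f (k + 1 + (c + 1)) m' ∧ m'.natReg 8 = c + 1 := by
  have lf : Program.mergeInit.loopFree = true := rfl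
  have s0 := Program.same_exec lf m
  have e10 : (Program.mergeInit.exec m).natReg 10 = m.natArr 4 (2 * c) := by
    simp [Program.mergeInit, Program.exec, Program.block, h8, two_mul]
  have e11 : (Program.mergeInit.exec m).natReg 11 = m.natArr 4 (2 * c + 1) := by
    simp [Program.mergeInit, Program.exec, Program.block, h8, two_mul]
  have e12 : (Program.mergeInit.exec m).natReg 12 = m.natArr 4 (2 * c + 1) := by
    simp [Program.mergeInit, Program.exec, Program.block, h8, two_mul]
  have e13 : (Program.mergeInit.exec m).natReg 13 = m.natArr 4 (2 * c + 1 + 1) := by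
    simp [Program.mergeInit, Program.exec, Program.block, h8, two_mul]
  have n1 := hq.next (2 * c) (by omega)
  have n2 := hq.next (2 * c + 1) (by omega)
  have key : Does Program.mergePair (Program.mergeInit.bound + ((((f (2 * c)).length + (f (2 * c + 1)).length) * mergeCost + 8)
      + (Program.pushOffset.bound + 4))) m fun m' => Queue f (k + 1 + (c + 1)) m' ∧ m'.natReg 8 = c + 1 := by
    refine Does.seq (Does.exec lf (Does.seq ?_))
    have a0 := s0.appends_nil rfl
    have ent := s0.entryAt rfl
    have e5 := s0.natReg 5 rfl
    have e7 := s0.natReg 7 rfl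
    have e4 := s0.natArr 4 rfl
    have e8 := (s0.natReg 8 rfl).trans h8
    generalize Program.mergeInit.exec m = m1 at *
    refine (does_mergeLoop (m := m1) (l₁ := f (2 * c)) (l₂ := f (2 * c + 1)) ?_ ?_ ?_ ?_ ?_ ?_).mono le_rfl ?_
    · rw [e10]; exact (hq.stored _ (by omega)).congr fun i _ _ => ent i
    · rw [e12]; exact (hq.stored _ (by omega)).congr fun i _ _ => ent i
    · rw [e10, e11, n1]
    · rw [e12, e13, n2]
    · rw [e11, e5]; exact hq.le (by omega)
    · rw [e13, e5]; exact hq.le (by omega)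
    · intro m2 s2 a2
      have q := hq.push (m' := m2) (by rw [hf]; simpa using a0.trans a2) ((s2.natReg _ rfl).trans e7)
        ((s2.natArr _ rfl).trans e4)
      refine Does.mono (n := (Program.seq Program.pushOffset (.setNatReg 8 (.add (.reg 8) (.const 1)))).bound)
        (Does.exec rfl ?_) le_rfl fun m' _ h => h
      have e8' := (s2.natReg 8 rfl).trans e8
      rw [Program.exec]
      exact ⟨q.same (Program.same_exec rfl _) rfl rfl rfl, by simp [Program.exec, Program.pushOffset, e8']⟩
  refine key.mono ?_ fun _ _ h => h
  unfold pairCost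
  omega

/-- The time needed to merge all lists. -/
def mergeTime (k : ℕ) : ℕ := 2 + (3 * (k + 1) * Nat.log 2 (2 * k + 1) * mergeCost + k * (pairCost + 4) + 4)

/-- The rounds take different times; only their sum is bounded, by `sum_length_heapList_le`. -/
theorem does_mergeAll {v : Pt} (hk : m.natReg 2 = S.k) (hq : Queue (S.heapList v) (S.k + 1) m) :
    Does Program.mergeAll (mergeTime S.k) m fun m' => Queue (S.heapList v) (2 * S.k + 1) m' := by
  refine Does.seq (Does.exec rfl ?_)
  have key := Does.count (P := Program.mergePair) 8 2
    (fun c => ((S.heapList v (2 * c)).length + (S.heapList v (2 * c + 1)).length) * mergeCost + pairCost)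
    (fun c m => m.natReg 8 = c ∧ m.natReg 2 = S.k ∧ Queue (S.heapList v) (S.k + 1 + c) m) S.k
    (fun i m hI => ⟨hI.1, hI.2.1⟩) ?_ (m := m.setNatReg 8 0) ?_
  · refine key.mono ?_ fun m' _ hm' => ?_
    · have := Nat.mul_le_mul_right mergeCost (S.sum_length_heapList_le (v := v))
      simp only [add_assoc]
      rw [Finset.sum_add_distrib, ← Finset.sum_mul, Finset.sum_const, Finset.card_range, smul_eq_mul]
      omega
    · have := hm'.2.2
      rwa [show S.k + 1 + S.k = 2 * S.k + 1 by ring] at this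
  · rintro c m hc ⟨h1, h2, h3⟩
    exact (does_mergePair hc h1 h3 (EdgeSystem.heapList_merge hc)).mono le_rfl fun m' s hm' =>
      ⟨hm'.2, (s.natReg _ rfl).trans h2, hm'.1⟩
  · exact ⟨by simp, by simpa using hk, hq.same (Program.same_exec (P := .setNatReg 8 (.const 0)) rfl m) rfl rfl rfl⟩

end

end RayCarving

namespace RayCarving

/-! ## The program: output -/

namespace Program

/-- Output a sweep with source in the registers `20`, `21`, target in the registers `22`, `23`. -/
def pushSweep : Program := block [
  setRealArr 2 (.reg 1) (.reg 20), setRealArr 3 (.reg 1) (.reg 21), setRealArr 4 (.reg 1) (.reg 22),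
  setRealArr 5 (.reg 1) (.reg 23), setRealArr 6 (.reg 1) (.reg 24), setRealArr 7 (.reg 1) (.reg 25),
  setNatReg 1 (.add (.reg 1) (.const 1))]

/-- If the test holds, output the sweep of the rays through the current vertex that start at multiples of the
given directions. -/
def emit (b : Test) (p g : PtExp) (α β : CaseExp) : Program :=
  cond b (.seq (block [α.assign 30, β.assign 31,
    setRealReg 20 (vP.sub (.smul (.reg 30) p)).x, setRealReg 21 (vP.sub (.smul (.reg 30) p)).y,
    setRealReg 22 (vP.sub (.smul (.reg 31) g)).x, setRealReg 23 (vP.sub (.smul (.reg 31) g)).y,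
    setRealReg 24 vP.x, setRealReg 25 vP.y]) pushSweep) skip

end Program

theorem outputSweeps_pushSweep (m : Memory) : outputSweeps (Program.pushSweep.exec m) = outputSweeps m ++
    [⟨(m.realReg 20, m.realReg 21), (m.realReg 22, m.realReg 23), (m.realReg 24, m.realReg 25)⟩] := by
  have h1 : (Program.pushSweep.exec m).natReg 1 = m.natReg 1 + 1 := by
    simp [Program.pushSweep, Program.block, Program.exec]
  rw [outputSweeps, h1, List.range_succ, List.map_append, outputSweeps]
  congr 1
  · refine List.map_congr_left fun i hi => ?_
    have hi' := (List.mem_range.1 hi).ne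
    simp [Program.pushSweep, Program.block, Program.exec, hi']
  · simp [Program.pushSweep, Program.block, Program.exec]

/-- Whether a program leaves the output unchanged. -/
def Program.silent (P : Program) : Bool :=
  !P.writesNatReg 1 && !P.writesRealArr 2 && !P.writesRealArr 3 && !P.writesRealArr 4 && !P.writesRealArr 5 &&
    !P.writesRealArr 6 && !P.writesRealArr 7

theorem Same.outputSweeps {m m' : Memory} {P : Program} (h : Same P m m') (hP : P.silent = true) :
    outputSweeps m' = outputSweeps m := by
  simp only [Program.silent, Bool.and_eq_true, Bool.not_eq_true'] at hP
  obtain ⟨⟨⟨⟨⟨⟨h0, h1⟩, h2⟩, h3⟩, h4⟩, h5⟩, h6⟩ := hP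
  simp only [RayCarving.outputSweeps, h.natReg _ h0, h.realArr _ h1, h.realArr _ h2, h.realArr _ h3, h.realArr _ h4,
    h.realArr _ h5, h.realArr _ h6]

namespace CaseExp
variable (e : CaseExp) (r s : ℕ)

@[simp] theorem writesNatReg_assign : (e.assign r).writesNatReg s = false := by
  induction e <;> simp [assign, Program.writesNatReg, *]
@[simp] theorem writesRealReg_assign : (e.assign r).writesRealReg s = (r == s) := by
  induction e <;> simp [assign, Program.writesRealReg, *]
@[simp] theorem writesNatArr_assign : (e.assign r).writesNatArr s = false := by
  induction e <;> simp [assign, Program.writesNatArr, *]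
@[simp] theorem writesRealArr_assign : (e.assign r).writesRealArr s = false := by
  induction e <;> simp [assign, Program.writesRealArr, *]

end CaseExp

/-- The memory contains an edge system, the index of the current vertex, the previous direction and the
current entry. -/
structure AtEntry (S : EdgeSystem) (T : ℝ) (v : ℕ) (p : Pt) (e : Entry) (m : Memory) : Prop where
  ready : Ready S T m
  v : m.natReg 3 = v
  p : (m.realReg 1, m.realReg 2) = p
  e : entryAt m (m.natReg 10) = e

namespace AtEntry
variable {S : EdgeSystem} {T : ℝ} {v : ℕ} {p : Pt} {e : Entry} {m m' : Memory}

theorem setRealReg {r : ℕ} (hr : 20 ≤ r) (x : ℝ) (h : AtEntry S T v p e m) : AtEntry S T v p e (m.setRealReg r x) := by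
  have := h.ready
  refine ⟨⟨this.k, this.P, this.nx, this.pv, this.bit, ?_⟩, h.v, ?_, h.e⟩
  · simp only [Memory.setRealReg_realReg, ← this.T]; rw [if_neg (by omega)]
  · simp only [Memory.setRealReg_realReg, ← h.p]; rw [if_neg (by omega), if_neg (by omega)]

theorem same {P : Program} (h : AtEntry S T v p e m) (hs : Same P m m') (h1 : P.safe = true) (h2 : P.quiet = true)
    (h3 : P.writesNatReg 3 = false) (h4 : P.writesNatReg 10 = false) (h5 : P.writesRealReg 1 = false)
    (h6 : P.writesRealReg 2 = false) : AtEntry S T v p e m' := by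
  refine ⟨h.ready.same hs h1, ?_, ?_, ?_⟩
  · rw [hs.natReg _ h3, h.v]
  · rw [hs.realReg _ h5, hs.realReg _ h6, h.p]
  · rw [hs.natReg _ h4, hs.entryAt h2, h.e]

end AtEntry

theorem emit_loopFree (b : Test) (p g : PtExp) (α β : CaseExp) : (Program.emit b p g α β).loopFree = true := by
  simp [Program.emit, Program.pushSweep, Program.block, Program.loopFree]

section
variable {S : EdgeSystem} {T : ℝ} {v : ℕ} {p : Pt} {e : Entry} {m : Memory}

/-- The values are required in every memory satisfying `AtEntry`, because scratch registers change
between the evaluations. -/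
theorem exec_emit (h : AtEntry S T v p e m) (b : Test) {f g : PtExp} {α β : CaseExp}
    {f' g' : Pt} {α' β' : ℝ} (hf : ∀ m, AtEntry S T v p e m → f.eval m = f') (hg : ∀ m, AtEntry S T v p e m → g.eval m = g')
    (hα : ∀ m, AtEntry S T v p e m → α.eval m = α') (hβ : ∀ m, AtEntry S T v p e m → β.eval m = β') :
    AtEntry S T v p e ((Program.emit b f g α β).exec m) ∧
    open Classical in outputSweeps ((Program.emit b f g α β).exec m) = outputSweeps m ++
      if b.Holds m then [⟨S.P v - α' • f', S.P v - β' • g', S.P v⟩] else [] := by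
  refine ⟨h.same (Program.same_exec (emit_loopFree b f g α β) m) ?_ ?_ ?_ ?_ ?_ ?_, ?_⟩
  iterate 6 simp [Program.emit, Program.pushSweep, Program.block, Program.safe, Program.quiet, Program.writesNatReg,
    Program.writesRealReg, Program.writesNatArr, Program.writesRealArr]
  by_cases hb : b.Holds m
  · rw [if_pos hb, Program.emit, Program.exec, if_pos hb]
    have hv : ∀ m, AtEntry S T v p e m → vP.eval m = S.P v := fun m h => by
      rw [vP, h.ready.vtx, NatExp.eval, h.v]
    have c1 := h.setRealReg (r := 30) (by omega) α'
    have c2 := c1.setRealReg (r := 31) (by omega) β'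
    have c3 := c2.setRealReg (r := 20) (by omega) (S.P v - α' • f').1
    have c4 := c3.setRealReg (r := 21) (by omega) (S.P v - α' • f').2
    have c5 := c4.setRealReg (r := 22) (by omega) (S.P v - β' • g').1
    have c6 := c5.setRealReg (r := 23) (by omega) (S.P v - β' • g').2
    have c7 := c6.setRealReg (r := 24) (by omega) (S.P v).1
    simp only [Program.exec, Program.block, CaseExp.exec_assign, PtExp.eval_x, PtExp.eval_y, PtExp.eval_sub, PtExp.eval_smul,
      RealExp.eval]
    rw [hα _ h, hβ _ c1, hv _ c2, hf _ c2]
    simp only [Memory.setRealReg_realReg, Nat.reduceEqDiff, if_true, if_false]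
    rw [hv _ c3, hf _ c3]
    rw [hv _ c4, hg _ c4]
    rw [hv _ c5, hg _ c5, hv _ c6, hv _ c7, outputSweeps_pushSweep]
    simp only [Memory.setRealReg_realReg, Nat.reduceEqDiff, if_true, if_false]
    rfl
  · rw [if_neg hb, Program.emit, Program.exec, if_neg hb, List.append_nil]
    rfl

/-- The test whether the line with a given direction avoids the region close to the current vertex. -/
def freeT (d : PtExp) : Test := .conj (.neg (.inCone (.reg 3) d)) (.neg (.inCone (.reg 3) d.neg))

/-- The inverse of `u`, or the length scale if `t` vanishes. -/
def scaleE (t u : RealExp) : CaseExp := .ite (.realEq t rzero) (.leaf (.reg 0)) (.leaf (.div (.const 1) u))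

/-- The sum of the previous and the current direction. -/
def sE : PtExp := pE.add (entD 10)

namespace Program

/-- Output the forward sweep of a single ray. -/
def emitRay (d : PtExp) (u w : RealExp) : Program :=
  emit (.conj (freeT (entD 10)) (.realEq u rzero)) d d (scaleE w w) (scaleE w w)

/-- Output a sweep of a sector. -/
def emitSide (p g l l' : PtExp) : Program :=
  emit (.conj (freeT sE) (.realEq (.dt l' sE) rzero)) p g
    (scaleE (.dt l (p.add g)) (.dt l p.neg)) (scaleE (.dt l (p.add g)) (.dt l g.neg))

/-- Output the sweeps of the current entry. -/
def emitEntry : Program :=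
  .seq (emitRay (entD 10) (entXf 10) (entXb 10)) (.seq (emitRay (entD 10).neg (entXb 10) (entXf 10))
    (.seq (emitSide pE (entD 10) (entLb 10) (entLf 10)) (emitSide pE.neg (entD 10).neg (entLf 10) (entLb 10))))

/-- Output the sweeps of the current entry and proceed to the next one. -/
def emitStep : Program :=
  .seq emitEntry (block [setRealReg 1 (entD 10).x, setRealReg 2 (entD 10).y,
    setNatReg 10 (.add (.reg 10) (.const 1))])

/-- Output the sweeps of the list of entries. -/
def emitLoop : Program := loop (.natLt (.reg 10) (.reg 11)) emitStep

/-- Start with the last list in the queue. -/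
def emitInit : Program := block [setRealReg 1 (.const 0), setRealReg 2 (.const (-1)),
  setNatReg 10 (.arr 4 (.add (.reg 2) (.reg 2))), setNatReg 11 (.arr 4 (.add (.add (.reg 2) (.reg 2)) (.const 1)))]

/-- Output the sweeps of the last list in the queue. -/
def emitAll : Program := .seq emitInit emitLoop

end Program

theorem AtEntry.eval_scaleE (h : AtEntry S T v p e m) (t u : RealExp) :
    open Classical in (scaleE t u).eval m = if t.eval m = 0 then T else 1 / u.eval m := by
  rw [scaleE, CaseExp.eval_ite (p := t.eval m = 0) (by simp [rzero])]
  simp [h.ready.T]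

theorem AtEntry.holds_freeT (h : AtEntry S T v p e m) (hv : v < S.k) (d : PtExp) :
    (freeT d).Holds m ↔ ¬ S.InCone v (d.eval m) ∧ ¬ S.InCone v (-d.eval m) := by
  have hi : (NatExp.reg 3).eval m < S.k := by rw [NatExp.eval, h.v]; exact hv
  have h1 := Test.holds_inCone h.ready hi d
  have h2 := Test.holds_inCone h.ready hi d.neg
  simp only [NatExp.eval, h.v, PtExp.eval_neg] at h1 h2
  simp only [freeT, Test.Holds, h1, h2]

theorem exec_emitRay (h : AtEntry S T v p e m) (hv : v < S.k) {d : PtExp} {u w : RealExp} {d' : Pt} {u' w' : ℝ}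
    (hd : ∀ m, AtEntry S T v p e m → d.eval m = d') (hu : u.eval m = u')
    (hw : ∀ m, AtEntry S T v p e m → w.eval m = w') :
    AtEntry S T v p e ((Program.emitRay d u w).exec m) ∧
    open Classical in outputSweeps ((Program.emitRay d u w).exec m) = outputSweeps m ++
      if (¬ S.InCone v e.d ∧ ¬ S.InCone v (-e.d)) ∧ u' = 0 then [raySweep (S.P v) T d' w'] else [] := by
  classical
  have hs : ∀ m, AtEntry S T v p e m → (scaleE w w).eval m = if w' = 0 then T else 1 / w' := fun m h => by
    rw [h.eval_scaleE, hw m h]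
  have key := exec_emit h (.conj (freeT (entD 10)) (.realEq u rzero)) hd hd hs hs
  refine ⟨key.1, key.2.trans ?_⟩
  congr 1
  refine if_congr ?_ ?_ rfl
  · simp only [Test.Holds, h.holds_freeT hv, eval_entD, h.e, hu, eval_rzero]
  · unfold raySweep; split_ifs <;> rfl

theorem exec_emitSide (h : AtEntry S T v p e m) (hv : v < S.k) {f g l l' : PtExp} {f' g' k k' : Pt}
    (hf : ∀ m, AtEntry S T v p e m → f.eval m = f') (hg : ∀ m, AtEntry S T v p e m → g.eval m = g')
    (hl : ∀ m, AtEntry S T v p e m → l.eval m = k) (hl' : l'.eval m = k') :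
    AtEntry S T v p e ((Program.emitSide f g l l').exec m) ∧
    open Classical in outputSweeps ((Program.emitSide f g l l').exec m) = outputSweeps m ++
      if (¬ S.InCone v (p + e.d) ∧ ¬ S.InCone v (-(p + e.d))) ∧ dt k' (p + e.d) = 0 then
        [sideSweep (S.P v) T f' g' k] else [] := by
  classical
  have hs : ∀ m, AtEntry S T v p e m → (scaleE (.dt l (f.add g)) (.dt l f.neg)).eval m =
      if dt k (f' + g') = 0 then T else 1 / dt k (-f') := fun m h => by
    rw [h.eval_scaleE, PtExp.eval_dt, PtExp.eval_dt, PtExp.eval_add, PtExp.eval_neg, hl m h, hf m h, hg m h]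
  have hs' : ∀ m, AtEntry S T v p e m → (scaleE (.dt l (f.add g)) (.dt l g.neg)).eval m =
      if dt k (f' + g') = 0 then T else 1 / dt k (-g') := fun m h => by
    rw [h.eval_scaleE, PtExp.eval_dt, PtExp.eval_dt, PtExp.eval_add, PtExp.eval_neg, hl m h, hf m h, hg m h]
  have key := exec_emit h (.conj (freeT sE) (.realEq (.dt l' sE) rzero)) hf hg hs hs'
  refine ⟨key.1, key.2.trans ?_⟩
  have e1 : sE.eval m = p + e.d := by
    rw [sE, PtExp.eval_add, eval_entD, h.e, pE, PtExp.eval_reg, h.p]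
  congr 1
  refine if_congr ?_ ?_ rfl
  · simp only [Test.Holds, h.holds_freeT hv, e1, hl', eval_rzero, PtExp.eval_dt]
  · unfold sideSweep; split_ifs <;> rfl

theorem exec_emitEntry (h : AtEntry S T v p e m) (hv : v < S.k) :
    outputSweeps (Program.emitEntry.exec m) = outputSweeps m ++ S.entrySweeps v T p e := by
  classical
  have gd : ∀ m, AtEntry S T v p e m → (entD 10).eval m = e.d := fun m h => by rw [eval_entD, h.e]
  have gdn : ∀ m, AtEntry S T v p e m → (entD 10).neg.eval m = -e.d := fun m h => by rw [PtExp.eval_neg, gd m h]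
  have gp : ∀ m, AtEntry S T v p e m → pE.eval m = p := fun m h => by rw [pE, PtExp.eval_reg, h.p]
  have gpn : ∀ m, AtEntry S T v p e m → pE.neg.eval m = -p := fun m h => by rw [PtExp.eval_neg, gp m h]
  have gxf : ∀ m, AtEntry S T v p e m → (entXf 10).eval m = e.xf := fun m h => by rw [eval_entXf, h.e]
  have gxb : ∀ m, AtEntry S T v p e m → (entXb 10).eval m = e.xb := fun m h => by rw [eval_entXb, h.e]
  have glf : ∀ m, AtEntry S T v p e m → (entLf 10).eval m = e.lf := fun m h => by rw [eval_entLf, h.e]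
  have glb : ∀ m, AtEntry S T v p e m → (entLb 10).eval m = e.lb := fun m h => by rw [eval_entLb, h.e]
  obtain ⟨h1, o1⟩ := exec_emitRay h hv gd (gxf m h) gxb
  obtain ⟨h2, o2⟩ := exec_emitRay h1 hv gdn (gxb _ h1) gxf
  obtain ⟨h3, o3⟩ := exec_emitSide h2 hv gp gd glb (glf _ h2)
  obtain ⟨-, o4⟩ := exec_emitSide h3 hv gpn gdn glf (glb _ h3)
  rw [Program.emitEntry, Program.exec, Program.exec, Program.exec, o4, o3, o2, o1]
  have ite_and : ∀ (P Q : Prop) [Decidable P] [Decidable Q] [Decidable (P ∧ Q)] (l : List LinearRaySweep),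
      (if P ∧ Q then l else []) = if P then if Q then l else [] else [] := fun P Q _ _ _ l => by
    split_ifs <;> simp_all
  rw [EdgeSystem.entrySweeps, List.append_assoc, List.append_assoc, List.append_assoc]
  congr 1
  simp only [ite_and]
  split_ifs <;> simp

theorem emitEntry_loopFree : Program.emitEntry.loopFree = true := by
  simp [Program.emitEntry, Program.emitRay, Program.emitSide, Program.loopFree, emit_loopFree]

theorem emitStep_loopFree : Program.emitStep.loopFree = true := by
  simp [Program.emitStep, Program.loopFree, emitEntry_loopFree, Program.block]

/-- The time needed for the output of the sweeps of an entry. -/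
def emitCost : ℕ := Program.emitStep.bound + 4

theorem exec_emitStep (h : AtEntry S T v p e m) (hv : v < S.k) :
    outputSweeps (Program.emitStep.exec m) = outputSweeps m ++ S.entrySweeps v T p e ∧
    ((Program.emitStep.exec m).realReg 1, (Program.emitStep.exec m).realReg 2) = e.d ∧
    (Program.emitStep.exec m).natReg 10 = m.natReg 10 + 1 := by
  have s1 := Program.same_exec emitEntry_loopFree m
  have o1 := exec_emitEntry h hv
  have h1 := h.same s1 rfl rfl rfl rfl rfl rfl
  rw [Program.emitStep, Program.exec]
  generalize Program.emitEntry.exec m = m1 at s1 o1 h1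
  refine ⟨?_, ?_, ?_⟩
  · rw [← o1]
    exact (Program.same_exec (P := Program.block [.setRealReg 1 (entD 10).x, .setRealReg 2 (entD 10).y,
      .setNatReg 10 (.add (.reg 10) (.const 1))]) rfl m1).outputSweeps rfl
  · simp [Program.exec, Program.block, h1.e]
  · simp [Program.exec, Program.block, s1.natReg 10 rfl]

/-- The invariant splits the expected output into a part `L` already written and the sweeps of the
remaining entries; the previous direction has to be carried along, since it begins the next sector.
-/
theorem does_emitLoop (h : AtVertex S T v m) (hv : v < S.k) (hp : (m.realReg 1, m.realReg 2) = p) {l : List Entry}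
    (hl : Stored m (m.natReg 10) l) (hlen : m.natReg 10 + l.length = m.natReg 11) :
    Does Program.emitLoop (l.length * emitCost + 4) m fun m' =>
      outputSweeps m' = outputSweeps m ++ S.envSweeps v T p l := by
  refine (Does.loop (fun n m' => ∃ L p' l', AtVertex S T v m' ∧ (m'.realReg 1, m'.realReg 2) = p' ∧
    Stored m' (m'.natReg 10) l' ∧ m'.natReg 10 + l'.length = m'.natReg 11 ∧ l'.length * emitCost ≤ n ∧
    outputSweeps m' = outputSweeps m ++ L ∧ S.envSweeps v T p l = L ++ S.envSweeps v T p' l') ?_ _ m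
    ⟨[], p, l, h, hp, hl, hlen, le_rfl, by simp, by simp⟩).mono le_rfl ?_
  · rintro n m' ⟨L, p', l', h', hp', hl', hlen', hn, ho, he⟩ hb
    simp only [Test.Holds, NatExp.eval] at hb
    rcases l' with - | ⟨x, l'⟩
    · simp at hlen'; omega
    refine ⟨Program.emitStep.bound, Does.mono (Q := fun m'' => m'' = Program.emitStep.exec m')
      (Does.exec emitStep_loopFree rfl) le_rfl ?_⟩
    rintro m'' hs rfl
    obtain ⟨q1, q2, q3⟩ := exec_emitStep (e := x) ⟨h'.ready, h'.v, hp', hl'.1⟩ hv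
    generalize Program.emitStep.exec m' = m'' at hs q1 q2 q3
    have hc : emitCost = Program.emitStep.bound + 4 := rfl
    simp only [List.length_cons] at hlen' hn
    refine ⟨l'.length * emitCost, ?_, L ++ S.entrySweeps v T p' x, x.d, l', h'.same hs rfl rfl, q2, ?_, ?_, le_rfl, ?_, ?_⟩
    · simp only [Test.cost, NatExp.cost]
      rw [hc] at hn ⊢
      linarith
    · rw [q3]; exact hl'.2.congr fun i _ _ => hs.entryAt rfl i
    · rw [q3, hs.natReg 11 rfl]; omega
    · rw [q1, ho, List.append_assoc]
    · rw [he, EdgeSystem.envSweeps, List.append_assoc]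
  · rintro m' - ⟨hb, n', L, p', l', -, -, -, hlen', -, ho, he⟩
    simp only [Test.Holds, NatExp.eval] at hb
    have : l' = [] := List.eq_nil_of_length_eq_zero (by omega)
    rw [ho, he, this, EdgeSystem.envSweeps, List.append_nil]

/-- The time needed for the output of the sweeps at a vertex. -/
def emitTime (k : ℕ) : ℕ := Program.emitInit.bound + (3 * (k + 1) * emitCost + 4)

theorem does_emitAll (h : AtVertex S T v m) (hv : v < S.k) (hq : Queue (S.heapList (S.P v)) (2 * S.k + 1) m) :
    Does Program.emitAll (emitTime S.k) m fun m' =>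
      outputSweeps m' = outputSweeps m ++ S.envSweeps v T startDir (S.heapList (S.P v) (2 * S.k)) := by
  have lf : Program.emitInit.loopFree = true := rfl
  refine Does.seq (Does.exec lf ?_)
  have s0 := Program.same_exec lf m
  have h' := h.same s0 rfl rfl
  have hk := h.ready.k
  have ho : outputSweeps (Program.emitInit.exec m) = outputSweeps m := s0.outputSweeps rfl
  have e10 : (Program.emitInit.exec m).natReg 10 = m.natArr 4 (2 * S.k) := by
    simp [Program.emitInit, Program.exec, Program.block, hk, two_mul]
  have e11 : (Program.emitInit.exec m).natReg 11 = m.natArr 4 (2 * S.k + 1) := by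
    simp [Program.emitInit, Program.exec, Program.block, hk, two_mul]
  rw [← ho]
  refine (does_emitLoop h' hv (p := startDir) ?_ (l := S.heapList (S.P v) (2 * S.k)) ?_ ?_).mono ?_ fun _ _ h => h
  · simp [Program.emitInit, Program.exec, Program.block, startDir]
  · rw [e10]; exact (hq.stored _ (by omega)).congr fun i _ _ => s0.entryAt rfl i
  · rw [e10, e11, hq.next _ (by omega)]
  · have := Nat.mul_le_mul_right emitCost (S.length_heapList_last_le (v := S.P v))
    omega

end

end RayCarving

namespace RayCarving

/-! ## The program: the loops over all vertices -/

namespace Program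

/-- Treat the current vertex. -/
def vertexStep : Program :=
  .seq baseAll (.seq mergeAll (.seq emitAll (setNatReg 3 (.add (.reg 3) (.const 1)))))

/-- Treat all vertices. -/
def vertexLoop : Program := .seq (setNatReg 3 (.const 0)) (loop (.natLt (.reg 3) (.reg 2)) vertexStep)

/-- Count the crossing of the current edge. -/
def parityStep : Program :=
  .seq (cond (.crosses (vtx (.reg 3)) (vtx (.reg 4)) (vtx (.arr 1 (.reg 4))))
    (setNatReg 9 (.sub (.const 1) (.reg 9))) skip) (setNatReg 4 (.add (.reg 4) (.const 1)))

/-- Compute the parity at the current vertex. -/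
def parityVertex : Program :=
  .seq (block [setNatReg 9 (.const 0), setNatReg 4 (.const 0)]) (.seq (loop (.natLt (.reg 4) (.reg 2)) parityStep)
    (block [setNatArr 3 (.reg 3) (.reg 9), setNatReg 3 (.add (.reg 3) (.const 1))]))

/-- Compute the parities at all vertices. -/
def parityLoop : Program := .seq (setNatReg 3 (.const 0)) (loop (.natLt (.reg 3) (.reg 2)) parityVertex)

end Program

section
variable {S : EdgeSystem} {T : ℝ} {v : ℕ} {m : Memory}

/-- The time needed at a vertex. -/
def vertexTime (k : ℕ) : ℕ := baseTime k + (mergeTime k + (emitTime k + 4))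

theorem does_vertexStep (h : AtVertex S T v m) (hv : v < S.k) :
    Does Program.vertexStep (vertexTime S.k) m fun m' => AtVertex S T (v + 1) m' ∧
      outputSweeps m' = outputSweeps m ++ S.envSweeps v T startDir (S.heapList (S.P v) (2 * S.k)) := by
  refine Does.seq ((does_baseAll h).mono le_rfl fun m1 s1 q1 => Does.seq ?_)
  have h1 := h.same s1 rfl rfl
  refine (does_mergeAll h1.ready.k q1).mono le_rfl fun m2 s2 q2 => Does.seq ?_
  have h2 := h1.same s2 rfl rfl
  refine (does_emitAll h2 hv q2).mono le_rfl fun m3 s3 o3 => ?_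
  have h3 := h2.same s3 rfl rfl
  refine Does.mono (Q := fun m4 => m4 = m3.setNatReg 3 (v + 1)) (n := 4) (Does.exec rfl ?_) le_rfl ?_
  · simp [Program.exec, h3.v]
  · rintro m4 s4 rfl
    refine ⟨⟨h3.ready.same s4 rfl, by simp⟩, ?_⟩
    rw [s4.outputSweeps rfl, o3, s2.outputSweeps rfl, s1.outputSweeps rfl]

theorem does_vertexLoop (h : Ready S T m) (ho : outputSweeps m = []) :
    Does Program.vertexLoop (S.k * (vertexTime S.k + 4) + 6) m fun m' =>
      outputSweeps m' = (List.range S.k).flatMap fun a => S.envSweeps a T startDir (S.heapList (S.P a) (2 * S.k)) := by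
  have key := Does.count (P := Program.vertexStep) 3 2 (fun _ => vertexTime S.k)
    (fun i m => AtVertex S T i m ∧ outputSweeps m =
      (List.range i).flatMap fun a => S.envSweeps a T startDir (S.heapList (S.P a) (2 * S.k))) S.k
    (fun i m hI => ⟨hI.1.v, hI.1.ready.k⟩) ?_ (m := m.setNatReg 3 0) ?_
  · have s : Does Program.vertexLoop _ m _ := Does.seq (Does.exec (P := .setNatReg 3 (.const 0)) rfl key)
    refine s.mono ?_ fun m' _ hm' => hm'.2
    rw [Finset.sum_const, Finset.card_range, smul_eq_mul]
    simp only [Program.bound, NatExp.cost]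
    omega
  · rintro i m hi ⟨h1, h2⟩
    refine (does_vertexStep h1 hi).mono le_rfl fun m' _ hm' => ⟨hm'.1, ?_⟩
    rw [hm'.2, h2, List.range_succ, List.flatMap_append]
    simp
  · have s := Program.same_exec (P := .setNatReg 3 (.const 0)) rfl m
    exact ⟨⟨h.same s rfl, by simp⟩, (s.outputSweeps rfl).trans ho⟩

/-- The memory contains the edge system and the length scale, but not yet the parities. -/
structure Loaded (S : EdgeSystem) (T : ℝ) (m : Memory) : Prop where
  k : m.natReg 2 = S.k
  P : ∀ i, (m.realArr 0 i, m.realArr 1 i) = S.P i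
  nx : m.natArr 1 = S.nx
  pv : m.natArr 2 = S.pv
  T : m.realReg 0 = T

theorem Loaded.same {m' : Memory} (h : Loaded S T m) {P : Program} (hs : Same P m m')
    (h1 : P.writesNatReg 2 = false) (h2 : P.writesRealArr 0 = false) (h3 : P.writesRealArr 1 = false)
    (h4 : P.writesNatArr 1 = false) (h5 : P.writesNatArr 2 = false) (h6 : P.writesRealReg 0 = false) :
    Loaded S T m' := by
  constructor
  · rw [hs.natReg _ h1, h.k]
  · intro i; rw [hs.realArr _ h2, hs.realArr _ h3, h.P]
  · rw [hs.natArr _ h4, h.nx]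
  · rw [hs.natArr _ h5, h.pv]
  · rw [hs.realReg _ h6, h.T]

/-- The time needed for a single edge. -/
def parityCost : ℕ := Program.parityStep.bound + 4

/-- Register 9 stays in 0 and 1 and is replaced by its difference from 1 at each crossing; its class
modulo 2 is the partial sum of the crossing indicators. -/
theorem does_parityEdges (h : Loaded S T m) (h9 : m.natReg 9 = 0) (h4 : m.natReg 4 = 0) (h3 : m.natReg 3 = v) :
    Does (.loop (.natLt (.reg 4) (.reg 2)) Program.parityStep) (S.k * parityCost + 4) m fun m' =>
      m'.natReg 9 = 1 ↔ S.par (S.P v) = 1 := by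
  have key := Does.count (P := Program.parityStep) 4 2 (fun _ => Program.parityStep.bound)
    (fun i m => Loaded S T m ∧ m.natReg 3 = v ∧ m.natReg 4 = i ∧ m.natReg 9 ≤ 1 ∧
      (m.natReg 9 : ZMod 2) = ∑ j ∈ Finset.range i, crossBit (S.P v) (S.P j) (S.P (S.nx j))) S.k
    (fun i m hI => ⟨hI.2.2.1, hI.1.k⟩) ?_ (m := m) ⟨h, h3, h4, by omega, by simp [h9]⟩
  · refine key.mono ?_ ?_
    · rw [Finset.sum_const, Finset.card_range, smul_eq_mul]; rfl
    · rintro m' - ⟨-, -, -, hle, he⟩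
      rw [EdgeSystem.par, ← he]
      obtain h | h : m'.natReg 9 = 0 ∨ m'.natReg 9 = 1 := by omega
      all_goals simp [h]
  · rintro i m hi ⟨h1, h2, h3, h4, h5⟩
    refine Does.mono (Q := fun m' => m' = Program.parityStep.exec m) (Does.exec rfl rfl) le_rfl ?_
    rintro m' s rfl
    have hc : (Test.crosses (vtx (.reg 3)) (vtx (.reg 4)) (vtx (.arr 1 (.reg 4)))).Holds m ↔
        Crosses (S.P v) (S.P i) (S.P (S.nx i)) := by
      rw [Test.holds_crosses]
      simp only [vtx, PtExp.eval_arr, NatExp.eval, h1.P, h2, h3, h1.nx]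
    have e9 : (Program.parityStep.exec m).natReg 9 =
        open Classical in if Crosses (S.P v) (S.P i) (S.P (S.nx i)) then 1 - m.natReg 9 else m.natReg 9 := by
      by_cases hh : Crosses (S.P v) (S.P i) (S.P (S.nx i))
      · rw [if_pos hh]
        simp only [Program.parityStep, Program.exec, if_pos (hc.2 hh)]
        simp
      · rw [if_neg hh]
        simp only [Program.parityStep, Program.exec, if_neg (mt hc.1 hh)]
        simp
    have e4 : (Program.parityStep.exec m).natReg 4 = i + 1 := by
      by_cases hh : Crosses (S.P v) (S.P i) (S.P (S.nx i))
      · simp only [Program.parityStep, Program.exec, if_pos (hc.2 hh)]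
        simp [h3]
      · simp only [Program.parityStep, Program.exec, if_neg (mt hc.1 hh)]
        simp [h3]
    refine ⟨h1.same s rfl rfl rfl rfl rfl rfl, (s.natReg _ rfl).trans h2, e4, ?_, ?_⟩
    · rw [e9]; split_ifs <;> omega
    · rw [e9, Finset.sum_range_succ, ← h5, crossBit]
      split_ifs
      · obtain h | h : m.natReg 9 = 0 ∨ m.natReg 9 = 1 := by omega
        · simp [h]
        · simp only [h]; decide
      · simp

/-- The time needed for the parity at a single vertex. -/
def parityTime (k : ℕ) : ℕ := 4 + (k * parityCost + 4 + 7)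

theorem does_parityLoop (h : Loaded S T m) :
    Does Program.parityLoop (S.k * (parityTime S.k + 4) + 6) m fun m' => Ready S T m' := by
  have key := Does.count (P := Program.parityVertex) 3 2 (fun _ => parityTime S.k)
    (fun i m => Loaded S T m ∧ m.natReg 3 = i ∧ ∀ j < i, m.natArr 3 j = 1 ↔ S.par (S.P j) = 1) S.k
    (fun i m hI => ⟨hI.2.1, hI.1.k⟩) ?_ (m := m.setNatReg 3 0) ?_
  · have s : Does Program.parityLoop _ m _ := Does.seq (Does.exec (P := .setNatReg 3 (.const 0)) rfl key)
    refine s.mono ?_ fun m' _ hm' => ⟨hm'.1.k, hm'.1.P, hm'.1.nx, hm'.1.pv, hm'.2.2, hm'.1.T⟩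
    rw [Finset.sum_const, Finset.card_range, smul_eq_mul]
    simp only [Program.bound, NatExp.cost]
    omega
  · rintro i m hi ⟨h1, h2, h3⟩
    have lf : (Program.block [.setNatReg 9 (.const 0), .setNatReg 4 (.const 0)]).loopFree = true := rfl
    refine Does.seq (Does.exec lf (Does.seq ?_))
    have s0 := Program.same_exec lf m
    have l0 := h1.same s0 rfl rfl rfl rfl rfl rfl
    refine (does_parityEdges l0 (by simp [Program.block, Program.exec]) (by simp [Program.block, Program.exec])
      ((s0.natReg _ rfl).trans h2)).mono le_rfl fun m1 s1 b1 => ?_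
    have l1 := l0.same s1 rfl rfl rfl rfl rfl rfl
    have e3 : m1.natReg 3 = i := by rw [s1.natReg _ rfl, s0.natReg _ rfl, h2]
    refine Does.mono (Does.exec rfl (Q := fun m2 => m2 = (m1.setNatArr 3 i (m1.natReg 9)).setNatReg 3 (i + 1)) ?_)
      le_rfl ?_
    · simp [Program.block, Program.exec, e3]
    · rintro m2 s2 rfl
      refine ⟨l1.same s2 rfl rfl rfl rfl rfl rfl, by simp, fun j hj => ?_⟩
      rcases Nat.lt_succ_iff_lt_or_eq.1 hj with hj | rfl
      · rw [← h3 j hj]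
        simp [hj.ne, s1.natArr 3 rfl, s0.natArr 3 rfl]
      · rw [← b1]; simp
  · have s := Program.same_exec (P := .setNatReg 3 (.const 0)) rfl m
    exact ⟨h.same s rfl rfl rfl rfl rfl rfl, by simp, fun j hj => absurd hj (by omega)⟩

end

/-! ## The program: reading the input -/

/-- `nx` and `pv` permute `n` consecutive numbers starting with `o` cyclically. -/
def CycleAt (nx pv : ℕ → ℕ) (o n : ℕ) : Prop :=
  ∀ j < n, nx (o + j) = (if j + 1 = n then o else o + j + 1) ∧ pv (o + j) = (if j = 0 then o + n - 1 else o + j - 1)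

/-- `nx` and `pv` consist of consecutive cycles of given lengths. -/
def Cycles (nx pv : ℕ → ℕ) : ℕ → List ℕ → Prop
  | _, [] => True
  | o, n :: l => CycleAt nx pv o n ∧ Cycles nx pv (o + n) l

theorem cycles_append {nx pv : ℕ → ℕ} (l l' : List ℕ) : ∀ o,
    Cycles nx pv o (l ++ l') ↔ Cycles nx pv o l ∧ Cycles nx pv (o + l.sum) l' := by
  induction l with
  | nil => simp [Cycles]
  | cons n l ih =>
    intro o
    simp only [List.cons_append, Cycles, ih, List.sum_cons, and_assoc, add_assoc]

theorem CycleAt.congr {nx pv nx' pv' : ℕ → ℕ} {o n : ℕ} (h : CycleAt nx pv o n)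
    (h1 : ∀ i < o + n, nx' i = nx i) (h2 : ∀ i < o + n, pv' i = pv i) : CycleAt nx' pv' o n := by
  intro j hj
  rw [h1 _ (by omega), h2 _ (by omega)]
  exact h j hj

theorem Cycles.congr {nx pv nx' pv' : ℕ → ℕ} {l : List ℕ} : ∀ {o : ℕ}, Cycles nx pv o l →
    (∀ i < o + l.sum, nx' i = nx i) → (∀ i < o + l.sum, pv' i = pv i) → Cycles nx' pv' o l := by
  induction l with
  | nil => intro _ _ _ _; trivial
  | cons n l ih =>
    intro o h h1 h2
    simp only [List.sum_cons] at h1 h2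
    exact ⟨h.1.congr (fun i hi => h1 i (by omega)) fun i hi => h2 i (by omega),
      ih h.2 (fun i hi => h1 i (by omega)) fun i hi => h2 i (by omega)⟩

namespace Program

/-- Record the successor of a vertex. -/
def readNext : Program :=
  cond (.natEq (.add (.reg 5) (.const 1)) (.reg 4)) (setNatArr 1 (.add (.reg 2) (.reg 5)) (.reg 2))
    (setNatArr 1 (.add (.reg 2) (.reg 5)) (.add (.add (.reg 2) (.reg 5)) (.const 1)))

/-- Record the predecessor of a vertex. -/
def readPrev : Program :=
  cond (.natEq (.reg 5) (.const 0)) (setNatArr 2 (.add (.reg 2) (.reg 5)) (.sub (.add (.reg 2) (.reg 4)) (.const 1)))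
    (setNatArr 2 (.add (.reg 2) (.reg 5)) (.sub (.add (.reg 2) (.reg 5)) (.const 1)))

/-- Read a vertex. -/
def readVertex : Program := block [readNext, readPrev,
  setRealReg 0 (.add (.reg 0) (.mul (.const 4) (.dt (vtx (.add (.reg 2) (.reg 5))) (vtx (.add (.reg 2) (.reg 5)))))),
  setNatReg 5 (.add (.reg 5) (.const 1))]

/-- Read a polygon. -/
def readPolygon : Program :=
  .seq (block [setNatReg 4 (.arr 0 (.reg 3)), setNatReg 5 (.const 0)]) (.seq (loop (.natLt (.reg 5) (.reg 4)) readVertex)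
    (block [setNatReg 2 (.add (.reg 2) (.reg 4)), setNatReg 3 (.add (.reg 3) (.const 1))]))

/-- Read all polygons. -/
def readAll : Program := .seq (setRealReg 0 (.const 4)) (loop (.natLt (.reg 3) (.reg 0)) readPolygon)

end Program

/-- The real register `0` is a bound for the size of the first vertices. -/
structure Scaled (m : Memory) (n : ℕ) : Prop where
  four_le : 4 ≤ m.realReg 0
  le : ∀ i < n, 4 + 4 * (m.realArr 0 i * m.realArr 0 i + m.realArr 1 i * m.realArr 1 i) ≤ m.realReg 0

theorem exec_readNext (m : Memory) : Program.readNext.exec m = m.setNatArr 1 (m.natReg 2 + m.natReg 5)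
    (if m.natReg 5 + 1 = m.natReg 4 then m.natReg 2 else m.natReg 2 + m.natReg 5 + 1) := by
  rw [Program.readNext, Program.exec]
  by_cases c : m.natReg 5 + 1 = m.natReg 4
  · rw [if_pos c]; exact if_pos c
  · rw [if_neg c]; exact if_neg c

theorem exec_readPrev (m : Memory) : Program.readPrev.exec m = m.setNatArr 2 (m.natReg 2 + m.natReg 5)
    (if m.natReg 5 = 0 then m.natReg 2 + m.natReg 4 - 1 else m.natReg 2 + m.natReg 5 - 1) := by
  rw [Program.readPrev, Program.exec]
  by_cases c : m.natReg 5 = 0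
  · rw [if_pos c]; exact if_pos c
  · rw [if_neg c]; exact if_neg c

theorem exec_readVertex {m : Memory} {o n j : ℕ} (h2 : m.natReg 2 = o) (h4 : m.natReg 4 = n) (h5 : m.natReg 5 = j) :
    (∀ i, (Program.readVertex.exec m).natArr 1 i =
      if i = o + j then (if j + 1 = n then o else o + j + 1) else m.natArr 1 i) ∧
    (∀ i, (Program.readVertex.exec m).natArr 2 i =
      if i = o + j then (if j = 0 then o + n - 1 else o + j - 1) else m.natArr 2 i) ∧
    (Program.readVertex.exec m).realReg 0 = m.realReg 0 +
      4 * (m.realArr 0 (o + j) * m.realArr 0 (o + j) + m.realArr 1 (o + j) * m.realArr 1 (o + j)) ∧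
    (Program.readVertex.exec m).natReg 5 = j + 1 := by
  simp only [Program.readVertex, Program.block, Program.exec, exec_readNext, exec_readPrev, Memory.setNatArr_natReg, h2, h4, h5]
  simp [vtx, dt, h2, h5]

/-- The scale is accumulated as 4 plus the sum of four times the squared norms. As all terms are
non-negative, it dominates each of them without any absolute value or maximum. -/
theorem does_readVertices {m : Memory} {o n : ℕ} {l : List ℕ} (h2 : m.natReg 2 = o) (h4 : m.natReg 4 = n)
    (h5 : m.natReg 5 = 0) (hs : Scaled m o) (hc : Cycles (m.natArr 1) (m.natArr 2) 0 l) (ho : o = l.sum) :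
    Does (.loop (.natLt (.reg 5) (.reg 4)) Program.readVertex) (n * (Program.readVertex.bound + 4) + 4) m fun m' =>
      Scaled m' (o + n) ∧ Cycles (m'.natArr 1) (m'.natArr 2) 0 (l ++ [n]) := by
  have key := Does.count (P := Program.readVertex) 5 4 (fun _ => Program.readVertex.bound)
    (fun i m => m.natReg 2 = o ∧ m.natReg 4 = n ∧ m.natReg 5 = i ∧ Scaled m (o + i) ∧
      Cycles (m.natArr 1) (m.natArr 2) 0 l ∧
      ∀ j < i, m.natArr 1 (o + j) = (if j + 1 = n then o else o + j + 1) ∧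
        m.natArr 2 (o + j) = (if j = 0 then o + n - 1 else o + j - 1)) n
    (fun i m hI => ⟨hI.2.2.1, hI.2.1⟩) ?_ (m := m) ⟨h2, h4, h5, hs, hc, fun j hj => absurd hj (by omega)⟩
  · refine key.mono ?_ ?_
    · rw [Finset.sum_const, Finset.card_range, smul_eq_mul]
    · rintro m' - ⟨-, -, -, h1, h2, h3⟩
      refine ⟨h1, (cycles_append _ _ _).2 ⟨h2, ?_, trivial⟩⟩
      rw [zero_add, ← ho]
      exact h3
  · rintro i m hi ⟨h1, h2, h3, h4, h5, h6⟩
    refine Does.mono (Q := fun m' => m' = Program.readVertex.exec m) (Does.exec rfl rfl) le_rfl ?_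
    rintro m' s rfl
    obtain ⟨e1, e2, e3, e4⟩ := exec_readVertex h1 h2 h3
    generalize Program.readVertex.exec m = m' at *
    refine ⟨(s.natReg _ rfl).trans h1, (s.natReg _ rfl).trans h2, e4, ⟨?_, ?_⟩, ?_, ?_⟩
    · have := h4.four_le
      rw [e3]; nlinarith [mul_self_nonneg (m.realArr 0 (o + i)), mul_self_nonneg (m.realArr 1 (o + i))]
    · intro j hj
      rw [s.realArr 0 rfl, s.realArr 1 rfl, e3]
      obtain hj | rfl : j < o + i ∨ j = o + i := by omega
      · have := h4.le j hj
        nlinarith [mul_self_nonneg (m.realArr 0 (o + i)), mul_self_nonneg (m.realArr 1 (o + i))]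
      · have := h4.four_le
        linarith
    · refine h5.congr (fun j hj => ?_) fun j hj => ?_
      · rw [e1, if_neg (by omega)]
      · rw [e2, if_neg (by omega)]
    · intro j hj
      rw [e1, e2]
      obtain hj | rfl : j < i ∨ j = i := by omega
      · rw [if_neg (show o + j ≠ o + i by omega), if_neg (show o + j ≠ o + i by omega)]; exact h6 j hj
      · rw [if_pos rfl, if_pos rfl]; exact ⟨rfl, rfl⟩

/-- The time needed for reading a polygon. -/
def readTime (n : ℕ) : ℕ := 5 + (n * (Program.readVertex.bound + 4) + 4 + 8)

theorem does_readPolygon {m : Memory} {o n p : ℕ} {l : List ℕ} (h2 : m.natReg 2 = o) (h3 : m.natReg 3 = p)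
    (h4 : m.natArr 0 p = n) (hs : Scaled m o) (hc : Cycles (m.natArr 1) (m.natArr 2) 0 l) (ho : o = l.sum) :
    Does Program.readPolygon (readTime n) m fun m' => m'.natReg 2 = o + n ∧ m'.natReg 3 = p + 1 ∧
      Scaled m' (o + n) ∧ Cycles (m'.natArr 1) (m'.natArr 2) 0 (l ++ [n]) := by
  have lf : (Program.block [.setNatReg 4 (.arr 0 (.reg 3)), .setNatReg 5 (.const 0)]).loopFree = true := rfl
  refine Does.seq (Does.exec lf (Does.seq ?_))
  have s0 := Program.same_exec lf m
  have hs0 : ∀ {m m' : Memory} {P : Program} {n : ℕ}, Same P m m' → P.writesRealReg 0 = false →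
      P.writesRealArr 0 = false → P.writesRealArr 1 = false → Scaled m n → Scaled m' n := by
    intro m m' P n s e1 e2 e3 h
    refine ⟨?_, ?_⟩
    · rw [s.realReg _ e1]; exact h.four_le
    · rw [s.realReg _ e1, s.realArr _ e2, s.realArr _ e3]; exact h.le
  refine (does_readVertices (o := o) (n := n) (l := l) ((s0.natReg _ rfl).trans h2) ?_ ?_ (hs0 s0 rfl rfl rfl hs) hc ho).mono
    le_rfl fun m1 s1 h1 => ?_
  · simp [Program.block, Program.exec, h3, h4]
  · simp [Program.block, Program.exec]
  · have e2 : m1.natReg 2 = o := by rw [s1.natReg _ rfl, s0.natReg _ rfl, h2]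
    have e3 : m1.natReg 3 = p := by rw [s1.natReg _ rfl, s0.natReg _ rfl, h3]
    have e4 : m1.natReg 4 = n := by rw [s1.natReg _ rfl]; simp [Program.block, Program.exec, h3, h4]
    refine Does.mono (Does.exec rfl (Q := fun m2 => m2 = (m1.setNatReg 2 (o + n)).setNatReg 3 (p + 1)) ?_) le_rfl ?_
    · simp [Program.block, Program.exec, e2, e3, e4]
    · rintro m2 s2 rfl
      exact ⟨by simp, by simp, hs0 s2 rfl rfl rfl h1.1, h1.2⟩

theorem does_readAll {m : Memory} {l : List ℕ} (h0 : m.natReg 0 = l.length) (h2 : m.natReg 2 = 0) (h3 : m.natReg 3 = 0)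
    (hl : ∀ i (hi : i < l.length), m.natArr 0 i = l[i]) :
    Does Program.readAll (2 + (∑ i ∈ Finset.range l.length, (readTime (m.natArr 0 i) + 4) + 4)) m fun m' =>
      m'.natReg 2 = l.sum ∧ Scaled m' l.sum ∧ Cycles (m'.natArr 1) (m'.natArr 2) 0 l := by
  refine Does.seq (Does.exec rfl ?_)
  have key := Does.count (P := Program.readPolygon) 3 0 (fun i => readTime (m.natArr 0 i))
    (fun i m' => m'.natArr 0 = m.natArr 0 ∧ m'.natReg 0 = l.length ∧ m'.natReg 3 = i ∧ m'.natReg 2 = (l.take i).sum ∧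
      Scaled m' (l.take i).sum ∧ Cycles (m'.natArr 1) (m'.natArr 2) 0 (l.take i)) l.length
    (fun i m hI => ⟨hI.2.2.1, hI.2.1⟩) ?_ (m := m.setRealReg 0 4) ?_
  · have e : (Program.setRealReg 0 (.const 4)).exec m = m.setRealReg 0 4 := by simp [Program.exec]
    rw [e]
    refine key.mono le_rfl ?_
    rintro m' - ⟨-, -, -, h1, h2, h3⟩
    rw [List.take_length] at h1 h2 h3
    exact ⟨h1, h2, h3⟩
  · rintro i m' hi ⟨h1, h2, h3, h4, h5, h6⟩
    refine (does_readPolygon h4 h3 (congrFun h1 i) h5 h6 rfl).mono le_rfl fun m2 s q => ?_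
    have e : l.take (i + 1) = l.take i ++ [m.natArr 0 i] := by
      rw [hl i hi, List.take_append_getElem hi]
    rw [e, List.sum_append, List.sum_singleton]
    exact ⟨(s.natArr _ rfl).trans h1, (s.natReg _ rfl).trans h2, q.2.1, q.1, q.2.2⟩
  · refine ⟨rfl, h0, h3, h2, ⟨by simp, fun i hi => absurd hi (by simp)⟩, trivial⟩

end RayCarving

namespace RayCarving

/-! ## The edge system of a list of polygons -/

namespace PolygonList

/-- The number of vertices of the first `a` polygons. -/
def offset (B : PolygonList) (a : ℕ) : ℕ := ((B.map Sigma.fst).take a).sum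

theorem offset_zero (B : PolygonList) : offset B 0 = 0 := by simp [offset]

theorem offset_cons (p : Σ n : ℕ, Polygon Pt n) (B : PolygonList) (a : ℕ) :
    offset (p :: B) (a + 1) = p.1 + offset B a := by simp [offset]

theorem vertexList_cons (p : Σ n : ℕ, Polygon Pt n) (B : PolygonList) :
    vertexList (p :: B) = List.ofFn p.2.vertices ++ vertexList B := rfl

theorem size_eq (B : PolygonList) : size B = (B.map Sigma.fst).sum := by
  induction B with
  | nil => rfl
  | cons p B ih =>
    unfold size at ih ⊢
    rw [vertexList_cons, List.length_append, ih, List.length_ofFn, List.map_cons, List.sum_cons]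

theorem vertexList_getD (B : PolygonList) : ∀ (a : ℕ) (ha : a < B.length) (j : Fin B[a].1),
    (vertexList B).getD (offset B a + j) 0 = B[a].2 j := by
  induction B with
  | nil => intro a ha; simp at ha
  | cons p B ih =>
    intro a ha j
    rw [vertexList_cons]
    rcases a with - | a
    · rw [offset_zero, zero_add, List.getD_append _ _ _ _ (by simp)]
      simp only [List.getElem_cons_zero] at j
      rw [List.getD_eq_getElem _ _ (by simp), List.getElem_ofFn]
      rfl
    · rw [offset_cons, List.getD_append_right _ _ _ _ (by simp; omega), List.length_ofFn,
        show p.1 + offset B a + j - p.1 = offset B a + j by omega]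
      exact ih a (by simpa using ha) j

theorem exists_index (B : PolygonList) : ∀ i < size B, ∃ (a : ℕ) (ha : a < B.length) (j : Fin B[a].1),
    i = offset B a + j := by
  induction B with
  | nil => intro i hi; simp [size, vertexList] at hi
  | cons p B ih =>
    intro i hi
    rw [size, vertexList_cons, List.length_append, List.length_ofFn] at hi
    by_cases h : i < p.1
    · exact ⟨0, by simp, ⟨i, h⟩, by simp [offset_zero]⟩
    · obtain ⟨a, ha, j, hj⟩ := ih (i - p.1) (by unfold size; omega)
      exact ⟨a + 1, by simpa using ha, j, by rw [offset_cons]; simp only [List.getElem_cons_succ]; omega⟩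

theorem offset_add_lt (B : PolygonList) : ∀ (a : ℕ) (ha : a < B.length) (j : Fin B[a].1), offset B a + j < size B := by
  induction B with
  | nil => intro a ha; simp at ha
  | cons p B ih =>
    intro a ha j
    rw [size, vertexList_cons, List.length_append, List.length_ofFn]
    rcases a with - | a
    · have := j.2
      simp only [List.getElem_cons_zero] at this
      rw [offset_zero]; omega
    · rw [offset_cons]
      have := ih a (by simpa using ha) j
      unfold size at this
      simp only [List.getElem_cons_succ] at this ⊢
      omega

theorem sum_range_size {M : Type*} [AddCommMonoid M] (B : PolygonList) : ∀ f : ℕ → M,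
    ∑ i ∈ Finset.range (size B), f i = ∑ a : Fin B.length, ∑ j : Fin B[a].1, f (offset B a + j) := by
  induction B with
  | nil => intro f; simp [size, vertexList]
  | cons p B ih =>
    intro f
    have h : size (p :: B) = p.1 + size B := by simp [size, vertexList_cons]
    rw [h, Finset.sum_range_add, ih]
    rw [show ∑ a : Fin (p :: B).length, ∑ j : Fin (p :: B)[a].1, f (offset (p :: B) a + j) =
      ∑ j : Fin p.1, f (offset (p :: B) 0 + j) + ∑ a : Fin B.length, ∑ j : Fin B[a].1, f (offset (p :: B) (a + 1) + j)
      from Fin.sum_univ_succ (n := B.length) _]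
    congr 1
    · rw [Finset.sum_range]; simp [offset_zero]
    · simp [offset_cons, add_assoc]

end PolygonList

theorem Cycles.cycleAt {nx pv : ℕ → ℕ} {l : List ℕ} : ∀ {o : ℕ}, Cycles nx pv o l → ∀ (a : ℕ) (ha : a < l.length),
    CycleAt nx pv (o + (l.take a).sum) l[a] := by
  induction l with
  | nil => intro o _ a ha; simp at ha
  | cons n l ih =>
    rintro o ⟨h1, h2⟩ a ha
    rcases a with - | a
    · simpa using h1
    · have := ih h2 a (by simpa using ha)
      simpa [add_assoc] using this

section
variable {B : PolygonList} {nx pv : ℕ → ℕ}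

theorem Cycles.nx_eq (hc : Cycles nx pv 0 (B.map Sigma.fst)) (a : ℕ) (ha : a < B.length) (j : Fin B[a].1) :
    nx (PolygonList.offset B a + j) = PolygonList.offset B a + finRotate _ j := by
  have h := hc.cycleAt a (by simpa using ha)
  rw [zero_add, List.getElem_map] at h
  have h1 := (h j j.2).1
  rw [← PolygonList.offset] at h1
  rw [h1]
  generalize B[a].1 = n at j
  rcases n with - | n
  · exact j.elim0
  · rw [coe_finRotate]
    have : j = Fin.last n ↔ (j : ℕ) + 1 = n + 1 := by rw [Fin.ext_iff]; simp
    by_cases hj : (j : ℕ) + 1 = n + 1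
    · rw [if_pos hj, if_pos (this.2 hj), add_zero]
    · rw [if_neg hj, if_neg (mt this.1 hj), add_assoc]

theorem Cycles.pv_eq (hc : Cycles nx pv 0 (B.map Sigma.fst)) (a : ℕ) (ha : a < B.length) (j : Fin B[a].1) :
    pv (PolygonList.offset B a + j) = PolygonList.offset B a + (finRotate _).symm j := by
  have h := hc.cycleAt a (by simpa using ha)
  rw [zero_add, List.getElem_map] at h
  -- Writing `j` as a rotated index avoids a formula for the inverse rotation.
  obtain ⟨i, rfl⟩ := (finRotate _).surjective j
  have h1 := (h (finRotate _ i) (finRotate _ i).2).2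
  rw [← PolygonList.offset] at h1
  rw [h1, Equiv.symm_apply_apply]
  generalize B[a].1 = n at i
  rcases n with - | n
  · exact i.elim0
  · rw [coe_finRotate]
    have hi := i.2
    by_cases hj : i = Fin.last n
    · rw [if_pos hj, if_pos rfl, hj, Fin.val_last]; omega
    · rw [if_neg hj, if_neg (by omega)]; omega

theorem edgeSet_eq_segment {n : ℕ} (p : Polygon Pt n) (j : Fin n) :
    p.edgeSet ℝ j = segment ℝ (p j) (p (finRotate n j)) := affineSegment_eq_segment ℝ _ _

theorem edgeSet_subset_region {n : ℕ} (p : Polygon Pt n) (j : Fin n) : p.edgeSet ℝ j ⊆ polygonRegion p :=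
  fun _ hx => Or.inl (mem_iUnion.2 ⟨j, hx⟩)

theorem PolygonList.IsDisjointSimple.disjoint (hB : PolygonList.IsDisjointSimple B) {a b : ℕ} (ha : a < B.length)
    (hb : b < B.length) (hab : a ≠ b) : Disjoint (polygonRegion B[a].2) (polygonRegion B[b].2) := by
  have h := List.pairwise_iff_getElem.1 hB.2
  rcases lt_or_gt_of_ne hab with hab | hab
  · exact h a b ha hb hab
  · exact (h b a hb ha hab).symm

theorem finRotate_ne_self {n : ℕ} (hn : 2 ≤ n) (j : Fin n) : finRotate n j ≠ j := by
  obtain ⟨n, rfl⟩ : ∃ n', n = n' + 1 := ⟨n - 1, by omega⟩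
  intro h
  have h4 := congrArg Fin.val h
  rw [coe_finRotate] at h4
  split_ifs at h4 with h5
  · rw [h5, Fin.val_last] at h4; omega
  · omega

/-- The edge system of a list of polygons. -/
noncomputable def edgeSystem (hB : PolygonList.IsDisjointSimple B) (hc : Cycles nx pv 0 (B.map Sigma.fst)) : EdgeSystem where
  k := PolygonList.size B
  P := fun i => (PolygonList.vertexList B).getD i 0
  nx := nx
  pv := pv
  nx_lt := by
    intro i hi
    obtain ⟨a, ha, j, rfl⟩ := B.exists_index i hi
    rw [hc.nx_eq]
    exact B.offset_add_lt a ha _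
  pv_lt := by
    intro i hi
    obtain ⟨a, ha, j, rfl⟩ := B.exists_index i hi
    rw [hc.pv_eq]
    exact B.offset_add_lt a ha _
  pv_nx := by
    intro i hi
    obtain ⟨a, ha, j, rfl⟩ := B.exists_index i hi
    rw [hc.nx_eq, hc.pv_eq, Equiv.symm_apply_apply]
  nx_pv := by
    intro i hi
    obtain ⟨a, ha, j, rfl⟩ := B.exists_index i hi
    rw [hc.pv_eq, hc.nx_eq, Equiv.apply_symm_apply]
  ne := by
    intro i hi
    obtain ⟨a, ha, j, rfl⟩ := B.exists_index i hi
    rw [hc.nx_eq, B.vertexList_getD, B.vertexList_getD]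
    intro h
    obtain ⟨h3, hinj, -⟩ := hB.1 _ (List.getElem_mem ha)
    exact finRotate_ne_self (by omega) j (hinj h).symm
  simple := by
    intro i hi i' hi' hne x hx hx'
    obtain ⟨a, ha, j, rfl⟩ := B.exists_index i hi
    obtain ⟨a', ha', j', rfl⟩ := B.exists_index i' hi'
    rw [hc.nx_eq, B.vertexList_getD, B.vertexList_getD, ← edgeSet_eq_segment] at hx hx'
    by_cases haa : a = a'
    · subst haa
      have hjj : j ≠ j' := by rintro rfl; exact hne rfl
      rw [hc.nx_eq, hc.nx_eq, B.vertexList_getD, B.vertexList_getD]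
      rcases (hB.1 _ (List.getElem_mem ha)).2.2 j j' hjj x ⟨hx, hx'⟩ with ⟨h1, h2⟩ | ⟨h1, h2⟩
      · exact Or.inl ⟨by rw [h1], h2⟩
      · exact Or.inr ⟨by rw [h1], h2⟩
    -- Edges of different polygons do not meet, because the closed regions are disjoint.
    · exact absurd (edgeSet_subset_region _ _ hx')
        (Set.disjoint_left.1 (hB.disjoint ha ha' haa) (edgeSet_subset_region _ _ hx))

theorem odd_ncard_iff {n : ℕ} (p : Polygon Pt n) (x : Pt) :
    Odd {i : Fin n | Crosses x (p i) (p (finRotate n i))}.ncard ↔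
      ∑ j : Fin n, crossBit x (p j) (p (finRotate n j)) = 1 := by
  classical
  simp only [crossBit]
  rw [Finset.sum_boole, ZMod.natCast_eq_one_iff_odd, Set.ncard_eq_toFinset_card']
  simp

theorem edgeSystem_edge (hB : PolygonList.IsDisjointSimple B) (hc : Cycles nx pv 0 (B.map Sigma.fst)) (a : ℕ)
    (ha : a < B.length) (j : Fin B[a].1) :
    (edgeSystem hB hc).edge (PolygonList.offset B a + j) = B[a].2.edgeSet ℝ j := by
  have h1 : (edgeSystem hB hc).edge (PolygonList.offset B a + j) =
    segment ℝ ((PolygonList.vertexList B).getD (PolygonList.offset B a + j) 0)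
      ((PolygonList.vertexList B).getD (nx (PolygonList.offset B a + j)) 0) := rfl
  rw [h1, hc.nx_eq, B.vertexList_getD, B.vertexList_getD, edgeSet_eq_segment]

theorem edgeSystem_par (hB : PolygonList.IsDisjointSimple B) (hc : Cycles nx pv 0 (B.map Sigma.fst)) (x : Pt) :
    (edgeSystem hB hc).par x = ∑ a : Fin B.length, ∑ j : Fin B[a].1, crossBit x (B[a].2 j) (B[a].2 (finRotate _ j)) := by
  have h1 : (edgeSystem hB hc).par x = ∑ i ∈ Finset.range (PolygonList.size B),
    crossBit x ((PolygonList.vertexList B).getD i 0) ((PolygonList.vertexList B).getD (nx i) 0) := rfl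
  rw [h1, PolygonList.sum_range_size]
  refine Finset.sum_congr rfl fun a _ => Finset.sum_congr rfl fun j _ => ?_
  have h2 := hc.nx_eq a.1 a.2 j
  have h3 := B.vertexList_getD a.1 a.2 j
  have h4 := B.vertexList_getD a.1 a.2 (finRotate _ j)
  rw [← h2] at h4
  exact congrArg₂ _ h3 h4

theorem mem_union_iff {x : Pt} : x ∈ PolygonList.union B ↔ ∃ (a : ℕ) (ha : a < B.length), x ∈ polygonRegion B[a].2 := by
  simp only [PolygonList.union, mem_iUnion, exists_prop, List.mem_iff_getElem]
  constructor
  · rintro ⟨p, ⟨a, ha, rfl⟩, hx⟩; exact ⟨a, ha, hx⟩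
  · rintro ⟨a, ha, hx⟩; exact ⟨_, ⟨a, ha, rfl⟩, hx⟩

/-- The total parity is the sum of the parities of the polygons. Since the regions are disjoint, at
most one summand is 1 off the boundaries, so odd total parity means being enclosed by one of the
polygons. -/
theorem edgeSystem_union (hB : PolygonList.IsDisjointSimple B) (hc : Cycles nx pv 0 (B.map Sigma.fst)) :
    PolygonList.union B = (edgeSystem hB hc).inside ∪ (edgeSystem hB hc).bd := by
  have hbd : ∀ x, x ∈ (edgeSystem hB hc).bd ↔ ∃ (a : ℕ) (ha : a < B.length), x ∈ B[a].2.boundary ℝ := by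
    intro x
    rw [EdgeSystem.mem_bd]
    constructor
    · rintro ⟨i, hi, hx⟩
      obtain ⟨a, ha, j, rfl⟩ := B.exists_index i hi
      rw [edgeSystem_edge] at hx
      exact ⟨a, ha, mem_iUnion.2 ⟨j, hx⟩⟩
    · rintro ⟨a, ha, hx⟩
      obtain ⟨j, hx⟩ := mem_iUnion.1 hx
      exact ⟨_, B.offset_add_lt a ha j, by rw [edgeSystem_edge]; exact hx⟩
  have hsum : ∀ (x : Pt) (a : ℕ) (ha : a < B.length), x ∉ B[a].2.boundary ℝ →
      (x ∈ polygonRegion B[a].2 ↔ ∑ j : Fin B[a].1, crossBit x (B[a].2 j) (B[a].2 (finRotate _ j)) = 1) := by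
    intro x a ha hx
    rw [← odd_ncard_iff]
    exact ⟨fun h => (h.resolve_left hx).2, fun h => Or.inr ⟨hx, h⟩⟩
  ext x
  by_cases hx : x ∈ (edgeSystem hB hc).bd
  · obtain ⟨a, ha, h⟩ := (hbd x).1 hx
    exact iff_of_true (mem_union_iff.2 ⟨a, ha, Or.inl h⟩) (Or.inr hx)
  · have hx' : ∀ (a : ℕ) (ha : a < B.length), x ∉ B[a].2.boundary ℝ := fun a ha h => hx ((hbd x).2 ⟨a, ha, h⟩)
    have h1 : x ∈ (edgeSystem hB hc).inside ∪ (edgeSystem hB hc).bd ↔ (edgeSystem hB hc).par x = 1 :=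
      ⟨fun h => (h.resolve_right hx).2, fun h => Or.inl ⟨hx, h⟩⟩
    rw [h1, mem_union_iff, edgeSystem_par]
    constructor
    · rintro ⟨a, ha, h⟩
      rw [Finset.sum_eq_single ⟨a, ha⟩]
      · exact (hsum x a ha (hx' a ha)).1 h
      · intro b _ hb
        have hba : a ≠ b := fun h => hb (Fin.ext h.symm)
        have h2 := Set.disjoint_left.1 (hB.disjoint ha b.2 hba) h
        have h3 := mt (hsum x b b.2 (hx' b b.2)).2 h2
        generalize ∑ j, crossBit x (B[b].2 j) (B[b].2 (finRotate _ j)) = s at h3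
        revert h3
        revert s
        decide
      · simp
    · intro h
      obtain ⟨a, -, h2⟩ := Finset.exists_ne_zero_of_sum_ne_zero (h ▸ one_ne_zero)
      refine ⟨a, a.2, (hsum x a a.2 (hx' a a.2)).2 ?_⟩
      generalize ∑ j, crossBit x (B[a].2 j) (B[a].2 (finRotate _ j)) = s at h2
      revert h2
      revert s
      decide

theorem interior_union (hB : PolygonList.IsDisjointSimple B) (hc : Cycles nx pv 0 (B.map Sigma.fst)) :
    interior (PolygonList.union B) = (edgeSystem hB hc).inside := by
  rw [edgeSystem_union hB hc, EdgeSystem.interior_inside_union_bd]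

end

end RayCarving

namespace RayCarving

/-! ## The complete program -/

namespace Program

/-- Output a sweep with pivot at the origin. -/
def pushQuadrant (a b c d : ℤ) : Program :=
  .seq (block [setRealReg 20 (.const a), setRealReg 21 (.const b), setRealReg 22 (.const c), setRealReg 23 (.const d)])
    pushSweep

/-- Output sweeps that cover the plane. -/
def allQuadrants : Program := .seq (pushQuadrant 1 0 0 1) (.seq (pushQuadrant 0 1 (-1) 0)
  (.seq (pushQuadrant (-1) 0 0 (-1)) (pushQuadrant 0 (-1) 1 0)))

/-- The complete program. -/
def rayCarving : Program :=
  cond (.natEq (.reg 0) (.const 0)) allQuadrants (.seq readAll (.seq parityLoop vertexLoop))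

end Program

/-- The sweeps that cover the plane. -/
def quadrantSweeps : List LinearRaySweep :=
  [⟨(1, 0), (0, 1), (0, 0)⟩, ⟨(0, 1), (-1, 0), (0, 0)⟩, ⟨(-1, 0), (0, -1), (0, 0)⟩, ⟨(0, -1), (1, 0), (0, 0)⟩]

/-- The pivot is taken from registers 24 and 25, which are never written here and are initially
zero. -/
theorem exec_pushQuadrant (m : Memory) (a b c d : ℤ) (h24 : m.realReg 24 = 0) (h25 : m.realReg 25 = 0) :
    outputSweeps ((Program.pushQuadrant a b c d).exec m) = outputSweeps m ++ [⟨(a, b), (c, d), (0, 0)⟩] := by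
  rw [Program.pushQuadrant, Program.exec, outputSweeps_pushSweep]
  simp only [Program.block, Program.exec, RealExp.eval, Memory.setRealReg_realReg, Nat.reduceEqDiff, if_true, if_false,
    h24, h25]
  rfl

theorem exec_allQuadrants (m : Memory) (h24 : m.realReg 24 = 0) (h25 : m.realReg 25 = 0) (ho : outputSweeps m = []) :
    outputSweeps (Program.allQuadrants.exec m) = quadrantSweeps := by
  have lf : ∀ a b c d, (Program.pushQuadrant a b c d).loopFree = true := fun _ _ _ _ => rfl
  have s : ∀ a b c d m, ((Program.pushQuadrant a b c d).exec m).realReg 24 = m.realReg 24 ∧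
      ((Program.pushQuadrant a b c d).exec m).realReg 25 = m.realReg 25 := fun a b c d m =>
    ⟨(Program.same_exec (lf a b c d) m).realReg _ rfl, (Program.same_exec (lf a b c d) m).realReg _ rfl⟩
  simp only [Program.allQuadrants, Program.exec]
  rw [exec_pushQuadrant, exec_pushQuadrant, exec_pushQuadrant, exec_pushQuadrant _ _ _ _ _ h24 h25, ho]
  · simp [quadrantSweeps]
  all_goals simp only [s, h24, h25]

/-- The endpoint at time `β / (α + β)` is opposite to `x`, which lies beyond the pivot on that ray.
For `α = β = 0` the quotient is zero by convention and `x` is the pivot. -/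
theorem mem_region_quadrant {p g x : Pt} {α β : ℝ} (hα : 0 ≤ α) (hβ : 0 ≤ β) (hx : x = -(α • p + β • g)) :
    x ∈ LinearRaySweep.region ⟨p, g, (0, 0)⟩ := by
  rw [mem_region_iff]
  refine ⟨β / (α + β), ⟨by positivity, div_le_one_of_le₀ (by linarith) (by positivity)⟩, 1 + (α + β), by positivity, ?_⟩
  have h1 : LinearRaySweep.endpoint ⟨p, g, (0, 0)⟩ (β / (α + β)) = p + (β / (α + β)) • (g - p) := by
    simp [LinearRaySweep.endpoint, AffineMap.lineMap_apply, add_comm]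
  rw [h1, hx]
  rcases eq_or_ne (α + β) 0 with h | h
  · obtain rfl : α = 0 := by linarith
    obtain rfl : β = 0 := by linarith
    ext <;> simp
  · have h2 : (α + β) * (β / (α + β)) = β := by field_simp
    ext
    · simp only [Prod.fst_neg, Prod.fst_add, Prod.smul_fst, Prod.fst_sub, smul_eq_mul]
      linear_combination (g.1 - p.1) * h2
    · simp only [Prod.snd_neg, Prod.snd_add, Prod.smul_snd, Prod.snd_sub, smul_eq_mul]
      linear_combination (g.2 - p.2) * h2

theorem isProper_quadrantSweeps : ∀ R ∈ quadrantSweeps, R.IsProper := by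
  intro R hR t ht h
  have h1 := congrArg Prod.fst h
  have h2 := congrArg Prod.snd h
  simp only [quadrantSweeps, List.mem_cons, List.not_mem_nil, or_false] at hR
  rcases hR with rfl | rfl | rfl | rfl <;>
  · simp [LinearRaySweep.endpoint, AffineMap.lineMap_apply] at h1 h2
    linarith

theorem union_quadrantSweeps : (⋃ R ∈ quadrantSweeps, R.region) = unionOfFreeRays ∅ := by
  have h1 : unionOfFreeRays ∅ = univ := by
    ext x
    simp only [unionOfFreeRays, mem_ofPred_eq, mem_univ, iff_true, interior_empty, inter_empty]
    exact ⟨x, x + (1, 0), by simp, trivial, 0, le_rfl, by simp⟩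
  rw [h1]
  ext x
  simp only [mem_univ, iff_true, mem_iUnion, quadrantSweeps, List.mem_cons, List.not_mem_nil, or_false, exists_prop]
  -- Every quadrant is covered by the sweep whose endpoint moves in the opposite one.
  rcases le_total x.1 0 with hx | hx <;> rcases le_total x.2 0 with hy | hy
  · exact ⟨_, Or.inl rfl, mem_region_quadrant (α := -x.1) (β := -x.2) (by linarith) (by linarith) (by ext <;> simp)⟩
  · exact ⟨_, Or.inr (Or.inr (Or.inr rfl)), mem_region_quadrant (α := x.2) (β := -x.1) (by linarith) (by linarith)
      (by ext <;> simp)⟩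
  · exact ⟨_, Or.inr (Or.inl rfl), mem_region_quadrant (α := -x.2) (β := x.1) (by linarith) (by linarith)
      (by ext <;> simp)⟩
  · exact ⟨_, Or.inr (Or.inr (Or.inl rfl)), mem_region_quadrant (α := x.1) (β := x.2) (by linarith) (by linarith)
      (by ext <;> simp)⟩

/-! ### The running time -/

/-- The time needed for an input with at least one polygon. -/
def totalTime (B : PolygonList) : ℕ :=
  4 + (2 + (∑ i ∈ Finset.range B.length, (readTime ((B.map Sigma.fst).getD i 0) + 4) + 4) +
    (B.size * (parityTime B.size + 4) + 6 + (B.size * (vertexTime B.size + 4) + 6)))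

/-- Every term of the time is at most a constant times `k * L`, since `k` and `L` are at least 1.
The constants from the program text are replaced by variables, so that they are not unfolded in the
arithmetic. -/
theorem exists_vertexTime_le : ∃ V : ℕ, ∀ k L : ℕ, 1 ≤ k → L = Nat.log 2 (2 * k + 1) → 1 ≤ L →
    vertexTime k + 4 ≤ V * (k * L) := by
  obtain ⟨a, ha⟩ : ∃ a, a = Program.baseInit.bound := ⟨_, rfl⟩
  obtain ⟨b, hb⟩ : ∃ b, b = Program.baseStep.bound + 4 := ⟨_, rfl⟩
  obtain ⟨d, hd⟩ : ∃ d, d = pairCost + 4 := ⟨_, rfl⟩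
  obtain ⟨e, he⟩ : ∃ e, e = Program.emitInit.bound := ⟨_, rfl⟩
  refine ⟨a + 2 * b + 6 * mergeCost + d + e + 6 * emitCost + 22, fun k L hk hL h1 => ?_⟩
  have x1 : 1 ≤ k * L := Nat.mul_pos hk h1
  have x2 : k ≤ k * L := Nat.le_mul_of_pos_right k h1
  have x3 : k + 1 ≤ 2 * (k * L) := by omega
  have x4 : (k + 1) * L ≤ 2 * (k * L) := by nlinarith
  have y1 := Nat.mul_le_mul_right b x3
  have y2 := Nat.mul_le_mul_right (3 * mergeCost) x4
  have y3 := Nat.mul_le_mul_right d x2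
  have y4 := Nat.mul_le_mul_right (3 * emitCost) x3
  have y5 := Nat.mul_le_mul_right a x1
  have y6 := Nat.mul_le_mul_right e x1
  unfold vertexTime baseTime mergeTime emitTime
  rw [← ha, ← hb, ← hd, ← he, ← hL]
  nlinarith

theorem sum_readTime_le (l : List ℕ) (hl : ∀ n ∈ l, 1 ≤ n) :
    ∑ i ∈ Finset.range l.length, (readTime (l.getD i 0) + 4) ≤ (Program.readVertex.bound + 25) * l.sum := by
  induction l with
  | nil => simp
  | cons n l ih =>
    have h := ih fun n hn => hl n (List.mem_cons_of_mem _ hn)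
    rw [List.length_cons, Finset.sum_range_succ']
    simp only [List.getD_cons_succ, List.getD_cons_zero, List.sum_cons]
    have h1 : 1 ≤ n := hl n List.mem_cons_self
    have h2 : readTime n + 4 ≤ (Program.readVertex.bound + 25) * n := by unfold readTime; nlinarith
    rw [mul_add]
    omega

theorem exists_totalTime_le : ∃ D : ℕ, ∀ B : PolygonList, PolygonList.IsDisjointSimple B → 1 ≤ B.size →
    totalTime B ≤ D * (B.size * (B.size * Nat.log 2 (2 * B.size + 1))) := by
  obtain ⟨V, hV⟩ := exists_vertexTime_le
  obtain ⟨r, hr⟩ : ∃ r, r = Program.readVertex.bound + 25 := ⟨_, rfl⟩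
  refine ⟨V + r + parityCost + 41, fun B hB hk => ?_⟩
  have h1 := sum_readTime_le (B.map Sigma.fst) (fun n hn => by
    obtain ⟨p, hp, rfl⟩ := List.mem_map.1 hn
    have := (hB.1 p hp).1
    omega)
  rw [List.length_map, ← PolygonList.size_eq, ← hr] at h1
  obtain ⟨k, hk'⟩ : ∃ k, k = B.size := ⟨_, rfl⟩
  obtain ⟨L, hL⟩ : ∃ L, L = Nat.log 2 (2 * k + 1) := ⟨_, rfl⟩
  unfold totalTime
  rw [← hk'] at h1 hk ⊢
  rw [← hL]
  have hL1 : 1 ≤ L := by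
    rw [hL]; exact Nat.log_pos (by norm_num) (by omega)
  have x1 : 1 ≤ k * L := Nat.mul_pos hk hL1
  have x2 : k ≤ k * L := Nat.le_mul_of_pos_right k hL1
  have x3 : k ≤ k * (k * L) := Nat.le_mul_of_pos_right k x1
  have x4 : 1 ≤ k * (k * L) := Nat.mul_pos hk x1
  have y1 := Nat.mul_le_mul_left k (hV k L hk hL hL1)
  have y2 := Nat.mul_le_mul_right parityCost (Nat.mul_le_mul_left k x2)
  have y3 := Nat.mul_le_mul_left r x3
  unfold parityTime
  nlinarith

/-- From 3 on, `2 * k + 1` is at most the square of `k`; then the binary logarithm is at most `2 *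
Real.log k / Real.log 2`, and the natural logarithm of 2 is at least one half. -/
theorem log_le {k : ℕ} (hk : 3 ≤ k) : (Nat.log 2 (2 * k + 1) : ℝ) ≤ 4 * Real.log k := by
  have h1 : 2 * k + 1 ≤ k ^ 2 := by nlinarith
  have h2 : Nat.log 2 (2 * k + 1) ≤ Nat.log 2 (k ^ 2) := Nat.log_mono_right h1
  have h3 : (2 : ℝ) ^ Nat.log 2 (k ^ 2) ≤ (k : ℝ) ^ 2 := by
    exact_mod_cast Nat.pow_log_le_self 2 (show k ^ 2 ≠ 0 by positivity)
  have h4 := Real.log_le_log (by positivity) h3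
  rw [Real.log_pow, Real.log_pow] at h4
  have h5 : (1 : ℝ) / 2 ≤ Real.log 2 := by have := Real.log_two_gt_d9; linarith
  have h6 : (Nat.log 2 (2 * k + 1) : ℝ) ≤ Nat.log 2 (k ^ 2) := by exact_mod_cast h2
  have h7 : (0 : ℝ) ≤ Nat.log 2 (k ^ 2) := by positivity
  push_cast at h4
  nlinarith

theorem one_le_log {k : ℕ} (hk : 3 ≤ k) : 1 ≤ Real.log k := by
  rw [Real.le_log_iff_exp_le (by positivity)]
  have h1 := Real.exp_one_lt_d9
  have h2 : (3 : ℝ) ≤ k := by exact_mod_cast hk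
  linarith

/-! ### Correctness -/

theorem outputSweeps_inputMemory (B : PolygonList) : outputSweeps (inputMemory B) = [] := by
  simp [outputSweeps, inputMemory]

/-- The edge system is built from the successor and predecessor arrays that the machine has
computed, so the memory after reading represents it by definition. The machine then computes the
envelopes to which `union_envSweeps` applies. -/
theorem does_rayCarving {B : PolygonList} (hB : PolygonList.IsDisjointSimple B) (hne : B ≠ []) :
    Does Program.rayCarving (totalTime B) (inputMemory B) fun m =>
      (∀ R ∈ outputSweeps m, R.IsProper) ∧
      (⋃ R ∈ outputSweeps m, R.region) = unionOfFreeRays (PolygonList.union B) ∧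
      (outputSweeps m).length ≤ B.size * (12 * (B.size + 1)) := by
  have hlen : B.length ≠ 0 := fun h => hne (List.eq_nil_of_length_eq_zero h)
  have hk : 0 < B.size := by
    obtain ⟨p, hp⟩ := List.exists_mem_of_ne_nil B hne
    have h1 := List.single_le_sum (by simp) p.1 (List.mem_map_of_mem (f := Sigma.fst) hp)
    have h2 := (hB.1 p hp).1
    rw [PolygonList.size_eq]; omega
  refine Does.cond (fun h => absurd h (by simpa [inputMemory] using hlen)) fun _ => Does.seq ?_
  have key := does_readAll (m := inputMemory B) (l := B.map Sigma.fst) (by simp [inputMemory]) (by simp [inputMemory])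
    (by simp [inputMemory]) (fun i hi => by
      have hi' : i < B.length := by simpa using hi
      simp [inputMemory, List.getElem?_eq_getElem hi'])
  refine key.mono (by simp [inputMemory]) fun m1 s1 ⟨h2, hs, hc⟩ => Does.seq ?_
  have hP : ∀ i, (m1.realArr 0 i, m1.realArr 1 i) = (PolygonList.vertexList B).getD i 0 := by
    intro i
    rw [s1.realArr 0 rfl, s1.realArr 1 rfl]
    simp [inputMemory]
  have hl : Loaded (edgeSystem hB hc) (m1.realReg 0) m1 := ⟨h2.trans B.size_eq.symm, hP, rfl, rfl, rfl⟩
  have hS : (edgeSystem hB hc).k = B.size := rfl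
  have o1 : outputSweeps m1 = [] := (s1.outputSweeps rfl).trans (outputSweeps_inputMemory B)
  rw [← hS]
  refine (does_parityLoop hl).mono le_rfl fun m2 s2 hr => ?_
  refine (does_vertexLoop hr ((s2.outputSweeps rfl).trans o1)).mono le_rfl fun m3 _ o3 => ?_
  have hT : 0 < m1.realReg 0 := by have := hs.four_le; linarith
  have hTk : ∀ i < (edgeSystem hB hc).k, ∀ j < (edgeSystem hB hc).k, |((edgeSystem hB hc).P i).1 - ((edgeSystem hB hc).P j).1| +
      |((edgeSystem hB hc).P i).2 - ((edgeSystem hB hc).P j).2| ≤ m1.realReg 0 := by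
    intro i hi j hj
    have e : ∀ i, (edgeSystem hB hc).P i = (m1.realArr 0 i, m1.realArr 1 i) := fun i => (hP i).symm
    rw [hS, PolygonList.size_eq] at hi hj
    have h1 := hs.le i hi
    have h2 := hs.le j hj
    rw [e, e]
    -- Applied to both coordinates, this bounds the distance by 2 plus two squared norms, and the
    -- scale is at least 4 plus four times each squared norm.
    have b : ∀ x y : ℝ, |x - y| ≤ 1 + (x * x + y * y) := fun x y => by
      rw [abs_le]
      constructor <;> nlinarith [sq_nonneg (x - 1), sq_nonneg (x + 1), sq_nonneg (y - 1), sq_nonneg (y + 1)]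
    have b1 := b (m1.realArr 0 i) (m1.realArr 0 j)
    have b2 := b (m1.realArr 1 i) (m1.realArr 1 j)
    have := hs.four_le
    simp only
    nlinarith [mul_self_nonneg (m1.realArr 0 i), mul_self_nonneg (m1.realArr 0 j), mul_self_nonneg (m1.realArr 1 i),
      mul_self_nonneg (m1.realArr 1 j)]
  obtain ⟨q1, q2⟩ := EdgeSystem.union_envSweeps (S := edgeSystem hB hc) hk (interior_union hB hc) hT hTk
    (E := EdgeSystem.heapSet (edgeSystem hB hc).k (2 * (edgeSystem hB hc).k))
    (fun i hi => EdgeSystem.mem_heapSet_last hi)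
    (l := fun a => (edgeSystem hB hc).heapList ((edgeSystem hB hc).P a) (2 * (edgeSystem hB hc).k))
    (fun a _ => EdgeSystem.heapList_env _ le_rfl)
  rw [o3]
  refine ⟨?_, ?_, ?_⟩
  · intro R hR
    obtain ⟨a, ha, hR⟩ := List.mem_flatMap.1 hR
    exact q1 a (List.mem_range.1 ha) R hR
  · rw [← q2]
    ext x
    simp only [mem_iUnion, exists_prop, List.mem_flatMap, List.mem_range, mem_ofPred_eq]
    constructor
    · rintro ⟨R, ⟨a, ha, hR⟩, hx⟩; exact ⟨a, ha, R, hR, hx⟩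
    · rintro ⟨a, ha, R, hR, hx⟩; exact ⟨R, ⟨a, ha, hR⟩, hx⟩
  -- At each vertex there are at most `3 * (k + 1)` entries with at most four sweeps each.
  · rw [List.length_flatMap]
    have := List.sum_le_card_nsmul (l := (List.range (edgeSystem hB hc).k).map fun a => ((edgeSystem hB hc).envSweeps a
      (m1.realReg 0) startDir ((edgeSystem hB hc).heapList ((edgeSystem hB hc).P a) (2 * (edgeSystem hB hc).k))).length)
      (12 * ((edgeSystem hB hc).k + 1)) ?_
    · simpa using this
    · intro n hn
      obtain ⟨a, -, rfl⟩ := List.mem_map.1 hn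
      refine (EdgeSystem.length_envSweeps_le _ _ _ _).trans ?_
      have := (edgeSystem hB hc).length_heapList_last_le (v := (edgeSystem hB hc).P a)
      omega

end RayCarving

theorem mainTheorem7 :
    ∃ (P : RayCarving.Program) (C : ℝ),
      ∀ B : RayCarving.PolygonList, RayCarving.PolygonList.IsDisjointSimple B →
        ∃ (m : RayCarving.Memory) (t : ℕ),
          RayCarving.Runs P (RayCarving.inputMemory B) m t ∧
          (∀ R ∈ RayCarving.outputSweeps m, R.IsProper) ∧
          (⋃ R ∈ RayCarving.outputSweeps m, R.region) =
            RayCarving.unionOfFreeRays (RayCarving.PolygonList.union B) ∧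
          (B ≠ [] →
            (t : ℝ) ≤ C * ((RayCarving.PolygonList.size B : ℝ) ^ 2 *
              Real.log (RayCarving.PolygonList.size B : ℝ)) ∧
            ((RayCarving.outputSweeps m).length : ℝ) ≤
              C * (RayCarving.PolygonList.size B : ℝ) ^ 2) := by
  obtain ⟨D, hD⟩ := RayCarving.exists_totalTime_le
  -- The factor 4 comes from `log_le`, and 24 from `12 * k * (k + 1) ≤ 24 * k ^ 2`.
  refine ⟨RayCarving.Program.rayCarving, 4 * D + 24, fun B hB => ?_⟩
  rcases eq_or_ne B [] with rfl | hne
  · have h0 : (RayCarving.Test.natEq (.reg 0) (.const 0)).Holds (RayCarving.inputMemory []) := by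
      simp [RayCarving.inputMemory]
    obtain ⟨t, -, ht⟩ := RayCarving.Program.allQuadrants.runs_exec (RayCarving.inputMemory []) rfl
    have ho := RayCarving.exec_allQuadrants (RayCarving.inputMemory []) rfl rfl
      (RayCarving.outputSweeps_inputMemory [])
    refine ⟨_, _, .cond_true h0 ht, ?_, ?_, fun h => absurd rfl h⟩
    · rw [ho]; exact RayCarving.isProper_quadrantSweeps
    · rw [ho, RayCarving.union_quadrantSweeps]
      congr 1
      simp [RayCarving.PolygonList.union]
  · obtain ⟨m, t, hrun, ht, h1, h2, h3⟩ := RayCarving.does_rayCarving hB hne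
    refine ⟨m, t, hrun, h1, h2, fun _ => ?_⟩
    have hk : 3 ≤ B.size := by
      obtain ⟨p, hp⟩ := List.exists_mem_of_ne_nil B hne
      have h1 := List.single_le_sum (by simp) p.1 (List.mem_map_of_mem (f := Sigma.fst) hp)
      have h2 := (hB.1 p hp).1
      rw [RayCarving.PolygonList.size_eq]; omega
    have hlog := RayCarving.log_le hk
    have hlog1 := RayCarving.one_le_log hk
    have hk' : (3 : ℝ) ≤ B.size := by exact_mod_cast hk
    constructor
    · have ht' : (t : ℝ) ≤ D * (B.size * (B.size * Nat.log 2 (2 * B.size + 1))) := by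
        exact_mod_cast ht.trans (hD B hB (by omega))
      have h4 : (D : ℝ) * (B.size * (B.size * Nat.log 2 (2 * B.size + 1))) ≤
          D * (B.size * (B.size * (4 * Real.log B.size))) := by gcongr
      have h5 : 0 ≤ 24 * ((B.size : ℝ) ^ 2 * Real.log B.size) := by positivity
      calc (t : ℝ) ≤ _ := ht'
        _ ≤ _ := h4
        _ ≤ _ := by linarith
    · have h3' : ((RayCarving.outputSweeps m).length : ℝ) ≤ B.size * (12 * (B.size + 1)) := by exact_mod_cast h3
      have hD0 : (0 : ℝ) ≤ D * (B.size : ℝ) ^ 2 := by positivity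
      nlinarith
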